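/- Fix an integer $n\ge 1$ and an indeterminate $v$. **The algebra $\mathbf{MU}$.** Let $\mathbf{MU}$ be the associative unital $\mathbb{Q}(v)$-algebra generated by $L$, $E_i$, $F_i$ ($1\le i\le n-1$) and $H_a^{\pm1}$ ($1\le a\le n$) with the relations $$H_aH_a^{-1}=H_a^{-1}H_a=1,\quad H_aH_b=H_bH_a,$$ $$E_i^2E_j+E_jE_i^2=(v+v^{-1})E_iE_jE_i,\quad F_i^2F_j+F_jF_i^2=(v+v^{-1})F_iF_jF_i\quad(|i-j|=1),$$ $$E_iE_j=E_jE_i,\quad F_iF_j=F_jF_i\quad(|i-j|>1),$$ $$H_aE_i=v^{\delta_{ai}-\delta_{a,i+1}}E_iH_a,\quad H_aF_i=v^{-\delta_{ai}+\delta_{a,i+1}}F_iH_a,$$ $$E_iF_j-F_jE_i=\delta_{ij}\frac{H_iH_{i+1}^{-1}-H_i^{-1}H_{i+1}}{v-v^{-1}},$$ $$H_aL=LH_a,\quad L^2=L,\quad LE_i=LE_iL,\quad F_iL=LF_iL,$$ $$(v+v^{-1})E_iLE_i=v^{-1}E_i^2L+vLE_i^2,\quad (v+v^{-1})F_iLF_i=vF_i^2L+v^{-1}LF_i^2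 .$$ **Convolution.** For a finite-dimensional vector space $V$ over a finite field $\mathbb{F}_q$, let $\mathscr X$ be the set of $n$-step flags $0=V_0\subseteq V_1\subseteq\dots\subseteq V_n=V$. The $GL(V)$-orbits on $\mathscr X\times\mathscr X\times V$ are indexed by pairs $(A,\Delta)$, where $A=(a_{ij})$ is an $n\times n$ matrix over $\mathbb{N}$ with $\sum_{i,j} a_{ij}=\dim V$, and $\Delta=\{(i_1,j_1),\dots,(i_k,j_k)\}$ with $i_1<\dots<i_k$, $j_k<\dots<j_1$ and $a_{ij}>0$ for $(i,j)\in\Delta$: the triple $((V_i),(V'_j),\omega)$ is in the orbit of $(A,\Delta)$ if $V$ has a basis $e_{ijk}$ ($1\le k\le a_{ij}$) such that $V_i$ is spanned by the $e_{i'jk}$ with $i'\le i$, $V'_j$ by the $e_{ij'k}$ with $j'\le j$, and $\omega=\sum_{(i,j)\in\Delta}e_{ij1}$. Let $e_{A,\Delta}$ be the characteristic function of this orbit, let $(g*h)(f,f',\omega)=\sum_{f''\in\mathscr X,\,\mu\in V}g(f,f'',\mu)\,h(f'',f',\omega-\mu)$, and put, with $q=v^2$, $[A]_\Delta=v^{-d(A,\Delta)+r(A,\Delta)}e_{A,\Delta}$,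 where $$d(A,\Delta)=\sum_{i<k\text{ or }j<l}a_{ij}a_{kl}+\sum_{\substack{(i,j):\ i\le s,\ j\le t\\ \text{for some }(s,t)\in\Delta}}a_{ij},\qquad r(A,\Delta)=\sum_{i<k}a_{ij}a_{kl}.$$ **Stabilization.** Let $\tilde\Xi$ be the set of pairs $(A,\Delta)$ where $A$ is an $n\times n$ matrix over $\mathbb{Z}$ with $a_{ij}\ge0$ for $i\ne j$, and $\Delta$ is as above except that $(i,i)\in\Delta$ is allowed also when $a_{ii}\le0$. For $A,B,C\in\tilde\Xi$ (decorations suppressed) there is a unique Laurent polynomial $G_{A,B}^{C}(v,v')\in\mathbb{Q}(v)[v',v'^{-1}]$ such that, for all sufficiently large $p$, the structure constants of $*$ are polynomial in $q$ and the coefficient of $[C+pI]$ in $[A+pI]*[B+pI]$ is $G_{A,B}^{C}(v,v^{-p})$. Let $\widehat{\mathcal K}$ be the $\mathbb{Q}(v)$-space of formal combinations $\sum_{(A,\Delta)\in\tilde\Xi}\xi_{A,\Delta}[A]_\Delta$ such that for each $a\in\mathbb{Z}^n$ only finitely many $(A,\Delta)$ with $\xi_{A,\Delta}\neq0$ have row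 sums $a$, and only finitely many have column sums $a$. The product $[A]\cdot[B]=\sum_C G_{A,B}^{C}(v,1)[C]$ extends to $\widehat{\mathcal K}$ (every coefficient of a product is a finite sum) and makes it an associative unital $\mathbb{Q}(v)$-algebra. **The algebra $\mathcal{MU}$.** For $(A,\Delta)\in\tilde\Xi$ with $A$ of zero diagonal and $\mathbf j\in\mathbb{Z}^n$ put $A(\mathbf j)_\Delta=\sum_{Z}v^{z_1j_1+\dots+z_nj_n}[A+Z]_\Delta\in\widehat{\mathcal K}$, the sum over all integer diagonal matrices $Z=\mathrm{diag}(z_1,\dots,z_n)$; let $\mathbf j_a$ be the $a$-th unit vector and $E_{ij}$ the matrix units. The mirabolic quantum $\mathfrak{gl}_n$, denoted $\mathcal{MU}$, is the subalgebra of $\widehat{\mathcal K}$ generated by $0(-2\mathbf j_1)_\emptyset+0(-\mathbf j_1)_{\{(1,1)\}}$, $0(\pm\mathbf j_a)_\emptyset$ ($1\le a\le n$), $E_{i,i+1}(\mathbf 0)_\emptyset$ and $E_{i+1,i}(\mathbf 0)_\emptyset$ ($1\le i\le n-1$). **Proposition.** There is a surjective $\mathbb{Q}(v)$-algebra homomorphism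 $\mathbf{MU}\to\mathcal{MU}$ with $E_i\mapsto E_{i,i+1}(\mathbf 0)_\emptyset$, $F_i\mapsto E_{i+1,i}(\mathbf 0)_\emptyset$, $H_a\mapsto 0(\mathbf j_a)_\emptyset$ and $L\mapsto 0(-2\mathbf j_1)_\emptyset+0(-\mathbf j_1)_{\{(1,1)\}}$ for all $1\le i\le n-1$, $1\le a\le n$. -/

import Mathlib

namespace Mirabolic

open scoped LaurentPolynomial

noncomputable section

/-- The ground field `ℚ(v)`. -/
abbrev Qv : Type := RatFunc ℚ

/-- The indeterminate `v`. -/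
def v : Qv := RatFunc.X

/-- `v` as a unit of `ℚ(v)`. -/
def vUnit : Qvˣ := Units.mk0 RatFunc.X RatFunc.X_ne_zero

/-- The index `i` of the pair `(i, i + 1)` attached to `i ∈ [1, n - 1]` (numbering starts at `0`). -/
def lft {n : ℕ} (i : Fin (n - 1)) : Fin n := ⟨i.1, by have := i.2; omega⟩

/-- The index `i + 1` of the pair `(i, i + 1)`. -/
def rgt {n : ℕ} (i : Fin (n - 1)) : Fin n := ⟨i.1 + 1, by have := i.2; omega⟩

/-- Kronecker delta with integer values. -/
def kron {n : ℕ} (a b : Fin n) : ℤ := if a = b then 1 else 0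

/-! ### The mirabolic quantum group `MU` by generators and relations -/

/-- Generators `L`, `E_i`, `F_i`, `H_a`, `H_a⁻¹`. -/
inductive MUGen (n : ℕ) : Type
  | L : MUGen n
  | E (i : Fin (n - 1)) : MUGen n
  | F (i : Fin (n - 1)) : MUGen n
  | H (a : Fin n) : MUGen n
  | Hinv (a : Fin n) : MUGen n

namespace Free

variable {n : ℕ}

/-- The free generator `L`. -/
def L : FreeAlgebra Qv (MUGen n) := FreeAlgebra.ι Qv MUGen.L
/-- The free generator `E_i`. -/
def E (i : Fin (n - 1)) : FreeAlgebra Qv (MUGen n) := FreeAlgebra.ι Qv (MUGen.E i)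
/-- The free generator `F_i`. -/
def F (i : Fin (n - 1)) : FreeAlgebra Qv (MUGen n) := FreeAlgebra.ι Qv (MUGen.F i)
/-- The free generator `H_a`. -/
def H (a : Fin n) : FreeAlgebra Qv (MUGen n) := FreeAlgebra.ι Qv (MUGen.H a)
/-- The free generator `H_a⁻¹`. -/
def Hinv (a : Fin n) : FreeAlgebra Qv (MUGen n) := FreeAlgebra.ι Qv (MUGen.Hinv a)

end Free

open Free in
/-- The defining relations of `MU`. -/
inductive MURel (n : ℕ) : FreeAlgebra Qv (MUGen n) → FreeAlgebra Qv (MUGen n) → Prop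
  | H_mul_Hinv (a : Fin n) : MURel n (H a * Hinv a) 1
  | Hinv_mul_H (a : Fin n) : MURel n (Hinv a * H a) 1
  | H_comm (a b : Fin n) : MURel n (H a * H b) (H b * H a)
  | E_serre (i j : Fin (n - 1)) (hij : i.1 + 1 = j.1 ∨ j.1 + 1 = i.1) :
      MURel n (E i ^ 2 * E j + E j * E i ^ 2) ((v + v⁻¹) • (E i * E j * E i))
  | F_serre (i j : Fin (n - 1)) (hij : i.1 + 1 = j.1 ∨ j.1 + 1 = i.1) :
      MURel n (F i ^ 2 * F j + F j * F i ^ 2) ((v + v⁻¹) • (F i * F j * F i))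
  | E_comm (i j : Fin (n - 1)) (hij : i.1 + 1 < j.1 ∨ j.1 + 1 < i.1) :
      MURel n (E i * E j) (E j * E i)
  | F_comm (i j : Fin (n - 1)) (hij : i.1 + 1 < j.1 ∨ j.1 + 1 < i.1) :
      MURel n (F i * F j) (F j * F i)
  | H_E (a : Fin n) (i : Fin (n - 1)) :
      MURel n (H a * E i) (v ^ (kron a (lft i) - kron a (rgt i)) • (E i * H a))
  | H_F (a : Fin n) (i : Fin (n - 1)) :
      MURel n (H a * F i) (v ^ (-kron a (lft i) + kron a (rgt i)) • (F i * H a))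
  | E_F (i j : Fin (n - 1)) :
      MURel n (E i * F j - F j * E i)
        (if i = j then
          (v - v⁻¹)⁻¹ • (H (lft i) * Hinv (rgt i) - Hinv (lft i) * H (rgt i)) else 0)
  | H_L (a : Fin n) : MURel n (H a * L) (L * H a)
  | L_idem : MURel n (L ^ 2) L
  | L_E (i : Fin (n - 1)) : MURel n (L * E i) (L * E i * L)
  | F_L (i : Fin (n - 1)) : MURel n (F i * L) (L * F i * L)
  | E_L_E (i : Fin (n - 1)) :
      MURel n ((v + v⁻¹) • (E i * L * E i)) (v⁻¹ • (E i ^ 2 * L) + v • (L * E i ^ 2))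
  | F_L_F (i : Fin (n - 1)) :
      MURel n ((v + v⁻¹) • (F i * L * F i)) (v • (F i ^ 2 * L) + v⁻¹ • (L * F i ^ 2))

/-- The mirabolic quantum group `MU`. -/
abbrev MU (n : ℕ) : Type := RingQuot (MURel n)

namespace MU

variable {n : ℕ}

/-- The generator `L` of `MU`. -/
def L : MU n := RingQuot.mkAlgHom Qv (MURel n) Free.L
/-- The generator `E_i` of `MU`. -/
def E (i : Fin (n - 1)) : MU n := RingQuot.mkAlgHom Qv (MURel n) (Free.E i)
/-- The generator `F_i` of `MU`. -/
def F (i : Fin (n - 1)) : MU n := RingQuot.mkAlgHom Qv (MURel n) (Free.F i)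
/-- The generator `H_a` of `MU`. -/
def H (a : Fin n) : MU n := RingQuot.mkAlgHom Qv (MURel n) (Free.H a)
/-- The generator `H_a⁻¹` of `MU`. -/
def Hinv (a : Fin n) : MU n := RingQuot.mkAlgHom Qv (MURel n) (Free.Hinv a)

end MU

/-! ### Decorated matrices -/

/-- The index set `Ξ̃`: pairs `(A, Δ)` of an integer matrix with nonnegative off-diagonal entries
and a set `Δ = {(i₁, j₁), …, (i_k, j_k)}` of positions with `i₁ < ⋯ < i_k`, `j_k < ⋯ < j₁`, whose
off-diagonal members sit at positive entries. -/
structure DecMat (n : ℕ) where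
  /-- the matrix `A` -/
  mat : Matrix (Fin n) (Fin n) ℤ
  /-- the decoration `Δ` -/
  dec : Finset (Fin n × Fin n)
  nonneg : ∀ i j, i ≠ j → 0 ≤ mat i j
  chain : ∀ x ∈ dec, ∀ y ∈ dec, x ≠ y → (x.1 < y.1 ∧ y.2 < x.2) ∨ (y.1 < x.1 ∧ x.2 < y.2)
  pos : ∀ x ∈ dec, x.1 ≠ x.2 → 0 < mat x.1 x.2

namespace DecMat

variable {n : ℕ}

/-- Row sums. -/
def ro (M : DecMat n) : Fin n → ℤ := fun i => ∑ j, M.mat i j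

/-- Column sums. -/
def co (M : DecMat n) : Fin n → ℤ := fun j => ∑ i, M.mat i j

/-- `(A + p I, Δ)`. For all large `p` every entry on the diagonal is positive. -/
def shift (p : ℕ) (M : DecMat n) : DecMat n where
  mat := M.mat + Matrix.diagonal (fun _ => (p : ℤ))
  dec := M.dec
  nonneg := fun i j h => by simpa [Matrix.diagonal_apply_ne _ h] using M.nonneg i j h
  chain := M.chain
  pos := fun x hx h => by simpa [Matrix.diagonal_apply_ne _ h] using M.pos x hx h

/-- The dimension `d(A, Δ)` of the orbit attached to `(A, Δ)`. -/
def orbitDim (M : DecMat n) : ℤ :=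
  (∑ i, ∑ j, ∑ k, ∑ l, if i < k ∨ j < l then M.mat i j * M.mat k l else 0) +
    ∑ i, ∑ j, if ∃ x ∈ M.dec, i ≤ x.1 ∧ j ≤ x.2 then M.mat i j else 0

/-- The dimension `r(A, Δ)` of the image of the orbit under the projection to the first flag. -/
def flagDim (M : DecMat n) : ℤ :=
  ∑ i, ∑ j, ∑ k, ∑ l, if i < k then M.mat i j * M.mat k l else 0

/-- The exponent in `[A]_Δ = v ^ (-d(A, Δ) + r(A, Δ)) e_{A, Δ}`. -/
def normExp (M : DecMat n) : ℤ := -M.orbitDim + M.flagDim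

/-- The labels `(i, j, k)` with `k < a_{ij}` of a basis adapted to a pair of flags whose relative
position is the matrix `A` (only used when all entries are nonnegative). -/
abbrev Box (M : DecMat n) : Type := Σ x : Fin n × Fin n, Fin (M.mat x.1 x.2).toNat

/-- The decorated matrix `(0, ∅)`. -/
def zero (n : ℕ) : DecMat n where
  mat := 0
  dec := ∅
  nonneg := by simp
  chain := by simp
  pos := by simp

/-- The decorated matrix `(0, {(1, 1)})`. -/
def zeroDec (n : ℕ) [NeZero n] : DecMat n where
  mat := 0
  dec := {(0, 0)}
  nonneg := by simp
  chain := by simp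
  pos := by simp

/-- The decorated matrix `(E_{ij}, ∅)`, where `E_{ij}` is the matrix unit. -/
def unit (i j : Fin n) : DecMat n where
  mat := Matrix.single i j 1
  dec := ∅
  nonneg := fun a b _ => by
    rw [Matrix.single_apply]; split_ifs <;> simp
  chain := by simp
  pos := by simp

end DecMat

/-! ### Flags, orbits and convolution over a finite field -/

/-- `n`-step partial flags `0 = V_0 ⊆ V_1 ⊆ ⋯ ⊆ V_n = V`. -/
structure PartialFlag (n : ℕ) (F V : Type) [Field F] [AddCommGroup V] [Module F V] where
  /-- the subspace `V_i` -/
  sub : Fin (n + 1) → Submodule F V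
  mono : Monotone sub
  bot : sub 0 = ⊥
  top : sub (Fin.last n) = ⊤

section Orbits

variable {n : ℕ} {F V : Type} [Field F] [AddCommGroup V] [Module F V]

/-- The `GL(V)`-orbit of triples (flag, flag, vector) attached to `(A, Δ)`: those triples for which
there is a basis `e_{ijk}` (`1 ≤ k ≤ a_{ij}`) of `V` such that the `i`-th step of the first flag is
spanned by the `e_{i'jk}` with `i' ≤ i`, the `j`-th step of the second flag by the `e_{ij'k}` with
`j' ≤ j`, and the vector is `∑_{(i, j) ∈ Δ} e_{ij1}`. -/
def orbit (M : DecMat n) : Set (PartialFlag n F V × PartialFlag n F V × V) :=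
  {t | ∃ b : Module.Basis M.Box F V,
    (∀ i : Fin (n + 1), t.1.sub i = Submodule.span F (b '' {x | x.1.1.1 < i.1})) ∧
    (∀ j : Fin (n + 1), t.2.1.sub j = Submodule.span F (b '' {x | x.1.2.1 < j.1})) ∧
    t.2.2 = ∑ x : M.Box, if x.1 ∈ M.dec ∧ x.2.1 = 0 then b x else 0}

/-- The characteristic function of the orbit attached to `(A, Δ)`. -/
def charFun (M : DecMat n) : PartialFlag n F V × PartialFlag n F V × V → ℤ :=
  Set.indicator (orbit M) 1

/-- The convolution product `(g * h)(f, f', ω) = ∑_{f'', μ} g(f, f'', μ) h(f'', f', ω - μ)`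
(the sum is finite when `V` is finite). -/
def conv (g h : PartialFlag n F V × PartialFlag n F V × V → ℤ) :
    PartialFlag n F V × PartialFlag n F V × V → ℤ :=
  fun t => ∑ᶠ y : PartialFlag n F V × V, g (t.1, y.1, y.2) * h (y.1, t.2.1, t.2.2 - y.2)

end Orbits

/-! ### Stabilization -/

variable {n : ℕ}

/-- `P` is the generic structure constant of the mirabolic quantum Schur algebra: for every finite
field with `q` elements, the value of `e_A * e_B` on the orbit of `C` is `P(q)`. -/
def IsGenericConst (A B C : DecMat n) (P : Polynomial ℚ) : Prop :=
  ∀ (F : Type) [Field F] [Finite F] (d : ℕ)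
    (t : PartialFlag n F (Fin d → F) × PartialFlag n F (Fin d → F) × (Fin d → F)),
    t ∈ orbit C → ((conv (charFun A) (charFun B) t : ℤ) : ℚ) = P.eval (Nat.card F : ℚ)

/-- The Laurent polynomial `G(v, v') ∈ ℚ(v)[v', v'⁻¹]` is the stable structure constant: for all
large `p`, the coefficient of `[_pC]` in the product `[_pA] * [_pB]` of normalized basis elements,
where `q = v ^ 2`, is `G(v, v ^ (-p))`. -/
def IsStableConst (A B C : DecMat n) (G : Qv[T;T⁻¹]) : Prop :=
  ∃ p₀ : ℕ, ∀ p : ℕ, p₀ ≤ p → ∃ P : Polynomial ℚ,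
    IsGenericConst (A.shift p) (B.shift p) (C.shift p) P ∧
    LaurentPolynomial.eval₂ (RingHom.id Qv) (vUnit ^ (-(p : ℤ))) G =
      v ^ ((A.shift p).normExp + (B.shift p).normExp - (C.shift p).normExp) *
        Polynomial.aeval (v ^ 2) P

open Classical in
/-- The structure constant `G(v, 1)` of `K`: the coefficient of `[C]` in `[A] · [B]`. It vanishes
when `co(A) ≠ ro(B)`, since then the convolution products are zero. -/
def structConst (A B C : DecMat n) : Qv :=
  if h : ∃ G : Qv[T;T⁻¹], IsStableConst A B C G then
    LaurentPolynomial.eval₂ (RingHom.id Qv) 1 h.choose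
  else 0

/-! ### The completion `K̂` -/

/-- The vector space `K̂` of formal combinations `∑ ξ_{A,Δ} [A]_Δ` such that for every `a ∈ ℤⁿ` only
finitely many `(A, Δ)` with `ξ_{A,Δ} ≠ 0` have row sums `a`, and only finitely many have column
sums `a`. -/
def KHat (n : ℕ) : Submodule Qv (DecMat n → Qv) where
  carrier := {ξ | ∀ a : Fin n → ℤ,
    {M | ξ M ≠ 0 ∧ M.ro = a}.Finite ∧ {M | ξ M ≠ 0 ∧ M.co = a}.Finite}
  zero_mem' := fun a => by simp
  add_mem' := by
    intro x y hx hy a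
    refine ⟨((hx a).1.union (hy a).1).subset ?_, ((hx a).2.union (hy a).2).subset ?_⟩
    all_goals
      rintro M ⟨hM, ha⟩
      by_cases h : x M = 0
      · exact Or.inr ⟨fun h' => hM (by simp [h, h']), ha⟩
      · exact Or.inl ⟨h, ha⟩
  smul_mem' := by
    intro c x hx a
    refine ⟨(hx a).1.subset ?_, (hx a).2.subset ?_⟩
    all_goals
      rintro M ⟨hM, ha⟩
      exact ⟨fun h => hM (by simp [h]), ha⟩

/-- The product of formal combinations: the coefficient of `[C]` in
`∑ ξ_A [A] · ∑ η_B [B] = ∑ ξ_A η_B [A] · [B]`. -/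
def formalMul (x y : DecMat n → Qv) (C : DecMat n) : Qv :=
  ∑ᶠ AB : DecMat n × DecMat n, x AB.1 * y AB.2 * structConst AB.1 AB.2 C

open Classical in
/-- The coefficients of `A(𝐣)_Δ = ∑_Z v ^ (z₁ j₁ + ⋯ + z_n j_n) [A + Z]_Δ`, where `Z` runs over all
integer diagonal matrices. -/
def diagSumFun (M : DecMat n) (j : Fin n → ℤ) (N : DecMat n) : Qv :=
  if N.dec = M.dec ∧ ∃ z : Fin n → ℤ, N.mat = M.mat + Matrix.diagonal z then
    v ^ (∑ i, (N.mat i i - M.mat i i) * j i)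
  else 0

theorem diagSumFun_mem (M : DecMat n) (j : Fin n → ℤ) : diagSumFun M j ∈ KHat n := by
  have key : ∀ N : DecMat n, diagSumFun M j N ≠ 0 →
      N.dec = M.dec ∧ ∃ z : Fin n → ℤ, N.mat = M.mat + Matrix.diagonal z := by
    intro N hN
    by_contra h
    exact hN (if_neg h)
  have hro : ∀ (N : DecMat n) (z : Fin n → ℤ), N.mat = M.mat + Matrix.diagonal z →
      N.ro = M.ro + z := by
    intro N z h
    funext i
    simp [DecMat.ro, h, Finset.sum_add_distrib, Matrix.diagonal_apply]
  have hco : ∀ (N : DecMat n) (z : Fin n → ℤ), N.mat = M.mat + Matrix.diagonal z →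
      N.co = M.co + z := by
    intro N z h
    funext i
    simp [DecMat.co, h, Finset.sum_add_distrib, Matrix.diagonal_apply]
  have hext : ∀ N N' : DecMat n, N.mat = N'.mat → N.dec = N'.dec → N = N' := by
    rintro ⟨_, _, _, _, _⟩ ⟨_, _, _, _, _⟩ h h'
    simp only at h h'
    subst h h'
    rfl
  intro a
  constructor
  all_goals
    refine Set.Subsingleton.finite ?_
    rintro N ⟨hN, ha⟩ N' ⟨hN', ha'⟩
    obtain ⟨hd, z, hz⟩ := key N hN
    obtain ⟨hd', z', hz'⟩ := key N' hN'
    have hzz : z = z' := by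
      first
        | exact add_left_cancel ((hro N z hz).symm.trans (ha.trans (ha'.symm.trans (hro N' z' hz'))))
        | exact add_left_cancel ((hco N z hz).symm.trans (ha.trans (ha'.symm.trans (hco N' z' hz'))))
    exact hext N N' (by rw [hz, hz', hzz]) (hd.trans hd'.symm)

/-- The element `A(𝐣)_Δ` of `K̂` (for `A` with zero diagonal). -/
def diagSum (M : DecMat n) (j : Fin n → ℤ) : KHat n := ⟨diagSumFun M j, diagSumFun_mem M j⟩

/-- The element `E_i = E_{i,i+1}(𝟎)_∅` of `K̂`. -/
def eltE (i : Fin (n - 1)) : KHat n := diagSum (DecMat.unit (lft i) (rgt i)) 0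

/-- The element `F_i = E_{i+1,i}(𝟎)_∅` of `K̂`. -/
def eltF (i : Fin (n - 1)) : KHat n := diagSum (DecMat.unit (rgt i) (lft i)) 0

/-- The element `0(𝐣_a)_∅` of `K̂`. -/
def eltH (a : Fin n) : KHat n := diagSum (DecMat.zero n) (Pi.single a 1)

/-- The element `0(-𝐣_a)_∅` of `K̂`. -/
def eltHinv (a : Fin n) : KHat n := diagSum (DecMat.zero n) (Pi.single a (-1))

/-- The element `0(-2𝐣_1)_∅ + 0(-𝐣_1)_{(1,1)}` of `K̂`. -/
def eltL (n : ℕ) [NeZero n] : KHat n :=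
  diagSum (DecMat.zero n) (Pi.single 0 (-2)) + diagSum (DecMat.zeroDec n) (Pi.single 0 (-1))

/-- The generators of the mirabolic quantum `gl_n`. -/
def generators (n : ℕ) [NeZero n] : Set (KHat n) :=
  {eltL n} ∪ Set.range eltE ∪ Set.range eltF ∪ Set.range eltH ∪ Set.range eltHinv

/-- The mirabolic quantum `gl_n`: the subalgebra of `K̂` generated by these elements. Here `K` is the
algebra with underlying vector space `K̂`, by means of `e`. -/
def mirabolicGl [NeZero n] {K : Type} [Ring K] [Algebra Qv K] (e : K ≃ₗ[Qv] KHat n) :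
    Subalgebra Qv K :=
  Algebra.adjoin Qv (e ⁻¹' generators n)

end

end Mirabolic

/-!
The relative position of two flags and a vector is determined by the dimensions of the intersections
`f i ⊓ h j` and by the sums `f i ⊔ h j` containing the vector, so the orbits are the level sets of
these data (`mem_orbit_iff`).

*Stabilization.* Convolution with an orbit function is a combination of operators `φ ↦ ∑ g, ∑ μ, φ
(g, f', ω - μ)`, where `g` runs through the refinements of `f` whose steps have prescribed sizes and
labels (a word of columns) and `μ` through the span of the marked steps. In a word only the columns
of diagonal positions grow with `p`. Splitting the others into columns of size one, interchanging
neighbours, trading the marks for a sum over translations, and absorbing the small columns into big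
ones turns every word into the trivial one (`ValidWord.preservesStable`). The sums in these moves
run over lines, hyperplanes or vectors between members of a flag, and the number of those in a given
position to `f'` and `ω` is polynomial in `q` and `q ^ p`. So all moves preserve stability, which
gives `exists_isStableConst`. A Laurent polynomial with infinitely many known values is unique. Row
sums, column sums and the size of the part off the diagonal bound the support of the structure
constants (`structConst_support`), so the sums defining the product are finite.

*Relations.* Over a field with `l ^ 2` elements, and with `v` read as `l`, functions on triples are
matrices indexed by flags over the group algebra of `V`. An element of the completed algebra is
realized by a family of such kernels if its coefficients are the stable forms of theirs
(`Realizes`). Products of kernels realize products (`Realizes.mul`), and an element is determined by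
its kernels (`eq_of_kernels`). Since each basis element is realized by an orbit function,
associativity and the unit are inherited from matrices. The generators are realized by explicit
kernels: `E i` and `F i` by moving one step of the flag by one dimension, `H a` by a power of `l`
depending on the size of a step, `L` by the average over the vectors of the first step. For these
kernels the relations are counts of subspaces, hence they hold in the completed algebra
(`freeHom_eq_of_rel`). The resulting homomorphism maps onto the subalgebra because it maps
generators to the chosen generators.
-/

namespace Mirabolic

open scoped LaurentPolynomial
open Module
open Finset (sum_congr range mem_filter sum_eq_single sum_eq_zero mem_singleton mul_sum mem_range
  sum_comm sum_const sum_add_distrib sum_sub_distrib sum_range_succ subset_union_left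
  subset_union_right mem_univ sum_singleton sum_mul sum_filter single_le_sum mem_powerset)
open Submodule (span eq_of_le_of_finrank_eq finrank_sup_add_finrank_inf_eq finrank_mono
  mem_dualAnnihilator span_singleton_le_iff_mem span_mono dualAnnihilator_anti mem_span_singleton
  finrank_lt_finrank_of_lt)
open Matrix (diagonal diagonal_apply_ne diagonal_apply single single_apply transpose_mul transpose
  diagonal_apply_eq diagonal_mul)

attribute [local instance] Module.Finite.of_finite

noncomputable section

/-! ### Pairs of flags and adapted bases -/

namespace PartialFlag

variable {n N : ℕ} {F V : Type} [Field F] [AddCommGroup V] [Module F V]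

/-- The steps of a flag as a sequence indexed by `ℕ`, equal to the whole space from the
index `n` on. -/
def seq (f : PartialFlag n F V) (i : ℕ) : Submodule F V := f.sub ⟨min i n, by omega⟩

theorem sub_eq_seq (f : PartialFlag n F V) (i : Fin (n + 1)) : f.sub i = f.seq i := by
  unfold seq
  exact congrArg f.sub (Fin.ext (min_eq_left (Nat.lt_succ_iff.1 i.2)).symm)

theorem seq_mono (f : PartialFlag n F V) : Monotone f.seq := by
  intro i j h
  apply f.mono
  rw [Fin.le_def]
  simp only
  omega

theorem seq_zero (f : PartialFlag n F V) : f.seq 0 = ⊥ := by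
  rw [← f.bot]
  unfold seq
  exact congrArg f.sub (Fin.ext (by simp))

theorem seq_of_le (f : PartialFlag n F V) {i : ℕ} (h : n ≤ i) : f.seq i = ⊤ := by
  rw [← f.top]
  unfold seq
  congr 1
  ext
  simp [h]

theorem seq_min (f : PartialFlag n F V) (i : ℕ) : f.seq (min i n) = f.seq i := by
  rcases le_total i n with h | h
  · rw [min_eq_left h]
  · rw [min_eq_right h, f.seq_of_le le_rfl, f.seq_of_le h]

theorem ext_seq {f g : PartialFlag n F V} (h : ∀ i, f.seq i = g.seq i) : f = g := by
  obtain ⟨s, _, _, _⟩ := f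
  obtain ⟨t, _, _, _⟩ := g
  have : s = t := by
    funext i
    have := h i
    rw [← sub_eq_seq, ← sub_eq_seq] at this
    exact this
  subst this
  rfl

/-- The flag whose steps are given by a monotone sequence. -/
def ofSeq (s : ℕ → Submodule F V) (hs : Monotone s) (h0 : s 0 = ⊥) (hn : s n = ⊤) :
    PartialFlag n F V where
  sub i := s i
  mono := fun i j h => hs h
  bot := by simpa using h0
  top := by simpa using hn

theorem seq_ofSeq (s : ℕ → Submodule F V) (hs : Monotone s) (h0 : s 0 = ⊥) (hn : s n = ⊤)
    (i : ℕ) : (ofSeq s hs h0 hn).seq i = s i := by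
  unfold seq ofSeq
  simp only
  rcases le_total i n with h | h
  · rw [min_eq_left h]
  · rw [min_eq_right h, hn]
    exact (top_le_iff.1 (hn ▸ hs h)).symm

instance [Finite V] : Finite (PartialFlag n F V) := by
  have : Finite (Submodule F V) := Finite.of_injective (fun p => (p : Set V)) SetLike.coe_injective
  refine Finite.of_injective (fun f : PartialFlag n F V => f.sub) ?_
  rintro ⟨_, _, _, _⟩ ⟨_, _, _, _⟩ h
  simp only at h
  subst h
  rfl

end PartialFlag

section Adapted

variable {n N : ℕ} {F V : Type} [Field F] [AddCommGroup V] [Module F V] [FiniteDimensional F V]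

/-- The dimension of the intersection of two steps. -/
def meetDim (g : PartialFlag N F V) (f : PartialFlag n F V) (i j : ℕ) : ℤ :=
  finrank F ↥(g.seq i ⊓ f.seq j)

theorem meetDim_zero_left (g : PartialFlag N F V) (f : PartialFlag n F V) (j : ℕ) :
    meetDim g f 0 j = 0 := by
  simp [meetDim, g.seq_zero]

theorem meetDim_zero_right (g : PartialFlag N F V) (f : PartialFlag n F V) (i : ℕ) :
    meetDim g f i 0 = 0 := by
  simp [meetDim, f.seq_zero]

theorem meetDim_top_right (g : PartialFlag N F V) (f : PartialFlag n F V) (i : ℕ) {j : ℕ}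
    (hj : n ≤ j) : meetDim g f i j = finrank F (g.seq i) := by
  rw [meetDim, f.seq_of_le hj, inf_top_eq]

theorem meetDim_top_left (g : PartialFlag N F V) (f : PartialFlag n F V) {i : ℕ} (j : ℕ)
    (hi : N ≤ i) : meetDim g f i j = finrank F (f.seq j) := by
  rw [meetDim, g.seq_of_le hi, top_inf_eq]

/-- The second difference of a function of two variables: the size of the block `(i, j)` when
`r` gives the dimensions of intersections. -/
def blockSize (r : ℕ → ℕ → ℤ) (i j : ℕ) : ℤ := r (i + 1) (j + 1) - r i (j + 1) - r (i + 1) j + r i j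

theorem sum_blockSize (r : ℕ → ℕ → ℤ) (h0 : ∀ j, r 0 j = 0) (h0' : ∀ i, r i 0 = 0) (i j : ℕ) :
    ∑ a ∈ range i, ∑ b ∈ range j, blockSize r a b = r i j := by
  have h1 : ∀ a, ∑ b ∈ range j, blockSize r a b = r (a + 1) j - r a j := by
    intro a
    have := Finset.sum_range_sub (fun b => r (a + 1) b - r a b) j
    simp only [h0', sub_self, sub_zero] at this
    rw [← this]
    refine sum_congr rfl fun b _ => ?_
    unfold blockSize
    ring
  simp_rw [h1]
  rw [Finset.sum_range_sub (fun a => r a j) i, h0, sub_zero]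

theorem finrank_sup_meets (g : PartialFlag N F V) (f : PartialFlag n F V) (i j : ℕ) :
    (finrank F ↥((g.seq i ⊓ f.seq (j + 1)) ⊔ (g.seq (i + 1) ⊓ f.seq j)) : ℤ) =
      meetDim g f i (j + 1) + meetDim g f (i + 1) j - meetDim g f i j := by
  have h := finrank_sup_add_finrank_inf_eq (g.seq i ⊓ f.seq (j + 1))
    (g.seq (i + 1) ⊓ f.seq j)
  have h2 : (g.seq i ⊓ f.seq (j + 1)) ⊓ (g.seq (i + 1) ⊓ f.seq j) = g.seq i ⊓ f.seq j := by
    have h3 := g.seq_mono (Nat.le_succ i)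
    have h4 := f.seq_mono (Nat.le_succ j)
    apply le_antisymm
    · exact le_inf (inf_le_left.trans inf_le_left) (inf_le_right.trans inf_le_right)
    · exact le_inf (le_inf inf_le_left (inf_le_right.trans h4))
        (le_inf (inf_le_left.trans h3) inf_le_right)
  rw [h2] at h
  unfold meetDim
  omega

/-- A vector outside `L` starts a family of the expected length which spans `U` modulo `L`. -/
theorem exists_complement_family (a : ℕ) : ∀ (L U : Submodule F V), L ≤ U →
    finrank F U = finrank F L + a → ∀ u : V, (0 < a → u ∈ U ∧ u ∉ L) →
    ∃ c : Fin a → V, (∀ k, c k ∈ U) ∧ (∀ h : 0 < a, c ⟨0, h⟩ = u) ∧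
      U ≤ L ⊔ span F (Set.range c) := by
  induction a with
  | zero =>
    intro L U hLU h u _
    refine ⟨fun k => 0, fun k => k.elim0, fun h => absurd h (lt_irrefl _), ?_⟩
    rw [eq_of_le_of_finrank_eq hLU (by omega)]
    exact le_sup_left
  | succ a ih =>
    intro L U hLU h u hu
    obtain ⟨huU, huL⟩ := hu (Nat.succ_pos a)
    have hL' : finrank F ↥(L ⊔ F ∙ u) = finrank F L + 1 := by
      have h1 := finrank_sup_add_finrank_inf_eq L (F ∙ u)
      have h2 : L ⊓ (F ∙ u) = ⊥ := by
        rw [eq_bot_iff]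
        rintro x ⟨hx, hx'⟩
        obtain ⟨c, rfl⟩ := Submodule.mem_span_singleton.1 hx'
        by_cases hc : c = 0
        · simp [hc]
        · exact absurd ((Submodule.smul_mem_iff _ hc).1 hx) huL
      have hu0 : u ≠ 0 := fun h => huL (h ▸ L.zero_mem)
      rw [h2, finrank_bot, finrank_span_singleton hu0] at h1
      omega
    have hLU' : L ⊔ F ∙ u ≤ U := sup_le hLU ((span_singleton_le_iff_mem _ _).2 huU)
    have hex : ∃ u' : V, 0 < a → u' ∈ U ∧ u' ∉ L ⊔ F ∙ u := by
      by_cases ha : 0 < a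
      · by_contra hcon
        push Not at hcon
        have hle : U ≤ L ⊔ F ∙ u := fun x hx => by
          obtain ⟨_, h3⟩ := hcon x
          exact h3 hx
        have := finrank_mono hle
        omega
      · exact ⟨0, fun h => absurd h ha⟩
    obtain ⟨u', hu'⟩ := hex
    obtain ⟨c, hc1, _, hc3⟩ := ih (L ⊔ F ∙ u) U hLU' (by omega) u' hu'
    refine ⟨Fin.cons u c, ?_, fun _ => rfl, ?_⟩
    · intro k
      refine Fin.cases ?_ (fun k => ?_) k
      · exact huU
      · exact hc1 k
    · rw [Fin.range_cons, Submodule.span_insert]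
      rwa [sup_assoc] at hc3

/-- Vectors chosen in the intersections of the steps of two flags, spanning each intersection
modulo the smaller ones, form a basis adapted to both flags. -/
theorem exists_basis_of_blocks (g : PartialFlag N F V) (f : PartialFlag n F V)
    (a : Fin N × Fin n → ℕ) (ha : ∀ x, (a x : ℤ) = blockSize (meetDim g f) x.1 x.2)
    (c : ∀ x, Fin (a x) → V) (hc : ∀ x k, c x k ∈ g.seq (x.1 + 1) ⊓ f.seq (x.2 + 1))
    (hspan : ∀ x : Fin N × Fin n, g.seq (x.1 + 1) ⊓ f.seq (x.2 + 1) ≤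
      ((g.seq x.1 ⊓ f.seq (x.2 + 1)) ⊔ (g.seq (x.1 + 1) ⊓ f.seq x.2)) ⊔
        span F (Set.range (c x))) :
    ∃ b : Basis (Σ x : Fin N × Fin n, Fin (a x)) F V, (∀ y, b y = c y.1 y.2) ∧
      (∀ i, g.seq i = span F (b '' {y | (y.1.1 : ℕ) < i})) ∧
      (∀ j, f.seq j = span F (b '' {y | (y.1.2 : ℕ) < j})) := by
  set b0 : (Σ x : Fin N × Fin n, Fin (a x)) → V := fun y => c y.1 y.2 with hb0
  set S : ℕ → ℕ → Submodule F V := fun i j =>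
    span F (b0 '' {y | (y.1.1 : ℕ) < i ∧ (y.1.2 : ℕ) < j}) with hS
  have hSmono : ∀ {i i' j j'}, i ≤ i' → j ≤ j' → S i j ≤ S i' j' := by
    intro i i' j j' h h'
    refine span_mono (Set.image_mono ?_)
    rintro y ⟨h1, h2⟩
    exact ⟨lt_of_lt_of_le h1 h, lt_of_lt_of_le h2 h'⟩
  have hle : ∀ i j, i ≤ N → j ≤ n → g.seq i ⊓ f.seq j ≤ S i j := by
    intro i
    induction i with
    | zero => intro j _ _; rw [g.seq_zero, bot_inf_eq]; exact bot_le
    | succ i ihi =>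
      intro j
      induction j with
      | zero => intro _ _; rw [f.seq_zero, inf_bot_eq]; exact bot_le
      | succ j ihj =>
        intro hi hj
        refine (hspan (⟨i, by omega⟩, ⟨j, by omega⟩)).trans ?_
        refine sup_le (sup_le ?_ ?_) ?_
        · exact (ihi (j + 1) (by omega) hj).trans (hSmono (Nat.le_succ _) le_rfl)
        · exact (ihj hi (by omega)).trans (hSmono le_rfl (Nat.le_succ _))
        · refine span_mono ?_
          rintro _ ⟨k, rfl⟩
          exact ⟨⟨(⟨i, by omega⟩, ⟨j, by omega⟩), k⟩, ⟨Nat.lt_succ_self _, Nat.lt_succ_self _⟩, rfl⟩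
  have htop : ⊤ ≤ span F (Set.range b0) := by
    have := hle N n le_rfl le_rfl
    rw [g.seq_of_le le_rfl, f.seq_of_le le_rfl, inf_top_eq] at this
    exact this.trans (span_mono (Set.image_subset_range _ _))
  have hcard : Fintype.card (Σ x : Fin N × Fin n, Fin (a x)) = finrank F V := by
    have h1 := sum_blockSize (meetDim g f) (meetDim_zero_left g f) (meetDim_zero_right g f) N n
    rw [meetDim_top_left g f _ le_rfl, f.seq_of_le le_rfl, finrank_top, Finset.sum_range] at h1
    simp_rw [Finset.sum_range] at h1
    rw [Fintype.card_sigma]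
    simp only [Fintype.card_fin]
    rw [Fintype.sum_prod_type]
    zify
    rw [← h1]
    exact sum_congr rfl fun i _ => sum_congr rfl fun j _ => ha (i, j)
  have hb : ∀ y, basisOfTopLeSpanOfCardEqFinrank b0 htop hcard y = b0 y := by intro y; simp
  refine ⟨basisOfTopLeSpanOfCardEqFinrank b0 htop hcard, hb, ?_, ?_⟩
  · intro i
    rw [coe_basisOfTopLeSpanOfCardEqFinrank]
    apply le_antisymm
    · rw [← g.seq_min]
      have := hle (min i N) n (min_le_right _ _) le_rfl
      rw [f.seq_of_le le_rfl, inf_top_eq] at this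
      refine this.trans (span_mono (Set.image_mono ?_))
      rintro y ⟨h1, -⟩
      exact lt_of_lt_of_le h1 (min_le_left _ _)
    · rw [Submodule.span_le]
      rintro _ ⟨y, hy, rfl⟩
      exact g.seq_mono (Nat.succ_le_of_lt hy) (hc y.1 y.2).1
  · intro j
    rw [coe_basisOfTopLeSpanOfCardEqFinrank]
    apply le_antisymm
    · rw [← f.seq_min]
      have := hle N (min j n) le_rfl (min_le_right _ _)
      rw [g.seq_of_le le_rfl, top_inf_eq] at this
      refine this.trans (span_mono (Set.image_mono ?_))
      rintro y ⟨-, h1⟩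
      exact lt_of_lt_of_le h1 (min_le_left _ _)
    · rw [Submodule.span_le]
      rintro _ ⟨y, hy, rfl⟩
      exact f.seq_mono (Nat.succ_le_of_lt hy) (hc y.1 y.2).2

theorem blockSize_nonneg (g : PartialFlag N F V) (f : PartialFlag n F V) (i j : ℕ) :
    0 ≤ blockSize (meetDim g f) i j := by
  have h := finrank_sup_meets g f i j
  have h2 : (g.seq i ⊓ f.seq (j + 1)) ⊔ (g.seq (i + 1) ⊓ f.seq j) ≤
      g.seq (i + 1) ⊓ f.seq (j + 1) :=
    sup_le (inf_le_inf_right _ (g.seq_mono (Nat.le_succ i)))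
      (inf_le_inf_left _ (f.seq_mono (Nat.le_succ j)))
  have h3 := finrank_mono h2
  unfold blockSize
  unfold meetDim at h ⊢
  omega

/-- Two flags have an adapted basis, in which prescribed vectors may occur as the first vectors of
their blocks. -/
theorem exists_adapted_basis (g : PartialFlag N F V) (f : PartialFlag n F V)
    (a : Fin N × Fin n → ℕ) (ha : ∀ x, (a x : ℤ) = blockSize (meetDim g f) x.1 x.2)
    (P : Fin N × Fin n → Prop) (u : Fin N × Fin n → V)
    (hu : ∀ x, P x → u x ∈ g.seq (x.1 + 1) ⊓ f.seq (x.2 + 1) ∧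
      u x ∉ (g.seq x.1 ⊓ f.seq (x.2 + 1)) ⊔ (g.seq (x.1 + 1) ⊓ f.seq x.2)) :
    ∃ b : Basis (Σ x : Fin N × Fin n, Fin (a x)) F V,
      (∀ x, P x → ∀ h : 0 < a x, b ⟨x, ⟨0, h⟩⟩ = u x) ∧
      (∀ i, g.seq i = span F (b '' {y | (y.1.1 : ℕ) < i})) ∧
      (∀ j, f.seq j = span F (b '' {y | (y.1.2 : ℕ) < j})) := by
  have key : ∀ x : Fin N × Fin n, ∃ c : Fin (a x) → V,
      (∀ k, c k ∈ g.seq (x.1 + 1) ⊓ f.seq (x.2 + 1)) ∧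
      (P x → ∀ h : 0 < a x, c ⟨0, h⟩ = u x) ∧
      g.seq (x.1 + 1) ⊓ f.seq (x.2 + 1) ≤
      ((g.seq x.1 ⊓ f.seq (x.2 + 1)) ⊔ (g.seq (x.1 + 1) ⊓ f.seq x.2)) ⊔
        span F (Set.range c) := by
    intro x
    have hLU : (g.seq x.1 ⊓ f.seq (x.2 + 1)) ⊔ (g.seq (x.1 + 1) ⊓ f.seq x.2) ≤
        g.seq (x.1 + 1) ⊓ f.seq (x.2 + 1) :=
      sup_le (inf_le_inf_right _ (g.seq_mono (Nat.le_succ _)))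
        (inf_le_inf_left _ (f.seq_mono (Nat.le_succ _)))
    have hfr : finrank F ↥(g.seq (x.1 + 1) ⊓ f.seq (x.2 + 1)) =
        finrank F ↥((g.seq x.1 ⊓ f.seq (x.2 + 1)) ⊔ (g.seq (x.1 + 1) ⊓ f.seq x.2)) + a x := by
      have h := finrank_sup_meets g f x.1 x.2
      have h2 := ha x
      unfold blockSize at h2
      unfold meetDim at h h2
      omega
    by_cases hx : P x
    · obtain ⟨c, h1, h2, h3⟩ := exists_complement_family (a x) _ _ hLU hfr (u x) fun _ => hu x hx
      exact ⟨c, h1, fun _ => h2, h3⟩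
    · have hex : ∃ u' : V, 0 < a x → u' ∈ g.seq (x.1 + 1) ⊓ f.seq (x.2 + 1) ∧
          u' ∉ (g.seq x.1 ⊓ f.seq (x.2 + 1)) ⊔ (g.seq (x.1 + 1) ⊓ f.seq x.2) := by
        by_cases h0 : 0 < a x
        · obtain ⟨u', h1, h2⟩ := SetLike.exists_of_lt
            (lt_of_le_of_ne hLU (fun h => by rw [h] at hfr; omega))
          exact ⟨u', fun _ => ⟨h1, h2⟩⟩
        · exact ⟨0, fun h => absurd h h0⟩
      obtain ⟨u', hu'⟩ := hex
      obtain ⟨c, h1, h2, h3⟩ := exists_complement_family (a x) _ _ hLU hfr u' hu'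
      exact ⟨c, h1, fun h => absurd h hx, h3⟩
  choose c hc1 hc2 hc3 using key
  obtain ⟨b, hb, hb1, hb2⟩ := exists_basis_of_blocks g f a ha c hc1 hc3
  exact ⟨b, fun x hx h => (hb _).trans (hc2 x hx h), hb1, hb2⟩

end Adapted

section AdaptedCoordinates

variable {n N : ℕ} {F V κ : Type} [Field F] [AddCommGroup V] [Module F V]

/-- A basis each of whose members carries a row and a column number, such that the steps of two
flags are spanned by the basis vectors with small row, respectively column, number. -/
structure IsAdapted (g : PartialFlag N F V) (f : PartialFlag n F V) (b : Basis κ F V)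
    (row col : κ → ℕ) : Prop where
  left : ∀ i, g.seq i = span F (b '' {y | row y < i})
  right : ∀ j, f.seq j = span F (b '' {y | col y < j})

namespace IsAdapted

variable {g : PartialFlag N F V} {f : PartialFlag n F V} {b : Basis κ F V} {row col : κ → ℕ}

theorem mem_left (h : IsAdapted g f b row col) {i : ℕ} {x : V} :
    x ∈ g.seq i ↔ ∀ y, b.repr x y ≠ 0 → row y < i := by
  rw [h.left, b.mem_span_image]
  simp [Set.subset_def]

theorem mem_right (h : IsAdapted g f b row col) {j : ℕ} {x : V} :
    x ∈ f.seq j ↔ ∀ y, b.repr x y ≠ 0 → col y < j := by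
  rw [h.right, b.mem_span_image]
  simp [Set.subset_def]

theorem mem_sup (h : IsAdapted g f b row col) {i j : ℕ} {x : V} :
    x ∈ g.seq i ⊔ f.seq j ↔ ∀ y, b.repr x y ≠ 0 → row y < i ∨ col y < j := by
  rw [h.left, h.right, ← Submodule.span_union, ← Set.image_union, b.mem_span_image]
  simp [Set.subset_def]

theorem mem_inf (h : IsAdapted g f b row col) {i j : ℕ} {x : V} :
    x ∈ g.seq i ⊓ f.seq j ↔ ∀ y, b.repr x y ≠ 0 → row y < i ∧ col y < j := by
  rw [Submodule.mem_inf, h.mem_left, h.mem_right]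
  exact ⟨fun h y hy => ⟨h.1 y hy, h.2 y hy⟩, fun h => ⟨fun y hy => (h y hy).1, fun y hy => (h y hy).2⟩⟩

theorem inf_eq (h : IsAdapted g f b row col) (i j : ℕ) :
    g.seq i ⊓ f.seq j = span F (b '' {y | row y < i ∧ col y < j}) := by
  ext x
  rw [h.mem_inf, b.mem_span_image]
  simp [Set.subset_def]

/-- The sum of intersections of steps over a set of blocks consists of the vectors supported
in the lower set generated by these blocks. -/
theorem mem_iSup (h : IsAdapted g f b row col) {I : Set (ℕ × ℕ)} {x : V} :
    x ∈ (⨆ y ∈ I, g.seq (y.1 + 1) ⊓ f.seq (y.2 + 1)) ↔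
      ∀ k, b.repr x k ≠ 0 → ∃ y ∈ I, row k ≤ y.1 ∧ col k ≤ y.2 := by
  simp_rw [h.inf_eq]
  rw [← Submodule.span_iUnion₂, ← Set.image_iUnion₂, b.mem_span_image]
  simp only [Set.subset_def, Finset.mem_coe, Finsupp.mem_support_iff, Set.mem_iUnion,
    Set.mem_ofPred_eq, Nat.lt_succ_iff, exists_prop]

theorem finrank_span_image [Fintype κ] (b : Basis κ F V) (s : Set κ) [DecidablePred (· ∈ s)] :
    finrank F ↥(span F (b '' s)) = (Finset.univ.filter (· ∈ s)).card := by
  have h := b.linearIndependent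
  have h2 : LinearIndependent F (fun y : s => b y) := h.comp _ Subtype.val_injective
  have h3 := finrank_span_eq_card h2
  have h4 : Set.range (fun y : s => b y) = b '' s := by ext x; simp
  rw [h4] at h3
  rw [h3, Fintype.card_subtype]

theorem meetDim_eq [Fintype κ] (h : IsAdapted g f b row col) (i j : ℕ) :
    meetDim g f i j = (Finset.univ.filter fun y => row y < i ∧ col y < j).card := by
  classical
  unfold meetDim
  rw [h.inf_eq, finrank_span_image]
  rfl

end IsAdapted

theorem exists_isAdapted [FiniteDimensional F V] (g : PartialFlag N F V) (f : PartialFlag n F V) :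
    ∃ (a : Fin N × Fin n → ℕ) (b : Basis (Σ x : Fin N × Fin n, Fin (a x)) F V),
      IsAdapted g f b (fun y => y.1.1) (fun y => y.1.2) ∧
      ∀ x, (a x : ℤ) = blockSize (meetDim g f) x.1 x.2 := by
  have ha : ∀ x : Fin N × Fin n,
      (((blockSize (meetDim g f) x.1 x.2).toNat : ℕ) : ℤ) = blockSize (meetDim g f) x.1 x.2 :=
    fun x => Int.toNat_of_nonneg (blockSize_nonneg g f _ _)
  obtain ⟨b, -, h1, h2⟩ := exists_adapted_basis g f
    (fun x => (blockSize (meetDim g f) x.1 x.2).toNat) ha (fun _ => False) (fun _ => 0)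
    (fun _ h => h.elim)
  exact ⟨_, b, ⟨h1, h2⟩, ha⟩

end AdaptedCoordinates

/-! ### The orbits as level sets of dimensions and incidences -/

namespace DecMat

variable {n : ℕ}

theorem ext_mat {M M' : DecMat n} (h : M.mat = M'.mat) (h' : M.dec = M'.dec) : M = M' := by
  obtain ⟨_, _, _, _, _⟩ := M
  obtain ⟨_, _, _, _, _⟩ := M'
  simp only at h h'
  subst h h'
  rfl

/-- All entries are nonnegative, and positive at the decorated positions: the orbit attached to the
decorated matrix is the intended one. -/
def Effective (M : DecMat n) : Prop := (∀ i j, 0 ≤ M.mat i j) ∧ ∀ x ∈ M.dec, 0 < M.mat x.1 x.2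

theorem shift_mat (p : ℕ) (M : DecMat n) (i j : Fin n) :
    (M.shift p).mat i j = M.mat i j + if i = j then (p : ℤ) else 0 := by
  simp [shift, diagonal_apply]

theorem exists_effective_shift (M : DecMat n) : ∃ p₀ : ℕ, ∀ p, p₀ ≤ p → (M.shift p).Effective := by
  refine ⟨∑ i, (M.mat i i).natAbs + 1, fun p hp => ?_⟩
  have h1 : ∀ i, 0 < M.mat i i + p := by
    intro i
    have := single_le_sum (f := fun i => (M.mat i i).natAbs) (fun _ _ => Nat.zero_le _)
      (mem_univ i)
    omega
  constructor
  · intro i j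
    rw [shift_mat]
    split_ifs with h
    · rw [← h]; exact (h1 i).le
    · rw [add_zero]; exact M.nonneg i j h
  · intro x hx
    rw [shift_mat]
    split_ifs with h
    · rw [← h]; exact h1 _
    · rw [add_zero]; exact M.pos x hx h

/-- `(a, b)` lies weakly below a member of the decoration. -/
def Below (M : DecMat n) (a b : ℕ) : Prop := ∃ x ∈ M.dec, a ≤ (x.1 : ℕ) ∧ b ≤ (x.2 : ℕ)

/-- The sum of the entries in the first `i` rows and first `j` columns. -/
def corner (M : DecMat n) (i j : ℕ) : ℤ :=
  ∑ x : Fin n × Fin n, if (x.1 : ℕ) < i ∧ (x.2 : ℕ) < j then M.mat x.1 x.2 else 0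

theorem corner_zero_left (M : DecMat n) (j : ℕ) : M.corner 0 j = 0 := by
  simp [corner]

theorem corner_zero_right (M : DecMat n) (j : ℕ) : M.corner j 0 = 0 := by
  simp [corner]

theorem blockSize_corner (M : DecMat n) (i j : Fin n) : blockSize M.corner i j = M.mat i j := by
  unfold blockSize corner
  rw [← sum_sub_distrib, ← sum_sub_distrib, ← sum_add_distrib]
  rw [sum_eq_single (i, j)]
  · simp
  · grind
  · simp

theorem dec_eq_of_below {M M' : DecMat n} (h : ∀ a b, M.Below a b ↔ M'.Below a b) :
    M.dec = M'.dec := by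
  have key : ∀ {M M' : DecMat n}, (∀ a b, M.Below a b ↔ M'.Below a b) → M.dec ⊆ M'.dec := by
    intro M M' h x hx
    obtain ⟨y, hy, h1, h2⟩ := (h x.1 x.2).1 ⟨x, hx, le_rfl, le_rfl⟩
    obtain ⟨z, hz, h3, h4⟩ := (h y.1 y.2).2 ⟨y, hy, le_rfl, le_rfl⟩
    have hxz : x = z := by
      by_contra hne
      have := M.chain x hx z hz hne
      simp only [Fin.lt_def] at this
      omega
    have hxy : x = y := by grind
    exact hxy ▸ hy
  exact Finset.Subset.antisymm (key h) (key fun a b => (h a b).symm)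

end DecMat

section Classification

variable {n : ℕ} {F V : Type} [Field F] [AddCommGroup V] [Module F V] [FiniteDimensional F V]

/-- The relative position of a triple is the one prescribed by a decorated matrix. -/
def HasPosition (M : DecMat n) (t : PartialFlag n F V × PartialFlag n F V × V) : Prop :=
  (∀ i j, i ≤ n → j ≤ n → meetDim t.1 t.2.1 i j = M.corner i j) ∧
    ∀ a b, t.2.2 ∉ t.1.seq a ⊔ t.2.1.seq b ↔ M.Below a b

theorem HasPosition.blockSize {M : DecMat n} {t : PartialFlag n F V × PartialFlag n F V × V}
    (h : HasPosition M t) (i j : Fin n) :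
    blockSize (meetDim t.1 t.2.1) i j = M.mat i j := by
  rw [← M.blockSize_corner]
  unfold Mirabolic.blockSize
  rw [h.1 _ _ i.2 j.2, h.1 _ _ i.2.le j.2, h.1 _ _ i.2 j.2.le, h.1 _ _ i.2.le j.2.le]

/-- The level sets of the position data are disjoint. -/
theorem HasPosition.unique {M M' : DecMat n} {t : PartialFlag n F V × PartialFlag n F V × V}
    (h : HasPosition M t) (h' : HasPosition M' t) : M = M' := by
  refine DecMat.ext_mat ?_ (DecMat.dec_eq_of_below fun a b => (h.2 a b).symm.trans (h'.2 a b))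
  ext i j
  rw [← h.blockSize, ← h'.blockSize]

theorem hasPosition_of_blockSize {M : DecMat n} {t : PartialFlag n F V × PartialFlag n F V × V}
    (h1 : ∀ i j : Fin n, blockSize (meetDim t.1 t.2.1) i j = M.mat i j)
    (h2 : ∀ a b, t.2.2 ∉ t.1.seq a ⊔ t.2.1.seq b ↔ M.Below a b) : HasPosition M t := by
  refine ⟨fun i j hi hj => ?_, h2⟩
  rw [← sum_blockSize (meetDim t.1 t.2.1) (meetDim_zero_left _ _) (meetDim_zero_right _ _),
    ← sum_blockSize M.corner M.corner_zero_left M.corner_zero_right]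
  refine sum_congr rfl fun a ha => sum_congr rfl fun b hb => ?_
  have ha' := Finset.mem_range.1 ha
  have hb' := Finset.mem_range.1 hb
  have h3 := h1 ⟨a, by omega⟩ ⟨b, by omega⟩
  have h4 := M.blockSize_corner ⟨a, by omega⟩ ⟨b, by omega⟩
  simp only at h3 h4
  rw [h3, h4]

theorem hasPosition_of_mem_orbit {M : DecMat n} (hM : M.Effective)
    {t : PartialFlag n F V × PartialFlag n F V × V} (ht : t ∈ orbit M) : HasPosition M t := by
  obtain ⟨b, h1, h2, h3⟩ := ht
  have had : IsAdapted t.1 t.2.1 b (fun y => (y.1.1 : ℕ)) (fun y => (y.1.2 : ℕ)) := by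
    constructor
    · intro i
      rw [← t.1.seq_min]
      unfold PartialFlag.seq
      grind
    · intro i
      rw [← t.2.1.seq_min]
      unfold PartialFlag.seq
      grind
  constructor
  · intro i j _ _
    rw [had.meetDim_eq, Finset.card_filter]
    unfold DecMat.corner
    rw [Fintype.sum_sigma]
    push_cast
    refine sum_congr rfl fun x _ => ?_
    simp only [sum_const, Finset.card_univ, Fintype.card_fin]
    have := hM.1 x.1 x.2
    split_ifs
    · simp [this]
    · simp
  · intro a c
    have hrepr : ∀ y, b.repr t.2.2 y = if y.1 ∈ M.dec ∧ y.2.1 = 0 then 1 else 0 := by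
      intro y
      rw [h3, map_sum, Finsupp.finsetSum_apply, sum_eq_single y]
      · split_ifs <;> simp
      · intro z _ hz
        split_ifs
        · simp [hz]
        · simp
      · simp
    rw [had.mem_sup]
    push Not
    constructor
    · rintro ⟨y, hy, h4, h5⟩
      rw [hrepr] at hy
      have hy' : y.1 ∈ M.dec ∧ y.2.1 = 0 := by
        by_contra hcon
        exact hy (if_neg hcon)
      exact ⟨y.1, hy'.1, h4, h5⟩
    · rintro ⟨x, hx, h4, h5⟩
      have hpos := hM.2 x hx
      refine ⟨⟨x, ⟨0, by omega⟩⟩, ?_, h4, h5⟩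
      rw [hrepr, if_pos ⟨hx, rfl⟩]
      exact one_ne_zero

/-- A vector which avoids exactly the sums of steps below the decoration is a sum of vectors from
the decorated intersections of steps, each nonzero modulo the smaller intersections. -/
theorem exists_decomposition {M : DecMat n} {t : PartialFlag n F V × PartialFlag n F V × V}
    (ht : ∀ a b, t.2.2 ∉ t.1.seq a ⊔ t.2.1.seq b ↔ M.Below a b) :
    ∃ u : Fin n × Fin n → V, t.2.2 = ∑ x ∈ M.dec, u x ∧
      ∀ x ∈ M.dec, u x ∈ t.1.seq (x.1 + 1) ⊓ t.2.1.seq (x.2 + 1) ∧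
        u x ∉ (t.1.seq x.1 ⊓ t.2.1.seq (x.2 + 1)) ⊔ (t.1.seq (x.1 + 1) ⊓ t.2.1.seq x.2) := by
  obtain ⟨a, b, had, -⟩ := exists_isAdapted t.1 t.2.1
  have hmem : t.2.2 ∈ ⨆ x ∈ M.dec, t.1.seq (x.1 + 1) ⊓ t.2.1.seq (x.2 + 1) := by
    have h1 : t.2.2 ∈ (⨆ y ∈ ((fun x : Fin n × Fin n => ((x.1 : ℕ), (x.2 : ℕ))) ''
        (M.dec : Set (Fin n × Fin n))), t.1.seq (y.1 + 1) ⊓ t.2.1.seq (y.2 + 1)) := by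
      rw [had.mem_iSup]
      intro k hk
      have h2 : t.2.2 ∉ t.1.seq (k.1.1 : ℕ) ⊔ t.2.1.seq (k.1.2 : ℕ) := by
        rw [had.mem_sup]
        grind
      obtain ⟨x, hx, h3, h4⟩ := (ht _ _).1 h2
      exact ⟨_, ⟨x, hx, rfl⟩, h3, h4⟩
    rw [iSup_image] at h1
    exact h1
  rw [Submodule.mem_iSup_finset_iff_exists_sum] at hmem
  obtain ⟨u, hu⟩ := hmem
  refine ⟨fun x => u x, hu.symm, fun x hx => ⟨(u x).2, fun hcon => ?_⟩⟩
  have h5 : t.2.2 ∉ t.1.seq x.1 ⊔ t.2.1.seq x.2 := (ht _ _).2 ⟨x, hx, le_rfl, le_rfl⟩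
  apply h5
  rw [← hu]
  refine Submodule.sum_mem _ fun y hy => ?_
  by_cases hxy : y = x
  · subst hxy
    exact (sup_le_sup inf_le_left inf_le_right :
      (t.1.seq y.1 ⊓ t.2.1.seq (y.2 + 1)) ⊔ (t.1.seq (y.1 + 1) ⊓ t.2.1.seq y.2) ≤
        t.1.seq y.1 ⊔ t.2.1.seq y.2) hcon
  · rcases M.chain y hy x hx hxy with h | h
    · exact (le_sup_left : t.1.seq x.1 ≤ _) (t.1.seq_mono (Nat.succ_le_of_lt h.1) (u y).2.1)
    · exact (le_sup_right : t.2.1.seq x.2 ≤ _) (t.2.1.seq_mono (Nat.succ_le_of_lt h.2) (u y).2.2)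

theorem mem_orbit_of_hasPosition {M : DecMat n} (hM : M.Effective)
    {t : PartialFlag n F V × PartialFlag n F V × V} (ht : HasPosition M t) : t ∈ orbit M := by
  obtain ⟨u, hu1, hu2⟩ := exists_decomposition ht.2
  obtain ⟨b, hb, h1, h2⟩ := exists_adapted_basis t.1 t.2.1 (fun x => (M.mat x.1 x.2).toNat)
    (fun x => by
      have := hM.1 x.1 x.2
      rw [ht.blockSize]
      omega) (fun x => x ∈ M.dec) u hu2
  refine ⟨b, fun i => ?_, fun j => ?_, ?_⟩
  · rw [PartialFlag.sub_eq_seq, h1]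
  · rw [PartialFlag.sub_eq_seq, h2]
  · rw [hu1, Fintype.sum_sigma, ← Finset.sum_filter_add_sum_filter_not Finset.univ (· ∈ M.dec)]
    rw [sum_eq_zero (s := Finset.univ.filter fun x => ¬ x ∈ M.dec)]
    · rw [add_zero, Finset.filter_mem_eq_inter, Finset.univ_inter]
      refine sum_congr rfl fun x hx => ?_
      have hpos := hM.2 x hx
      have hpos' : 0 < (M.mat x.1 x.2).toNat := by omega
      rw [sum_eq_single ⟨0, hpos'⟩]
      · grind
      · grind
      · simp
    · intro x hx
      have := (Finset.mem_filter.1 hx).2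
      exact sum_eq_zero fun k _ => if_neg fun h => this h.1

/-- The orbits are the level sets of the position data. -/
theorem mem_orbit_iff {M : DecMat n} (hM : M.Effective)
    {t : PartialFlag n F V × PartialFlag n F V × V} : t ∈ orbit M ↔ HasPosition M t :=
  ⟨hasPosition_of_mem_orbit hM, mem_orbit_of_hasPosition hM⟩

/-- Every triple lies in the orbit of some decorated matrix. -/
theorem exists_hasPosition (t : PartialFlag n F V × PartialFlag n F V × V) :
    ∃ M : DecMat n, M.Effective ∧ HasPosition M t := by
  classical
  obtain ⟨a, b, had, ha⟩ := exists_isAdapted t.1 t.2.1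
  set I : Finset (Fin n × Fin n) :=
    Finset.univ.filter fun x => t.2.2 ∉ t.1.seq x.1 ⊔ t.2.1.seq x.2 with hI
  set D : Finset (Fin n × Fin n) := I.filter fun x => Maximal (· ∈ I) x with hD
  have hsupp : ∀ c d : ℕ, t.2.2 ∉ t.1.seq c ⊔ t.2.1.seq d →
      ∃ x ∈ I, c ≤ x.1 ∧ d ≤ x.2 ∧ 0 < a x := by
    intro c d h
    rw [had.mem_sup] at h
    push Not at h
    obtain ⟨y, hy, h1, h2⟩ := h
    refine ⟨y.1, ?_, h1, h2, lt_of_le_of_lt (Nat.zero_le _) y.2.2⟩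
    rw [hI, mem_filter]
    refine ⟨mem_univ _, ?_⟩
    rw [had.mem_sup]
    intro hcon
    rcases hcon y hy with h | h <;> exact lt_irrefl _ h
  have hpos : ∀ x ∈ D, 0 < blockSize (meetDim t.1 t.2.1) x.1 x.2 := by
    intro x hx
    rw [hD, mem_filter] at hx
    obtain ⟨y, hy, h1, h2, h3⟩ := hsupp x.1 x.2 (Finset.mem_filter.1 hx.1).2
    have hxy : x ≤ y := ⟨h1, h2⟩
    have := le_antisymm hxy (hx.2.2 hy hxy)
    subst this
    rw [← ha]
    exact_mod_cast h3
  refine ⟨⟨fun i j => blockSize (meetDim t.1 t.2.1) i j, D,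
    fun i j _ => blockSize_nonneg _ _ _ _, ?_, fun x hx _ => hpos x hx⟩, ⟨?_, hpos⟩, ?_⟩
  · intro x hx y hy hxy
    rw [hD, mem_filter] at hx hy
    have h1 : ¬ x ≤ y := fun h => hxy (le_antisymm h (hx.2.2 hy.1 h))
    have h2 : ¬ y ≤ x := fun h => hxy (le_antisymm (hy.2.2 hx.1 h) h)
    rw [Prod.le_def] at h1 h2
    simp only [Fin.le_def, Fin.lt_def] at h1 h2 ⊢
    omega
  · intro i j
    exact blockSize_nonneg _ _ _ _
  · refine hasPosition_of_blockSize (fun i j => rfl) fun c d => ?_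
    constructor
    · intro h
      obtain ⟨x, hx, h1, h2, -⟩ := hsupp c d h
      obtain ⟨y, hxy, hy⟩ := Finset.exists_le_maximal I hx
      exact ⟨y, Finset.mem_filter.2 ⟨hy.1, hy⟩, h1.trans hxy.1, h2.trans hxy.2⟩
    · rintro ⟨x, hx, h1, h2⟩ hcon
      have hx' := (Finset.mem_filter.1 (Finset.mem_filter.1 hx).1).2
      exact hx' (sup_le_sup (t.1.seq_mono h1) (t.2.1.seq_mono h2) hcon)

/-- Over every field the orbit of an effective decorated matrix is nonempty. -/
theorem orbit_nonempty (F : Type) [Field F] (M : DecMat n) :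
    ∃ (d : ℕ) (t : PartialFlag n F (Fin d → F) × PartialFlag n F (Fin d → F) × (Fin d → F)),
      t ∈ orbit M := by
  classical
  let e : M.Box ≃ Fin (Fintype.card M.Box) := Fintype.equivFin _
  let b : Basis M.Box F (Fin (Fintype.card M.Box) → F) := (Pi.basisFun F _).reindex e.symm
  let mk : (M.Box → Fin n) → PartialFlag n F (Fin (Fintype.card M.Box) → F) := fun r =>
    { sub := fun i => span F (b '' {x | (r x : ℕ) < i.1})
      mono := fun i j h => span_mono (Set.image_mono fun x (hx : (r x : ℕ) < i.1) =>
        show (r x : ℕ) < j.1 from lt_of_lt_of_le hx h)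
      bot := by simp
      top := by
        have : {x | ((r x : Fin n) : ℕ) < (Fin.last n).1} = Set.univ := by
          ext x
          simp
        rw [this, Set.image_univ, b.span_eq] }
  exact ⟨_, (mk fun x => x.1.1, mk fun x => x.1.2,
    ∑ x : M.Box, if x.1 ∈ M.dec ∧ x.2.1 = 0 then b x else 0), b, fun i => rfl, fun j => rfl, rfl⟩

end Classification

/-! ### Functions represented by Laurent polynomials -/

section Represented

open Polynomial in
/-- A rational function which takes integer values at infinitely many natural numbers is a
polynomial. -/
theorem exists_eq_mul_of_integer_values (f g : ℚ[X]) (Q : Set ℕ) (hQ : Q.Infinite)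
    (h : ∀ q ∈ Q, g.eval (q : ℚ) ≠ 0 ∧ ∃ z : ℤ, (z : ℚ) * g.eval (q : ℚ) = f.eval (q : ℚ)) :
    ∃ P : ℚ[X], f = P * g := by
  have hg : g ≠ 0 := by
    rintro rfl
    obtain ⟨q, hq⟩ := hQ.nonempty
    exact (h q hq).1 (by simp)
  have hden : ∀ a : ℚ[X], ∃ D : ℕ, D ≠ 0 ∧ ∀ m : ℕ, ∃ z : ℤ, (D : ℚ) * a.eval (m : ℚ) = z := by
    intro a
    induction a using Polynomial.induction_on' with
    | add a b ha hb =>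
      obtain ⟨D, hD, h1⟩ := ha
      obtain ⟨E, hE, h2⟩ := hb
      refine ⟨D * E, mul_ne_zero hD hE, fun m => ?_⟩
      obtain ⟨z, hz⟩ := h1 m
      obtain ⟨w, hw⟩ := h2 m
      refine ⟨E * z + D * w, ?_⟩
      push_cast
      rw [← hz, ← hw, eval_add]
      ring
    | monomial k c =>
      refine ⟨c.den, c.den_nz, fun m => ⟨c.num * m ^ k, ?_⟩⟩
      push_cast
      rw [eval_monomial, ← mul_assoc, Rat.den_mul_eq_num]
  obtain ⟨D, hD, hz⟩ := hden (f / g)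
  have hdiv : g * (f / g) + f % g = f := EuclideanDomain.div_add_mod f g
  have hdeg : (f % g).degree < g.degree := EuclideanDomain.mod_lt f hg
  have hlim := Polynomial.div_tendsto_atTop_zero_of_degree_lt (f % g) g hdeg
  have hlim2 : Filter.Tendsto (fun m : ℕ => (D : ℚ) * ((f % g).eval (m : ℚ) / g.eval (m : ℚ)))
      Filter.atTop (nhds 0) := by
    have := (hlim.comp tendsto_natCast_atTop_atTop).const_mul (D : ℚ)
    simpa using this
  have hev : ∀ᶠ m : ℕ in Filter.atTop,
      |(D : ℚ) * ((f % g).eval (m : ℚ) / g.eval (m : ℚ))| < 1 := by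
    have := hlim2.abs
    rw [abs_zero] at this
    exact this.eventually (gt_mem_nhds one_pos)
  obtain ⟨m₀, hm₀⟩ := Filter.eventually_atTop.1 hev
  have hzero : ∀ q ∈ Q, m₀ ≤ q → (f % g).eval (q : ℚ) = 0 := by
    intro q hq hq'
    obtain ⟨h1, z, h2⟩ := h q hq
    obtain ⟨w, hw⟩ := hz q
    have h3 : (f % g).eval (q : ℚ) / g.eval (q : ℚ) = z - (f / g).eval (q : ℚ) := by
      rw [div_eq_iff h1]
      have := congrArg (Polynomial.eval (q : ℚ)) hdiv
      rw [eval_add, eval_mul] at this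
      linear_combination this - h2
    have h4 := hm₀ q hq'
    rw [h3, mul_sub, hw] at h4
    have h5 : ((D * z - w : ℤ) : ℚ) = D * z - w := by push_cast; ring
    rw [← h5, ← Int.cast_abs] at h4
    have h6 : |(D * z - w : ℤ)| < 1 := by exact_mod_cast h4
    have h7 : (D * z - w : ℤ) = 0 := Int.abs_lt_one_iff.1 h6
    have h8 : (D : ℚ) * ((f % g).eval (q : ℚ) / g.eval (q : ℚ)) = 0 := by
      rw [h3, mul_sub, hw, ← h5, h7]
      simp
    rcases mul_eq_zero.1 h8 with h9 | h9
    · exact absurd (by exact_mod_cast h9) hD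
    · exact (div_eq_zero_iff.1 h9).resolve_right h1
  have hr : f % g = 0 := by
    have hinf : (Q \ Set.Iio m₀).Infinite := hQ.sdiff (Set.finite_Iio m₀)
    refine Polynomial.eq_zero_of_infinite_isRoot _ ?_
    refine (hinf.image (f := fun m : ℕ => (m : ℚ)) Nat.cast_injective.injOn).mono ?_
    rintro _ ⟨q, ⟨hq, hq'⟩, rfl⟩
    exact hzero q hq (not_lt.1 hq')
  refine ⟨f / g, ?_⟩
  rw [hr, add_zero] at hdiv
  rw [mul_comm]
  exact hdiv.symm

/-- The evaluation `v' ↦ v ^ (-p)` of Laurent polynomials in `v'`. -/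
abbrev evalAt (p : ℕ) : Qv[T;T⁻¹] →+* Qv :=
  LaurentPolynomial.eval₂ (RingHom.id Qv) (vUnit ^ (-(p : ℤ)))

theorem vUnit_val : (vUnit : Qv) = v := rfl

theorem v_ne_zero : v ≠ 0 := RatFunc.X_ne_zero

theorem evalAt_T (p : ℕ) (m : ℤ) : evalAt p (LaurentPolynomial.T m) = v ^ (-(p : ℤ) * m) := by
  rw [evalAt, LaurentPolynomial.eval₂_T, ← zpow_mul, Units.val_zpow_eq_zpow_val, vUnit_val]

theorem evalAt_C (p : ℕ) (c : Qv) : evalAt p (LaurentPolynomial.C c) = c := by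
  rw [evalAt, LaurentPolynomial.eval₂_C, RingHom.id_apply]

theorem aeval_v_injective : Function.Injective (Polynomial.aeval v : Polynomial ℚ →ₐ[ℚ] Qv) := by
  have h : ∀ f : Polynomial ℚ, Polynomial.aeval v f = algebraMap (Polynomial ℚ) Qv f := by
    intro f
    have : (Polynomial.aeval v : Polynomial ℚ →ₐ[ℚ] Qv) =
        (IsScalarTower.toAlgHom ℚ (Polynomial ℚ) Qv) := by
      apply Polynomial.algHom_ext
      simp [v]
    rw [this]
    rfl
  intro f g hfg
  rw [h, h] at hfg
  exact IsFractionRing.injective (Polynomial ℚ) Qv hfg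

theorem aeval_v_sq (f : Polynomial ℚ) :
    Polynomial.aeval (v ^ 2) f = Polynomial.aeval v (f.comp (Polynomial.X ^ 2)) := by
  rw [Polynomial.aeval_comp]
  simp

theorem aeval_v_sq_injective :
    Function.Injective (Polynomial.aeval (v ^ 2) : Polynomial ℚ →ₐ[ℚ] Qv) := by
  rw [injective_iff_map_eq_zero]
  intro f hf
  rw [aeval_v_sq] at hf
  have h := (injective_iff_map_eq_zero _).1 aeval_v_injective _ hf
  rcases Polynomial.comp_eq_zero_iff.1 h with h1 | ⟨-, h1⟩
  · exact h1
  · have := congrArg Polynomial.natDegree h1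
    simp at this

theorem v_zpow_injective : Function.Injective fun m : ℤ => v ^ m := by
  have h1 : ∀ k : ℕ, v ^ k = 1 → k = 0 := by
    intro k hk
    have : Polynomial.aeval v (Polynomial.X ^ k : Polynomial ℚ) =
        Polynomial.aeval v (1 : Polynomial ℚ) := by
      simpa using hk
    have := congrArg Polynomial.natDegree (aeval_v_injective this)
    simpa using this
  have h2 : ∀ k : ℤ, v ^ k = 1 → k = 0 := by
    intro k hk
    rcases Int.eq_nat_or_neg k with ⟨m, rfl | rfl⟩
    · rw [zpow_natCast] at hk
      exact_mod_cast h1 m hk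
    · rw [zpow_neg, inv_eq_one, zpow_natCast] at hk
      have := h1 m hk
      omega
  intro a b hab
  simp only at hab
  have := h2 (a - b) (by rw [zpow_sub₀ v_ne_zero, hab, div_self (zpow_ne_zero _ v_ne_zero)])
  omega

/-- A Laurent polynomial is determined by its values at `v ^ (-p)` for large `p`. -/
theorem laurent_eq_of_evalAt (G G' : Qv[T;T⁻¹]) (p₀ : ℕ)
    (h : ∀ p, p₀ ≤ p → evalAt p G = evalAt p G') : G = G' := by
  rw [← sub_eq_zero]
  set H := G - G' with hH
  have hH0 : ∀ p, p₀ ≤ p → evalAt p H = 0 := by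
    intro p hp
    rw [hH, map_sub, h p hp, sub_self]
  obtain ⟨k, f, hf⟩ := LaurentPolynomial.exists_T_pow H
  have hfe : ∀ p, p₀ ≤ p → f.eval (v ^ (-(p : ℤ))) = 0 := by
    intro p hp
    have h1 := congrArg (evalAt p) hf
    rw [map_mul, hH0 p hp, zero_mul] at h1
    have h2 : evalAt p (Polynomial.toLaurent f) = f.eval (v ^ (-(p : ℤ))) := by
      rw [evalAt, LaurentPolynomial.eval₂_toLaurent, Polynomial.eval₂_id,
        Units.val_zpow_eq_zpow_val, vUnit_val]
    rw [← h2, h1]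
  have hf0 : f = 0 := by
    refine Polynomial.eq_zero_of_infinite_isRoot _ ?_
    have hinf : (Set.Ici p₀).Infinite := Set.Ici_infinite p₀
    refine (hinf.image (f := fun p : ℕ => v ^ (-(p : ℤ))) ?_).mono ?_
    · intro a _ b _ hab
      have := v_zpow_injective hab
      simpa using this
    · rintro _ ⟨p, hp, rfl⟩
      exact hfe p hp
  rw [hf0, map_zero] at hf
  exact ((LaurentPolynomial.isUnit_T k).mul_left_eq_zero).1 hf.symm

/-- The function `s` of `p` and `q` is represented by the Laurent polynomial `G` in `v' = v ^ (-p)`,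
where `q` is to be read as `u`: for each `p`, it is a rational function of `q` without poles at
integers `q ≥ 2`, and its value at `u` is `G(v ^ (-p))`. -/
def Represents (u : Qv) (s : ℕ → ℕ → ℚ) (G : Qv[T;T⁻¹]) : Prop :=
  ∀ p, ∃ f g : Polynomial ℚ,
    (∀ q : ℕ, 2 ≤ q → g.eval (q : ℚ) ≠ 0 ∧ s p q * g.eval (q : ℚ) = f.eval (q : ℚ)) ∧
    Polynomial.aeval u g * evalAt p G = Polynomial.aeval u f

namespace Represents

variable {u : Qv} {s s' : ℕ → ℕ → ℚ} {G G' : Qv[T;T⁻¹]}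

theorem add (h : Represents u s G) (h' : Represents u s' G') :
    Represents u (s + s') (G + G') := by
  intro p
  obtain ⟨f, g, h1, h2⟩ := h p
  obtain ⟨f', g', h1', h2'⟩ := h' p
  refine ⟨f * g' + f' * g, g * g', fun q hq => ⟨?_, ?_⟩, ?_⟩
  · rw [Polynomial.eval_mul]
    exact mul_ne_zero (h1 q hq).1 (h1' q hq).1
  · simp only [Polynomial.eval_mul, Polynomial.eval_add, Pi.add_apply]
    rw [← (h1 q hq).2, ← (h1' q hq).2]
    ring
  · grind

theorem mul (h : Represents u s G) (h' : Represents u s' G') :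
    Represents u (s * s') (G * G') := by
  intro p
  obtain ⟨f, g, h1, h2⟩ := h p
  obtain ⟨f', g', h1', h2'⟩ := h' p
  refine ⟨f * f', g * g', fun q hq => ⟨?_, ?_⟩, ?_⟩
  · rw [Polynomial.eval_mul]
    exact mul_ne_zero (h1 q hq).1 (h1' q hq).1
  · simp only [Polynomial.eval_mul, Pi.mul_apply]
    rw [← (h1 q hq).2, ← (h1' q hq).2]
    ring
  · rw [map_mul, map_mul, map_mul, ← h2, ← h2']
    ring

theorem const (u : Qv) (c : ℚ) :
    Represents u (fun _ _ => c) (LaurentPolynomial.C (algebraMap ℚ Qv c)) := by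
  intro p
  refine ⟨Polynomial.C c, 1, fun q _ => by simp, ?_⟩
  rw [evalAt_C]
  simp

theorem poly (u : Qv) (h : Polynomial ℚ) :
    Represents u (fun _ q => h.eval (q : ℚ)) (LaurentPolynomial.C (Polynomial.aeval u h)) := by
  intro p
  refine ⟨h, 1, fun q _ => by simp, ?_⟩
  rw [evalAt_C]
  simp

theorem inv_poly {u : Qv} (h : Polynomial ℚ) (hu : Polynomial.aeval u h ≠ 0)
    (hh : ∀ q : ℕ, 2 ≤ q → h.eval (q : ℚ) ≠ 0) :
    Represents u (fun _ q => (h.eval (q : ℚ))⁻¹)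
      (LaurentPolynomial.C (Polynomial.aeval u h)⁻¹) := by
  intro p
  refine ⟨1, h, fun q hq => ⟨hh q hq, ?_⟩, ?_⟩
  · rw [inv_mul_cancel₀ (hh q hq)]; simp
  · rw [evalAt_C, mul_inv_cancel₀ hu]; simp

theorem zpow (e : ℕ) (c d : ℤ) :
    Represents (v ^ e) (fun p q => (q : ℚ) ^ (c + p * d))
      (LaurentPolynomial.C (v ^ (e * c)) * LaurentPolynomial.T (-(e * d))) := by
  intro p
  have hG : evalAt p (LaurentPolynomial.C (v ^ (e * c)) * LaurentPolynomial.T (-(e * d))) =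
      (v ^ e) ^ (c + p * d) := by
    rw [map_mul, evalAt_C, evalAt_T, ← zpow_add₀ v_ne_zero, ← zpow_natCast v e, ← zpow_mul]
    congr 1
    ring
  rw [hG]
  have hve : v ^ e ≠ 0 := pow_ne_zero _ v_ne_zero
  rcases Int.eq_nat_or_neg (c + p * d) with ⟨m, h | h⟩
  · refine ⟨Polynomial.X ^ m, 1, fun q _ => ?_, ?_⟩
    · simp only [h]; simp
    · rw [h]; simp
  · refine ⟨1, Polynomial.X ^ m, fun q hq => ?_, ?_⟩
    · have hq0 : (q : ℚ) ≠ 0 := by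
        have : q ≠ 0 := by omega
        exact_mod_cast this
      simp only [h]
      simp [hq0]
    · rw [h, zpow_neg, zpow_natCast, map_pow, Polynomial.aeval_X,
        mul_inv_cancel₀ (pow_ne_zero _ hve), map_one]

theorem comp_sq (h : Represents (v ^ 2) s G) : Represents v (fun p l => s p (l ^ 2)) G := by
  intro p
  obtain ⟨f, g, h1, h2⟩ := h p
  refine ⟨f.comp (Polynomial.X ^ 2), g.comp (Polynomial.X ^ 2), fun q hq => ?_, ?_⟩
  · have := h1 (q ^ 2) (by nlinarith)
    simpa using this
  · rw [← aeval_v_sq, ← aeval_v_sq, h2]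

/-- Functions which agree at infinitely many `q`, for all large `p`, are represented by the same
Laurent polynomial. -/
theorem unique (hu : Function.Injective (Polynomial.aeval u : Polynomial ℚ →ₐ[ℚ] Qv))
    (h : Represents u s G) (h' : Represents u s' G') (Q : Set ℕ) (hQ : Q.Infinite)
    (hQ2 : ∀ q ∈ Q, 2 ≤ q) (p₀ : ℕ) (hs : ∀ p, p₀ ≤ p → ∀ q ∈ Q, s p q = s' p q) : G = G' := by
  refine laurent_eq_of_evalAt G G' p₀ fun p hp => ?_
  obtain ⟨f, g, h1, h2⟩ := h p
  obtain ⟨f', g', h1', h2'⟩ := h' p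
  have key : f * g' = f' * g := by
    refine Polynomial.eq_of_infinite_eval_eq _ _ ?_
    refine (hQ.image (f := fun m : ℕ => (m : ℚ)) Nat.cast_injective.injOn).mono ?_
    rintro _ ⟨q, hq, rfl⟩
    have h3 := (h1 q (hQ2 q hq)).2
    have h4 := (h1' q (hQ2 q hq)).2
    change (f * g').eval (q : ℚ) = (f' * g).eval (q : ℚ)
    rw [Polynomial.eval_mul, Polynomial.eval_mul, ← h3, ← h4, hs p hp q hq]
    ring
  have hne : ∀ {f g : Polynomial ℚ}, (∀ q : ℕ, 2 ≤ q → g.eval (q : ℚ) ≠ 0 ∧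
      f.eval (q : ℚ) = f.eval (q : ℚ)) → Polynomial.aeval u g ≠ 0 := by
    intro f g hg h0
    have : g = 0 := (injective_iff_map_eq_zero _).1 hu g h0
    exact (hg 2 le_rfl).1 (by simp [this])
  have hg := hne (f := f) (g := g) fun q hq => ⟨(h1 q hq).1, rfl⟩
  have hg' := hne (f := f) (g := g') fun q hq => ⟨(h1' q hq).1, rfl⟩
  have h5 := congrArg (Polynomial.aeval u) key
  grind

end Represents

/-- The functions of `p` and `q` represented by a Laurent polynomial, with `q = v ^ 2`. -/
def stableFun : Subalgebra ℚ (ℕ → ℕ → ℚ) where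
  carrier := {s | ∃ G, Represents (v ^ 2) s G}
  mul_mem' := fun ⟨_, h⟩ ⟨_, h'⟩ => ⟨_, h.mul h'⟩
  add_mem' := fun ⟨_, h⟩ ⟨_, h'⟩ => ⟨_, h.add h'⟩
  algebraMap_mem' := fun c => ⟨_, Represents.const _ c⟩

theorem stableFun_const (c : ℚ) : (fun _ _ => c : ℕ → ℕ → ℚ) ∈ stableFun :=
  ⟨_, Represents.const _ c⟩

theorem stableFun_poly (h : Polynomial ℚ) :
    (fun _ q => h.eval (q : ℚ) : ℕ → ℕ → ℚ) ∈ stableFun :=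
  ⟨_, Represents.poly _ h⟩

theorem stableFun_inv_poly (h : Polynomial ℚ) (hh : ∀ q : ℕ, 2 ≤ q → h.eval (q : ℚ) ≠ 0) :
    (fun _ q => (h.eval (q : ℚ))⁻¹ : ℕ → ℕ → ℚ) ∈ stableFun := by
  refine ⟨_, Represents.inv_poly h (fun h0 => ?_) hh⟩
  have : h = 0 := (injective_iff_map_eq_zero _).1 aeval_v_sq_injective h h0
  exact hh 2 le_rfl (by simp [this])

theorem stableFun_zpow (c d : ℤ) :
    (fun p q => (q : ℚ) ^ (c + p * d) : ℕ → ℕ → ℚ) ∈ stableFun :=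
  ⟨_, Represents.zpow 2 c d⟩

theorem stableFun_mul {s s' : ℕ → ℕ → ℚ} (h : s ∈ stableFun) (h' : s' ∈ stableFun) :
    (fun p q => s p q * s' p q) ∈ stableFun := stableFun.mul_mem h h'

theorem stableFun_sub {s s' : ℕ → ℕ → ℚ} (h : s ∈ stableFun) (h' : s' ∈ stableFun) :
    (fun p q => s p q - s' p q) ∈ stableFun := stableFun.sub_mem h h'

theorem stableFun_sum {ι : Type*} (I : Finset ι) {s : ι → ℕ → ℕ → ℚ}
    (h : ∀ i ∈ I, s i ∈ stableFun) : (fun p q => ∑ i ∈ I, s i p q) ∈ stableFun := by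
  have := stableFun.sum_mem h
  convert this using 1
  funext p q
  simp

end Represented

/-! ### Counting lines and hyperplanes -/

section FiniteSets

/-- A subset of a finite type as a `Finset`. -/
def toFs {α : Type*} [Finite α] (s : Set α) : Finset α := s.toFinite.toFinset

@[simp]
theorem mem_toFs {α : Type*} [Finite α] {s : Set α} {a : α} : a ∈ toFs s ↔ a ∈ s :=
  Set.Finite.mem_toFinset _

theorem card_toFs {α : Type*} [Finite α] (s : Set α) : (toFs s).card = s.ncard :=
  (Set.ncard_eq_toFinset_card s s.toFinite).symm

open Classical in
/-- A sum whose terms depend only on the pattern of properties which hold, in terms of the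
numbers of elements with prescribed properties (inclusion-exclusion). -/
theorem sum_eq_sum_pattern {X Q : Type*} [Finite X] [Fintype Q] [DecidableEq Q] (S : Set X) (E : Q → X → Prop)
    (w : X → ℚ) (h c : Finset Q → ℚ)
    (hw : ∀ x ∈ S, ∀ P : Finset Q, (∀ y, y ∈ P ↔ E y x) → w x = h P)
    (hc : ∀ W : Finset Q, (({x | x ∈ S ∧ ∀ y ∈ W, E y x} : Set X).ncard : ℚ) = c W) :
    ∑ x ∈ toFs S, w x =
      ∑ P : Finset Q, ∑ U ∈ Pᶜ.powerset, (-1) ^ U.card * h P * c (P ∪ U) := by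
  have hc' : ∀ W : Finset Q, c W = ∑ x ∈ toFs S, if ∀ y ∈ W, E y x then (1 : ℚ) else 0 := by
    intro W
    rw [← hc W, ← card_toFs, Finset.sum_boole]
    congr 2
    ext x
    simp
  simp_rw [hc', mul_sum]
  have hswap : ∀ P : Finset Q, ∑ U ∈ Pᶜ.powerset, ∑ x ∈ toFs S,
      (-1) ^ U.card * h P * (if ∀ y ∈ P ∪ U, E y x then (1 : ℚ) else 0) =
      ∑ x ∈ toFs S, ∑ U ∈ Pᶜ.powerset,
        (-1) ^ U.card * h P * (if ∀ y ∈ P ∪ U, E y x then (1 : ℚ) else 0) :=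
    fun P => sum_comm
  simp_rw [hswap]
  rw [sum_comm]
  refine sum_congr rfl fun x hx => ?_
  rw [hw x (mem_toFs.1 hx) (Finset.univ.filter fun y => E y x) fun y => by simp]
  set T : Finset Q := Finset.univ.filter fun y => E y x with hT
  have hTm : ∀ W : Finset Q, (∀ y ∈ W, E y x) ↔ W ⊆ T := by
    intro W
    simp [hT, Finset.subset_iff]
  simp_rw [hTm]
  rw [sum_eq_single T]
  · rw [sum_eq_single ∅]
    · simp
    · intro U hU hne
      rw [if_neg, mul_zero]
      intro hsub
      apply hne
      rw [mem_powerset] at hU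
      rw [Finset.eq_empty_iff_forall_notMem]
      intro y hy
      exact (Finset.mem_compl.1 (hU hy)) (hsub (Finset.mem_union_right _ hy))
    · simp
  · intro P _ hP
    by_cases hPT : P ⊆ T
    · have h1 : ∑ U ∈ Pᶜ.powerset, (-1) ^ U.card * h P * (if P ∪ U ⊆ T then (1 : ℚ) else 0) =
          ∑ U ∈ (T \ P).powerset, (-1) ^ U.card * h P := by
        symm
        have hsub : (T \ P).powerset ⊆ Pᶜ.powerset := by
          refine Finset.powerset_mono.2 fun y hy => ?_
          rw [Finset.mem_compl]
          exact (Finset.mem_sdiff.1 hy).2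
        rw [← Finset.sum_subset hsub]
        · refine sum_congr rfl fun U hU => ?_
          grind
        · intro U hU hU'
          rw [if_neg, mul_zero]
          intro hsub
          apply hU'
          rw [mem_powerset] at hU ⊢
          intro y hy
          exact Finset.mem_sdiff.2 ⟨hsub (Finset.mem_union_right _ hy), Finset.mem_compl.1 (hU hy)⟩
      rw [h1, ← sum_mul]
      have h2 : (T \ P).Nonempty := by grind
      have h3 := Finset.sum_powerset_neg_one_pow_card_of_nonempty h2
      have h4 : ∑ U ∈ (T \ P).powerset, (-1 : ℚ) ^ U.card = 0 := by exact_mod_cast h3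
      rw [h4, zero_mul]
    · refine sum_eq_zero fun U _ => ?_
      grind
  · simp

theorem stableFun_patternSum {Q : Type*} [Fintype Q] [DecidableEq Q]
    (h c : Finset Q → ℕ → ℕ → ℚ) (hh : ∀ P, h P ∈ stableFun) (hc : ∀ W, c W ∈ stableFun) :
    (fun p q => ∑ P : Finset Q, ∑ U ∈ Pᶜ.powerset, (-1) ^ U.card * h P p q * c (P ∪ U) p q) ∈
      stableFun := by
  refine stableFun_sum _ fun P _ => stableFun_sum _ fun U _ => ?_
  exact stableFun_mul (stableFun_mul (stableFun_const _) (hh P)) (hc _)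

end FiniteSets

section Counting

variable {F V : Type} [Field F] [Finite F] [AddCommGroup V] [Module F V] [Finite V]

theorem ncard_submodule (U : Submodule F V) :
    (U : Set V).ncard = Nat.card F ^ finrank F U := by
  rw [← Module.natCard_eq_pow_finrank (K := F) (V := U)]
  rfl

theorem two_le_natCard (F : Type) [Field F] [Finite F] : 2 ≤ Nat.card F := Finite.one_lt_card

theorem natCard_cast_ne_zero (F : Type) [Field F] [Finite F] : (Nat.card F : ℚ) ≠ 0 := by
  have := two_le_natCard F
  exact_mod_cast (by omega : Nat.card F ≠ 0)

theorem finrank_inf_sup {A B : Submodule F V} (h : A ≤ B) (C : Submodule F V) :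
    (finrank F ↥(B ⊓ (A ⊔ C)) : ℤ) =
      finrank F A + finrank F ↥(B ⊓ C) - finrank F ↥(A ⊓ C) := by
  have h1 : B ⊓ (A ⊔ C) = A ⊔ (B ⊓ C) := by rw [inf_comm, sup_inf_assoc_of_le _ h, inf_comm C B]
  have h2 := finrank_sup_add_finrank_inf_eq A (B ⊓ C)
  have h3 : A ⊓ (B ⊓ C) = A ⊓ C := by rw [← inf_assoc, inf_eq_left.2 h]
  rw [h1]
  rw [h3] at h2
  omega

theorem finrank_sup_span {A : Submodule F V} {x : V} (hx : x ∉ A) :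
    finrank F ↥(A ⊔ F ∙ x) = finrank F A + 1 := by
  have h1 := finrank_sup_add_finrank_inf_eq A (F ∙ x)
  have h2 : A ⊓ (F ∙ x) = ⊥ := by
    rw [eq_bot_iff]
    rintro y ⟨hy, hy'⟩
    obtain ⟨c, rfl⟩ := Submodule.mem_span_singleton.1 hy'
    by_cases hc : c = 0
    · simp [hc]
    · exact absurd ((Submodule.smul_mem_iff _ hc).1 hy) hx
  have hx0 : x ≠ 0 := fun h => hx (h ▸ A.zero_mem)
  rw [h2, finrank_bot, finrank_span_singleton hx0] at h1
  omega

theorem mem_sup_span {A : Submodule F V} {x y : V} :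
    y ∈ A ⊔ F ∙ x ↔ ∃ c : F, y - c • x ∈ A := by
  rw [Submodule.mem_sup]
  constructor
  · rintro ⟨a, ha, b, hb, rfl⟩
    obtain ⟨c, rfl⟩ := Submodule.mem_span_singleton.1 hb
    exact ⟨c, by simpa using ha⟩
  · rintro ⟨c, hc⟩
    exact ⟨_, hc, c • x, Submodule.mem_span_singleton.2 ⟨c, rfl⟩, by simp⟩

theorem finrank_sup_span_inf {A : Submodule F V} {x : V} (hx : x ∉ A) (C : Submodule F V) :
    (x ∈ A ⊔ C → finrank F ↥((A ⊔ F ∙ x) ⊓ C) = finrank F ↥(A ⊓ C) + 1) ∧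
      (x ∉ A ⊔ C → finrank F ↥((A ⊔ F ∙ x) ⊓ C) = finrank F ↥(A ⊓ C)) := by
  constructor
  · intro h
    obtain ⟨a, ha, c, hc, hac⟩ := Submodule.mem_sup.1 h
    have hcA : c ∉ A ⊓ C := fun hcon => hx (hac ▸ A.add_mem ha hcon.1)
    rw [← finrank_sup_span hcA]
    suffices hs : (A ⊔ F ∙ x) ⊓ C = (A ⊓ C) ⊔ F ∙ c by rw [hs]
    ext y
    rw [Submodule.mem_inf, mem_sup_span, mem_sup_span]
    constructor
    · rintro ⟨⟨t, ht⟩, hy⟩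
      refine ⟨t, ?_, C.sub_mem hy (C.smul_mem t hc)⟩
      have : y - t • c = (y - t • x) + t • a := by rw [← hac, smul_add]; abel
      rw [this]
      exact A.add_mem ht (A.smul_mem t ha)
    · rintro ⟨t, ht1, ht2⟩
      refine ⟨⟨t, ?_⟩, ?_⟩
      · have : y - t • x = (y - t • c) - t • a := by rw [← hac, smul_add]; abel
        rw [this]
        exact A.sub_mem ht1 (A.smul_mem t ha)
      · have := C.add_mem ht2 (C.smul_mem t hc)
        simpa using this
  · intro h
    suffices hs : (A ⊔ F ∙ x) ⊓ C = A ⊓ C by rw [hs]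
    apply le_antisymm _ (inf_le_inf_right _ le_sup_left)
    intro y hy
    obtain ⟨t, ht⟩ := mem_sup_span.1 hy.1
    by_cases h0 : t = 0
    · refine ⟨?_, hy.2⟩
      simpa [h0] using ht
    · exfalso
      apply h
      have h2 : t • x ∈ A ⊔ C := by
        have : t • x = -(y - t • x) + y := by abel
        rw [this]
        exact Submodule.add_mem_sup (A.neg_mem ht) hy.2
      exact (Submodule.smul_mem_iff _ h0).1 h2

/-- The number of vectors spanning a given line modulo `A`. -/
theorem ncard_line_generators {A W : Submodule F V} (hAW : A ≤ W)
    (hW : finrank F W = finrank F A + 1) :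
    (({x | x ∉ A ∧ A ⊔ F ∙ x = W} : Set V).ncard : ℚ) =
      ((Nat.card F : ℚ) - 1) * (Nat.card F : ℚ) ^ (finrank F A : ℤ) := by
  have h1 : ({x | x ∉ A ∧ A ⊔ F ∙ x = W} : Set V) = (W : Set V) \ (A : Set V) := by
    ext x
    simp only [Set.mem_ofPred_eq, Set.mem_sdiff, SetLike.mem_coe]
    constructor
    · rintro ⟨hx, rfl⟩
      exact ⟨(le_sup_right : F ∙ x ≤ _) (Submodule.mem_span_singleton_self x), hx⟩
    · rintro ⟨hxW, hx⟩
      refine ⟨hx, eq_of_le_of_finrank_eq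
        (sup_le hAW ((span_singleton_le_iff_mem _ _).2 hxW)) ?_⟩
      rw [finrank_sup_span hx, hW]
  have h2 := Set.ncard_sdiff_add_ncard_of_subset (s := (A : Set V)) (t := (W : Set V)) hAW
  rw [ncard_submodule, ncard_submodule, hW] at h2
  rw [h1]
  have h3 : (((W : Set V) \ (A : Set V)).ncard : ℚ) + (Nat.card F : ℚ) ^ finrank F A =
      (Nat.card F : ℚ) ^ (finrank F A + 1) := by exact_mod_cast h2
  rw [zpow_natCast]
  linear_combination h3

/-- The number of vectors `x ∈ B`, `x ∈ A + f_a` such that `ω ∈ A + Fx + f_b`. -/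
theorem ncard_line_pattern {A B : Submodule F V} (hAB : A ≤ B) {fa fb : Submodule F V}
    (hf : fa ≤ fb ∨ fb ≤ fa) (ω : V) :
    ((ω ∈ A ⊔ fb) → ({x | x ∈ B ∧ x ∈ A ⊔ fa ∧ ω ∈ (A ⊔ F ∙ x) ⊔ fb} : Set V).ncard =
      Nat.card F ^ finrank F ↥(B ⊓ (A ⊔ fa))) ∧
    ((ω ∉ A ⊔ fb) → (ω ∈ A ⊔ fa ∧ ω ∈ B ⊔ fb) →
      ({x | x ∈ B ∧ x ∈ A ⊔ fa ∧ ω ∈ (A ⊔ F ∙ x) ⊔ fb} : Set V).ncard =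
        (Nat.card F - 1) * Nat.card F ^ finrank F ↥(B ⊓ (A ⊔ fb))) ∧
    ((ω ∉ A ⊔ fb) → ¬ (ω ∈ A ⊔ fa ∧ ω ∈ B ⊔ fb) →
      ({x | x ∈ B ∧ x ∈ A ⊔ fa ∧ ω ∈ (A ⊔ F ∙ x) ⊔ fb} : Set V).ncard = 0) := by
  have hK : ∀ x, ω ∈ (A ⊔ F ∙ x) ⊔ fb ↔ ∃ c : F, ω - c • x ∈ A ⊔ fb := by
    intro x
    rw [sup_right_comm, mem_sup_span]
  refine ⟨fun h => ?_, fun h h' => ?_, fun h h' => ?_⟩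
  · rw [← ncard_submodule]
    congr 1
    ext x
    simp only [Set.mem_ofPred_eq, SetLike.mem_coe, Submodule.mem_inf]
    refine ⟨fun hx => ⟨hx.1, hx.2.1⟩, fun hx => ⟨hx.1, hx.2, (hK x).2 ⟨0, by simpa using h⟩⟩⟩
  · obtain ⟨h1, h2⟩ := h'
    obtain ⟨w, hw, u, hu, hwu⟩ := Submodule.mem_sup.1 h2
    have hba : fb ≤ fa := by
      rcases hf with hf | hf
      · exact absurd (sup_le_sup_left hf A h1) h
      · exact hf
    have hwa : w ∈ A ⊔ fa := by
      have : w = ω - u := by rw [← hwu]; abel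
      rw [this]
      exact Submodule.sub_mem _ h1 ((le_sup_right : fa ≤ _) (hba hu))
    have hwb : w ∉ A ⊔ fb := by
      intro hcon
      apply h
      rw [← hwu]
      exact Submodule.add_mem _ hcon ((le_sup_right : fb ≤ _) hu)
    have hset : ({x | x ∈ B ∧ x ∈ A ⊔ fa ∧ ω ∈ (A ⊔ F ∙ x) ⊔ fb} : Set V) =
        Set.range fun y : Fˣ × ↥(B ⊓ (A ⊔ fb)) => (y.1 : F) • w + (y.2 : V) := by
      ext x
      simp only [Set.mem_ofPred_eq, Set.mem_range, Prod.exists]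
      constructor
      · rintro ⟨hxB, -, hx⟩
        obtain ⟨c, hc⟩ := (hK x).1 hx
        have hc0 : c ≠ 0 := by
          rintro rfl
          exact h (by simpa using hc)
        refine ⟨Units.mk0 c⁻¹ (inv_ne_zero hc0), ⟨x - c⁻¹ • w, ?_, ?_⟩, by simp⟩
        · exact B.sub_mem hxB (B.smul_mem _ hw)
        · have : x - c⁻¹ • w = (-c⁻¹) • ((ω - c • x) - u) := by
            rw [← hwu, smul_sub, smul_sub, smul_smul, smul_add]
            simp only [neg_mul, inv_mul_cancel₀ hc0, neg_smul, one_smul]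
            abel
          rw [this]
          exact Submodule.smul_mem _ _ (Submodule.sub_mem _ hc ((le_sup_right : fb ≤ _) hu))
      · rintro ⟨c, ⟨y, hyB, hy⟩, rfl⟩
        refine ⟨B.add_mem (B.smul_mem _ hw) hyB,
          Submodule.add_mem _ (Submodule.smul_mem _ _ hwa) (sup_le_sup_left hba A hy),
          (hK _).2 ⟨(c⁻¹ : Fˣ), ?_⟩⟩
        have : ω - (c⁻¹ : Fˣ) • ((c : F) • w + y) = u - (c⁻¹ : Fˣ) • y := by
          rw [smul_add, ← hwu, ← Units.smul_def c w, smul_smul, inv_mul_cancel, one_smul]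
          abel
        have h3 : ω - ((c⁻¹ : Fˣ) : F) • ((c : F) • w + y) = u - ((c⁻¹ : Fˣ) : F) • y := this
        simp only
        rw [h3]
        exact Submodule.sub_mem _ ((le_sup_right : fb ≤ _) hu) (Submodule.smul_mem _ _ hy)
    have hinj : Function.Injective
        fun y : Fˣ × ↥(B ⊓ (A ⊔ fb)) => (y.1 : F) • w + (y.2 : V) := by
      rintro ⟨c, y, hy⟩ ⟨d, z, hz⟩ heq
      simp only at heq
      have h4 : ((c : F) - d) • w = z - y := by
        rw [sub_smul, sub_eq_sub_iff_add_eq_add, heq]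
        abel
      by_cases hcd : (c : F) - d = 0
      · have hcd' : c = d := Units.ext (sub_eq_zero.1 hcd)
        subst hcd'
        have : y = z := add_left_cancel heq
        subst this
        rfl
      · exfalso
        apply hwb
        rw [← Submodule.smul_mem_iff _ hcd, h4]
        exact Submodule.sub_mem _ hz.2 hy.2
    rw [hset, ← Set.image_univ, Set.ncard_image_of_injective _ hinj, Set.ncard_univ, Nat.card_prod,
      Nat.card_units,
      Module.natCard_eq_pow_finrank (K := F) (V := ↥(B ⊓ (A ⊔ fb)))]
  · rw [Set.ncard_eq_zero (Set.toFinite _)]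
    rw [Set.eq_empty_iff_forall_notMem]
    rintro x ⟨hxB, hxa, hx⟩
    apply h'
    obtain ⟨c, hc⟩ := (hK x).1 hx
    have h2 : ω ∈ B ⊔ fb := by
      have : ω = (ω - c • x) + c • x := by abel
      rw [this]
      exact Submodule.add_mem _ (sup_le_sup_right hAB fb hc)
        ((le_sup_left : B ≤ _) (B.smul_mem _ hxB))
    refine ⟨?_, h2⟩
    rcases hf with hf | hf
    · exfalso
      apply h
      have : ω = (ω - c • x) + c • x := by abel
      rw [this]
      exact Submodule.add_mem _ hc (Submodule.smul_mem _ _ (sup_le_sup_left hf A hxa))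
    · have : ω = (ω - c • x) + c • x := by abel
      rw [this]
      exact Submodule.add_mem _ (sup_le_sup_left hf A hc) (Submodule.smul_mem _ _ hxa)

/-! The dual statements, for functionals and the hyperplanes they define. -/

theorem ncard_dualAnnihilator (U : Submodule F V) :
    ((U.dualAnnihilator : Set (Dual F V)).ncard : ℚ) =
      (Nat.card F : ℚ) ^ ((finrank F V : ℤ) - finrank F U) := by
  have h1 : (U.dualAnnihilator : Set (Dual F V)).ncard =
      Nat.card F ^ finrank F U.dualAnnihilator := by
    rw [← Module.natCard_eq_pow_finrank (K := F) (V := U.dualAnnihilator)]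
    rfl
  have h2 := Subspace.finrank_add_finrank_dualAnnihilator_eq U
  rw [h1]
  push_cast
  rw [← zpow_natCast]
  congr 1
  omega

theorem finrank_inf_ker {B : Submodule F V} {ξ : Dual F V} (h : ξ ∉ B.dualAnnihilator) :
    finrank F ↥(B ⊓ LinearMap.ker ξ) + 1 = finrank F B := by
  have hξ : ξ.domRestrict B ≠ 0 := by
    intro h0
    apply h
    rw [mem_dualAnnihilator]
    intro w hw
    exact LinearMap.congr_fun h0 ⟨w, hw⟩
  have h1 := Module.Dual.finrank_ker_add_one_of_ne_zero (K := F) hξ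
  rw [← h1]
  congr 1
  have h2 : B ⊓ LinearMap.ker ξ = (LinearMap.ker (ξ.domRestrict B)).map B.subtype := by
    ext x
    simp [Submodule.mem_map, and_comm]
  rw [h2]
  exact (Submodule.finrank_map_subtype_eq B _)

theorem inf_ker_of_mem {B : Submodule F V} {ξ : Dual F V} (h : ξ ∈ B.dualAnnihilator) :
    B ⊓ LinearMap.ker ξ = B :=
  inf_eq_left.2 fun x hx => (mem_dualAnnihilator ξ).1 h x hx

/-- The number of functionals defining a given hyperplane of `B`. -/
theorem ncard_hyperplane_equations {B W : Submodule F V} (hWB : W ≤ B)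
    (hW : finrank F W + 1 = finrank F B) :
    (({ξ | ξ ∉ B.dualAnnihilator ∧ B ⊓ LinearMap.ker ξ = W} : Set (Dual F V)).ncard : ℚ) =
      ((Nat.card F : ℚ) - 1) * (Nat.card F : ℚ) ^ ((finrank F V : ℤ) - finrank F B) := by
  have h1 : ({ξ | ξ ∉ B.dualAnnihilator ∧ B ⊓ LinearMap.ker ξ = W} : Set (Dual F V)) =
      (W.dualAnnihilator : Set (Dual F V)) \ (B.dualAnnihilator : Set (Dual F V)) := by
    ext ξ
    simp only [Set.mem_ofPred_eq, Set.mem_sdiff, SetLike.mem_coe]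
    constructor
    · rintro ⟨hξ, rfl⟩
      refine ⟨?_, hξ⟩
      rw [mem_dualAnnihilator]
      intro w hw
      exact hw.2
    · rintro ⟨hξW, hξ⟩
      refine ⟨hξ, (eq_of_le_of_finrank_eq (le_inf hWB ?_) ?_).symm⟩
      · intro w hw
        exact (mem_dualAnnihilator ξ).1 hξW w hw
      · have := finrank_inf_ker hξ
        omega
  have hfin : Finite (Dual F V) := Module.finite_of_finite F
  have hle : (B.dualAnnihilator : Set (Dual F V)) ⊆ W.dualAnnihilator := dualAnnihilator_anti hWB
  have h2 := Set.ncard_sdiff_add_ncard_of_subset hle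
  have h3 : ((((W.dualAnnihilator : Set (Dual F V)) \
      (B.dualAnnihilator : Set (Dual F V))).ncard : ℕ) : ℚ) +
      ((B.dualAnnihilator : Set (Dual F V)).ncard : ℚ) =
      ((W.dualAnnihilator : Set (Dual F V)).ncard : ℚ) := by exact_mod_cast h2
  rw [ncard_dualAnnihilator, ncard_dualAnnihilator] at h3
  have h4 : (finrank F V : ℤ) - finrank F W = (finrank F V : ℤ) - finrank F B + 1 := by omega
  rw [h4, zpow_add_one₀ (natCard_cast_ne_zero F)] at h3
  rw [h1]
  linear_combination h3

/-- The number of functionals vanishing on `A` and on `B ∩ f_a`, such that `ω` lies outside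
`(B ∩ ker ξ) + f_b`. -/
theorem ncard_hyperplane_pattern {A B : Submodule F V} (hAB : A ≤ B) {fa fb : Submodule F V}
    (hf : fa ≤ fb ∨ fb ≤ fa) (ω : V) :
    ((ω ∉ B ⊔ fb) → (({ξ | ξ ∈ A.dualAnnihilator ∧ ξ ∈ (B ⊓ fa).dualAnnihilator ∧
        ω ∉ (B ⊓ LinearMap.ker ξ) ⊔ fb} : Set (Dual F V)).ncard : ℚ) =
      (Nat.card F : ℚ) ^ ((finrank F V : ℤ) - finrank F ↥(B ⊓ (A ⊔ fa)))) ∧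
    ((ω ∈ B ⊔ fb) → ω ∈ A ⊔ (fa ⊔ fb) → (({ξ | ξ ∈ A.dualAnnihilator ∧
        ξ ∈ (B ⊓ fa).dualAnnihilator ∧
        ω ∉ (B ⊓ LinearMap.ker ξ) ⊔ fb} : Set (Dual F V)).ncard : ℚ) = 0) ∧
    ((ω ∈ B ⊔ fb) → ω ∉ A ⊔ (fa ⊔ fb) → (({ξ | ξ ∈ A.dualAnnihilator ∧
        ξ ∈ (B ⊓ fa).dualAnnihilator ∧
        ω ∉ (B ⊓ LinearMap.ker ξ) ⊔ fb} : Set (Dual F V)).ncard : ℚ) =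
      (Nat.card F : ℚ) ^ ((finrank F V : ℤ) - finrank F ↥(B ⊓ (A ⊔ (fa ⊔ fb)))) -
      (Nat.card F : ℚ) ^ ((finrank F V : ℤ) - finrank F ↥(B ⊓ (A ⊔ (fa ⊔ fb))) - 1)) := by
  have hmod : ∀ C : Submodule F V, B ⊓ (A ⊔ C) = A ⊔ (B ⊓ C) := fun C => by
    rw [inf_comm, sup_inf_assoc_of_le _ hAB, inf_comm C B]
  have hann : ∀ C : Submodule F V, ∀ ξ : Dual F V, ξ ∈ (B ⊓ (A ⊔ C)).dualAnnihilator ↔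
      ξ ∈ A.dualAnnihilator ∧ ξ ∈ (B ⊓ C).dualAnnihilator := by
    intro C ξ
    rw [hmod, Submodule.dualAnnihilator_sup_eq, Submodule.mem_inf]
  have hfin : Finite (Dual F V) := Module.finite_of_finite F
  refine ⟨fun h => ?_, fun h h' => ?_, fun h h' => ?_⟩
  · rw [← ncard_dualAnnihilator]
    congr 2
    ext ξ
    simp only [Set.mem_ofPred_eq, SetLike.mem_coe, hann]
    exact ⟨fun hx => ⟨hx.1, hx.2.1⟩,
      fun hx => ⟨hx.1, hx.2, fun hcon => h
        ((sup_le_sup_right inf_le_left fb : (B ⊓ LinearMap.ker ξ) ⊔ fb ≤ B ⊔ fb) hcon)⟩⟩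
  all_goals
    obtain ⟨w, hw, u, hu, hwu⟩ := Submodule.mem_sup.1 h
    have hK : ∀ ξ : Dual F V, ω ∉ (B ⊓ LinearMap.ker ξ) ⊔ fb ↔
        ξ ∈ (B ⊓ fb).dualAnnihilator ∧ ξ w ≠ 0 := by
      intro ξ
      constructor
      · intro hξ
        have hξw : ξ w ≠ 0 := by
          intro h0
          apply hξ
          rw [← hwu]
          exact Submodule.add_mem_sup ⟨hw, h0⟩ hu
        refine ⟨?_, hξw⟩
        rw [mem_dualAnnihilator]
        intro y hy
        by_contra hy0
        apply hξ
        have h1 : ω = (w - (ξ w / ξ y) • y) + (u + (ξ w / ξ y) • y) := by rw [← hwu]; abel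
        rw [h1]
        refine Submodule.add_mem_sup ⟨B.sub_mem hw (B.smul_mem _ hy.1), ?_⟩
          (fb.add_mem hu (fb.smul_mem _ hy.2))
        change ξ (w - (ξ w / ξ y) • y) = 0
        rw [map_sub, map_smul, smul_eq_mul, div_mul_cancel₀ _ hy0, sub_self]
      · rintro ⟨h1, h2⟩ hcon
        obtain ⟨b, hb, c, hc, hbc⟩ := Submodule.mem_sup.1 hcon
        apply h2
        have h3 : w - b = c - u := by rw [sub_eq_sub_iff_add_eq_add, hwu, add_comm c b, hbc]
        have h4 : ξ (w - b) = 0 := (mem_dualAnnihilator ξ).1 h1 _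
          ⟨B.sub_mem hw hb.1, h3 ▸ fb.sub_mem hc hu⟩
        rw [map_sub, LinearMap.mem_ker.1 hb.2, sub_zero] at h4
        exact h4
    have hcomb : ∀ ξ : Dual F V, (ξ ∈ (B ⊓ fa).dualAnnihilator ∧ ξ ∈ (B ⊓ fb).dualAnnihilator) ↔
        ξ ∈ (B ⊓ (fa ⊔ fb)).dualAnnihilator := by
      intro ξ
      rcases hf with hf | hf
      · rw [sup_eq_right.2 hf]
        exact ⟨fun h => h.2, fun h => ⟨dualAnnihilator_anti (inf_le_inf_left _ hf) h, h⟩⟩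
      · rw [sup_eq_left.2 hf]
        exact ⟨fun h => h.1, fun h => ⟨h, dualAnnihilator_anti (inf_le_inf_left _ hf) h⟩⟩
    have hset : ({ξ | ξ ∈ A.dualAnnihilator ∧ ξ ∈ (B ⊓ fa).dualAnnihilator ∧
        ω ∉ (B ⊓ LinearMap.ker ξ) ⊔ fb} : Set (Dual F V)) =
        ((B ⊓ (A ⊔ (fa ⊔ fb))).dualAnnihilator : Set (Dual F V)) \
          ((B ⊓ (A ⊔ (fa ⊔ fb)) ⊔ F ∙ w).dualAnnihilator : Set (Dual F V)) := by
      ext ξ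
      simp only [Set.mem_ofPred_eq, Set.mem_sdiff, SetLike.mem_coe, hK,
        Submodule.dualAnnihilator_sup_eq, Submodule.mem_inf, hann, ← hcomb]
      have hsp : ξ ∈ (F ∙ w).dualAnnihilator ↔ ξ w = 0 := by
        rw [mem_dualAnnihilator]
        constructor
        · exact fun h => h w (Submodule.mem_span_singleton_self w)
        · intro h y hy
          obtain ⟨c, rfl⟩ := Submodule.mem_span_singleton.1 hy
          rw [map_smul, h, smul_zero]
      rw [hsp]
      tauto
    have hwmem : w ∈ B ⊓ (A ⊔ (fa ⊔ fb)) ↔ ω ∈ A ⊔ (fa ⊔ fb) := by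
      have hu' : u ∈ A ⊔ (fa ⊔ fb) := (le_sup_right.trans le_sup_right : fb ≤ _) hu
      rw [Submodule.mem_inf, and_iff_right hw, ← hwu]
      exact (Submodule.add_mem_iff_left _ hu').symm
    rw [hset]
  · rw [sup_eq_left.2 ((span_singleton_le_iff_mem _ _).2 (hwmem.2 h'))]
    simp
  · have hle : ((B ⊓ (A ⊔ (fa ⊔ fb)) ⊔ F ∙ w).dualAnnihilator : Set (Dual F V)) ⊆
        (B ⊓ (A ⊔ (fa ⊔ fb))).dualAnnihilator := dualAnnihilator_anti le_sup_left
    have h2 := Set.ncard_sdiff_add_ncard_of_subset hle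
    rw [eq_sub_iff_add_eq, sub_sub]
    have h3 := ncard_dualAnnihilator (B ⊓ (A ⊔ (fa ⊔ fb)) ⊔ F ∙ w)
    rw [finrank_sup_span (fun hcon => h' (hwmem.1 hcon))] at h3
    push_cast at h3
    rw [← h3, ← ncard_dualAnnihilator]
    exact_mod_cast h2

end Counting

/-! ### Stable families of functions on triples -/

/-- A family of functions of (flag with `N` steps, flag with `n` steps, vector), given for all
finite fields and vector spaces and depending on the parameter `p` of the stabilization. -/
def Fam (N n : ℕ) : Type 1 :=
  ∀ (_ : ℕ) (F V : Type) [Field F] [Finite F] [AddCommGroup V] [Module F V] [Finite V],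
    PartialFlag N F V → PartialFlag n F V → V → ℚ

section Types

variable {n N M : ℕ} {F V : Type} [Field F] [AddCommGroup V] [Module F V]

/-- The type of a triple: the dimensions `r` of the intersections of steps, and the set `Z` of
sums of steps which contain the vector. -/
structure HasType (g : PartialFlag N F V) (f : PartialFlag n F V) (ω : V) (r : ℕ → ℕ → ℤ)
    (Z : ℕ → ℕ → Prop) : Prop where
  dim : ∀ i j, i ≤ N → j ≤ n → meetDim g f i j = r i j
  mem : ∀ i j, i ≤ N → j ≤ n → (ω ∈ g.seq i ⊔ f.seq j ↔ Z i j)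

theorem HasType.congr {g : PartialFlag N F V} {f : PartialFlag n F V} {ω : V}
    {r r' : ℕ → ℕ → ℤ} {Z Z' : ℕ → ℕ → Prop} (h : HasType g f ω r Z)
    (hr : ∀ i j, i ≤ N → j ≤ n → r i j = r' i j)
    (hZ : ∀ i j, i ≤ N → j ≤ n → (Z i j ↔ Z' i j)) : HasType g f ω r' Z' :=
  ⟨fun i j hi hj => (h.dim i j hi hj).trans (hr i j hi hj),
    fun i j hi hj => (h.mem i j hi hj).trans (hZ i j hi hj)⟩

end Types

/-- The family `φ` is stable with respect to the shift `β`: on triples of type `(r + p β, Z)` it is,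
for large `p`, given by a function of `p` and `q` represented by a Laurent polynomial. -/
def Stable {N n : ℕ} (β : ℕ → ℕ → ℤ) (φ : Fam N n) : Prop :=
  ∀ (r : ℕ → ℕ → ℤ) (Z : ℕ → ℕ → Prop), ∃ p₀ : ℕ, ∃ s ∈ stableFun, ∀ p, p₀ ≤ p →
    ∀ (F V : Type) [Field F] [Finite F] [AddCommGroup V] [Module F V] [Finite V]
      (g : PartialFlag N F V) (f : PartialFlag n F V) (ω : V),
      HasType g f ω (fun i j => r i j + p * β i j) Z → φ p F V g f ω = s p (Nat.card F)

theorem Stable.congr {N n : ℕ} {β β' : ℕ → ℕ → ℤ} {φ : Fam N n} (h : Stable β φ)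
    (hβ : ∀ i j, i ≤ N → j ≤ n → β i j = β' i j) : Stable β' φ := by
  intro r Z
  obtain ⟨p₀, s, hs, h'⟩ := h r Z
  refine ⟨p₀, s, hs, fun p hp F V _ _ _ _ _ g f ω ht => h' p hp F V g f ω ?_⟩
  exact ht.congr (fun i j hi hj => by rw [hβ i j hi hj]) fun _ _ _ _ => Iff.rfl

theorem Stable.sub {N n : ℕ} {β : ℕ → ℕ → ℤ} {φ ψ : Fam N n} (h : Stable β φ)
    (h' : Stable β ψ) : Stable β (fun p F V _ _ _ _ _ g f ω => φ p F V g f ω - ψ p F V g f ω) := by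
  intro r Z
  obtain ⟨p₀, s, hs, h1⟩ := h r Z
  obtain ⟨p₁, s', hs', h2⟩ := h' r Z
  refine ⟨max p₀ p₁, _, stableFun_sub hs hs', fun p hp F V _ _ _ _ _ g f ω ht => ?_⟩
  grind

theorem Stable.mul_fun {N n : ℕ} {β : ℕ → ℕ → ℤ} {φ : Fam N n} (h : Stable β φ)
    {c : ℕ → ℕ → ℚ} (hc : c ∈ stableFun) :
    Stable β (fun p F V _ _ _ _ _ g f ω => c p (Nat.card F) * φ p F V g f ω) := by
  intro r Z
  obtain ⟨p₀, s, hs, h1⟩ := h r Z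
  refine ⟨p₀, _, stableFun_mul hc hs, fun p hp F V _ _ _ _ _ g f ω ht => ?_⟩
  exact congrArg (c p (Nat.card F) * ·) (h1 p hp F V g f ω ht)

/-! ### Change of the steps of a flag -/

/-- Data for forming a new flag with `N` steps from a flag with `M` steps. -/
structure Reindex (M N : ℕ) where
  /-- the index of the old step used as new step -/
  u : ℕ → ℕ
  mono : Monotone u
  zero : u 0 = 0
  top : M ≤ u N

namespace Reindex

variable {M N n : ℕ} {F V : Type} [Field F] [AddCommGroup V] [Module F V]

/-- The new flag. -/
def map (R : Reindex M N) (g : PartialFlag M F V) : PartialFlag N F V :=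
  PartialFlag.ofSeq (fun l => g.seq (R.u l)) (fun _ _ h => g.seq_mono (R.mono h))
    (by rw [R.zero, g.seq_zero]) (g.seq_of_le R.top)

theorem seq_map (R : Reindex M N) (g : PartialFlag M F V) (l : ℕ) :
    (R.map g).seq l = g.seq (R.u l) := PartialFlag.seq_ofSeq _ _ _ _ _

/-- The pullback of a family of functions. -/
def pull (R : Reindex M N) (φ : Fam N n) : Fam M n :=
  fun p F V _ _ _ _ _ g f ω => φ p F V (R.map g) f ω

theorem stable_pull (R : Reindex M N) {φ : Fam N n} {β β' : ℕ → ℕ → ℤ} (hφ : Stable β φ)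
    (hβ : ∀ l j, l ≤ N → j ≤ n → β l j = β' (min (R.u l) M) j) : Stable β' (R.pull φ) := by
  intro r Z
  obtain ⟨p₀, s, hs, h⟩ := hφ (fun l j => r (min (R.u l) M) j) (fun l j => Z (min (R.u l) M) j)
  refine ⟨p₀, s, hs, fun p hp F V _ _ _ _ _ g f ω ht => h p hp F V _ f ω ?_⟩
  constructor
  · intro i j hi hj
    have h1 := ht.dim (min (R.u i) M) j (min_le_right _ _) hj
    unfold meetDim at h1 ⊢
    rw [g.seq_min] at h1
    rw [R.seq_map, h1, hβ i j hi hj]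
  · intro i j hi hj
    rw [← ht.mem (min (R.u i) M) j (min_le_right _ _) hj, R.seq_map, g.seq_min]

end Reindex

/-- Data for forming flags with `N` steps from a flag with `M` steps and a new subspace, which
lies between the steps with indices `lo` and `hi` and becomes the step with index `m`. -/
structure Insertion (M N : ℕ) extends Reindex M N where
  /-- the index of the new subspace -/
  m : ℕ
  /-- the index of the step below the new subspace -/
  lo : ℕ
  /-- the index of the step above the new subspace -/
  hi : ℕ
  pos : 0 < m
  lt : m < N
  below : ∀ l, l < m → u l ≤ lo
  above : ∀ l, m < l → hi ≤ u l
  le : lo ≤ hi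
  hi_le : hi ≤ M

namespace Insertion

variable {M N n : ℕ} {F V : Type} [Field F] [AddCommGroup V] [Module F V]

/-- The flag formed from `g` and the new subspace `W`, which is first moved into the interval
between the steps `lo` and `hi`. -/
def build (I : Insertion M N) (g : PartialFlag M F V) (W : Submodule F V) : PartialFlag N F V :=
  PartialFlag.ofSeq (fun l => if l = I.m then (g.seq I.lo ⊔ W) ⊓ g.seq I.hi else g.seq (I.u l))
    (by
      intro a b hab
      rcases eq_or_lt_of_le hab with rfl | hab'
      · exact le_rfl
      · by_cases ha : a = I.m
        · have hb : ¬ b = I.m := by omega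
          simp only [ha, hb, if_true, if_false]
          exact inf_le_right.trans (g.seq_mono (I.above b (by omega)))
        · by_cases hb : b = I.m
          · simp only [ha, hb, if_true, if_false]
            exact le_inf ((g.seq_mono (I.below a (by omega))).trans le_sup_left)
              (g.seq_mono ((I.below a (by omega)).trans I.le))
          · simp only [ha, hb, if_false]
            exact g.seq_mono (I.mono hab))
    (by
      have := I.pos
      rw [if_neg (by omega), I.zero, g.seq_zero])
    (by
      have := I.lt
      rw [if_neg (by omega), g.seq_of_le I.top])

theorem seq_build (I : Insertion M N) (g : PartialFlag M F V) (W : Submodule F V) (l : ℕ) :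
    (I.build g W).seq l =
      if l = I.m then (g.seq I.lo ⊔ W) ⊓ g.seq I.hi else g.seq (I.u l) :=
  PartialFlag.seq_ofSeq _ _ _ _ _

theorem seq_build_of_ne (I : Insertion M N) (g : PartialFlag M F V) (W : Submodule F V) {l : ℕ}
    (hl : l ≠ I.m) : (I.build g W).seq l = g.seq (I.u l) := by
  rw [I.seq_build, if_neg hl]

theorem seq_build_self (I : Insertion M N) (g : PartialFlag M F V) {W : Submodule F V}
    (h1 : g.seq I.lo ≤ W) (h2 : W ≤ g.seq I.hi) : (I.build g W).seq I.m = W := by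
  rw [I.seq_build, if_pos rfl, sup_eq_right.2 h1, inf_eq_left.2 h2]

theorem build_hasType (I : Insertion M N) {g : PartialFlag M F V} {f : PartialFlag n F V} {ω : V}
    {r : ℕ → ℕ → ℤ} {Z : ℕ → ℕ → Prop} (h : HasType g f ω r Z) {W : Submodule F V}
    (h1 : g.seq I.lo ≤ W) (h2 : W ≤ g.seq I.hi) {row : ℕ → ℤ} {zrow : ℕ → Prop}
    (hrow : ∀ j, j ≤ n → (finrank F ↥(W ⊓ f.seq j) : ℤ) = row j)
    (hz : ∀ j, j ≤ n → (ω ∈ W ⊔ f.seq j ↔ zrow j)) :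
    HasType (I.build g W) f ω (fun l j => if l = I.m then row j else r (min (I.u l) M) j)
      (fun l j => if l = I.m then zrow j else Z (min (I.u l) M) j) := by
  constructor
  · intro i j hi hj
    by_cases hm : i = I.m
    · subst hm
      rw [if_pos rfl, ← hrow j hj, meetDim, I.seq_build_self g h1 h2]
    · rw [if_neg hm, ← h.dim _ j (min_le_right _ _) hj, meetDim, meetDim,
        I.seq_build_of_ne g W hm, g.seq_min]
  · intro i j hi hj
    by_cases hm : i = I.m
    · subst hm
      rw [if_pos rfl, ← hz j hj, I.seq_build_self g h1 h2]
    · rw [if_neg hm, ← h.mem _ j (min_le_right _ _) hj, I.seq_build_of_ne g W hm, g.seq_min]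

instance [Finite V] : Finite (Submodule F V) :=
  Finite.of_injective (fun p => (p : Set V)) SetLike.coe_injective

/-- The sum over all new subspaces of dimension one more than the step `lo`. -/
def lineSum (I : Insertion M N) (φ : Fam N n) : Fam M n :=
  fun p F V _ _ _ _ _ g f ω =>
    ∑ W ∈ toFs {W : Submodule F V | g.seq I.lo ≤ W ∧ W ≤ g.seq I.hi ∧
      finrank F W = finrank F (g.seq I.lo) + 1}, φ p F V (I.build g W) f ω

/-- The sum over all new subspaces of dimension one less than the step `hi`. -/
def hypSum (I : Insertion M N) (φ : Fam N n) : Fam M n :=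
  fun p F V _ _ _ _ _ g f ω =>
    ∑ W ∈ toFs {W : Submodule F V | g.seq I.lo ≤ W ∧ W ≤ g.seq I.hi ∧
      finrank F W + 1 = finrank F (g.seq I.hi)}, φ p F V (I.build g W) f ω

end Insertion

section Patterns

variable {n : ℕ}

/-- The indices `j` for which a pattern contains `(j, b)`. -/
def indices (W : Finset (Fin (n + 1) × Bool)) (b : Bool) : Finset ℕ :=
  (W.filter fun y => y.2 = b).image fun y => (y.1 : ℕ)

theorem le_of_mem_indices {W : Finset (Fin (n + 1) × Bool)} {b : Bool} {j : ℕ}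
    (h : j ∈ indices W b) : j ≤ n := by
  unfold indices at h
  grind

theorem forall_mem_pattern {W : Finset (Fin (n + 1) × Bool)} {H K : ℕ → Prop} :
    (∀ y ∈ W, if y.2 then K y.1 else H y.1) ↔
      (∀ j ∈ indices W false, H j) ∧ ∀ j ∈ indices W true, K j := by
  unfold indices
  simp only [Finset.mem_image, mem_filter]
  constructor
  · grind
  · grind

/-- The least element of `T`, or `n` if there is none below. -/
def least (n : ℕ) (T : Finset ℕ) : ℕ := (insert n T).min' (Finset.insert_nonempty _ _)

theorem least_le (n : ℕ) (T : Finset ℕ) : least n T ≤ n :=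
  Finset.min'_le _ _ (Finset.mem_insert_self _ _)

theorem forall_mem_iff_least {T : Finset ℕ} {H : ℕ → Prop}
    (hH : ∀ i j, i ≤ j → H i → H j) (hn : H n) : (∀ j ∈ T, H j) ↔ H (least n T) := by
  constructor
  · intro h
    rcases Finset.mem_insert.1 (Finset.min'_mem (insert n T) (Finset.insert_nonempty _ _)) with h1 | h1
    · unfold least
      rw [h1]
      exact hn
    · exact h _ h1
  · intro h j hj
    exact hH _ _ (Finset.min'_le _ _ (Finset.mem_insert_of_mem hj)) h

theorem forall_mem_iff_sup {T : Finset ℕ} {H : ℕ → Prop} (hH : ∀ i j, i ≤ j → H j → H i)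
    (h0 : T.Nonempty ∨ H 0) : (∀ j ∈ T, H j) ↔ H (T.sup id) := by
  constructor
  · intro h
    rcases T.eq_empty_or_nonempty with rfl | hT
    · rcases h0 with h0 | h0
      · exact absurd h0 (by simp)
      · simpa using h0
    · obtain ⟨j, hj, h1⟩ := Finset.exists_mem_eq_sup T hT id
      rw [h1]
      exact h j hj
  · intro h j hj
    exact hH _ _ (Finset.le_sup (f := id) hj) h

theorem sup_le_of_forall {T : Finset ℕ} (h : ∀ j ∈ T, j ≤ n) : T.sup id ≤ n := Finset.sup_le h

end Patterns

theorem stableFun_zero : (fun _ _ => 0 : ℕ → ℕ → ℚ) ∈ stableFun := stableFun_const 0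

theorem stableFun_ite {P : Prop} [Decidable P] {s s' : ℕ → ℕ → ℚ} (h : s ∈ stableFun)
    (h' : s' ∈ stableFun) : (if P then s else s') ∈ stableFun := by
  split_ifs
  · exact h
  · exact h'

theorem stableFun_q_sub_one : (fun _ q => (q : ℚ) - 1 : ℕ → ℕ → ℚ) ∈ stableFun := by
  have := stableFun_poly (Polynomial.X - 1)
  simpa using this

theorem stableFun_q_sub_one_inv : (fun _ q => ((q : ℚ) - 1)⁻¹ : ℕ → ℕ → ℚ) ∈ stableFun := by
  have := stableFun_inv_poly (Polynomial.X - 1) fun q hq => by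
    have h2 : (2 : ℚ) ≤ q := by exact_mod_cast hq
    simp only [Polynomial.eval_sub, Polynomial.eval_X, Polynomial.eval_one]
    intro h
    linarith
  simpa using this

theorem natCard_sub_one_ne_zero (F : Type) [Field F] [Finite F] : (Nat.card F : ℚ) - 1 ≠ 0 := by
  have h := two_le_natCard F
  have h2 : (2 : ℚ) ≤ Nat.card F := by exact_mod_cast h
  intro h3
  linarith

namespace Insertion

variable {M N n : ℕ}

section

variable {F V : Type} [Field F] [Finite F] [AddCommGroup V] [Module F V] [Finite V]

/-- A map whose fibres over `T` all have `c` elements relates the sums over its source and over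
`T`. -/
theorem mul_sum_of_ncard_fiber {X Y : Type*} [Finite X] [Finite Y] {S : Set X} {T : Set Y}
    {g : X → Y} {c : ℚ} (hg : ∀ x ∈ S, g x ∈ T)
    (hc : ∀ y ∈ T, ({x | x ∈ S ∧ g x = y}.ncard : ℚ) = c) (ψ : Y → ℚ) :
    c * ∑ y ∈ toFs T, ψ y = ∑ x ∈ toFs S, ψ (g x) := by
  classical
  rw [← Finset.sum_fiberwise_of_maps_to (s := toFs S) (t := toFs T) (g := g)
    fun x hx => mem_toFs.2 (hg x (mem_toFs.1 hx)), mul_sum]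
  refine sum_congr rfl fun y hy => ?_
  rw [← hc y (mem_toFs.1 hy), sum_congr rfl (g := fun _ => ψ y) fun x hx => by
    rw [(mem_filter.1 hx).2], sum_const, nsmul_eq_mul, ← card_toFs]
  congr 3
  ext x
  simp

/-- A sum over lines as a sum over vectors spanning them. -/
theorem sum_lines {A B : Submodule F V} (hAB : A ≤ B) (ψ : Submodule F V → ℚ) :
    (((Nat.card F : ℚ) - 1) * (Nat.card F : ℚ) ^ (finrank F A : ℤ)) *
      ∑ W ∈ toFs {W : Submodule F V | A ≤ W ∧ W ≤ B ∧ finrank F W = finrank F A + 1}, ψ W =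
    ∑ x ∈ toFs {x : V | x ∈ B ∧ x ∉ A}, ψ (A ⊔ F ∙ x) := by
  refine mul_sum_of_ncard_fiber (g := fun x => A ⊔ F ∙ x) ?_ ?_ ψ
  · exact fun x hx => ⟨le_sup_left, sup_le hAB ((span_singleton_le_iff_mem _ _).2 hx.1),
      finrank_sup_span hx.2⟩
  rintro W ⟨h1, h2, h3⟩
  rw [← ncard_line_generators h1 h3]
  congr 2
  ext x
  constructor
  · exact fun hx => ⟨hx.1.2, hx.2⟩
  · rintro ⟨hx, rfl⟩
    exact ⟨⟨h2 ((le_sup_right : F ∙ x ≤ _) (Submodule.mem_span_singleton_self x)), hx⟩, rfl⟩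

/-- A sum over hyperplanes as a sum over functionals defining them. -/
theorem sum_hyperplanes [Finite (Dual F V)] {A B : Submodule F V} (hAB : A ≤ B)
    (ψ : Submodule F V → ℚ) :
    (((Nat.card F : ℚ) - 1) * (Nat.card F : ℚ) ^ ((finrank F V : ℤ) - finrank F B)) *
      ∑ W ∈ toFs {W : Submodule F V | A ≤ W ∧ W ≤ B ∧ finrank F W + 1 = finrank F B}, ψ W =
    ∑ ξ ∈ toFs {ξ : Dual F V | ξ ∈ A.dualAnnihilator ∧ ξ ∉ B.dualAnnihilator},
      ψ (B ⊓ LinearMap.ker ξ) := by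
  refine mul_sum_of_ncard_fiber (g := fun ξ => B ⊓ LinearMap.ker ξ) ?_ ?_ ψ
  · exact fun ξ hx => ⟨le_inf hAB fun w hw => (mem_dualAnnihilator ξ).1 hx.1 w hw, inf_le_left,
      finrank_inf_ker hx.2⟩
  rintro W ⟨h1, h2, h3⟩
  rw [← ncard_hyperplane_equations h2 h3]
  congr 2
  ext ξ
  constructor
  · exact fun hx => ⟨hx.1.2, hx.2⟩
  · rintro ⟨hx, rfl⟩
    exact ⟨⟨(mem_dualAnnihilator ξ).2 fun w hw => (h1 hw).2, hx⟩, rfl⟩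

theorem sum_toFs_and_not {X : Type*} [Finite X] (P Q : X → Prop) [DecidablePred Q] (w : X → ℚ) :
    ∑ x ∈ toFs {x | P x ∧ ¬ Q x}, w x = ∑ x ∈ toFs {x | P x}, if Q x then 0 else w x := by
  have : toFs {x | P x ∧ ¬ Q x} = (toFs {x | P x}).filter fun x => ¬ Q x := by
    ext x
    simp
  rw [this, sum_filter]
  simp only [ite_not]

theorem eq_of_card_factor_mul_eq (F : Type) [Field F] [Finite F] {a b p : ℤ} {s t : ℚ}
    (h : (((Nat.card F : ℚ) - 1) * (Nat.card F : ℚ) ^ (a + p * b)) * s = t) :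
    s = ((Nat.card F : ℚ) - 1)⁻¹ * (Nat.card F : ℚ) ^ (-a + p * -b) * t := by
  have hq := natCard_cast_ne_zero F
  rw [← h, show -a + p * -b = -(a + p * b) by ring, zpow_neg, ← mul_inv,
    inv_mul_cancel_left₀ (mul_ne_zero (natCard_sub_one_ne_zero F) (zpow_ne_zero _ hq))]

theorem mem_pattern {P : Finset (Fin (n + 1) × Bool)} {H K : ℕ → Prop}
    (hP : ∀ y, y ∈ P ↔ if y.2 then K y.1 else H y.1) {j : ℕ} (hj : j ≤ n) :
    ((Fin.ofNat (n + 1) j, false) ∈ P ↔ H j) ∧ ((Fin.ofNat (n + 1) j, true) ∈ P ↔ K j) := by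
  have hval : ((Fin.ofNat (n + 1) j : Fin (n + 1)) : ℕ) = j := Nat.mod_eq_of_lt (by omega)
  rw [hP, hP]
  simp only [Bool.false_eq_true, if_false, if_true, hval, and_self]

end

open Classical in
/-- Summation over lines preserves stability. -/
theorem stable_lineSum (I : Insertion M N) {φ : Fam N n} {β β' : ℕ → ℕ → ℤ} (hφ : Stable β' φ)
    (hm : ∀ j, j ≤ n → β' I.m j = β I.lo j)
    (hβ : ∀ l j, l ≤ N → l ≠ I.m → j ≤ n → β' l j = β (min (I.u l) M) j) :
    Stable β (I.lineSum φ) := by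
  intro r Z
  have hloM : I.lo ≤ M := I.le.trans I.hi_le
  set row : Finset (Fin (n + 1) × Bool) → ℕ → ℤ := fun P j =>
    r I.lo j + if (Fin.ofNat (n + 1) j, false) ∈ P then 1 else 0 with hrowdef
  set zrow : Finset (Fin (n + 1) × Bool) → ℕ → Prop := fun P j =>
    (Fin.ofNat (n + 1) j, true) ∈ P with hzdef
  choose p₁ s hs hsφ using fun P => hφ
    (fun l j => if l = I.m then row P j else r (min (I.u l) M) j)
    (fun l j => if l = I.m then zrow P j else Z (min (I.u l) M) j)
  set e : ℕ → ℤ := fun j => r I.lo n + r I.hi j - r I.lo j with hedef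
  set d : ℕ → ℤ := fun j => β I.lo n + β I.hi j - β I.lo j with hddef
  set h : Finset (Fin (n + 1) × Bool) → ℕ → ℕ → ℚ := fun P =>
    if (Fin.ofNat (n + 1) 0, false) ∈ P then (fun _ _ => 0) else s P with hhdef
  set c : Finset (Fin (n + 1) × Bool) → ℕ → ℕ → ℚ := fun W =>
    if Z I.lo (least n (indices W true)) then
      fun p q => (q : ℚ) ^ (e (least n (indices W false)) + p * d (least n (indices W false)))
    else if Z I.lo (least n (indices W false)) ∧ Z I.hi (least n (indices W true)) then
      fun p q => ((q : ℚ) - 1) *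
        (q : ℚ) ^ (e (least n (indices W true)) + p * d (least n (indices W true)))
    else fun _ _ => 0 with hcdef
  have hh : ∀ P, h P ∈ stableFun := fun P => stableFun_ite stableFun_zero (hs P)
  have hc : ∀ W, c W ∈ stableFun := fun W =>
    stableFun_ite (stableFun_zpow _ _) (stableFun_ite
      (stableFun_mul stableFun_q_sub_one (stableFun_zpow _ _)) stableFun_zero)
  refine ⟨Finset.univ.sup p₁, _, stableFun_mul (stableFun_mul stableFun_q_sub_one_inv
    (stableFun_zpow (-r I.lo n) (-β I.lo n))) (stableFun_patternSum h c hh hc), ?_⟩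
  intro p hp F V _ _ _ _ _ g f ω ht
  set A := g.seq I.lo with hA
  set B := g.seq I.hi with hB
  have hAB : A ≤ B := g.seq_mono I.le
  have hdimA : (finrank F A : ℤ) = r I.lo n + p * β I.lo n := by
    rw [← ht.dim I.lo n hloM le_rfl, meetDim_top_right g f _ le_rfl]
  have hsum := sum_lines hAB fun W => φ p F V (I.build g W) f ω
  rw [hdimA] at hsum
  rw [sum_toFs_and_not (· ∈ B) (· ∈ A)] at hsum
  refine (eq_of_card_factor_mul_eq F hsum).trans (congrArg _ ?_)
  have hcard : ∀ j, j ≤ n → (finrank F ↥(B ⊓ (A ⊔ f.seq j)) : ℤ) = e j + p * d j := by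
    intro j hj
    rw [finrank_inf_sup hAB]
    have h1 := ht.dim I.hi j I.hi_le hj
    have h2 := ht.dim I.lo j hloM hj
    unfold meetDim at h1 h2
    rw [hdimA, h1, h2, hedef, hddef]
    ring
  refine sum_eq_sum_pattern (Q := Fin (n + 1) × Bool) {x : V | x ∈ B}
    (fun y x => if y.2 then ω ∈ (A ⊔ F ∙ x) ⊔ f.seq y.1 else x ∈ A ⊔ f.seq y.1) _
    (fun P => h P p (Nat.card F)) (fun W => c W p (Nat.card F)) ?_ ?_
  · intro x hx P hP
    have hmem := fun j => mem_pattern (H := fun j => x ∈ A ⊔ f.seq j)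
      (K := fun j => ω ∈ (A ⊔ F ∙ x) ⊔ f.seq j) (j := j) hP
    have h0 : (Fin.ofNat (n + 1) 0, false) ∈ P ↔ x ∈ A := by
      rw [(hmem 0 (Nat.zero_le _)).1, f.seq_zero, sup_bot_eq]
    by_cases hxA : x ∈ A
    · simp only [hhdef, h0, hxA, if_true]
    · simp only [hhdef, h0, hxA, if_false]
      refine hsφ P p ((Finset.le_sup (f := p₁) (mem_univ P)).trans hp) F V _ f ω ?_
      have hWB : A ⊔ F ∙ x ≤ B := sup_le hAB ((span_singleton_le_iff_mem _ _).2 hx)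
      have hT := I.build_hasType ht (W := A ⊔ F ∙ x) le_sup_left hWB
        (row := fun j => row P j + p * β I.lo j) (zrow := zrow P) ?_ ?_
      · refine hT.congr (fun l j hl hj => ?_) fun _ _ _ _ => Iff.rfl
        grind
      · intro j hj
        have h1 := finrank_sup_span_inf hxA (f.seq j)
        have h2 := ht.dim I.lo j hloM hj
        unfold meetDim at h2
        simp only [hrowdef, (hmem j hj).1]
        split_ifs with hxj
        · rw [h1.1 hxj]
          push_cast
          rw [h2]
          ring
        · rw [h1.2 hxj, h2]
          ring
      · grind
  · intro W
    have hfmono : ∀ i j, i ≤ j → f.seq i ≤ f.seq j := fun i j h => f.seq_mono h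
    set a := least n (indices W false) with ha
    set b := least n (indices W true) with hb
    have han : a ≤ n := least_le _ _
    have hbn : b ≤ n := least_le _ _
    have hset : ({x | x ∈ {x : V | x ∈ B} ∧ ∀ y ∈ W,
        if y.2 then ω ∈ (A ⊔ F ∙ x) ⊔ f.seq y.1 else x ∈ A ⊔ f.seq y.1} : Set V) =
        {x | x ∈ B ∧ x ∈ A ⊔ f.seq a ∧ ω ∈ (A ⊔ F ∙ x) ⊔ f.seq b} := by
      ext x
      simp only [Set.mem_ofPred_eq]
      rw [forall_mem_pattern (H := fun j => x ∈ A ⊔ f.seq j)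
        (K := fun j => ω ∈ (A ⊔ F ∙ x) ⊔ f.seq j),
        forall_mem_iff_least (n := n) (fun i j hij hx => sup_le_sup_left (hfmono i j hij) A hx),
        forall_mem_iff_least (n := n) (fun i j hij hx => sup_le_sup_left (hfmono i j hij) _ hx)]
      · rw [f.seq_of_le le_rfl, sup_top_eq]; trivial
      · rw [f.seq_of_le le_rfl, sup_top_eq]; trivial
    rw [hset]
    obtain ⟨h1, h2, h3⟩ := ncard_line_pattern hAB (fa := f.seq a) (fb := f.seq b)
      ((le_total a b).imp (hfmono a b) (hfmono b a)) ω
    have hZ1 := ht.mem I.lo b hloM hbn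
    have hZ2 := ht.mem I.lo a hloM han
    have hZ3 := ht.mem I.hi b I.hi_le hbn
    rw [← hA] at hZ1 hZ2
    rw [← hB] at hZ3
    simp only [hcdef, ← hZ1, ← hZ2, ← hZ3, ← ha, ← hb]
    by_cases hc1 : ω ∈ A ⊔ f.seq b
    · simp only [hc1, if_true]
      rw [h1 hc1, ← hcard a han, zpow_natCast]
      push_cast
      rfl
    · simp only [hc1, if_false]
      by_cases hc2 : ω ∈ A ⊔ f.seq a ∧ ω ∈ B ⊔ f.seq b
      · simp only [hc2, and_self, if_true]
        rw [h2 hc1 hc2, ← hcard b hbn, zpow_natCast]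
        have := two_le_natCard F
        rw [Nat.cast_mul, Nat.cast_sub (by omega)]
        push_cast
        rfl
      · rw [if_neg hc2, h3 hc1 hc2]
        simp

open Classical in
/-- Summation over hyperplanes preserves stability. -/
theorem stable_hypSum (I : Insertion M N) {φ : Fam N n} {β β' : ℕ → ℕ → ℤ} (hφ : Stable β' φ)
    (hm : ∀ j, j ≤ n → β' I.m j = β I.hi j)
    (hβ : ∀ l j, l ≤ N → l ≠ I.m → j ≤ n → β' l j = β (min (I.u l) M) j) :
    Stable β (I.hypSum φ) := by
  intro r Z
  have hloM : I.lo ≤ M := I.le.trans I.hi_le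
  set row : Finset (Fin (n + 1) × Bool) → ℕ → ℤ := fun P j =>
    r I.hi j - if (Fin.ofNat (n + 1) j, false) ∈ P then 0 else 1 with hrowdef
  set zrow : Finset (Fin (n + 1) × Bool) → ℕ → Prop := fun P j =>
    (Fin.ofNat (n + 1) j, true) ∉ P with hzdef
  choose p₁ s hs hsφ using fun P => hφ
    (fun l j => if l = I.m then row P j else r (min (I.u l) M) j)
    (fun l j => if l = I.m then zrow P j else Z (min (I.u l) M) j)
  set e : ℕ → ℤ := fun j => r M n - (r I.lo n + r I.hi j - r I.lo j) with hedef
  set d : ℕ → ℤ := fun j => β M n - (β I.lo n + β I.hi j - β I.lo j) with hddef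
  set h : Finset (Fin (n + 1) × Bool) → ℕ → ℕ → ℚ := fun P =>
    if (Fin.ofNat (n + 1) n, false) ∈ P then (fun _ _ => 0) else s P with hhdef
  set c : Finset (Fin (n + 1) × Bool) → ℕ → ℕ → ℚ := fun W =>
    let a := (indices W false).sup id
    let b := (indices W true).sup id
    if (indices W true).Nonempty ∧ Z I.hi b then
      if Z I.lo (max a b) then fun _ _ => 0
      else fun p q => (q : ℚ) ^ (e (max a b) + p * d (max a b)) -
        (q : ℚ) ^ ((e (max a b) - 1) + p * d (max a b))
    else fun p q => (q : ℚ) ^ (e a + p * d a)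
    with hcdef
  have hh : ∀ P, h P ∈ stableFun := fun P => stableFun_ite stableFun_zero (hs P)
  have hc : ∀ W, c W ∈ stableFun := fun W =>
    stableFun_ite (stableFun_ite stableFun_zero (stableFun_sub (stableFun_zpow _ _)
      (stableFun_zpow _ _))) (stableFun_zpow _ _)
  refine ⟨Finset.univ.sup p₁, _, stableFun_mul (stableFun_mul stableFun_q_sub_one_inv
    (stableFun_zpow (-(r M n - r I.hi n)) (-(β M n - β I.hi n))))
    (stableFun_patternSum h c hh hc), ?_⟩
  intro p hp F V _ _ _ _ _ g f ω ht
  have hfinD : Finite (Dual F V) := Module.finite_of_finite F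
  set A := g.seq I.lo with hA
  set B := g.seq I.hi with hB
  have hAB : A ≤ B := g.seq_mono I.le
  have hdimA : (finrank F A : ℤ) = r I.lo n + p * β I.lo n := by
    rw [← ht.dim I.lo n hloM le_rfl, meetDim_top_right g f _ le_rfl]
  have hdimB : (finrank F B : ℤ) = r I.hi n + p * β I.hi n := by
    rw [← ht.dim I.hi n I.hi_le le_rfl, meetDim_top_right g f _ le_rfl]
  have hdimV : (finrank F V : ℤ) = r M n + p * β M n := by
    rw [← ht.dim M n le_rfl le_rfl, meetDim_top_right g f _ le_rfl, g.seq_of_le le_rfl, finrank_top]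
  have hsum := sum_hyperplanes hAB fun W => φ p F V (I.build g W) f ω
  have hexp : (finrank F V : ℤ) - finrank F B = (r M n - r I.hi n) + p * (β M n - β I.hi n) := by
    rw [hdimV, hdimB]
    ring
  rw [hexp] at hsum
  rw [sum_toFs_and_not (· ∈ A.dualAnnihilator) (· ∈ B.dualAnnihilator)] at hsum
  refine (eq_of_card_factor_mul_eq F hsum).trans (congrArg _ ?_)
  have hcard : ∀ j, j ≤ n → (finrank F V : ℤ) - finrank F ↥(B ⊓ (A ⊔ f.seq j)) =
      e j + p * d j := by
    intro j hj
    rw [finrank_inf_sup hAB]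
    have h1 := ht.dim I.hi j I.hi_le hj
    have h2 := ht.dim I.lo j hloM hj
    unfold meetDim at h1 h2
    rw [hdimA, hdimV, h1, h2, hedef, hddef]
    ring
  refine sum_eq_sum_pattern (Q := Fin (n + 1) × Bool) {ξ : Dual F V | ξ ∈ A.dualAnnihilator}
    (fun y ξ => if y.2 then ω ∉ (B ⊓ LinearMap.ker ξ) ⊔ f.seq y.1
      else ξ ∈ (B ⊓ f.seq y.1).dualAnnihilator) _
    (fun P => h P p (Nat.card F)) (fun W => c W p (Nat.card F)) ?_ ?_
  · intro ξ hξ P hP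
    have hmem := fun j => mem_pattern (H := fun j => ξ ∈ (B ⊓ f.seq j).dualAnnihilator)
      (K := fun j => ω ∉ (B ⊓ LinearMap.ker ξ) ⊔ f.seq j) (j := j) hP
    have h0 : (Fin.ofNat (n + 1) n, false) ∈ P ↔ ξ ∈ B.dualAnnihilator := by
      rw [(hmem n le_rfl).1, f.seq_of_le le_rfl, inf_top_eq]
    by_cases hxB : ξ ∈ B.dualAnnihilator
    · simp only [hhdef, h0, hxB, if_true]
    · simp only [hhdef, h0, hxB, if_false]
      refine hsφ P p ((Finset.le_sup (f := p₁) (mem_univ P)).trans hp) F V _ f ω ?_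
      have hAW : A ≤ B ⊓ LinearMap.ker ξ := le_inf hAB fun w hw => (mem_dualAnnihilator ξ).1 hξ w hw
      have hT := I.build_hasType ht (W := B ⊓ LinearMap.ker ξ) hAW inf_le_left
        (row := fun j => row P j + p * β I.hi j) (zrow := zrow P) ?_ ?_
      · refine hT.congr (fun l j hl hj => ?_) fun _ _ _ _ => Iff.rfl
        grind
      · intro j hj
        have h2 := ht.dim I.hi j I.hi_le hj
        unfold meetDim at h2
        rw [inf_right_comm]
        simp only [hrowdef, (hmem j hj).1]
        split_ifs with hxj
        · rw [inf_ker_of_mem hxj, h2]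
          ring
        · have h3 := finrank_inf_ker hxj
          rw [← hB] at h2
          grind
      · grind
  · intro W
    have hfmono : ∀ i j, i ≤ j → f.seq i ≤ f.seq j := fun i j h => f.seq_mono h
    set a := (indices W false).sup id with ha
    set b := (indices W true).sup id with hb
    have han : a ≤ n := sup_le_of_forall fun j hj => le_of_mem_indices hj
    have hbn : b ≤ n := sup_le_of_forall fun j hj => le_of_mem_indices hj
    have hmax : f.seq a ⊔ f.seq b = f.seq (max a b) := by
      rcases le_total a b with hab | hab
      · rw [max_eq_right hab, sup_eq_right.2 (hfmono _ _ hab)]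
      · rw [max_eq_left hab, sup_eq_left.2 (hfmono _ _ hab)]
    have hH : ∀ ξ : Dual F V, (∀ j ∈ indices W false, ξ ∈ (B ⊓ f.seq j).dualAnnihilator) ↔
        ξ ∈ (B ⊓ f.seq a).dualAnnihilator := by
      intro ξ
      refine forall_mem_iff_sup (fun i j hij hx =>
        dualAnnihilator_anti (inf_le_inf_left _ (hfmono i j hij)) hx) (Or.inr ?_)
      rw [f.seq_zero, inf_bot_eq, Submodule.dualAnnihilator_bot]
      trivial
    by_cases hne : (indices W true).Nonempty
    · have hset : ({ξ | ξ ∈ {ξ : Dual F V | ξ ∈ A.dualAnnihilator} ∧ ∀ y ∈ W,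
          if y.2 then ω ∉ (B ⊓ LinearMap.ker ξ) ⊔ f.seq y.1
          else ξ ∈ (B ⊓ f.seq y.1).dualAnnihilator} : Set (Dual F V)) =
          {ξ | ξ ∈ A.dualAnnihilator ∧ ξ ∈ (B ⊓ f.seq a).dualAnnihilator ∧
            ω ∉ (B ⊓ LinearMap.ker ξ) ⊔ f.seq b} := by
        ext ξ
        simp only [Set.mem_ofPred_eq]
        rw [forall_mem_pattern (H := fun j => ξ ∈ (B ⊓ f.seq j).dualAnnihilator)
          (K := fun j => ω ∉ (B ⊓ LinearMap.ker ξ) ⊔ f.seq j), hH,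
          forall_mem_iff_sup (fun i j hij hx hx' => hx (sup_le_sup_left (hfmono i j hij) _ hx'))
            (Or.inl hne)]
      rw [hset]
      obtain ⟨h1, h2, h3⟩ := ncard_hyperplane_pattern hAB (fa := f.seq a) (fb := f.seq b)
        ((le_total a b).imp (hfmono a b) (hfmono b a)) ω
      have hZ1 := ht.mem I.hi b I.hi_le hbn
      have hZ2 := ht.mem I.lo (max a b) hloM (max_le han hbn)
      rw [← hB] at hZ1
      rw [← hA] at hZ2
      simp only [hcdef, ← ha, ← hb, hne, true_and, ← hZ1, ← hZ2]
      rw [hmax] at h2 h3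
      by_cases hc1 : ω ∈ B ⊔ f.seq b
      · simp only [hc1, if_true]
        by_cases hc2 : ω ∈ A ⊔ f.seq (max a b)
        · grind
        · simp only [hc2, if_false]
          rw [h3 hc1 hc2, hcard _ (max_le han hbn)]
          congr 2
          ring
      · simp only [hc1, if_false]
        rw [h1 hc1, hcard a han]
    · have hset : ({ξ | ξ ∈ {ξ : Dual F V | ξ ∈ A.dualAnnihilator} ∧ ∀ y ∈ W,
          if y.2 then ω ∉ (B ⊓ LinearMap.ker ξ) ⊔ f.seq y.1
          else ξ ∈ (B ⊓ f.seq y.1).dualAnnihilator} : Set (Dual F V)) =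
          ((B ⊓ (A ⊔ f.seq a)).dualAnnihilator : Set (Dual F V)) := by
        ext ξ
        simp only [Set.mem_ofPred_eq, SetLike.mem_coe]
        rw [forall_mem_pattern (H := fun j => ξ ∈ (B ⊓ f.seq j).dualAnnihilator)
          (K := fun j => ω ∉ (B ⊓ LinearMap.ker ξ) ⊔ f.seq j), hH,
          Finset.not_nonempty_iff_eq_empty.1 hne, inf_comm B (A ⊔ f.seq a),
          sup_inf_assoc_of_le _ hAB, inf_comm (f.seq a) B, Submodule.dualAnnihilator_sup_eq,
          Submodule.mem_inf]
        simp
      rw [hset, ncard_dualAnnihilator, hcard a han]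
      simp only [hcdef, hne, false_and, if_false, ← ha]

end Insertion

/-! ### Averaging over translations -/

section Translation

variable {N n : ℕ}

/-- The sum over all translations of the vector by elements of the step `t`. -/
def transl (t : ℕ) (φ : Fam N n) : Fam N n :=
  fun p F V _ _ _ _ _ g f ω => ∑ μ ∈ toFs {μ : V | μ ∈ g.seq t}, φ p F V g f (ω - μ)

section

variable {F V : Type} [Field F] [Finite F] [AddCommGroup V] [Module F V] [Finite V]

open Classical in
/-- The number of vectors `μ` in a step such that `ω - μ` lies in prescribed sums of steps. -/
theorem ncard_transl_pattern (g : PartialFlag N F V) (f : PartialFlag n F V) (ω : V) (t : ℕ)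
    (W : Finset (ℕ × ℕ)) :
    (({μ | μ ∈ g.seq t ∧ ∀ y ∈ W, ω - μ ∈ g.seq y.1 ⊔ f.seq y.2} : Set V).ncard : ℚ) =
      if ∀ y ∈ W, ω ∈ g.seq (max y.1 t) ⊔ f.seq y.2 then
        (Nat.card F : ℚ) ^ (∑ x : Fin N × Fin n,
          if (x.1 : ℕ) < t ∧ ∀ y ∈ W, (x.1 : ℕ) < y.1 ∨ (x.2 : ℕ) < y.2 then
            blockSize (meetDim g f) x.1 x.2 else 0)
      else 0 := by
  obtain ⟨a, b, hb, ha⟩ := exists_isAdapted g f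
  split_ifs with hW
  · set S : Set (Σ x : Fin N × Fin n, Fin (a x)) :=
      {k | (k.1.1 : ℕ) < t ∧ ∀ y ∈ W, (k.1.1 : ℕ) < y.1 ∨ (k.1.2 : ℕ) < y.2} with hS
    set μ₀ : V := ∑ k, if (k.1.1 : ℕ) < t then b.repr ω k • b k else 0 with hμ₀
    have hμr : ∀ k, b.repr μ₀ k = if (k.1.1 : ℕ) < t then b.repr ω k else 0 := by
      intro k
      rw [hμ₀, map_sum, Finsupp.finsetSum_apply, sum_eq_single k]
      · split_ifs <;> simp
      · intro l _ hl
        split_ifs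
        · simp [hl]
        · simp
      · simp
    have hset : ({μ | μ ∈ g.seq t ∧ ∀ y ∈ W, ω - μ ∈ g.seq y.1 ⊔ f.seq y.2} : Set V) =
        (fun ν => μ₀ + ν) '' (span F (b '' S) : Set V) := by
      ext μ
      rw [Set.mem_image]
      have hspan : μ - μ₀ ∈ span F (b '' S) ↔
          ∀ k, b.repr (μ - μ₀) k ≠ 0 → k ∈ S := by
        rw [b.mem_span_image]
        simp [Set.subset_def]
      have hiff : (∃ x ∈ (span F (b '' S) : Set V), μ₀ + x = μ) ↔
          μ - μ₀ ∈ span F (b '' S) := by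
        constructor
        · rintro ⟨x, hx, rfl⟩
          simpa using hx
        · intro h
          exact ⟨_, h, by abel⟩
      rw [hiff, hspan, Set.mem_ofPred_eq, hb.mem_left]
      have hsup : ∀ y : ℕ × ℕ, (ω - μ ∈ g.seq y.1 ⊔ f.seq y.2 ↔
        ∀ k, b.repr (ω - μ) k ≠ 0 → (k.1.1 : ℕ) < y.1 ∨ (k.1.2 : ℕ) < y.2) :=
        fun y => hb.mem_sup
      have hW' : ∀ y ∈ W, ∀ k, b.repr ω k ≠ 0 →
        (k.1.1 : ℕ) < max y.1 t ∨ (k.1.2 : ℕ) < y.2 := fun y hy => hb.mem_sup.1 (hW y hy)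
      simp only [hsup]
      constructor
      · rintro ⟨h1, h2⟩ k hk
        have hkt : (k.1.1 : ℕ) < t := by
          by_contra hcon
          apply hk
          rw [map_sub, Finsupp.sub_apply, hμr, if_neg hcon, sub_zero]
          by_contra h3
          exact hcon (h1 k h3)
        refine ⟨hkt, fun y hy => h2 y hy k ?_⟩
        rw [map_sub, Finsupp.sub_apply, hμr, if_pos hkt] at hk
        rw [map_sub, Finsupp.sub_apply]
        intro h3
        apply hk
        rw [← neg_sub, h3, neg_zero]
      · intro h
        refine ⟨fun k hk => ?_, fun y hy k hk => ?_⟩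
        · by_contra hcon
          apply hcon
          refine (h k ?_).1
          rw [map_sub, Finsupp.sub_apply, hμr, if_neg hcon, sub_zero]
          exact hk
        · by_cases hkt : (k.1.1 : ℕ) < t
          · refine (h k ?_).2 y hy
            rw [map_sub, Finsupp.sub_apply] at hk
            rw [map_sub, Finsupp.sub_apply, hμr, if_pos hkt]
            grind
          · have h4 : b.repr μ k = 0 := by
              by_contra h5
              apply hkt
              refine (h k ?_).1
              rw [map_sub, Finsupp.sub_apply, hμr, if_neg hkt, sub_zero]
              exact h5
            rw [map_sub, Finsupp.sub_apply, h4, sub_zero] at hk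
            grind
    rw [hset, Set.ncard_image_of_injective _ (add_right_injective μ₀), ncard_submodule,
      IsAdapted.finrank_span_image]
    push_cast
    rw [← zpow_natCast]
    congr 1
    rw [Finset.card_filter]
    push_cast
    rw [Fintype.sum_sigma]
    refine sum_congr rfl fun x _ => ?_
    simp only [hS, Set.mem_ofPred_eq]
    rw [sum_const, Finset.card_univ, Fintype.card_fin]
    split_ifs
    · simp [ha]
    · simp
  · norm_cast
    rw [Set.ncard_eq_zero (Set.toFinite _), Set.eq_empty_iff_forall_notMem]
    rintro μ ⟨h1, h2⟩
    apply hW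
    intro y hy
    have h3 : ω = (ω - μ) + μ := by abel
    rw [h3]
    refine Submodule.add_mem _ ?_ ((le_sup_left : g.seq (max y.1 t) ≤ _)
      (g.seq_mono (le_max_right _ _) h1))
    exact sup_le_sup_right (g.seq_mono (le_max_left _ _)) _ (h2 y hy)

end

open Classical in
/-- Summation over translations preserves stability. -/
theorem stable_transl {t : ℕ} (ht : t ≤ N) {φ : Fam N n} {β : ℕ → ℕ → ℤ} (hφ : Stable β φ) :
    Stable β (transl t φ) := by
  intro r Z
  choose p₁ s hs hsφ using fun P : Finset (Fin (N + 1) × Fin (n + 1)) =>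
    hφ r (fun i j => (Fin.ofNat (N + 1) i, Fin.ofNat (n + 1) j) ∈ P)
  set e : (ℕ → ℕ → ℤ) → Finset (Fin (N + 1) × Fin (n + 1)) → ℤ := fun ρ W =>
    ∑ x : Fin N × Fin n, if (x.1 : ℕ) < t ∧ ∀ y ∈ W, (x.1 : ℕ) < y.1 ∨ (x.2 : ℕ) < y.2 then
      blockSize ρ x.1 x.2 else 0 with he
  set c : Finset (Fin (N + 1) × Fin (n + 1)) → ℕ → ℕ → ℚ := fun W =>
    if ∀ y ∈ W, Z (max y.1 t) y.2 then fun p q => (q : ℚ) ^ (e r W + p * e β W)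
    else fun _ _ => 0 with hc
  refine ⟨Finset.univ.sup p₁, _, stableFun_patternSum s c hs
    (fun W => stableFun_ite (stableFun_zpow _ _) stableFun_zero), ?_⟩
  intro p hp F V _ _ _ _ _ g f ω hT
  refine sum_eq_sum_pattern (Q := Fin (N + 1) × Fin (n + 1)) {μ : V | μ ∈ g.seq t}
    (fun y μ => ω - μ ∈ g.seq y.1 ⊔ f.seq y.2) _
    (fun P => s P p (Nat.card F)) (fun W => c W p (Nat.card F)) ?_ ?_
  · intro μ hμ P hP
    refine hsφ P p ((Finset.le_sup (f := p₁) (mem_univ P)).trans hp) F V g f (ω - μ) ?_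
    refine ⟨hT.dim, fun i j hi hj => ?_⟩
    rw [hP]
    have h1 : ((Fin.ofNat (N + 1) i : Fin (N + 1)) : ℕ) = i := Nat.mod_eq_of_lt (by omega)
    have h2 : ((Fin.ofNat (n + 1) j : Fin (n + 1)) : ℕ) = j := Nat.mod_eq_of_lt (by omega)
    simp only [h1, h2]
  · intro W
    have h := ncard_transl_pattern g f ω t (W.image fun y => ((y.1 : ℕ), (y.2 : ℕ)))
    simp only [Finset.forall_mem_image] at h
    refine h.trans ?_
    have h1 : (∀ y ∈ W, ω ∈ g.seq (max (y.1 : ℕ) t) ⊔ f.seq y.2) ↔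
        ∀ y ∈ W, Z (max y.1 t) y.2 := by
      refine forall₂_congr fun y _ => hT.mem _ _ ?_ ?_
      · have := y.1.2
        omega
      · have := y.2.2
        omega
    simp only [hc, h1]
    split_ifs
    · congr 1
      simp only [he, mul_sum]
      rw [← sum_add_distrib]
      refine sum_congr rfl fun x _ => ?_
      split_ifs
      · have hx1 := x.1.2
        have hx2 := x.2.2
        unfold blockSize
        rw [hT.dim _ _ (by omega) (by omega), hT.dim _ _ (by omega) (by omega),
          hT.dim _ _ (by omega) (by omega), hT.dim _ _ (by omega) (by omega)]
        ring
      · ring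
    · rfl

end Translation

/-! ### Words of columns and the operators they define -/

/-- A column of a word: it describes one step of a flag relative to a second flag. -/
structure Col where
  /-- the step of the second flag to which the column belongs -/
  label : ℕ
  /-- the dimension of the column, up to the parameter `p` of stabilization -/
  size : ℤ
  /-- whether the parameter `p` is added to the dimension -/
  big : Bool
  /-- whether translations by the column are averaged over -/
  mark : Bool

/-- The dimension of a column. -/
def Col.dim (c : Col) (p : ℕ) : ℤ := c.size + if c.big then (p : ℤ) else 0

section Lattice

variable {F V : Type} [Field F] [AddCommGroup V] [Module F V] {n : ℕ}

/-- The quotient `B / A` lives in the `i`-th subquotient of the flag `f`. -/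
structure IsPure (f : PartialFlag n F V) (i : ℕ) (A B : Submodule F V) : Prop where
  le : A ≤ B
  inf_le : B ⊓ f.seq i ≤ A
  le_sup : B ≤ A ⊔ f.seq (i + 1)

variable {f : PartialFlag n F V} {i j : ℕ} {A B W W' : Submodule F V}

theorem IsPure.mono_left (h : IsPure f i A B) (h1 : A ≤ W) (h2 : W ≤ B) : IsPure f i W B :=
  ⟨h2, h.inf_le.trans h1, h.le_sup.trans (sup_le_sup_right h1 _)⟩

theorem IsPure.mono_right (h : IsPure f i A B) (h1 : A ≤ W) (h2 : W ≤ B) : IsPure f i A W :=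
  ⟨h1, (inf_le_inf_right _ h2).trans h.inf_le, h2.trans h.le_sup⟩

theorem IsPure.trans (h : IsPure f i A W) (h' : IsPure f i W B) : IsPure f i A B := by
  refine ⟨h.le.trans h'.le, ?_, ?_⟩
  · exact (le_inf h'.inf_le inf_le_right).trans h.inf_le
  · exact h'.le_sup.trans (sup_le h.le_sup le_sup_right)

theorem IsPure.refl (f : PartialFlag n F V) (i : ℕ) (A : Submodule F V) : IsPure f i A A :=
  ⟨le_rfl, inf_le_left, le_sup_left⟩

theorem IsPure.eq_sup (h : IsPure f i A B) : B = A ⊔ (B ⊓ f.seq (i + 1)) := by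
  rw [inf_comm, ← sup_inf_assoc_of_le _ h.le]
  exact (inf_eq_right.2 h.le_sup).symm

/-- The subspace which interchanges two successive columns whose labels descend. -/
def crossing (f : PartialFlag n F V) (j : ℕ) (A B : Submodule F V) : Submodule F V :=
  A ⊔ (B ⊓ f.seq (j + 1))

theorem crossing_spec (hij : j < i) (h : IsPure f i A W) (h' : IsPure f j W B) :
    IsPure f j A (crossing f j A B) ∧ IsPure f i (crossing f j A B) B ∧
      W ⊓ crossing f j A B = A ∧ W ⊔ crossing f j A B = B := by
  have hji : f.seq (j + 1) ≤ f.seq i := f.seq_mono hij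
  have hji' : f.seq j ≤ f.seq i := f.seq_mono hij.le
  have hAB : A ≤ B := h.le.trans h'.le
  have hcB : crossing f j A B ≤ B := sup_le hAB inf_le_left
  refine ⟨⟨le_sup_left, ?_, sup_le_sup_left inf_le_right _⟩, ⟨hcB, ?_, ?_⟩, ?_, ?_⟩
  · refine le_trans ?_ h.inf_le
    refine le_inf ((inf_le_inf_right _ hcB).trans h'.inf_le) (inf_le_right.trans hji')
  · intro x hx
    obtain ⟨hxB, hxi⟩ := Submodule.mem_inf.1 hx
    obtain ⟨w, hw, z, hz, rfl⟩ := Submodule.mem_sup.1 (h'.le_sup hxB)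
    have hwA : w ∈ A := h.inf_le ⟨hw, by
      have := (f.seq i).sub_mem hxi (hji hz)
      simpa using this⟩
    refine Submodule.add_mem_sup hwA ⟨?_, hz⟩
    have := B.sub_mem hxB (h'.le hw)
    simpa using this
  · refine h'.le_sup.trans (sup_le (h.le_sup.trans (sup_le_sup_right le_sup_left _)) ?_)
    exact (f.seq_mono (by omega)).trans le_sup_right
  · apply le_antisymm
    · unfold crossing
      rw [inf_comm, sup_inf_assoc_of_le _ h.le]
      refine sup_le le_rfl (le_trans ?_ h.inf_le)
      exact le_inf inf_le_right ((inf_le_left.trans inf_le_right).trans hji)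
    · exact le_inf h.le le_sup_left
  · apply le_antisymm (sup_le h'.le hcB)
    rw [h'.eq_sup]
    refine sup_le le_sup_left ?_
    rw [← h'.eq_sup]
    exact le_sup_right.trans le_sup_right

theorem eq_crossing (hij : j < i) (h : IsPure f j A W') (h' : IsPure f i W' B) :
    crossing f j A B = W' := by
  apply le_antisymm
  · refine sup_le h.le (le_trans (inf_le_inf_left _ (f.seq_mono hij)) h'.inf_le)
  · rw [h.eq_sup]
    exact sup_le_sup_left (inf_le_inf_right _ h'.le) _

theorem pure_of_compl (hij : j < i) (h : IsPure f j A W') (h' : IsPure f i W' B)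
    (h1 : W ⊓ W' = A) (h2 : W ⊔ W' = B) : IsPure f i A W ∧ IsPure f j W B := by
  have hji : f.seq (j + 1) ≤ f.seq (i + 1) := f.seq_mono (by omega)
  have hji' : f.seq j ≤ f.seq i := f.seq_mono hij.le
  have hAW : A ≤ W := h1 ▸ inf_le_left
  have hWB : W ≤ B := h2 ▸ le_sup_left
  refine ⟨⟨hAW, ?_, ?_⟩, ⟨hWB, ?_, ?_⟩⟩
  · rw [← h1]
    exact le_inf inf_le_left ((inf_le_inf_right _ hWB).trans h'.inf_le)
  · exact hWB.trans (h'.le_sup.trans (sup_le (h.le_sup.trans (sup_le_sup_left hji _)) le_sup_right))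
  · refine le_trans ?_ hAW
    exact (le_inf ((inf_le_inf_left _ hji').trans h'.inf_le) inf_le_right).trans h.inf_le
  · rw [← h2]
    exact sup_le le_sup_left (h.le_sup.trans (sup_le_sup_right hAW _))

end Lattice

section Words

variable {F V : Type} [Field F] [AddCommGroup V] [Module F V] {n N : ℕ}

/-- The steps of the flag `g` have, relative to the flag `f`, the shape given by a word. -/
def IsLabelled (c : ℕ → Col) (p : ℕ) (f : PartialFlag n F V) (g : PartialFlag N F V) : Prop :=
  ∀ k, k < N → IsPure f (c k).label (g.seq k) (g.seq (k + 1)) ∧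
    (finrank F (g.seq (k + 1)) : ℤ) = finrank F (g.seq k) + (c k).dim p

/-- The span of the marked columns. -/
def markedSpan (c : ℕ → Col) (f : PartialFlag n F V) (g : PartialFlag N F V) : Submodule F V :=
  ⨆ k : ℕ, ⨆ _ : k < N ∧ (c k).mark = true, f.seq ((c k).label + 1) ⊓ g.seq (k + 1)

theorem markedSpan_le {c : ℕ → Col} {f : PartialFlag n F V} {g : PartialFlag N F V}
    {D : Submodule F V} (h : ∀ k, k < N → (c k).mark = true →
      f.seq ((c k).label + 1) ⊓ g.seq (k + 1) ≤ D) : markedSpan c f g ≤ D :=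
  iSup₂_le fun k hk => h k hk.1 hk.2

theorem le_markedSpan {c : ℕ → Col} {f : PartialFlag n F V} {g : PartialFlag N F V} {k : ℕ}
    (hk : k < N) (hm : (c k).mark = true) :
    f.seq ((c k).label + 1) ⊓ g.seq (k + 1) ≤ markedSpan c f g :=
  le_iSup₂ (f := fun (k : ℕ) (_ : k < N ∧ (c k).mark = true) =>
    f.seq ((c k).label + 1) ⊓ g.seq (k + 1)) k ⟨hk, hm⟩

theorem inf_le_of_isLabelled {c : ℕ → Col} {p : ℕ} {f : PartialFlag n F V}
    {g : PartialFlag N F V} (h : IsLabelled c p f g) {i : ℕ} {D : Submodule F V} (k : ℕ)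
    (hk : k ≤ N) (hD : ∀ l, l < k → (c l).label ≤ i →
      f.seq ((c l).label + 1) ⊓ g.seq (l + 1) ≤ D) : f.seq (i + 1) ⊓ g.seq k ≤ D := by
  induction k with
  | zero => rw [g.seq_zero, inf_bot_eq]; exact bot_le
  | succ k ih =>
    have ih' := ih (by omega) fun l hl => hD l (by omega)
    obtain ⟨hp, -⟩ := h k (by omega)
    intro x hx
    obtain ⟨hxi, hxk⟩ := Submodule.mem_inf.1 hx
    rcases le_or_gt (c k).label i with hle | hlt
    · obtain ⟨y, hy, z, hz, rfl⟩ := Submodule.mem_sup.1 (hp.le_sup hxk)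
      have hzk : z ∈ g.seq (k + 1) := by
        have := (g.seq (k + 1)).sub_mem hxk (hp.le hy)
        simpa using this
      have hyi : y ∈ f.seq (i + 1) := by
        have := (f.seq (i + 1)).sub_mem hxi (f.seq_mono (by omega : (c k).label + 1 ≤ i + 1) hz)
        simpa using this
      exact D.add_mem (ih' ⟨hyi, hy⟩) (hD k (by omega) hle ⟨hz, hzk⟩)
    · exact ih' ⟨hxi, hp.inf_le ⟨hxk, f.seq_mono (by omega : i + 1 ≤ _) hxi⟩⟩

/-- The kernel operator defined by a word: the sum over the flags of the given shape and over the
translations by the span of the marked columns. -/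
def wordOp (c : ℕ → Col) (φ : Fam N n) : Fam n n :=
  fun p F V _ _ _ _ _ f f' ω =>
    ∑ g ∈ toFs {g : PartialFlag N F V | IsLabelled c p f g},
      ∑ μ ∈ toFs {μ : V | μ ∈ markedSpan c f g}, φ p F V g f' (ω - μ)

end Words

section Insertions

/-- Insertion of a new step between the steps `k` and `k + 1`. -/
def gapInsertion {N : ℕ} (k : ℕ) (hk : k < N) : Insertion N (N + 1) where
  u l := if l ≤ k then l else l - 1
  mono := by
    intro a b h
    dsimp only
    split_ifs <;> omega
  zero := by simp
  top := by
    rw [if_neg (by omega)]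
    omega
  m := k + 1
  lo := k
  hi := k + 1
  pos := by omega
  lt := by omega
  below l hl := by split_ifs <;> omega
  above l hl := by split_ifs <;> omega
  le := by omega
  hi_le := by omega

/-- Replacement of the step `k + 1` by a subspace between the steps `lo` and `hi`. -/
def stepInsertion {N : ℕ} (k lo hi : ℕ) (hk : k + 1 < N) (h1 : k ≤ lo) (h2 : lo ≤ hi)
    (h3 : k + 1 ≤ hi) (h4 : lo ≤ k + 1) (h5 : hi ≤ k + 2) : Insertion N N where
  u l := l
  mono := fun _ _ h => h
  zero := rfl
  top := le_rfl
  m := k + 1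
  lo := lo
  hi := hi
  pos := by omega
  lt := by omega
  below l hl := by omega
  above l hl := by omega
  le := h2
  hi_le := by omega

/-- Omission of the step `k + 1`. -/
def dropStep {N : ℕ} (k : ℕ) (hk : k < N) : Reindex (N + 1) N where
  u l := if l ≤ k then l else l + 1
  mono := by
    intro a b h
    dsimp only
    split_ifs <;> omega
  zero := by simp
  top := by rw [if_neg (by omega)]

/-- Repetition of the step `k`. -/
def repeatStep {N : ℕ} (k : ℕ) (hk : k ≤ N) : Reindex N (N + 1) where
  u l := if l ≤ k then l else l - 1
  mono := by
    intro a b h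
    dsimp only
    split_ifs <;> omega
  zero := by simp
  top := by split_ifs <;> omega

theorem Insertion.sum_build {M N : ℕ} (I : Insertion M N) {F V : Type} [Field F] [AddCommGroup V]
    [Module F V] [Finite V] (S : Set (PartialFlag N F V)) (S' : Set (PartialFlag M F V))
    (T : PartialFlag M F V → Set (Submodule F V)) (d : PartialFlag N F V → PartialFlag M F V)
    (h1 : ∀ g ∈ S, d g ∈ S' ∧ g.seq I.m ∈ T (d g) ∧ I.build (d g) (g.seq I.m) = g)
    (h2 : ∀ g' ∈ S', ∀ W ∈ T g', I.build g' W ∈ S ∧ d (I.build g' W) = g' ∧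
      (I.build g' W).seq I.m = W) (H : PartialFlag N F V → ℚ) :
    ∑ g ∈ toFs S, H g = ∑ g' ∈ toFs S', ∑ W ∈ toFs (T g'), H (I.build g' W) := by
  rw [Finset.sum_sigma']
  refine Finset.sum_bij' (fun g _ => ⟨d g, g.seq I.m⟩) (fun x _ => I.build x.1 x.2) ?_ ?_ ?_ ?_ ?_
  · intro g hg
    obtain ⟨h3, h4, -⟩ := h1 g (mem_toFs.1 hg)
    exact Finset.mem_sigma.2 ⟨mem_toFs.2 h3, mem_toFs.2 h4⟩
  · rintro ⟨g', W⟩ hx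
    obtain ⟨h3, h4⟩ := Finset.mem_sigma.1 hx
    exact mem_toFs.2 (h2 g' (mem_toFs.1 h3) W (mem_toFs.1 h4)).1
  · intro g hg
    exact (h1 g (mem_toFs.1 hg)).2.2
  · rintro ⟨g', W⟩ hx
    obtain ⟨h3, h4⟩ := Finset.mem_sigma.1 hx
    obtain ⟨-, h5, h6⟩ := h2 g' (mem_toFs.1 h3) W (mem_toFs.1 h4)
    simp only
    rw [h5, h6]
  · intro g hg
    rw [(h1 g (mem_toFs.1 hg)).2.2]

end Insertions

section Operators

variable {N n : ℕ}

theorem markedSpan_congr {F V : Type} [Field F] [AddCommGroup V] [Module F V] {M : ℕ}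
    {c : ℕ → Col} {c' : ℕ → Col} {f : PartialFlag n F V} {g : PartialFlag N F V}
    {g' : PartialFlag M F V}
    (h : ∀ k, k < N → (c k).mark = true →
      f.seq ((c k).label + 1) ⊓ g.seq (k + 1) ≤ markedSpan c' f g')
    (h' : ∀ k, k < M → (c' k).mark = true →
      f.seq ((c' k).label + 1) ⊓ g'.seq (k + 1) ≤ markedSpan c f g) :
    markedSpan c f g = markedSpan c' f g' :=
  le_antisymm (markedSpan_le h) (markedSpan_le h')

/-- Two successive columns with the same label and mark may be merged. -/
theorem wordOp_merge {c c' : ℕ → Col} {k : ℕ} (hk : k < N) (hlow : ∀ l, l < k → c l = c' l)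
    (hhigh : ∀ l, k < l → c (l + 1) = c' l) (hl : (c k).label = (c' k).label)
    (hl' : (c (k + 1)).label = (c' k).label) (hm : (c k).mark = (c' k).mark)
    (hm' : (c (k + 1)).mark = (c' k).mark)
    (hd : ∀ p, (c k).dim p + (c (k + 1)).dim p = (c' k).dim p) (φ : Fam (N + 1) n)
    (ψ : Fam N n)
    (hψ : ∀ (p : ℕ) (F V : Type) [Field F] [Finite F] [AddCommGroup V] [Module F V] [Finite V]
      (f : PartialFlag n F V) (g : PartialFlag N F V) (f' : PartialFlag n F V) (ω : V),
      IsLabelled c' p f g → ψ p F V g f' ω =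
        ∑ W ∈ toFs {W : Submodule F V | g.seq k ≤ W ∧ W ≤ g.seq (k + 1) ∧
          (finrank F W : ℤ) = finrank F (g.seq k) + (c k).dim p},
          φ p F V ((gapInsertion k hk).build g W) f' ω)
    (p : ℕ) (F V : Type) [Field F] [Finite F] [AddCommGroup V] [Module F V] [Finite V]
    (f f' : PartialFlag n F V) (ω : V) :
    wordOp c φ p F V f f' ω = wordOp c' ψ p F V f f' ω := by
  set I := gapInsertion k hk with hI
  have hIm : I.m = k + 1 := rfl
  have hIlo : I.lo = k := rfl
  have hIhi : I.hi = k + 1 := rfl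
  have hIu : ∀ l, I.u l = if l ≤ k then l else l - 1 := fun _ => rfl
  have hdrop : ∀ (g : PartialFlag (N + 1) F V) l, ((dropStep k hk).map g).seq l =
      g.seq (if l ≤ k then l else l + 1) := fun g l => Reindex.seq_map _ _ _
  -- membership in the labelled flags in terms of the flag with a step omitted
  have hb : ∀ (g : PartialFlag N F V) (W : Submodule F V), g.seq k ≤ W → W ≤ g.seq (k + 1) →
      (I.build g W).seq (k + 1) = W := fun g W h1 h2 => I.seq_build_self g h1 h2
  have hb1 : ∀ (g : PartialFlag N F V) (W : Submodule F V) l, l ≤ k →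
      (I.build g W).seq l = g.seq l := by
    intro g W l hlk
    rw [I.seq_build_of_ne g W (by omega), hIu, if_pos hlk]
  have hb2 : ∀ (g : PartialFlag N F V) (W : Submodule F V) l, k < l →
      (I.build g W).seq (l + 1) = g.seq l := by
    intro g W l hlk
    rw [I.seq_build_of_ne g W (by omega), hIu, if_neg (by omega)]
    rfl
  have hspan : ∀ (g : PartialFlag N F V) (W : Submodule F V), g.seq k ≤ W → W ≤ g.seq (k + 1) →
      markedSpan c f (I.build g W) = markedSpan c' f g := by
    intro g W h1 h2
    refine markedSpan_congr ?_ ?_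
    · intro l hlN hml
      rcases lt_trichotomy l k with h | h | h
      · rw [hb1 g W (l + 1) (by omega), hlow l h]
        rw [hlow l h] at hml
        exact le_markedSpan (by omega) hml
      · subst h
        rw [hb g W h1 h2, hl]
        rw [hm] at hml
        exact (inf_le_inf_left _ h2).trans (le_markedSpan hk hml)
      · obtain ⟨l, rfl⟩ : ∃ l', l = l' + 1 := ⟨l - 1, by omega⟩
        rw [hb2 g W (l + 1) (by omega)]
        rcases eq_or_lt_of_le (Nat.lt_succ_iff.1 h) with h3 | h3
        · subst h3
          rw [hl']
          rw [hm'] at hml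
          exact le_markedSpan hk hml
        · rw [hhigh l h3]
          rw [hhigh l h3] at hml
          exact le_markedSpan (by omega) hml
    · intro l hlN hml
      rcases lt_trichotomy l k with h | h | h
      · rw [← hb1 g W (l + 1) (by omega), ← hlow l h]
        rw [← hlow l h] at hml
        exact le_markedSpan (by omega) hml
      · subst h
        rw [← hb2 g W (l + 1) (by omega), ← hl']
        rw [← hm'] at hml
        exact le_markedSpan (by omega) hml
      · rw [← hb2 g W (l + 1) (by omega), ← hhigh l h]
        rw [← hhigh l h] at hml
        exact le_markedSpan (by omega) hml
  have key := I.sum_build {g : PartialFlag (N + 1) F V | IsLabelled c p f g}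
    {g : PartialFlag N F V | IsLabelled c' p f g}
    (fun g => {W : Submodule F V | g.seq k ≤ W ∧ W ≤ g.seq (k + 1) ∧
          (finrank F W : ℤ) = finrank F (g.seq k) + (c k).dim p}) (dropStep k hk).map ?_ ?_
    (fun g => ∑ μ ∈ toFs {μ : V | μ ∈ markedSpan c f g}, φ p F V g f' (ω - μ))
  · unfold wordOp
    rw [key]
    refine sum_congr rfl fun g hg => ?_
    rw [mem_toFs] at hg
    simp_rw [hψ p F V f g f' _ hg]
    rw [sum_comm]
    refine sum_congr rfl fun W hW => ?_
    rw [mem_toFs] at hW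
    rw [hspan g W hW.1 hW.2.1]
  · intro g hg
    change IsLabelled c p f g at hg
    have hk1 := hg k (by omega)
    have hk2 := hg (k + 1) (by omega)
    refine ⟨?_, ?_, ?_⟩
    · intro l hlN
      rw [hdrop, hdrop]
      rcases lt_trichotomy l k with h | h | h
      · rw [if_pos h.le, if_pos (by omega), ← hlow l h]
        exact hg l (by omega)
      · subst h
        rw [if_pos le_rfl, if_neg (by omega), ← hd p]
        rw [hl] at hk1
        rw [hl'] at hk2
        refine ⟨hk1.1.trans hk2.1, ?_⟩
        rw [hk2.2, hk1.2]
        ring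
      · rw [if_neg (by omega), if_neg (by omega), ← hhigh l h]
        exact hg (l + 1) (by omega)
    · change _ ∧ _ ∧ _
      rw [hdrop, hdrop, if_pos le_rfl, if_neg (by omega)]
      exact ⟨hk1.1.le, hk2.1.le, hk1.2⟩
    · apply PartialFlag.ext_seq
      intro l
      rcases lt_trichotomy l (k + 1) with h | h | h
      · rw [hb1 _ _ l (by omega), hdrop, if_pos (by omega)]
      · subst h
        refine hb _ _ ?_ ?_
        · rw [hdrop, if_pos le_rfl]
          exact hk1.1.le
        · rw [hdrop, if_neg (by omega)]
          exact hk2.1.le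
      · obtain ⟨l, rfl⟩ : ∃ l', l = l' + 1 := ⟨l - 1, by omega⟩
        rw [hb2 _ _ l (by omega), hdrop, if_neg (by omega)]
  · intro g hg W hW
    change IsLabelled c' p f g at hg
    obtain ⟨h1, h2, h3⟩ := hW
    have hgk := hg k hk
    refine ⟨?_, ?_, hb g W h1 h2⟩
    · intro l hlN
      rcases lt_trichotomy l k with h | h | h
      · rw [hb1 _ _ l h.le, hb1 _ _ (l + 1) h, hlow l h]
        exact hg l (by omega)
      · subst h
        rw [hb1 _ _ l le_rfl, hb g W h1 h2, hl]
        exact ⟨hgk.1.mono_right h1 h2, h3⟩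
      · obtain ⟨l, rfl⟩ : ∃ l', l = l' + 1 := ⟨l - 1, by omega⟩
        rw [hb2 _ _ (l + 1) (by omega)]
        rcases eq_or_lt_of_le (Nat.lt_succ_iff.1 h) with h4 | h4
        · subst h4
          rw [hb g W h1 h2, hl']
          refine ⟨hgk.1.mono_left h1 h2, ?_⟩
          grind
        · rw [hb2 _ _ l (by omega), hhigh l h4]
          exact hg l (by omega)
    · apply PartialFlag.ext_seq
      grind

end Operators

section Operators

variable {N n : ℕ}

/-- Two successive columns with descending labels, the first of them unmarked, may be
interchanged. -/
theorem wordOp_swap {c c' : ℕ → Col} {k : ℕ} (hk : k + 1 < N) (h0 : c' k = c (k + 1))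
    (h1 : c' (k + 1) = c k) (hne : ∀ l, l ≠ k → l ≠ k + 1 → c' l = c l)
    (hlabel : (c (k + 1)).label < (c k).label) (hmark : (c k).mark = false) (φ ψ : Fam N n)
    (hψ : ∀ (p : ℕ) (F V : Type) [Field F] [Finite F] [AddCommGroup V] [Module F V] [Finite V]
      (f : PartialFlag n F V) (g : PartialFlag N F V) (f' : PartialFlag n F V) (ω : V),
      IsLabelled c' p f g → ψ p F V g f' ω =
        ∑ W ∈ toFs {W : Submodule F V | W ⊓ g.seq (k + 1) = g.seq k ∧
          W ⊔ g.seq (k + 1) = g.seq (k + 2)},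
          φ p F V ((stepInsertion k k (k + 2) hk le_rfl (by omega) (by omega) (by omega)
            le_rfl).build g W) f' ω)
    (p : ℕ) (F V : Type) [Field F] [Finite F] [AddCommGroup V] [Module F V] [Finite V]
    (f f' : PartialFlag n F V) (ω : V) :
    wordOp c φ p F V f f' ω = wordOp c' ψ p F V f f' ω := by
  set I : Insertion N N := stepInsertion k k (k + 2) hk le_rfl (by omega) (by omega) (by omega)
    le_rfl with hI
  have hIm : I.m = k + 1 := rfl
  have hIu : ∀ l, I.u l = l := fun _ => rfl
  set j := (c (k + 1)).label with hj
  set i := (c k).label with hi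
  have hb : ∀ (g : PartialFlag N F V) (W : Submodule F V), g.seq k ≤ W → W ≤ g.seq (k + 2) →
      (I.build g W).seq (k + 1) = W := fun g W h1 h2 => I.seq_build_self g h1 h2
  have hb1 : ∀ (g : PartialFlag N F V) (W : Submodule F V) l, l ≠ k + 1 →
      (I.build g W).seq l = g.seq l := by
    intro g W l hlk
    rw [I.seq_build_of_ne g W (by omega), hIu]
  have key := I.sum_build {g : PartialFlag N F V | IsLabelled c p f g}
    {g : PartialFlag N F V | IsLabelled c' p f g}
    (fun g => {W : Submodule F V | W ⊓ g.seq (k + 1) = g.seq k ∧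
          W ⊔ g.seq (k + 1) = g.seq (k + 2)})
    (fun g => I.build g (crossing f j (g.seq k) (g.seq (k + 2)))) ?_ ?_
    (fun g => ∑ μ ∈ toFs {μ : V | μ ∈ markedSpan c f g}, φ p F V g f' (ω - μ))
  · unfold wordOp
    rw [key]
    refine sum_congr rfl fun g hg => ?_
    rw [mem_toFs] at hg
    change IsLabelled c' p f g at hg
    simp_rw [hψ p F V f g f' _ hg]
    rw [sum_comm]
    refine sum_congr rfl fun W hW => ?_
    rw [mem_toFs] at hW
    obtain ⟨h2, h3⟩ := hW
    have h4 := hg k (by omega)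
    have h5 := hg (k + 1) hk
    rw [h0] at h4
    rw [h1] at h5
    have hAW : g.seq k ≤ W := h2 ▸ inf_le_left
    have hWB : W ≤ g.seq (k + 2) := h3 ▸ le_sup_left
    suffices hs : markedSpan c f (I.build g W) = markedSpan c' f g by rw [hs]
    refine markedSpan_congr ?_ ?_
    · intro l hlN hml
      by_cases hlk : l = k
      · grind
      · by_cases hlk' : l = k + 1
        · subst hlk'
          rw [hb1 g W _ (by omega)]
          refine le_trans ?_ (le_markedSpan (k := k) (by omega) (by rw [h0]; exact hml))
          rw [h0]
          refine le_inf inf_le_left ?_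
          refine le_trans ?_ h5.1.inf_le
          rw [inf_comm]
          exact inf_le_inf_left _ (f.seq_mono hlabel)
        · rw [hb1 g W _ (by omega), ← hne l hlk hlk']
          exact le_markedSpan hlN (by rw [hne l hlk hlk']; exact hml)
    · intro l hlN hml
      by_cases hlk : l = k
      · subst hlk
        refine le_trans ?_ (le_markedSpan (k := l + 1) hk (by rw [← h0]; exact hml))
        rw [h0, hb1 g W _ (by omega)]
        exact inf_le_inf_left _ h5.1.le
      · by_cases hlk' : l = k + 1
        · grind
        · rw [← hb1 g W _ (by omega), hne l hlk hlk']
          exact le_markedSpan hlN (by rw [← hne l hlk hlk']; exact hml)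
  · intro g hg
    change IsLabelled c p f g at hg
    obtain ⟨h2, h2'⟩ := hg k (by omega)
    obtain ⟨h3, h3'⟩ := hg (k + 1) hk
    obtain ⟨h4, h5, h6, h7⟩ := crossing_spec hlabel h2 h3
    set X := crossing f j (g.seq k) (g.seq (k + 2)) with hX
    have hbX := hb g X h4.le h5.le
    have hdim := finrank_sup_add_finrank_inf_eq (g.seq (k + 1)) X
    rw [h6, h7] at hdim
    change (finrank F (g.seq (k + 2)) : ℤ) = finrank F (g.seq (k + 1)) + (c (k + 1)).dim p at h3'
    change (finrank F (g.seq (k + 2)) : ℕ) + _ = _ at hdim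
    refine ⟨?_, ?_, ?_⟩
    · intro l hlN
      by_cases hlk : l = k
      · subst hlk
        rw [hbX, hb1 g X l (by omega), h0]
        exact ⟨h4, by omega⟩
      · by_cases hlk' : l = k + 1
        · rw [hlk', hbX, hb1 g X _ (by omega), h1]
          grind
        · rw [hb1 g X l (by omega), hb1 g X (l + 1) (by omega), hne l hlk hlk']
          exact hg l hlN
    · grind
    · apply PartialFlag.ext_seq
      intro l
      by_cases hlk : l = k + 1
      · subst hlk
        refine hb _ _ ?_ ?_
        · rw [hb1 g X _ (by omega)]
          exact h2.le
        · rw [hb1 g X _ (by omega)]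
          exact h3.le
      · rw [hb1 _ _ l hlk, hb1 g X l hlk]
  · intro g hg W hW
    change IsLabelled c' p f g at hg
    obtain ⟨h2, h3⟩ := hW
    have h4 := hg k (by omega)
    have h5 := hg (k + 1) hk
    rw [h0] at h4
    rw [h1] at h5
    have hAW : g.seq k ≤ W := h2 ▸ inf_le_left
    have hWB : W ≤ g.seq (k + 2) := h3 ▸ le_sup_left
    obtain ⟨h6, h7⟩ := pure_of_compl hlabel h4.1 h5.1 h2 h3
    have hdim := finrank_sup_add_finrank_inf_eq W (g.seq (k + 1))
    rw [h2, h3] at hdim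
    obtain ⟨h4, h4'⟩ := h4
    obtain ⟨h5, h5'⟩ := h5
    rw [show k + 1 + 1 = k + 2 from rfl] at h5'
    refine ⟨?_, ?_, hb g W hAW hWB⟩
    · intro l hlN
      by_cases hlk : l = k
      · subst hlk
        rw [hb g W hAW hWB, hb1 g W l (by omega)]
        exact ⟨h6, by omega⟩
      · by_cases hlk' : l = k + 1
        · subst hlk'
          rw [hb g W hAW hWB, hb1 g W _ (by omega)]
          exact ⟨h7, by rw [show k + 1 + 1 = k + 2 from rfl]; omega⟩
        · rw [hb1 g W l (by omega), hb1 g W (l + 1) (by omega), ← hne l hlk hlk']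
          exact hg l hlN
    · have hcr : crossing f j ((I.build g W).seq k) ((I.build g W).seq (k + 2)) =
          g.seq (k + 1) := by
        rw [hb1 g W k (by omega), hb1 g W (k + 2) (by omega)]
        exact eq_crossing hlabel h4 h5
      apply PartialFlag.ext_seq
      intro l
      rw [hcr]
      by_cases hlk : l = k + 1
      · subst hlk
        refine hb _ _ ?_ ?_
        · rw [hb1 g W _ (by omega)]
          exact h4.le
        · rw [hb1 g W _ (by omega)]
          exact h5.le
      · rw [hb1 _ _ l hlk, hb1 g W l hlk]

/-- A column of dimension zero may be omitted. -/
theorem wordOp_remove {c c' : ℕ → Col} {k : ℕ} (hk : k ≤ N) (hlow : ∀ l, l < k → c l = c' l)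
    (hhigh : ∀ l, k ≤ l → c (l + 1) = c' l) (hd : ∀ p, (c k).dim p = 0)
    (hm : (c k).mark = true → ∀ l, l < k → (c l).label ≤ (c k).label → (c l).mark = true)
    (φ : Fam (N + 1) n) (p : ℕ) (F V : Type) [Field F] [Finite F] [AddCommGroup V] [Module F V]
    [Finite V] (f f' : PartialFlag n F V) (ω : V) :
    wordOp c φ p F V f f' ω = wordOp c' ((repeatStep k hk).pull φ) p F V f f' ω := by
  have hr : ∀ (g : PartialFlag N F V) l, ((repeatStep k hk).map g).seq l =
      g.seq (if l ≤ k then l else l - 1) := fun g l => Reindex.seq_map _ _ _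
  have hr1 : ∀ (g : PartialFlag N F V) l, l ≤ k → ((repeatStep k hk).map g).seq l = g.seq l := by
    intro g l hl
    rw [hr, if_pos hl]
  have hr2 : ∀ (g : PartialFlag N F V) l, k ≤ l →
      ((repeatStep k hk).map g).seq (l + 1) = g.seq l := by
    intro g l hl
    rw [hr, if_neg (by omega)]
    rfl
  have hlab : ∀ g : PartialFlag N F V, IsLabelled c' p f g →
      IsLabelled c p f ((repeatStep k hk).map g) := by
    intro g hg l hlN
    rcases lt_trichotomy l k with h | h | h
    · rw [hr1 g l h.le, hr1 g (l + 1) h, hlow l h]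
      exact hg l (by omega)
    · subst h
      rw [hr1 g l le_rfl, hr2 g l le_rfl, hd p, add_zero]
      exact ⟨IsPure.refl f _ _, rfl⟩
    · obtain ⟨l, rfl⟩ : ∃ l', l = l' + 1 := ⟨l - 1, by omega⟩
      rw [hr2 g l (by omega), hr2 g (l + 1) (by omega), hhigh l (by omega)]
      exact hg l (by omega)
  have hspan : ∀ g : PartialFlag N F V, IsLabelled c' p f g →
      markedSpan c f ((repeatStep k hk).map g) = markedSpan c' f g := by
    intro g hg
    refine markedSpan_congr ?_ ?_
    · intro l hlN hml
      rcases lt_trichotomy l k with h | h | h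
      · rw [hr1 g (l + 1) (by omega), hlow l h]
        rw [hlow l h] at hml
        exact le_markedSpan (by omega) hml
      · subst h
        rw [hr2 g l le_rfl]
        refine inf_le_of_isLabelled hg l hk fun l' hl' hle => le_markedSpan (by omega) ?_
        rw [← hlow l' hl'] at hle ⊢
        exact hm hml l' hl' hle
      · obtain ⟨l, rfl⟩ : ∃ l', l = l' + 1 := ⟨l - 1, by omega⟩
        rw [hr2 g (l + 1) (by omega), hhigh l (by omega)]
        rw [hhigh l (by omega)] at hml
        exact le_markedSpan (by omega) hml
    · intro l hlN hml
      rcases lt_or_ge l k with h | h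
      · rw [← hr1 g (l + 1) (by omega), ← hlow l h]
        rw [← hlow l h] at hml
        exact le_markedSpan (by omega) hml
      · rw [← hr2 g (l + 1) (by omega), ← hhigh l h]
        rw [← hhigh l h] at hml
        exact le_markedSpan (by omega) hml
  unfold wordOp
  symm
  have hinj : Function.Injective ((repeatStep k hk).map (F := F) (V := V)) := by
    intro g g' h
    apply PartialFlag.ext_seq
    grind
  refine Finset.sum_nbij (repeatStep k hk).map ?_ hinj.injOn ?_ ?_
  · intro g hg
    exact mem_toFs.2 (hlab g (mem_toFs.1 hg))
  · intro g hg
    have hg' : IsLabelled c p f g := mem_toFs.1 hg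
    have hgk : g.seq (k + 1) = g.seq k := by
      obtain ⟨h1, h2⟩ := hg' k (by omega)
      rw [hd p, add_zero] at h2
      exact (eq_of_le_of_finrank_eq h1.le (by omega)).symm
    have hmono : Monotone fun l => g.seq (if l < k then l else l + 1) := by
      intro a b hab
      refine g.seq_mono ?_
      split_ifs <;> omega
    have h0 : g.seq (if 0 < k then 0 else 0 + 1) = ⊥ := by
      split_ifs with h
      · exact g.seq_zero
      · obtain rfl : k = 0 := by omega
        rw [hgk, g.seq_zero]
    have htop : g.seq (if N < k then N else N + 1) = ⊤ := by
      rw [if_neg (by omega)]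
      exact g.seq_of_le le_rfl
    set d : PartialFlag N F V := PartialFlag.ofSeq _ hmono h0 htop with hd'
    have hdr : ∀ l, d.seq l = g.seq (if l < k then l else l + 1) :=
      fun l => PartialFlag.seq_ofSeq _ _ _ _ _
    have hdr1 : ∀ l, l ≤ k → d.seq l = g.seq l := by grind
    have hdr2 : ∀ l, k ≤ l → d.seq l = g.seq (l + 1) := by
      intro l hl
      rw [hdr, if_neg (by omega)]
    refine ⟨d, ?_, ?_⟩
    · refine mem_toFs.2 fun l hlN => ?_
      rcases lt_or_ge l k with h | h
      · rw [hdr1 l h.le, hdr1 (l + 1) h, ← hlow l h]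
        exact hg' l (by omega)
      · rw [hdr2 l h, hdr2 (l + 1) (by omega), ← hhigh l h]
        exact hg' (l + 1) (by omega)
    · apply PartialFlag.ext_seq
      grind
  · intro g hg
    rw [hspan g (mem_toFs.1 hg)]
    rfl

theorem sum_mem_bot {F V : Type} [Field F] [AddCommGroup V] [Module F V] [Finite V] (h : V → ℚ) :
    ∑ μ ∈ toFs {μ : V | μ ∈ (⊥ : Submodule F V)}, h μ = h 0 := by
  have h1 : toFs {μ : V | μ ∈ (⊥ : Submodule F V)} = {0} := by
    ext x
    rw [mem_toFs, mem_singleton]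
    exact Submodule.mem_bot F
  rw [h1, sum_singleton]

/-- If the marked columns form an initial segment, they may be unmarked after summation over the
translations by a step of the flag. -/
theorem wordOp_unmark {c c' : ℕ → Col} {t : ℕ} (ht : t ≤ N)
    (hmark : ∀ k, k < N → ((c k).mark = true ↔ k < t))
    (hlabel : ∀ k, (c k).label = (c' k).label) (hd : ∀ k p, (c k).dim p = (c' k).dim p)
    (hmark' : ∀ k, k < N → (c' k).mark = false) (φ : Fam N n)
    (p : ℕ) (F V : Type) [Field F] [Finite F] [AddCommGroup V] [Module F V] [Finite V]
    (f f' : PartialFlag n F V) (ω : V) :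
    wordOp c φ p F V f f' ω = wordOp c' (transl t φ) p F V f f' ω := by
  unfold wordOp
  have hlab : ∀ g : PartialFlag N F V, IsLabelled c p f g ↔ IsLabelled c' p f g := by
    intro g
    refine forall₂_congr fun k _ => ?_
    rw [hlabel k, hd k p]
  simp_rw [hlab]
  refine sum_congr rfl fun g hg => ?_
  have hg' : IsLabelled c' p f g := mem_toFs.1 hg
  have h1 : markedSpan c f g = g.seq t := by
    apply le_antisymm
    · refine markedSpan_le fun k hkN hk => inf_le_right.trans (g.seq_mono ?_)
      exact (hmark k hkN).1 hk
    · have h2 := inf_le_of_isLabelled ((hlab g).2 hg') (i := n) (D := markedSpan c f g) t ht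
        fun l hl _ => le_markedSpan (by omega) ((hmark l (by omega)).2 hl)
      rwa [f.seq_of_le (by omega), top_inf_eq] at h2
  have h2 : markedSpan c' f g = ⊥ := by
    rw [eq_bot_iff]
    refine markedSpan_le fun k hkN hk => ?_
    rw [hmark' k hkN] at hk
    exact absurd hk (by simp)
  rw [h1, h2, sum_mem_bot, sub_zero]
  rfl

/-- The word with one column for every step defines the identity, up to a condition on
dimensions. -/
theorem wordOp_of_label_eq {c : ℕ → Col} (hlabel : ∀ k, k < n → (c k).label = k)
    (hmark : ∀ k, k < n → (c k).mark = false) (φ : Fam n n)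
    (p : ℕ) (F V : Type) [Field F] [Finite F] [AddCommGroup V] [Module F V] [Finite V]
    (f f' : PartialFlag n F V) (ω : V) [Decidable (∀ k, k < n →
      (finrank F (f.seq (k + 1)) : ℤ) = finrank F (f.seq k) + (c k).dim p)] :
    wordOp c φ p F V f f' ω = if ∀ k, k < n →
      (finrank F (f.seq (k + 1)) : ℤ) = finrank F (f.seq k) + (c k).dim p
      then φ p F V f f' ω else 0 := by
  unfold wordOp
  have hle : ∀ g : PartialFlag n F V, IsLabelled c p f g → ∀ k, k ≤ n → g.seq k ≤ f.seq k := by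
    intro g hg k
    induction k with
    | zero => intro _; rw [g.seq_zero]; exact bot_le
    | succ k ih =>
      intro hk
      have h1 := (hg k (by omega)).1.le_sup
      rw [hlabel k (by omega)] at h1
      exact h1.trans (sup_le ((ih (by omega)).trans (f.seq_mono (Nat.le_succ k))) le_rfl)
  have hge : ∀ g : PartialFlag n F V, IsLabelled c p f g → ∀ k, k ≤ n →
      f.seq (n - k) ≤ g.seq (n - k) := by
    intro g hg k
    induction k with
    | zero => intro _; rw [Nat.sub_zero, g.seq_of_le le_rfl]; exact le_top
    | succ k ih =>
      intro hk
      obtain ⟨m, hm⟩ : ∃ m, n - k = m + 1 := ⟨n - k - 1, by omega⟩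
      have hm' : n - (k + 1) = m := by omega
      have h1 := (hg m (by omega)).1.inf_le
      rw [hlabel m (by omega)] at h1
      have h2 := ih (by omega)
      rw [hm] at h2
      rw [hm']
      exact (le_inf ((f.seq_mono (Nat.le_succ m)).trans h2) le_rfl).trans h1
  have heq : ∀ g : PartialFlag n F V, IsLabelled c p f g → g = f := by
    intro g hg
    apply PartialFlag.ext_seq
    intro k
    rcases le_total k n with hk | hk
    · grind
    · rw [g.seq_of_le hk, f.seq_of_le hk]
  have hspan : markedSpan c f f = ⊥ := by
    rw [eq_bot_iff]
    refine markedSpan_le fun k hkN hk => ?_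
    rw [hmark k hkN] at hk
    exact absurd hk (by simp)
  have hsum : ∑ μ ∈ toFs {μ : V | μ ∈ markedSpan c f f}, φ p F V f f' (ω - μ) =
      φ p F V f f' ω := by
    rw [hspan, sum_mem_bot, sub_zero]
  split_ifs with h
  · rw [sum_eq_single f]
    · exact hsum
    · intro g hg hne
      exact absurd (heq g (mem_toFs.1 hg)) hne
    · intro hf
      exfalso
      apply hf
      refine mem_toFs.2 fun k hk => ⟨?_, h k hk⟩
      rw [hlabel k hk]
      exact ⟨f.seq_mono (Nat.le_succ k), inf_le_right, le_sup_right⟩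
  · refine sum_eq_zero fun g hg => ?_
    exfalso
    have hg' : IsLabelled c p f g := mem_toFs.1 hg
    have := heq g hg'
    subst this
    exact h fun k hk => (hg' k hk).2

end Operators

section Shift

/-- Whether a column contributes to the growth of the intersection with the step `j`. -/
def Col.growth (c : Col) (j : ℕ) : ℤ := if c.big = true ∧ c.label < j then 1 else 0

/-- The growth with `p` of the dimensions of intersections, for a flag described by a word. -/
def wordShift (c : ℕ → Col) (k j : ℕ) : ℤ := ∑ l ∈ range k, (c l).growth j

theorem wordShift_succ (c : ℕ → Col) (k j : ℕ) :
    wordShift c (k + 1) j = wordShift c k j + (c k).growth j :=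
  sum_range_succ _ _

theorem wordShift_congr {c c' : ℕ → Col} {k : ℕ} (h : ∀ l, l < k → c l = c' l) (j : ℕ) :
    wordShift c k j = wordShift c' k j :=
  sum_congr rfl fun l hl => by rw [h l (Finset.mem_range.1 hl)]

theorem wordShift_merge {c c' : ℕ → Col} {k : ℕ} (hlow : ∀ l, l < k → c l = c' l)
    (hhigh : ∀ l, k < l → c (l + 1) = c' l)
    (hg : ∀ j, (c k).growth j + (c (k + 1)).growth j = (c' k).growth j) {l : ℕ} (hl : k < l)
    (j : ℕ) : wordShift c (l + 1) j = wordShift c' l j := by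
  induction l, hl using Nat.le_induction with
  | base =>
    rw [wordShift_succ, wordShift_succ, wordShift_succ, ← hg j, wordShift_congr hlow]
    ring
  | succ l hl ih =>
    rw [wordShift_succ, ih, wordShift_succ, hhigh l hl]

theorem wordShift_swap {c c' : ℕ → Col} {k : ℕ} (h0 : c' k = c (k + 1))
    (h1 : c' (k + 1) = c k) (hne : ∀ l, l ≠ k → l ≠ k + 1 → c' l = c l) {l : ℕ} (hl : l ≠ k + 1)
    (j : ℕ) : wordShift c l j = wordShift c' l j := by
  have hlow : ∀ l, l < k → c l = c' l := fun l hl => (hne l (by omega) (by omega)).symm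
  rcases lt_or_ge l (k + 1) with h | h
  · exact wordShift_congr (fun l' hl' => hlow l' (by omega)) j
  · have h2 : k + 2 ≤ l := by omega
    induction l, h2 using Nat.le_induction with
    | base =>
      rw [wordShift_succ, wordShift_succ, wordShift_succ, wordShift_succ, h0, h1,
        wordShift_congr hlow]
      ring
    | succ l hl ih =>
      rw [wordShift_succ, wordShift_succ, ih (by omega) (by omega), hne l (by omega) (by omega)]

end Shift

section Complements

variable {F V : Type} [Field F] [AddCommGroup V] [Module F V] [Finite V] {A B C : Submodule F V}

theorem sum_toFs_sub {X : Type*} [Finite X] {S T U : Set X} {ψ ψ' : X → ℚ} (hTS : T ⊆ S)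
    (hU : ∀ x, x ∈ U ↔ x ∈ S ∧ x ∉ T) (hψ : ∀ x ∈ T, ψ x = ψ' x) :
    ∑ x ∈ toFs S, ψ x - ∑ x ∈ toFs T, ψ' x = ∑ x ∈ toFs U, ψ x := by
  classical
  have hsub : toFs T ⊆ toFs S := fun x hx => mem_toFs.2 (hTS (mem_toFs.1 hx))
  have hset : toFs U = toFs S \ toFs T := by
    ext x
    simp [hU]
  rw [hset, sub_eq_iff_eq_add, ← Finset.sum_sdiff hsub]
  exact congrArg _ (sum_congr rfl fun x hx => hψ x (mem_toFs.1 hx))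

/-- The complements of a hyperplane `C` of `B / A` are the lines not contained in it. -/
theorem sum_compl_of_hyperplane (hAC : A ≤ C) (hCB : C ≤ B) (h : finrank F B = finrank F C + 1)
    {ψ ψ' : Submodule F V → ℚ} (hψ : ∀ W, A ≤ W → W ≤ C → ψ W = ψ' W) :
    ∑ W ∈ toFs {W : Submodule F V | A ≤ W ∧ W ≤ B ∧ finrank F W = finrank F A + 1}, ψ W -
      ∑ W ∈ toFs {W : Submodule F V | A ≤ W ∧ W ≤ C ∧ finrank F W = finrank F A + 1}, ψ' W =
    ∑ W ∈ toFs {W : Submodule F V | W ⊓ C = A ∧ W ⊔ C = B}, ψ W := by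
  refine sum_toFs_sub (fun W hW => ⟨hW.1, hW.2.1.trans hCB, hW.2.2⟩) (fun W => ?_)
    fun W hW => hψ W hW.1 hW.2.1
  have hdim := finrank_sup_add_finrank_inf_eq W C
  constructor
  · rintro ⟨h1, h2⟩
    rw [h1, h2] at hdim
    refine ⟨⟨h1 ▸ inf_le_left, h2 ▸ le_sup_left, by omega⟩, ?_⟩
    rintro ⟨-, h3, -⟩
    rw [sup_eq_right.2 h3] at h2
    rw [h2] at h
    omega
  · rintro ⟨⟨h1, h2, h3⟩, h4⟩
    have h5 : ¬ W ≤ C := fun h5 => h4 ⟨h1, h5, h3⟩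
    have h6 : finrank F ↥(W ⊓ C) < finrank F W :=
      finrank_lt_finrank_of_lt (lt_of_le_of_ne inf_le_left fun h => h5 (inf_eq_left.1 h))
    have h7 : A ≤ W ⊓ C := le_inf h1 hAC
    have h8 := finrank_mono h7
    have h9 := (eq_of_le_of_finrank_eq h7 (by omega)).symm
    refine ⟨h9, eq_of_le_of_finrank_eq (sup_le h2 hCB) ?_⟩
    rw [h9] at hdim
    omega

/-- The complements of a line `C` of `B / A` are the hyperplanes which do not contain it. -/
theorem sum_compl_of_line (hAC : A ≤ C) (hCB : C ≤ B) (h : finrank F C = finrank F A + 1)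
    {ψ ψ' : Submodule F V → ℚ} (hψ : ∀ W, C ≤ W → W ≤ B → ψ W = ψ' W) :
    ∑ W ∈ toFs {W : Submodule F V | A ≤ W ∧ W ≤ B ∧ finrank F W + 1 = finrank F B}, ψ W -
      ∑ W ∈ toFs {W : Submodule F V | C ≤ W ∧ W ≤ B ∧ finrank F W + 1 = finrank F B}, ψ' W =
    ∑ W ∈ toFs {W : Submodule F V | W ⊓ C = A ∧ W ⊔ C = B}, ψ W := by
  refine sum_toFs_sub (fun W hW => ⟨hAC.trans hW.1, hW.2⟩) (fun W => ?_)
    fun W hW => hψ W hW.1 hW.2.1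
  have hdim := finrank_sup_add_finrank_inf_eq W C
  constructor
  · rintro ⟨h1, h2⟩
    rw [h1, h2] at hdim
    refine ⟨⟨h1 ▸ inf_le_left, h2 ▸ le_sup_left, by omega⟩, ?_⟩
    rintro ⟨h3, -, -⟩
    rw [inf_eq_right.2 h3] at h1
    rw [h1] at h
    omega
  · rintro ⟨⟨h1, h2, h3⟩, h4⟩
    have h5 : ¬ C ≤ W := fun h5 => h4 ⟨h5, h2, h3⟩
    have h6 : finrank F ↥(W ⊓ C) < finrank F C :=
      finrank_lt_finrank_of_lt (lt_of_le_of_ne inf_le_right fun h => h5 (inf_eq_right.1 h))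
    have h7 : A ≤ W ⊓ C := le_inf h1 hAC
    have h8 := finrank_mono h7
    have h9 := (eq_of_le_of_finrank_eq h7 (by omega)).symm
    refine ⟨h9, eq_of_le_of_finrank_eq (sup_le h2 hCB) ?_⟩
    rw [h9] at hdim
    omega

end Complements

section Reductions

variable {N n : ℕ}

/-- The operator defined by a word maps stable families to stable families. -/
def PreservesStable (n N : ℕ) (c : ℕ → Col) : Prop :=
  ∀ φ : Fam N n, Stable (wordShift c) φ →
    Stable (n := n) (N := n) (fun i j => (min i j : ℕ)) (wordOp c φ)

theorem PreservesStable.of_wordOp_eq {M : ℕ} {c c' : ℕ → Col} (h : PreservesStable n M c')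
    (ψ : Fam N n → Fam M n) (hψ : ∀ φ, Stable (wordShift c) φ → Stable (wordShift c') (ψ φ))
    (heq : ∀ (φ : Fam N n) (p : ℕ) (F V : Type) [Field F] [Finite F] [AddCommGroup V] [Module F V]
      [Finite V] (f f' : PartialFlag n F V) (ω : V),
      wordOp c φ p F V f f' ω = wordOp c' (ψ φ) p F V f f' ω) : PreservesStable n N c := by
  intro φ hφ r Z
  obtain ⟨p₀, s, hs, h1⟩ := h (ψ φ) (hψ φ hφ) r Z
  refine ⟨p₀, s, hs, fun p hp F V _ _ _ _ _ g f ω ht => ?_⟩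
  rw [heq]
  exact h1 p hp F V g f ω ht

/-- An empty column of bounded size may be dropped. -/
theorem preservesStable_of_remove {c c' : ℕ → Col} {k : ℕ} (hk : k ≤ N)
    (hlow : ∀ l, l < k → c l = c' l) (hhigh : ∀ l, k ≤ l → c (l + 1) = c' l)
    (hd : (c k).size = 0) (hb : (c k).big = false)
    (hm : (c k).mark = true → ∀ l, l < k → (c l).label ≤ (c k).label → (c l).mark = true)
    (h : PreservesStable n N c') : PreservesStable n (N + 1) c := by
  refine h.of_wordOp_eq (repeatStep k hk).pull (fun φ hφ => ?_)
    (wordOp_remove hk hlow hhigh (fun p => by simp [Col.dim, hd, hb]) hm)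
  refine Reindex.stable_pull _ hφ fun l j hl hj => ?_
  have hu : (repeatStep k hk).u l = if l ≤ k then l else l - 1 := rfl
  have hg : ∀ j, (c k).growth j = 0 := fun j => by simp [Col.growth, hb]
  rw [hu]
  split_ifs with h1
  · rw [min_eq_left (by omega)]
    exact wordShift_congr (fun l' hl' => hlow l' (by omega)) j
  · obtain ⟨l, rfl⟩ : ∃ l', l = l' + 1 := ⟨l - 1, by omega⟩
    rw [min_eq_left (by omega), Nat.add_sub_cancel]
    rcases eq_or_lt_of_le (Nat.lt_succ_iff.1 (not_le.1 h1)) with h2 | h2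
    · subst h2
      rw [wordShift_succ, hg, add_zero]
      exact wordShift_congr hlow j
    · refine wordShift_merge hlow (fun l hl => hhigh l hl.le) (fun j => ?_) h2 j
      rw [hg, zero_add, hhigh k le_rfl]

/-- The number of lines between two subspaces. -/
theorem card_lines {F V : Type} [Field F] [Finite F] [AddCommGroup V] [Module F V] [Finite V]
    {A B : Submodule F V} (hAB : A ≤ B) {a : ℕ} (h : finrank F B = finrank F A + a) :
    ((Nat.card F : ℚ) - 1) *
      ((toFs {W : Submodule F V | A ≤ W ∧ W ≤ B ∧ finrank F W = finrank F A + 1}).card : ℚ) =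
      (Nat.card F : ℚ) ^ a - 1 := by
  have h1 := Insertion.sum_lines hAB fun _ => 1
  simp only [sum_const, nsmul_eq_mul, mul_one] at h1
  have h2 : ((toFs {x : V | x ∈ B ∧ x ∉ A}).card : ℚ) =
      (Nat.card F : ℚ) ^ finrank F B - (Nat.card F : ℚ) ^ finrank F A := by
    have h3 := Set.ncard_sdiff_add_ncard_of_subset (s := (A : Set V)) (t := (B : Set V)) hAB
    rw [ncard_submodule, ncard_submodule] at h3
    rw [card_toFs, eq_sub_iff_add_eq]
    exact_mod_cast h3
  rw [h2, h, zpow_natCast, pow_add] at h1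
  have h4 : (Nat.card F : ℚ) ^ finrank F A ≠ 0 := pow_ne_zero _ (natCard_cast_ne_zero F)
  apply mul_left_cancel₀ h4
  linear_combination h1

/-- A column of size `a` may be split into columns of sizes `1` and `a - 1`: this averages over the
`(q ^ a - 1) / (q - 1)` lines in the quotient. -/
theorem preservesStable_of_split {c c' : ℕ → Col} {k : ℕ} (hk : k < N)
    (hlow : ∀ l, l < k → c l = c' l) (hhigh : ∀ l, k < l → c (l + 1) = c' l)
    {a : ℕ} (ha : 1 ≤ a) (hk1 : c k = ⟨(c' k).label, 1, false, (c' k).mark⟩)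
    (hk2 : c (k + 1) = ⟨(c' k).label, a - 1, false, (c' k).mark⟩)
    (hs : (c' k).size = a) (hb : (c' k).big = false)
    (h : PreservesStable n (N + 1) c) : PreservesStable n N c' := by
  refine h.of_wordOp_eq (fun φ p F V _ _ _ _ _ g f ω =>
    (((Nat.card F : ℚ) - 1) * ((Nat.card F : ℚ) ^ a - 1)⁻¹) * (dropStep k hk).pull φ p F V g f ω)
    (fun φ hφ => ?_) ?_
  · refine Stable.mul_fun (c := fun _ q => ((q : ℚ) - 1) * ((q : ℚ) ^ a - 1)⁻¹)
      (Reindex.stable_pull _ hφ fun l j hl hj => ?_) ?_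
    · have hu : (dropStep k hk).u l = if l ≤ k then l else l + 1 := rfl
      rw [hu]
      split_ifs with h1
      · rw [min_eq_left (by omega)]
        exact (wordShift_congr (fun l' hl' => hlow l' (by omega)) j).symm
      · rw [min_eq_left (by omega)]
        refine (wordShift_merge hlow hhigh (fun j => ?_) (by omega) j).symm
        simp [Col.growth, hk1, hk2, hb]
    · refine stableFun_mul stableFun_q_sub_one ?_
      have := stableFun_inv_poly (Polynomial.X ^ a - 1) fun q hq => by
        have h2 : (2 : ℚ) ≤ q := by exact_mod_cast hq
        simp only [Polynomial.eval_sub, Polynomial.eval_pow, Polynomial.eval_X, Polynomial.eval_one]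
        have : (1 : ℚ) < (q : ℚ) ^ a := one_lt_pow₀ (by linarith) (by omega)
        linarith
      simpa using this
  · intro φ p F V _ _ _ _ _ f f' ω
    symm
    refine wordOp_merge hk hlow hhigh (by rw [hk1]) (by rw [hk2]) (by rw [hk1]) (by rw [hk2])
      (fun p => by rw [hk1, hk2]; simp [Col.dim, hs, hb]) _ _ ?_ p F V f f' ω
    intro p F V _ _ _ _ _ f g f' ω hg
    obtain ⟨h1, h2⟩ := hg k hk
    have h3 : finrank F (g.seq (k + 1)) = finrank F (g.seq k) + a := by
      simp only [Col.dim, hs, hb] at h2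
      grind
    have hset : {W : Submodule F V | g.seq k ≤ W ∧ W ≤ g.seq (k + 1) ∧
        (finrank F W : ℤ) = finrank F (g.seq k) + (c k).dim p} =
        {W : Submodule F V | g.seq k ≤ W ∧ W ≤ g.seq (k + 1) ∧
          finrank F W = finrank F (g.seq k) + 1} := by
      ext W
      simp only [Set.mem_ofPred_eq, hk1, Col.dim]
      simp only [Bool.false_eq_true, if_false, add_zero]
      norm_cast
    have hcard := card_lines h1.le h3
    have hbd : ∀ W, (dropStep k hk).map ((gapInsertion k hk).build g W) = g := by
      intro W
      apply PartialFlag.ext_seq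
      intro l
      rw [Reindex.seq_map]
      have hu : (dropStep k hk).u l = if l ≤ k then l else l + 1 := rfl
      have hu' : ∀ l, (gapInsertion k hk).u l = if l ≤ k then l else l - 1 := fun _ => rfl
      have hm' : (gapInsertion k hk).m = k + 1 := rfl
      rw [hu, Insertion.seq_build_of_ne _ _ _ (by rw [hm']; split_ifs <;> omega), hu']
      split_ifs <;> first | rfl | omega
    have hq : (Nat.card F : ℚ) ^ a - 1 ≠ 0 := by
      have h5 := two_le_natCard F
      have h6 : (2 : ℚ) ≤ Nat.card F := by exact_mod_cast h5
      have : (1 : ℚ) < (Nat.card F : ℚ) ^ a := one_lt_pow₀ (by linarith) (by omega)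
      linarith
    rw [hset]
    simp only [Reindex.pull, hbd]
    rw [sum_const, nsmul_eq_mul]
    grind

theorem wordShift_gap {c c' : ℕ → Col} {k : ℕ} (hk : k < N) (hlow : ∀ l, l < k → c l = c' l)
    (hhigh : ∀ l, k < l → c (l + 1) = c' l)
    (hg : ∀ j, (c k).growth j + (c (k + 1)).growth j = (c' k).growth j) (l j : ℕ)
    (hl : l ≤ N + 1) (hlm : l ≠ (gapInsertion k hk).m) :
    wordShift c l j = wordShift c' (min ((gapInsertion k hk).u l) N) j := by
  change l ≠ k + 1 at hlm
  have hu : (gapInsertion k hk).u l = if l ≤ k then l else l - 1 := rfl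
  rw [hu]
  split_ifs with h1
  · rw [min_eq_left (by omega)]
    exact wordShift_congr (fun l' hl' => hlow l' (by omega)) j
  · rw [min_eq_left (by omega)]
    obtain ⟨l, rfl⟩ : ∃ l', l = l' + 1 := ⟨l - 1, by omega⟩
    exact wordShift_merge hlow hhigh hg (by omega) j

/-- A column of size one preceding a big column with its label may be absorbed, at the cost of a sum
over lines. -/
theorem preservesStable_of_merge_line {c c' : ℕ → Col} {k : ℕ} (hk : k < N)
    (hlow : ∀ l, l < k → c l = c' l) (hhigh : ∀ l, k < l → c (l + 1) = c' l) {a : ℤ}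
    (hk1 : c k = ⟨(c' k).label, 1, false, (c' k).mark⟩)
    (hk2 : c (k + 1) = ⟨(c' k).label, a, true, (c' k).mark⟩)
    (hs : (c' k).size = a + 1) (hb : (c' k).big = true)
    (h : PreservesStable n N c') : PreservesStable n (N + 1) c := by
  refine h.of_wordOp_eq (gapInsertion k hk).lineSum (fun φ hφ => ?_) ?_
  · refine Insertion.stable_lineSum _ hφ (fun j hj => ?_) fun l j hl hlm _ =>
      wordShift_gap hk hlow hhigh (fun j => by simp [Col.growth, hk1, hk2, hb]) l j hl hlm
    change wordShift c (k + 1) j = wordShift c' k j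
    rw [wordShift_succ, wordShift_congr hlow]
    simp [Col.growth, hk1]
  · intro φ p F V _ _ _ _ _ f f' ω
    refine wordOp_merge hk hlow hhigh (by rw [hk1]) (by rw [hk2]) (by rw [hk1]) (by rw [hk2])
      (fun p => ?_) _ _ ?_ p F V f f' ω
    · rw [hk1, hk2]
      simp only [Col.dim, hs, hb, Bool.false_eq_true, if_false, if_true]
      ring
    · intro p F V _ _ _ _ _ f g f' ω hg
      have hset : {W : Submodule F V | g.seq k ≤ W ∧ W ≤ g.seq (k + 1) ∧
          (finrank F W : ℤ) = finrank F (g.seq k) + (c k).dim p} =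
          {W : Submodule F V | g.seq k ≤ W ∧ W ≤ g.seq (k + 1) ∧
            finrank F W = finrank F (g.seq k) + 1} := by
        ext W
        simp only [Set.mem_ofPred_eq, hk1, Col.dim]
        simp only [Bool.false_eq_true, if_false, add_zero]
        norm_cast
      rw [hset]
      rfl

/-- The dual of `preservesStable_of_merge_line`, with a sum over hyperplanes. -/
theorem preservesStable_of_merge_hyperplane {c c' : ℕ → Col} {k : ℕ} (hk : k < N)
    (hlow : ∀ l, l < k → c l = c' l) (hhigh : ∀ l, k < l → c (l + 1) = c' l) {a : ℤ}
    (hk1 : c k = ⟨(c' k).label, a, true, (c' k).mark⟩)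
    (hk2 : c (k + 1) = ⟨(c' k).label, 1, false, (c' k).mark⟩)
    (hs : (c' k).size = a + 1) (hb : (c' k).big = true)
    (h : PreservesStable n N c') : PreservesStable n (N + 1) c := by
  refine h.of_wordOp_eq (gapInsertion k hk).hypSum (fun φ hφ => ?_) ?_
  · refine Insertion.stable_hypSum _ hφ (fun j hj => ?_) fun l j hl hlm _ =>
      wordShift_gap hk hlow hhigh (fun j => by simp [Col.growth, hk1, hk2, hb]) l j hl hlm
    change wordShift c (k + 1) j = wordShift c' (k + 1) j
    rw [wordShift_succ, wordShift_succ, wordShift_congr hlow]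
    simp [Col.growth, hk1, hb]
  · intro φ p F V _ _ _ _ _ f f' ω
    have hd : ∀ p, (c k).dim p + 1 = (c' k).dim p := by
      intro p
      rw [hk1]
      simp only [Col.dim, hs, hb, if_true]
      ring
    refine wordOp_merge hk hlow hhigh (by rw [hk1]) (by rw [hk2]) (by rw [hk1]) (by rw [hk2])
      (fun p => ?_) _ _ ?_ p F V f f' ω
    · rw [← hd p, hk2]
      simp [Col.dim]
    · intro p F V _ _ _ _ _ f g f' ω hg
      obtain ⟨-, h2⟩ := hg k hk
      have hset : {W : Submodule F V | g.seq k ≤ W ∧ W ≤ g.seq (k + 1) ∧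
          (finrank F W : ℤ) = finrank F (g.seq k) + (c k).dim p} =
          {W : Submodule F V | g.seq k ≤ W ∧ W ≤ g.seq (k + 1) ∧
            finrank F W + 1 = finrank F (g.seq (k + 1))} := by grind
      rw [hset]
      rfl

theorem Insertion.build_eq {M : ℕ} (I I' : Insertion M N) (hm : I.m = I'.m)
    (hu : ∀ l, I.u l = I'.u l) {F V : Type} [Field F] [AddCommGroup V] [Module F V]
    {g : PartialFlag M F V} {W : Submodule F V} (h1 : g.seq I.lo ≤ W) (h2 : W ≤ g.seq I.hi)
    (h3 : g.seq I'.lo ≤ W) (h4 : W ≤ g.seq I'.hi) : I.build g W = I'.build g W := by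
  refine PartialFlag.ext_seq fun l => ?_
  by_cases hl : l = I.m
  · rw [hl, I.seq_build_self g h1 h2, hm, I'.seq_build_self g h3 h4]
  · rw [I.seq_build_of_ne g W hl, I'.seq_build_of_ne g W (hm ▸ hl), hu]

/-- Neighbouring columns, one of which has size one, may be interchanged: this sums over the
complements of one step in the next but one. -/
theorem preservesStable_of_swap {c c' : ℕ → Col} {k : ℕ} (hk : k + 1 < N) (h0 : c' k = c (k + 1))
    (h1 : c' (k + 1) = c k) (hne : ∀ l, l ≠ k → l ≠ k + 1 → c' l = c l)
    (hlabel : (c (k + 1)).label < (c k).label) (hmark : (c k).mark = false)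
    (hu : ((c k).size = 1 ∧ (c k).big = false) ∨
      ((c (k + 1)).size = 1 ∧ (c (k + 1)).big = false))
    (h : PreservesStable n N c') : PreservesStable n N c := by
  have hlow : ∀ l, l < k → c l = c' l := fun l hl => (hne l (by omega) (by omega)).symm
  rcases hu with ⟨hs, hb⟩ | ⟨hs, hb⟩
  · set I : Insertion N N := stepInsertion k k (k + 2) hk le_rfl (by omega) (by omega) (by omega)
      le_rfl with hI
    set I' : Insertion N N := stepInsertion k k (k + 1) hk le_rfl (by omega) (by omega) (by omega)
      (by omega) with hI'
    have hβ1 : ∀ j, wordShift c (k + 1) j = wordShift c' k j := by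
      intro j
      rw [wordShift_succ, wordShift_congr hlow]
      simp [Col.growth, hb]
    have hβ2 : ∀ l j, l ≤ N → l ≠ k + 1 → wordShift c l j = wordShift c' (min l N) j := by
      intro l j hl hlk
      rw [min_eq_left hl]
      exact wordShift_swap h0 h1 hne hlk j
    refine h.of_wordOp_eq (fun φ p F V _ _ _ _ _ g f ω =>
      I.lineSum φ p F V g f ω - I'.lineSum φ p F V g f ω) (fun φ hφ => Stable.sub ?_ ?_)
      fun φ => wordOp_swap hk h0 h1 hne hlabel hmark φ _ ?_
    · exact Insertion.stable_lineSum I hφ (fun j _ => hβ1 j) fun l j hl hlm _ => hβ2 l j hl hlm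
    · exact Insertion.stable_lineSum I' hφ (fun j _ => hβ1 j) fun l j hl hlm _ => hβ2 l j hl hlm
    · intro p F V _ _ _ _ _ f g f' ω hg
      obtain ⟨h2, -⟩ := hg k (by omega)
      obtain ⟨h3, h3'⟩ := hg (k + 1) hk
      have h4 : finrank F (g.seq (k + 2)) = finrank F (g.seq (k + 1)) + 1 := by
        rw [h1] at h3'
        simp only [Col.dim, hs, hb, Bool.false_eq_true, if_false, add_zero] at h3'
        exact_mod_cast h3'
      refine sum_compl_of_hyperplane h2.le h3.le h4 fun W hW1 hW2 => ?_
      rw [I.build_eq I' rfl (fun _ => rfl) hW1 (hW2.trans h3.le) hW1 hW2]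
  · set I : Insertion N N := stepInsertion k k (k + 2) hk le_rfl (by omega) (by omega) (by omega)
      le_rfl with hI
    set I' : Insertion N N := stepInsertion k (k + 1) (k + 2) hk (by omega) (by omega) (by omega)
      (by omega) (by omega) with hI'
    have hβ2 : ∀ l j, l ≤ N → l ≠ k + 1 → wordShift c l j = wordShift c' (min l N) j := by
      intro l j hl hlk
      rw [min_eq_left hl]
      exact wordShift_swap h0 h1 hne hlk j
    have hβ1 : ∀ j, wordShift c (k + 1) j = wordShift c' (k + 2) j := by
      intro j
      rw [← wordShift_swap h0 h1 hne (by omega : k + 2 ≠ k + 1), wordShift_succ c (k + 1)]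
      simp [Col.growth, hb]
    refine h.of_wordOp_eq (fun φ p F V _ _ _ _ _ g f ω =>
      I.hypSum φ p F V g f ω - I'.hypSum φ p F V g f ω) (fun φ hφ => Stable.sub ?_ ?_)
      fun φ => wordOp_swap hk h0 h1 hne hlabel hmark φ _ ?_
    · exact Insertion.stable_hypSum I hφ (fun j _ => hβ1 j) fun l j hl hlm _ => hβ2 l j hl hlm
    · exact Insertion.stable_hypSum I' hφ (fun j _ => hβ1 j) fun l j hl hlm _ => hβ2 l j hl hlm
    · intro p F V _ _ _ _ _ f g f' ω hg
      obtain ⟨h2, h2'⟩ := hg k (by omega)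
      obtain ⟨h3, -⟩ := hg (k + 1) hk
      have h4 : finrank F (g.seq (k + 1)) = finrank F (g.seq k) + 1 := by
        rw [h0] at h2'
        simp only [Col.dim, hs, hb, Bool.false_eq_true, if_false, add_zero] at h2'
        exact_mod_cast h2'
      refine sum_compl_of_line h2.le h3.le h4 fun W hW1 hW2 => ?_
      rw [I.build_eq I' rfl (fun _ => rfl) (h2.le.trans hW1) hW2 hW1 hW2]

/-- If exactly the first `t` columns are marked, the marks amount to a sum over translations. -/
theorem preservesStable_of_unmark {c c' : ℕ → Col} {t : ℕ} (ht : t ≤ N)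
    (hmark : ∀ k, k < N → ((c k).mark = true ↔ k < t))
    (hlabel : ∀ k, (c k).label = (c' k).label) (hs : ∀ k, (c k).size = (c' k).size)
    (hb : ∀ k, (c k).big = (c' k).big) (hmark' : ∀ k, k < N → (c' k).mark = false)
    (h : PreservesStable n N c') : PreservesStable n N c := by
  refine h.of_wordOp_eq (transl t) (fun φ hφ => ?_)
    (wordOp_unmark ht hmark hlabel (fun k p => by simp [Col.dim, hs, hb]) hmark')
  refine stable_transl ht (hφ.congr fun i j _ _ => ?_)
  unfold wordShift Col.growth
  exact sum_congr rfl fun l _ => by rw [hlabel, hb]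

/-- A word with one large column for every step preserves stability. -/
theorem preservesStable_of_label_eq {c : ℕ → Col} (hlabel : ∀ k, k < n → (c k).label = k)
    (hmark : ∀ k, k < n → (c k).mark = false) (hb : ∀ k, k < n → (c k).big = true) :
    PreservesStable n n c := by
  classical
  intro φ hφ
  have hshift : ∀ i j, i ≤ n → j ≤ n → wordShift c i j = ((min i j : ℕ) : ℤ) := by
    intro i j hi hj
    have h1 : wordShift c i j = ∑ l ∈ range i, if l < j then 1 else 0 := by
      refine sum_congr rfl fun l hl => ?_
      have := Finset.mem_range.1 hl
      unfold Col.growth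
      rw [hlabel l (by omega), hb l (by omega)]
      simp
    rw [h1, Finset.sum_boole]
    congr 1
    rw [show (range i).filter (· < j) = range (min i j) by ext x; simp, Finset.card_range]
  have hφ' := hφ.congr hshift
  intro r Z
  obtain ⟨p₀, s, hs, h1⟩ := hφ' r Z
  refine ⟨p₀, if ∀ k, k < n → r (k + 1) n = r k n + (c k).size then s else fun _ _ => 0,
    stableFun_ite hs stableFun_zero, fun p hp F V _ _ _ _ _ f f' ω ht => ?_⟩
  rw [wordOp_of_label_eq hlabel hmark]
  have hcond : (∀ k, k < n → (finrank F (f.seq (k + 1)) : ℤ) =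
      finrank F (f.seq k) + (c k).dim p) ↔ ∀ k, k < n → r (k + 1) n = r k n + (c k).size := by
    refine forall₂_congr fun k hk => ?_
    rw [← meetDim_top_right f f' _ le_rfl, ← meetDim_top_right f f' _ le_rfl,
      ht.dim _ _ (by omega) le_rfl, ht.dim _ _ (by omega) le_rfl, Col.dim, hb k hk]
    dsimp only
    rw [min_eq_left (by omega : k + 1 ≤ n), min_eq_left (by omega : k ≤ n)]
    grind
  simp only [hcond]
  split_ifs
  · exact h1 p hp F V f f' ω ht
  · rfl

end Reductions

section SortingWords

variable {N n : ℕ}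

/-- The conditions on a word under which its operator preserves stability. -/
structure ValidWord (n N : ℕ) (c : ℕ → Col) : Prop where
  label_lt : ∀ k, k < N → (c k).label < n
  size_nonneg : ∀ k, k < N → (c k).big = false → 0 ≤ (c k).size
  big_lt : ∀ k l, k < l → l < N → (c k).big = true → (c l).big = true →
    (c k).label < (c l).label
  exists_big : ∀ i, i < n → ∃ k, k < N ∧ (c k).big = true ∧ (c k).label = i
  mark_lt : ∀ k l, k < l → l < N → (c k).mark = false → (c l).mark = true →
    (c l).label < (c k).label

theorem sum_range_merge {h h' : ℕ → ℕ} {k : ℕ} (hlow : ∀ l, l < k → h l = h' l)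
    (hhigh : ∀ l, k < l → h (l + 1) = h' l) {M : ℕ} (hM : k < M) :
    ∑ l ∈ range (M + 1), h l + h' k =
      ∑ l ∈ range M, h' l + h k + h (k + 1) := by
  induction M, hM using Nat.le_induction with
  | base =>
    rw [sum_range_succ, sum_range_succ, sum_range_succ,
      sum_congr rfl fun l hl => hlow l (Finset.mem_range.1 hl)]
    ring
  | succ M hM ih =>
    rw [sum_range_succ, sum_range_succ h', hhigh M hM]
    omega

theorem sum_range_remove {h h' : ℕ → ℕ} {k : ℕ} (hlow : ∀ l, l < k → h l = h' l)
    (hhigh : ∀ l, k ≤ l → h (l + 1) = h' l) {M : ℕ} (hM : k ≤ M) :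
    ∑ l ∈ range (M + 1), h l = ∑ l ∈ range M, h' l + h k := by
  induction M, hM using Nat.le_induction with
  | base =>
    rw [sum_range_succ, sum_congr rfl fun l hl => hlow l (Finset.mem_range.1 hl)]
  | succ M hM ih =>
    rw [sum_range_succ, sum_range_succ h', hhigh M hM]
    omega

theorem sum_range_swap {h h' : ℕ → ℕ} {k : ℕ} (hne : ∀ l, l ≠ k → l ≠ k + 1 → h' l = h l) {M : ℕ}
    (hM : k + 1 < M) :
    ∑ l ∈ range M, h' l + (h k + h (k + 1)) =
      ∑ l ∈ range M, h l + (h' k + h' (k + 1)) := by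
  have key : ∀ f : ℕ → ℕ, ∑ l ∈ range M, f l =
      f k + (f (k + 1) + ∑ l ∈ ((range M).erase k).erase (k + 1), f l) := by
    intro f
    rw [Finset.add_sum_erase _ _ (by simp; omega), Finset.add_sum_erase _ _ (by simp; omega)]
  have hs : ∑ l ∈ ((range M).erase k).erase (k + 1), h' l =
      ∑ l ∈ ((range M).erase k).erase (k + 1), h l := by
    refine sum_congr rfl fun l hl => ?_
    simp only [Finset.mem_erase] at hl
    exact hne l hl.2.1 hl.1
  rw [key h, key h', hs]
  ring

/-- The contribution of a column to the measure by which words are reduced. -/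
def Col.cost (c : Col) : ℕ := if c.big then 0 else max 1 (3 * c.size.toNat - 1)

/-- The number of marked columns, as a sum. -/
def Col.markNum (c : Col) : ℕ := if c.mark then 1 else 0

/-- The measure by which words are reduced. -/
def wordKey (N : ℕ) (c : ℕ → Col) : ℕ ×ₗ ℕ ×ₗ ℕ :=
  toLex (∑ k ∈ range N, (c k).cost, toLex (∑ k ∈ range N, (c k).markNum,
    ∑ k ∈ range N, (N - k) * (c k).label))

theorem wordKey_lt_of_cost {M : ℕ} {c c' : ℕ → Col} (h : ∑ k ∈ range M, (c' k).cost <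
    ∑ k ∈ range N, (c k).cost) : wordKey M c' < wordKey N c :=
  Prod.Lex.toLex_lt_toLex.2 (Or.inl h)

/-- Omission of a column. -/
def removeCol (c : ℕ → Col) (k l : ℕ) : Col := if l < k then c l else c (l + 1)

/-- Splitting off a column of dimension one. -/
def splitCol (c : ℕ → Col) (k l : ℕ) : Col :=
  if l < k then c l else if l = k then ⟨(c k).label, 1, false, (c k).mark⟩
  else if l = k + 1 then ⟨(c k).label, (c k).size - 1, false, (c k).mark⟩ else c (l - 1)

/-- Merging two columns. -/
def mergeCol (c : ℕ → Col) (k l : ℕ) : Col :=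
  if l < k then c l else if l = k then
    ⟨(c k).label, (c k).size + (c (k + 1)).size, true, (c k).mark⟩ else c (l + 1)

/-- Interchanging two columns. -/
def swapCol (c : ℕ → Col) (k l : ℕ) : Col :=
  if l = k then c (k + 1) else if l = k + 1 then c k else c l

/-- Forgetting the marks. -/
def unmarkCol (c : ℕ → Col) (l : ℕ) : Col := ⟨(c l).label, (c l).size, (c l).big, false⟩

theorem ValidWord.remove {c : ℕ → Col} (h : ValidWord n (N + 1) c) {k : ℕ} (hk : k ≤ N)
    (hb : (c k).big = false) : ValidWord n N (removeCol c k) := by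
  have hr : ∀ l, removeCol c k l = c (if l < k then l else l + 1) := by
    intro l
    unfold removeCol
    split_ifs <;> rfl
  constructor
  · intro l hl
    rw [hr]
    exact h.label_lt _ (by split_ifs <;> omega)
  · intro l hl
    rw [hr]
    exact h.size_nonneg _ (by split_ifs <;> omega)
  · intro l m hlm hm
    rw [hr, hr]
    exact h.big_lt _ _ (by split_ifs <;> omega) (by split_ifs <;> omega)
  · intro i hi
    obtain ⟨m, hm, hm', hm''⟩ := h.exists_big i hi
    have hmk : m ≠ k := fun hmk => by
      rw [hmk, hb] at hm'
      exact absurd hm' (by simp)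
    refine ⟨if m < k then m else m - 1, by split_ifs <;> omega, ?_⟩
    grind
  · intro l m hlm hm
    rw [hr, hr]
    exact h.mark_lt _ _ (by split_ifs <;> omega) (by split_ifs <;> omega)

theorem ValidWord.split {c : ℕ → Col} (h : ValidWord n N c) {k : ℕ} (hk : k < N)
    (hb : (c k).big = false) (hs : 1 ≤ (c k).size) : ValidWord n (N + 1) (splitCol c k) := by
  have hu : ∀ l, (splitCol c k l).label = (c (if l ≤ k then l else l - 1)).label ∧
      (splitCol c k l).big = (c (if l ≤ k then l else l - 1)).big ∧
      (splitCol c k l).mark = (c (if l ≤ k then l else l - 1)).mark := by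
    intro l
    unfold splitCol
    grind
  have hsz : ∀ l, l < N + 1 → (splitCol c k l).big = false → 0 ≤ (splitCol c k l).size := by
    intro l hl
    unfold splitCol
    split_ifs with h1 h2 h3
    · exact h.size_nonneg l (by omega)
    · intro _
      simp
    · intro _
      simp only
      omega
    · exact h.size_nonneg (l - 1) (by omega)
  refine ⟨?_, hsz, ?_, ?_, ?_⟩
  · intro l hl
    rw [(hu l).1]
    exact h.label_lt _ (by split_ifs <;> omega)
  · intro l m hlm hm
    rw [(hu l).1, (hu l).2.1, (hu m).1, (hu m).2.1]
    intro h1 h2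
    by_cases h3 : l = k ∧ m = k + 1
    · grind
    · exact h.big_lt _ _ (by split_ifs <;> omega) (by split_ifs <;> omega) h1 h2
  · intro i hi
    obtain ⟨m, hm, hm', hm''⟩ := h.exists_big i hi
    refine ⟨if m ≤ k then m else m + 1, by split_ifs <;> omega, ?_⟩
    grind
  · intro l m hlm hm
    rw [(hu l).1, (hu l).2.2, (hu m).1, (hu m).2.2]
    intro h1 h2
    by_cases h3 : l = k ∧ m = k + 1
    · grind
    · exact h.mark_lt _ _ (by split_ifs <;> omega) (by split_ifs <;> omega) h1 h2

theorem ValidWord.merge {c : ℕ → Col} (h : ValidWord n (N + 1) c) {k : ℕ} (hk : k < N)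
    (hl : (c (k + 1)).label = (c k).label) (hb : (c (k + 1)).big ≠ (c k).big)
    (hm : ∀ l, l < N + 1 → (c l).mark = false) : ValidWord n N (mergeCol c k) := by
  -- the large one of the two columns
  obtain ⟨u, hu, hub⟩ : ∃ u, (u = k ∨ u = k + 1) ∧ (c u).big = true := by grind
  have hlu : (c u).label = (c k).label := by
    rcases hu with rfl | rfl
    · rfl
    · exact hl
  have hv : ∀ l, (mergeCol c k l).label =
      (c (if l < k then l else if l = k then u else l + 1)).label ∧
      (mergeCol c k l).big = (c (if l < k then l else if l = k then u else l + 1)).big := by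
    intro l
    unfold mergeCol
    grind
  have hmm : ∀ l, l < N → (mergeCol c k l).mark = false := by
    intro l hlN
    unfold mergeCol
    grind
  refine ⟨?_, ?_, ?_, ?_, ?_⟩
  · intro l hl
    rw [(hv l).1]
    exact h.label_lt _ (by split_ifs <;> omega)
  · intro l hl
    unfold mergeCol
    split_ifs with h1 h2
    · exact h.size_nonneg l (by omega)
    · intro h3
      exact absurd h3 (by simp)
    · exact h.size_nonneg (l + 1) (by omega)
  · intro l m hlm hm
    rw [(hv l).1, (hv l).2, (hv m).1, (hv m).2]
    exact h.big_lt _ _ (by split_ifs <;> omega) (by split_ifs <;> omega)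
  · intro i hi
    obtain ⟨m, hm, hm', hm''⟩ := h.exists_big i hi
    by_cases hmk : m = k ∨ m = k + 1
    · grind
    · refine ⟨if m < k then m else m - 1, by split_ifs <;> omega, ?_⟩
      grind
  · grind

theorem ValidWord.swap {c : ℕ → Col} (h : ValidWord n N c) {k : ℕ} (hk : k + 1 < N)
    (hl : (c (k + 1)).label < (c k).label) (hm : (c k).mark = false) :
    ValidWord n N (swapCol c k) := by
  have hv : ∀ l, swapCol c k l = c (if l = k then k + 1 else if l = k + 1 then k else l) := by
    intro l
    unfold swapCol
    split_ifs <;> rfl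
  refine ⟨?_, ?_, ?_, ?_, ?_⟩
  · intro l hl
    rw [hv]
    exact h.label_lt _ (by split_ifs <;> omega)
  · intro l hl
    rw [hv]
    exact h.size_nonneg _ (by split_ifs <;> omega)
  · intro l m hlm hm
    rw [hv, hv]
    intro h1 h2
    by_cases h3 : l = k ∧ m = k + 1
    · grind
    · exact h.big_lt _ _ (by split_ifs <;> omega) (by split_ifs <;> omega) h1 h2
  · intro i hi
    obtain ⟨m, hm, hm'⟩ := h.exists_big i hi
    refine ⟨if m = k then k + 1 else if m = k + 1 then k else m, by split_ifs <;> omega, ?_⟩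
    grind
  · intro l m hlm hmN
    rw [hv, hv]
    intro h1 h2
    by_cases h3 : l = k ∧ m = k + 1
    · grind
    · exact h.mark_lt _ _ (by split_ifs <;> omega) (by split_ifs <;> omega) h1 h2

theorem ValidWord.unmark {c : ℕ → Col} (h : ValidWord n N c) : ValidWord n N (unmarkCol c) :=
  ⟨h.label_lt, h.size_nonneg, h.big_lt, h.exists_big, fun _ _ _ _ _ h2 => by
    exact absurd h2 (by simp [unmarkCol])⟩

/-- A valid word without marks, with increasing labels, in which no two neighbouring columns can be
merged, has exactly one column for every label. -/
theorem ValidWord.eq_of_sorted {c : ℕ → Col} (h : ValidWord n N c)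
    (hl : ∀ k, k + 1 < N → (c k).label ≤ (c (k + 1)).label)
    (hm : ∀ k, k + 1 < N → (c (k + 1)).label = (c k).label → (c (k + 1)).big = (c k).big) :
    N = n ∧ ∀ k, k < n → (c k).label = k ∧ (c k).big = true := by
  have hmono : ∀ k l, k ≤ l → l < N → (c k).label ≤ (c l).label := by
    intro k l hkl
    induction l, hkl using Nat.le_induction with
    | base => intro _; exact le_rfl
    | succ l hkl ih => intro hlN; exact (ih (by omega)).trans (hl l hlN)
  have hprop : ∀ k l, k ≤ l → l < N → (c k).label = (c l).label → (c k).big = (c l).big := by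
    intro k l hkl
    induction l, hkl using Nat.le_induction with
    | base => intro _ _; rfl
    | succ l hkl ih =>
      intro hlN heq
      have h1 := hmono k l hkl (by omega)
      have h2 := hl l hlN
      rw [ih (by omega) (by omega), hm l hlN (by omega)]
  have hbig : ∀ k, k < N → (c k).big = true := by
    intro k hk
    obtain ⟨m, hmN, hmb, hml⟩ := h.exists_big _ (h.label_lt k hk)
    grind
  have hstrict : ∀ k l, k < l → l < N → (c k).label < (c l).label := fun k l hkl hlN =>
    h.big_lt k l hkl hlN (hbig k (by omega)) (hbig l hlN)
  have hge : ∀ k, k < N → k ≤ (c k).label := by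
    intro k
    induction k with
    | zero => intro _; omega
    | succ k ih =>
      intro hk
      have := hstrict k (k + 1) (by omega) hk
      have := ih (by omega)
      omega
  have hle : ∀ i, i < n → i < N ∧ (c i).label = i := by
    intro i
    induction i using Nat.strong_induction_on with
    | _ i ih =>
      intro hi
      obtain ⟨m, hmN, -, hml⟩ := h.exists_big i hi
      have h1 := hge m hmN
      rcases eq_or_lt_of_le (hml ▸ h1 : m ≤ i) with h2 | h2
      · subst h2
        exact ⟨hmN, hml⟩
      · have := (ih m h2 (by omega)).2
        omega
  have hNn : N ≤ n := by
    by_contra hcon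
    have h1 := hge n (by omega)
    have h2 := h.label_lt n (by omega)
    omega
  grind

/-- The operator defined by a valid word preserves stability: the word is reduced to the trivial one
by splitting, interchanging and merging columns. -/
theorem ValidWord.preservesStable {c : ℕ → Col} (h : ValidWord n N c) :
    PreservesStable n N c := by
  obtain ⟨x, hx⟩ : ∃ x, x = wordKey N c := ⟨_, rfl⟩
  induction x using WellFoundedLT.induction generalizing N c with
  | _ x ih =>
  subst hx
  have ih' : ∀ {M : ℕ} {c' : ℕ → Col}, ValidWord n M c' → wordKey M c' < wordKey N c →
      PreservesStable n M c' := fun hv hlt => ih _ hlt hv rfl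
  by_cases h0 : ∃ k, k < N ∧ (c k).big = false ∧ (c k).size = 0
  · obtain ⟨k, hk, hb, hs⟩ := h0
    obtain ⟨M, rfl⟩ : ∃ M, N = M + 1 := ⟨N - 1, by omega⟩
    have hlow : ∀ l, l < k → c l = removeCol c k l := fun l hl => by rw [removeCol, if_pos hl]
    have hhigh : ∀ l, k ≤ l → c (l + 1) = removeCol c k l := fun l hl => by
      rw [removeCol, if_neg (by omega)]
    refine preservesStable_of_remove (Nat.lt_succ_iff.1 hk) hlow hhigh hs hb (fun hm l hl hle => ?_)
      (ih' (h.remove (Nat.lt_succ_iff.1 hk) hb) (wordKey_lt_of_cost ?_))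
    · by_contra hcon
      have := h.mark_lt l k hl hk (by simpa using hcon) hm
      omega
    · have := sum_range_remove (h := fun l => (c l).cost) (h' := fun l => (removeCol c k l).cost)
        (fun l hl => by rw [hlow l hl]) (fun l hl => by rw [hhigh l hl]) (Nat.lt_succ_iff.1 hk)
      have h1 : (c k).cost = 1 := by simp [Col.cost, hb, hs]
      omega
  by_cases h2 : ∃ k, k < N ∧ (c k).big = false ∧ 2 ≤ (c k).size
  · obtain ⟨k, hk, hb, hs⟩ := h2
    obtain ⟨a, ha⟩ : ∃ a : ℕ, (c k).size = a := ⟨(c k).size.toNat, by omega⟩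
    have hk1 : splitCol c k k = ⟨(c k).label, 1, false, (c k).mark⟩ := by
      rw [splitCol, if_neg (lt_irrefl _), if_pos rfl]
    have hk2 : splitCol c k (k + 1) = ⟨(c k).label, a - 1, false, (c k).mark⟩ := by
      rw [splitCol, if_neg (by omega), if_neg (by omega), if_pos rfl, ha]
    have hlow : ∀ l, l < k → splitCol c k l = c l := fun l hl => by rw [splitCol, if_pos hl]
    have hhigh : ∀ l, k < l → splitCol c k (l + 1) = c l := fun l hl => by
      rw [splitCol, if_neg (by omega), if_neg (by omega), if_neg (by omega)]
      rfl
    refine preservesStable_of_split hk hlow hhigh (by omega : 1 ≤ a) hk1 hk2 ha hb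
      (ih' (h.split hk hb (by omega)) (wordKey_lt_of_cost ?_))
    have h3 := sum_range_merge (h := fun l => (splitCol c k l).cost) (h' := fun l => (c l).cost)
        (fun l hl => by rw [hlow l hl]) (fun l hl => by rw [hhigh l hl]) hk
    have h4 : (c k).cost = max 1 (3 * a - 1) := by simp [Col.cost, hb, ha]
    have h5 : (splitCol c k k).cost = 2 := by rw [hk1]; simp [Col.cost]
    have h6 : (splitCol c k (k + 1)).cost = max 1 (3 * (a - 1) - 1) := by
      rw [hk2]
      simp [Col.cost]
    rw [h4, h5, h6] at h3
    omega
  have hunit : ∀ k, k < N → (c k).big = false → (c k).size = 1 := by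
    intro k hk hb
    have h3 := h.size_nonneg k hk hb
    grind
  by_cases h3 : ∃ k, k + 1 < N ∧ (c (k + 1)).label < (c k).label ∧ (c k).mark = false
  · obtain ⟨k, hk, hl, hm⟩ := h3
    have e0 : swapCol c k k = c (k + 1) := by rw [swapCol, if_pos rfl]
    have e1 : swapCol c k (k + 1) = c k := by rw [swapCol, if_neg (by omega), if_pos rfl]
    have hne : ∀ l, l ≠ k → l ≠ k + 1 → swapCol c k l = c l := fun l h1 h2 => by
      rw [swapCol, if_neg h1, if_neg h2]
    refine preservesStable_of_swap hk e0 e1 hne hl hm ?_ (ih' (h.swap hk hl hm) ?_)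
    · rcases hb : (c k).big with _ | _
      · exact Or.inl ⟨hunit k (by omega) hb, rfl⟩
      · rcases hb' : (c (k + 1)).big with _ | _
        · exact Or.inr ⟨hunit _ hk hb', rfl⟩
        · have := h.big_lt k (k + 1) (by omega) hk hb hb'
          omega
    · refine Prod.Lex.toLex_lt_toLex.2 (Or.inr ⟨?_, Prod.Lex.toLex_lt_toLex.2 (Or.inr ⟨?_, ?_⟩)⟩)
      · have := sum_range_swap (h := fun l => (c l).cost) (h' := fun l => (swapCol c k l).cost)
          (fun l h1 h2 => by rw [hne l h1 h2]) hk
        simp only [e0, e1] at this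
        simp only
        omega
      · have := sum_range_swap (h := fun l => (c l).markNum)
          (h' := fun l => (swapCol c k l).markNum) (fun l h1 h2 => by rw [hne l h1 h2]) hk
        simp only [e0, e1] at this
        simp only
        omega
      · have := sum_range_swap (h := fun l => (N - l) * (c l).label)
          (h' := fun l => (N - l) * (swapCol c k l).label)
          (fun l h1 h2 => by rw [hne l h1 h2]) hk
        simp only [e0, e1] at this
        simp only
        obtain ⟨d, hd⟩ : ∃ d, N - k = d + 1 := ⟨N - k - 1, by omega⟩
        rw [hd, show N - (k + 1) = d by omega] at this
        nlinarith
  by_cases h4 : ∃ k, k < N ∧ (c k).mark = true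
  · have hinit : ∀ k l, k ≤ l → l < N → (c l).mark = true → (c k).mark = true := by
      intro k l hkl hlN hl
      rcases eq_or_lt_of_le hkl with rfl | hkl'
      · exact hl
      · by_contra hcon
        have hcon' : (c k).mark = false := by simpa using hcon
        -- there is a last unmarked column before a marked one
        have hprop : ∀ m, k ≤ m → m ≤ l → (c m).mark = false := by
          intro m hkm
          induction m, hkm using Nat.le_induction with
          | base => intro _; exact hcon'
          | succ m hkm ihm =>
            intro hml
            have hm := ihm (by omega)
            by_contra hcon2
            have hcon3 : (c (m + 1)).mark = true := by simpa using hcon2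
            exact h3 ⟨m, by omega, h.mark_lt m (m + 1) (by omega) (by omega) hm hcon3, hm⟩
        rw [hprop l hkl le_rfl] at hl
        exact absurd hl (by simp)
    obtain ⟨t, ht, htm⟩ : ∃ t, t ≤ N ∧ ∀ k, k < N → ((c k).mark = true ↔ k < t) := by
      classical
      by_cases h5 : ∃ k, k < N ∧ (c k).mark = false
      · refine ⟨Nat.find h5, (Nat.find_spec h5).1.le, fun k hk => ?_⟩
        constructor
        · grind
        · intro hkt
          by_contra hcon
          exact Nat.find_min h5 hkt ⟨hk, by simpa using hcon⟩
      · refine ⟨N, le_rfl, fun k hk => ⟨fun _ => hk, fun _ => ?_⟩⟩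
        by_contra hcon
        exact h5 ⟨k, hk, by simpa using hcon⟩
    refine preservesStable_of_unmark ht htm (c' := unmarkCol c) (fun _ => rfl) (fun _ => rfl)
      (fun _ => rfl) (fun _ _ => rfl) (ih' h.unmark ?_)
    refine Prod.Lex.toLex_lt_toLex.2 (Or.inr ⟨rfl, Prod.Lex.toLex_lt_toLex.2 (Or.inl ?_)⟩)
    obtain ⟨k, hk, hkm⟩ := h4
    have h5 : ∑ k ∈ range N, (unmarkCol c k).markNum = 0 :=
      sum_eq_zero fun l _ => by simp [Col.markNum, unmarkCol]
    simp only
    rw [h5]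
    refine Finset.sum_pos' (fun l _ => Nat.zero_le _) ⟨k, Finset.mem_range.2 hk, ?_⟩
    simp [Col.markNum, hkm]
  have hmark : ∀ k, k < N → (c k).mark = false := by grind
  by_cases h5 : ∃ k, k + 1 < N ∧ (c (k + 1)).label = (c k).label ∧ (c (k + 1)).big ≠ (c k).big
  · obtain ⟨k, hk, hl, hb⟩ := h5
    obtain ⟨M, rfl⟩ : ∃ M, N = M + 1 := ⟨N - 1, by omega⟩
    have hkM : k < M := by omega
    have hkk : mergeCol c k k =
        ⟨(c k).label, (c k).size + (c (k + 1)).size, true, (c k).mark⟩ := by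
      rw [mergeCol, if_neg (lt_irrefl _), if_pos rfl]
    have hlow : ∀ l, l < k → c l = mergeCol c k l := fun l hl => by rw [mergeCol, if_pos hl]
    have hhigh : ∀ l, k < l → c (l + 1) = mergeCol c k l := fun l hl => by
      rw [mergeCol, if_neg (by omega), if_neg (by omega)]
    have hv := h.merge hkM hl hb hmark
    have hP : PreservesStable n M (mergeCol c k) := by
      refine ih' hv (wordKey_lt_of_cost ?_)
      have h6 := sum_range_merge (h := fun l => (c l).cost) (h' := fun l => (mergeCol c k l).cost)
        (fun l hl => by rw [hlow l hl]) (fun l hl => by rw [hhigh l hl]) hkM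
      have h7 : (mergeCol c k k).cost = 0 := by rw [hkk]; simp [Col.cost]
      have h8 : 0 < (c k).cost + (c (k + 1)).cost := by
        unfold Col.cost
        rcases h9 : (c k).big with _ | _
        · simp
        · grind
      omega
    have hmk := hmark k (by omega)
    have hmk' := hmark (k + 1) hk
    rcases hbk : (c k).big with _ | _
    · have hbk' : (c (k + 1)).big = true := by
        rw [hbk] at hb
        simpa using hb
      have hsk := hunit k (by omega) hbk
      refine preservesStable_of_merge_line hkM hlow hhigh (a := (c (k + 1)).size) ?_ ?_ ?_ ?_ hP
      · rw [hkk, ← hsk, ← hbk]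
      · rw [hkk, ← hbk', ← hl, hmk, ← hmk']
      · rw [hkk, hsk, add_comm]
      · rw [hkk]
    · have hbk' : (c (k + 1)).big = false := by
        rw [hbk] at hb
        simpa using hb
      have hsk := hunit (k + 1) hk hbk'
      refine preservesStable_of_merge_hyperplane hkM hlow hhigh (a := (c k).size) ?_ ?_ ?_ ?_ hP
      · rw [hkk, ← hbk]
      · rw [hkk, ← hbk', ← hl, hmk, ← hmk', ← hsk]
      · rw [hkk, hsk]
      · rw [hkk]
  obtain ⟨hNn, hc⟩ := h.eq_of_sorted (fun k hk => by grind)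
    (fun k hk hl => by
      by_contra hcon
      exact h5 ⟨k, hk, hl, hcon⟩)
  subst hNn
  exact preservesStable_of_label_eq (fun k hk => (hc k hk).1) hmark fun k hk => (hc k hk).2

end SortingWords

section MatrixWords

variable {n : ℕ} [NeZero n]

open Classical in
/-- The word attached to a decorated matrix and a set `I` of positions: its columns are the entries
of the matrix, ordered by columns, and those at the positions in `I` are marked. -/
def matrixWord (A : DecMat n) (I : Finset (ℕ × ℕ)) (k : ℕ) : Col where
  label := k % n
  size := A.mat (Fin.ofNat n (k % n)) (Fin.ofNat n (k / n))
  big := decide (k % n = k / n)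
  mark := decide ((k % n, k / n) ∈ I)

theorem div_add_lt {i j : ℕ} (hi : i < n) : (j * n + i) / n = j := by
  rw [add_comm, Nat.add_mul_div_right _ _ (NeZero.pos n), Nat.div_eq_of_lt hi, zero_add]

theorem mod_add_lt {i j : ℕ} (hi : i < n) : (j * n + i) % n = i := by
  rw [add_comm, Nat.add_mul_mod_self_right, Nat.mod_eq_of_lt hi]

theorem cell_lt {i j : ℕ} (hi : i < n) (hj : j < n) : j * n + i < n * n := by
  have : (j + 1) * n ≤ n * n := Nat.mul_le_mul_right _ hj
  rw [add_mul, one_mul] at this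
  omega

theorem exists_cell {k : ℕ} (hk : k < n * n) : ∃ i j, i < n ∧ j < n ∧ k = j * n + i :=
  ⟨k % n, k / n, Nat.mod_lt _ (NeZero.pos n), Nat.div_lt_of_lt_mul hk, (Nat.div_add_mod' k n).symm⟩

/-- The set of positions is closed under passing to smaller positions. -/
def IsLower (I : Finset (ℕ × ℕ)) : Prop := ∀ a b a' b', a' ≤ a → b' ≤ b → (a, b) ∈ I → (a', b') ∈ I

theorem validWord_matrixWord (A : DecMat n) {I : Finset (ℕ × ℕ)} (hI : IsLower I) :
    ValidWord n (n * n) (matrixWord A I) := by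
  have hn := NeZero.pos n
  constructor
  · intro k _
    exact Nat.mod_lt _ hn
  · intro k hk hb
    obtain ⟨i, j, hi, hj, rfl⟩ := exists_cell hk
    simp only [matrixWord, div_add_lt hi, mod_add_lt hi, decide_eq_false_iff_not] at hb ⊢
    apply A.nonneg
    intro h
    have := congrArg Fin.val h
    simp only [Fin.val_ofNat, Nat.mod_eq_of_lt hi, Nat.mod_eq_of_lt hj] at this
    exact hb this
  · intro k l hkl hl h1 h2
    simp only [matrixWord, decide_eq_true_eq] at h1 h2 ⊢
    rw [h1, h2]
    have h3 : k / n ≤ l / n := Nat.div_le_div_right hkl.le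
    rcases eq_or_lt_of_le h3 with h4 | h4
    · have h5 := Nat.div_add_mod k n
      have h6 := Nat.div_add_mod l n
      rw [h1, h4] at h5
      rw [h2] at h6
      omega
    · exact h4
  · intro i hi
    refine ⟨i * n + i, cell_lt hi hi, ?_, ?_⟩
    · simp only [matrixWord, div_add_lt hi, mod_add_lt hi, decide_true]
    · simp only [matrixWord, mod_add_lt hi]
  · intro k l hkl hl h1 h2
    simp only [matrixWord, decide_eq_true_eq, decide_eq_false_iff_not] at h1 h2 ⊢
    by_contra hcon
    exact h1 (hI _ _ _ _ (not_lt.1 hcon) (Nat.div_le_div_right hkl.le) h2)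

theorem wordShift_matrixWord (A : DecMat n) (I : Finset (ℕ × ℕ)) {j : ℕ} (hj : j ≤ n) (x : ℕ) :
    wordShift (matrixWord A I) (j * n) x = (min j x : ℕ) := by
  induction j with
  | zero => simp [wordShift]
  | succ j ih =>
    have h1 := ih (by omega)
    unfold wordShift at h1 ⊢
    rw [add_mul, one_mul, Finset.sum_range_add, h1]
    have h2 : ∀ i ∈ range n, (matrixWord A I (j * n + i)).growth x =
        if i = j then (if j < x then 1 else 0) else 0 := by
      intro i hi
      have hi' := Finset.mem_range.1 hi
      simp only [Col.growth, matrixWord, div_add_lt hi', mod_add_lt hi', decide_eq_true_eq]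
      split_ifs with h3 h4 h4 h5 h5 <;> omega
    rw [sum_congr rfl h2, Finset.sum_ite_eq' (range n) j, if_pos (by simp; omega)]
    split_ifs <;> omega

/-- The columns of an `n`-step flag refined to `n ^ 2` steps. -/
def columnSteps (n : ℕ) : Reindex (n * n) n where
  u j := j * n
  mono := fun _ _ h => Nat.mul_le_mul_right _ h
  zero := by simp
  top := le_rfl

section Refinement

variable {F V : Type} [Field F] [AddCommGroup V] [Module F V]

/-- The refinement of the flag `h` by the flag `f`. -/
def refineFlag (f h : PartialFlag n F V) : PartialFlag (n * n) F V :=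
  PartialFlag.ofSeq (fun k => h.seq (k / n) ⊔ (f.seq (k % n) ⊓ h.seq (k / n + 1)))
    (by
      refine monotone_nat_of_le_succ fun k => ?_
      have hn := NeZero.pos n
      by_cases hk : k % n + 1 < n
      · have h1 : k + 1 = k / n * n + (k % n + 1) := by
          have := Nat.div_add_mod' k n
          omega
        have h2 : (k + 1) / n = k / n := by rw [h1, div_add_lt hk]
        have h3 : (k + 1) % n = k % n + 1 := by
          conv_lhs => rw [h1]
          rw [mod_add_lt hk]
        rw [h2, h3]
        exact sup_le_sup_left (inf_le_inf_right _ (f.seq_mono (Nat.le_succ _))) _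
      · have h4 := Nat.mod_lt k hn
        have h1 : k + 1 = (k / n + 1) * n + 0 := by
          have := Nat.div_add_mod' k n
          rw [add_mul, one_mul]
          omega
        have h2 : (k + 1) / n = k / n + 1 := by rw [h1, div_add_lt hn]
        rw [h2]
        refine le_trans ?_ le_sup_left
        exact sup_le (h.seq_mono (Nat.le_succ _)) inf_le_right)
    (by rw [Nat.zero_div, Nat.zero_mod, h.seq_zero, f.seq_zero, bot_inf_eq, sup_bot_eq])
    (by rw [Nat.mul_div_cancel _ (NeZero.pos n), h.seq_of_le le_rfl, top_sup_eq])

theorem seq_refineFlag (f h : PartialFlag n F V) {i j : ℕ} (hi : i ≤ n) :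
    (refineFlag f h).seq (j * n + i) = h.seq j ⊔ (f.seq i ⊓ h.seq (j + 1)) := by
  have hs : ∀ k, (refineFlag f h).seq k = h.seq (k / n) ⊔ (f.seq (k % n) ⊓ h.seq (k / n + 1)) :=
    fun k => PartialFlag.seq_ofSeq _ _ _ _ _
  rw [hs]
  rcases eq_or_lt_of_le hi with rfl | hi'
  · have h1 : j * i + i = (j + 1) * i + 0 := by ring
    rw [h1, div_add_lt (NeZero.pos i), mod_add_lt (NeZero.pos i), f.seq_zero, bot_inf_eq,
      sup_bot_eq, f.seq_of_le le_rfl, top_inf_eq, sup_eq_right.2 (h.seq_mono (Nat.le_succ j))]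
  · rw [div_add_lt hi', mod_add_lt hi']

theorem seq_of_isLabelled_matrixWord {A : DecMat n} {I : Finset (ℕ × ℕ)} {p : ℕ}
    {f : PartialFlag n F V} {g : PartialFlag (n * n) F V}
    (hg : IsLabelled (matrixWord A I) p f g) {i j : ℕ} (hi : i ≤ n) (hj : j < n) :
    g.seq (j * n + i) = g.seq (j * n) ⊔ (f.seq i ⊓ g.seq ((j + 1) * n)) := by
  have hpure : ∀ m, m < n → IsPure f m (g.seq (j * n + m)) (g.seq (j * n + m + 1)) := by
    intro m hm
    have := (hg (j * n + m) (cell_lt hm hj)).1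
    simpa only [matrixWord, mod_add_lt hm] using this
  have hle : ∀ m, m ≤ n → g.seq (j * n + m) ≤ g.seq (j * n) ⊔ f.seq m := by
    intro m
    induction m with
    | zero => intro _; exact le_sup_left
    | succ m ih =>
      intro hm
      refine (hpure m (by omega)).le_sup.trans (sup_le ((ih (by omega)).trans ?_) le_sup_right)
      exact sup_le_sup_left (f.seq_mono (Nat.le_succ m)) _
  have hge : ∀ m, m ≤ n → i ≤ n - m → f.seq i ⊓ g.seq ((j + 1) * n) ≤ g.seq (j * n + (n - m)) := by
    intro m
    induction m with
    | zero =>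
      intro _ _
      rw [Nat.sub_zero, add_mul, one_mul]
      exact inf_le_right
    | succ m ih =>
      intro hm him
      have h1 := (hpure (n - (m + 1)) (by omega)).inf_le
      refine le_trans (le_inf ?_ ?_) h1
      · grind
      · exact inf_le_left.trans (f.seq_mono him)
  apply le_antisymm
  · have h1 : g.seq (j * n + i) ≤ g.seq ((j + 1) * n) := g.seq_mono (by
      rw [add_mul, one_mul]; omega)
    rw [← sup_inf_assoc_of_le _ (g.seq_mono (by rw [add_mul]; omega) :
      g.seq (j * n) ≤ g.seq ((j + 1) * n))]
    exact le_inf (hle i hi) h1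
  · refine sup_le (g.seq_mono (Nat.le_add_right _ _)) ?_
    have := hge (n - i) (by omega) (by omega)
    rwa [show n - (n - i) = i by omega] at this

/-- The two flags have the relative position given by the matrix of `A`, shifted by `p`. -/
def HasBlocks (A : DecMat n) (p : ℕ) (f h : PartialFlag n F V) : Prop :=
  ∀ i j : Fin n, blockSize (meetDim f h) i j = (A.shift p).mat i j

theorem dim_matrixWord (A : DecMat n) (I : Finset (ℕ × ℕ)) (p : ℕ) (i j : Fin n) :
    (matrixWord A I ((j : ℕ) * n + i)).dim p = (A.shift p).mat i j := by
  rw [DecMat.shift_mat]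
  simp only [Col.dim, matrixWord, div_add_lt i.2, mod_add_lt i.2, decide_eq_true_eq, Fin.ext_iff]
  rw [Fin.ofNat_val_eq_self, Fin.ofNat_val_eq_self]

theorem finrank_refine_step [FiniteDimensional F V] (f h : PartialFlag n F V) (i j : ℕ) :
    (finrank F ↥(h.seq j ⊔ (f.seq (i + 1) ⊓ h.seq (j + 1))) : ℤ) =
      finrank F ↥(h.seq j ⊔ (f.seq i ⊓ h.seq (j + 1))) + blockSize (meetDim f h) i j := by
  have key : ∀ i, (finrank F ↥(h.seq j ⊔ (f.seq i ⊓ h.seq (j + 1))) : ℤ) =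
      finrank F (h.seq j) + meetDim f h i (j + 1) - meetDim f h i j := by
    intro i
    have h1 := finrank_sup_add_finrank_inf_eq (h.seq j) (f.seq i ⊓ h.seq (j + 1))
    have h2 : h.seq j ⊓ (f.seq i ⊓ h.seq (j + 1)) = f.seq i ⊓ h.seq j := by
      rw [inf_left_comm, inf_eq_left.2 (h.seq_mono (Nat.le_succ j))]
    rw [h2] at h1
    unfold meetDim
    omega
  rw [key, key]
  unfold blockSize
  ring

theorem isLabelled_refineFlag [FiniteDimensional F V] {A : DecMat n} {I : Finset (ℕ × ℕ)} {p : ℕ}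
    {f h : PartialFlag n F V} (hh : HasBlocks A p f h) :
    IsLabelled (matrixWord A I) p f (refineFlag f h) := by
  intro k hk
  obtain ⟨i, j, hi, hj, rfl⟩ := exists_cell hk
  rw [add_assoc, seq_refineFlag f h hi.le, seq_refineFlag f h (by omega : i + 1 ≤ n)]
  constructor
  · simp only [matrixWord, mod_add_lt hi]
    refine ⟨sup_le_sup_left (inf_le_inf_right _ (f.seq_mono (Nat.le_succ _))) _, ?_, ?_⟩
    · rw [inf_comm]
      refine le_trans (inf_le_inf_left _ (sup_le (h.seq_mono (Nat.le_succ j)) inf_le_right)) ?_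
      exact le_sup_right
    · exact sup_le (le_sup_left.trans le_sup_left) (inf_le_left.trans le_sup_right)
  · rw [finrank_refine_step, hh ⟨i, hi⟩ ⟨j, hj⟩, dim_matrixWord A I p ⟨i, hi⟩ ⟨j, hj⟩]

theorem hasBlocks_of_isLabelled [FiniteDimensional F V] {A : DecMat n} {I : Finset (ℕ × ℕ)}
    {p : ℕ} {f : PartialFlag n F V} {g : PartialFlag (n * n) F V}
    (hg : IsLabelled (matrixWord A I) p f g) :
    HasBlocks A p f ((columnSteps n).map g) ∧ refineFlag f ((columnSteps n).map g) = g := by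
  have hs : ∀ j, ((columnSteps n).map g).seq j = g.seq (j * n) := fun j => Reindex.seq_map _ _ _
  have heq : ∀ i j, i ≤ n → j < n → (refineFlag f ((columnSteps n).map g)).seq (j * n + i) =
      g.seq (j * n + i) := by
    intro i j hi hj
    rw [seq_refineFlag _ _ hi, hs, hs, seq_of_isLabelled_matrixWord hg hi hj]
  constructor
  · intro i j
    have h1 := (hg ((j : ℕ) * n + i) (cell_lt i.2 j.2)).2
    rw [add_assoc, ← heq i j i.2.le j.2, ← heq (i + 1) j i.2 j.2, seq_refineFlag _ _ i.2.le,
      seq_refineFlag _ _ i.2, finrank_refine_step, dim_matrixWord] at h1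
    exact add_left_cancel h1
  · apply PartialFlag.ext_seq
    intro k
    rcases lt_or_ge k (n * n) with hk | hk
    · obtain ⟨i, j, hi, hj, rfl⟩ := exists_cell hk
      exact heq i j hi.le hj
    · rw [PartialFlag.seq_of_le _ hk, PartialFlag.seq_of_le _ hk]

open Classical in
/-- The positions `(a, b)` such that `μ` does not lie in the sum of the steps `f_a` and `h_b`. -/
def reach (f h : PartialFlag n F V) (μ : V) : Finset (ℕ × ℕ) :=
  (range n ×ˢ range n).filter fun y => μ ∉ f.seq y.1 ⊔ h.seq y.2

open Classical in
theorem mem_reach {f h : PartialFlag n F V} {μ : V} {a b : ℕ} :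
    (a, b) ∈ reach f h μ ↔ μ ∉ f.seq a ⊔ h.seq b := by
  unfold reach
  rw [mem_filter, Finset.mem_product, mem_range, mem_range]
  refine ⟨fun h => h.2, fun hab => ⟨⟨?_, ?_⟩, hab⟩⟩
  · by_contra hcon
    rw [f.seq_of_le (not_lt.1 hcon), top_sup_eq] at hab
    exact hab trivial
  · by_contra hcon
    rw [h.seq_of_le (not_lt.1 hcon), sup_top_eq] at hab
    exact hab trivial

theorem isLower_reach (f h : PartialFlag n F V) (μ : V) : IsLower (reach f h μ) := by
  intro a b a' b' ha hb hab
  rw [mem_reach] at hab ⊢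
  exact fun hcon => hab (sup_le_sup (f.seq_mono ha) (h.seq_mono hb) hcon)

theorem mem_markedSpan_refineFlag [FiniteDimensional F V] {A : DecMat n} {I : Finset (ℕ × ℕ)}
    (hI : IsLower I) (hIn : I ⊆ range n ×ˢ range n) (f h : PartialFlag n F V)
    (μ : V) : μ ∈ markedSpan (matrixWord A I) f (refineFlag f h) ↔ reach f h μ ⊆ I := by
  obtain ⟨a, b, hb, -⟩ := exists_isAdapted f h
  have h1 : markedSpan (matrixWord A I) f (refineFlag f h) =
      ⨆ y ∈ (I : Set (ℕ × ℕ)), f.seq (y.1 + 1) ⊓ h.seq (y.2 + 1) := by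
    have hinf : ∀ i j, i < n → f.seq (i + 1) ⊓ (refineFlag f h).seq (j * n + i + 1) =
        f.seq (i + 1) ⊓ h.seq (j + 1) := by
      intro i j hi
      rw [add_assoc, seq_refineFlag f h (by omega : i + 1 ≤ n)]
      apply le_antisymm
      · exact inf_le_inf_left _ (sup_le (h.seq_mono (Nat.le_succ _)) inf_le_right)
      · exact le_inf inf_le_left le_sup_right
    apply le_antisymm
    · refine markedSpan_le fun k hk hm => ?_
      obtain ⟨i, j, hi, hj, rfl⟩ := exists_cell hk
      simp only [matrixWord, div_add_lt hi, mod_add_lt hi, decide_eq_true_eq] at hm ⊢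
      rw [hinf i j hi]
      exact le_iSup₂ (f := fun (y : ℕ × ℕ) (_ : y ∈ (I : Set (ℕ × ℕ))) =>
        f.seq (y.1 + 1) ⊓ h.seq (y.2 + 1)) (i, j) hm
    · refine iSup₂_le fun y hy => ?_
      have hy' := Finset.mem_product.1 (hIn hy)
      have hi := Finset.mem_range.1 hy'.1
      have hj := Finset.mem_range.1 hy'.2
      rw [← hinf y.1 y.2 hi]
      have h2 := le_markedSpan (c := matrixWord A I) (f := f) (g := refineFlag f h)
        (k := y.2 * n + y.1) (cell_lt hi hj) (by
          simp only [matrixWord, div_add_lt hi, mod_add_lt hi, decide_eq_true_eq]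
          exact hy)
      simpa only [matrixWord, mod_add_lt hi] using h2
  rw [h1, hb.mem_iSup]
  constructor
  · intro hμ y hy
    have hy' : μ ∉ f.seq y.1 ⊔ h.seq y.2 := mem_reach.1 hy
    rw [hb.mem_sup] at hy'
    push Not at hy'
    obtain ⟨k, hk, hk1, hk2⟩ := hy'
    obtain ⟨z, hz, hz1, hz2⟩ := hμ k hk
    exact hI z.1 z.2 y.1 y.2 (hk1.trans hz1) (hk2.trans hz2) hz
  · intro hμ k hk
    refine ⟨((k.1.1 : ℕ), (k.1.2 : ℕ)), hμ ?_, le_rfl, le_rfl⟩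
    rw [mem_reach, hb.mem_sup]
    intro hcon
    rcases hcon k hk with h | h <;> exact lt_irrefl _ h

end Refinement

theorem Stable.of_eq {N n : ℕ} {β : ℕ → ℕ → ℤ} {φ ψ : Fam N n} (h : Stable β φ)
    (heq : ∀ (p : ℕ) (F V : Type) [Field F] [Finite F] [AddCommGroup V] [Module F V] [Finite V]
      (g : PartialFlag N F V) (f : PartialFlag n F V) (ω : V),
      ψ p F V g f ω = φ p F V g f ω) : Stable β ψ := by
  intro r Z
  obtain ⟨p₀, s, hs, h1⟩ := h r Z
  exact ⟨p₀, s, hs, fun p hp F V _ _ _ _ _ g f ω ht => (heq p F V g f ω).trans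
    (h1 p hp F V g f ω ht)⟩

theorem Stable.sum {N n : ℕ} {β : ℕ → ℕ → ℤ} {ι : Type*} (S : Finset ι) {φ : ι → Fam N n}
    (h : ∀ i ∈ S, Stable β (φ i)) :
    Stable β (fun p F V _ _ _ _ _ g f ω => ∑ i ∈ S, φ i p F V g f ω) := by
  intro r Z
  have h' : ∀ i : S, ∃ p₀ : ℕ, ∃ s ∈ stableFun, ∀ p, p₀ ≤ p →
    ∀ (F V : Type) [Field F] [Finite F] [AddCommGroup V] [Module F V] [Finite V]
      (g : PartialFlag N F V) (f : PartialFlag n F V) (ω : V),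
      HasType g f ω (fun i j => r i j + p * β i j) Z → φ i p F V g f ω = s p (Nat.card F) :=
    fun i => h i i.2 r Z
  choose p₀ s hs h1 using h'
  refine ⟨S.attach.sup p₀, fun p q => ∑ i ∈ S.attach, s i p q,
    stableFun_sum _ fun i _ => hs i, fun p hp F V _ _ _ _ _ g f ω ht => ?_⟩
  simp only
  rw [← Finset.sum_attach]
  exact sum_congr rfl fun i hi => h1 i p ((Finset.le_sup (f := p₀) hi).trans hp) F V g f ω ht

open Classical in
/-- The operator whose kernel is the characteristic function of the triples with relative position
given by the matrix of `A` and with reach `I`. -/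
def reachOp (A : DecMat n) (I : Finset (ℕ × ℕ)) (φ : Fam n n) : Fam n n :=
  fun p F V _ _ _ _ _ f f' ω =>
    ∑ h ∈ toFs {h : PartialFlag n F V | HasBlocks A p f h},
      ∑ μ ∈ toFs {μ : V | reach f h μ = I}, φ p F V h f' (ω - μ)

/-- The vectors of the marked span are those whose reach is contained in `I`. -/
theorem wordOp_matrixWord (A : DecMat n) {I : Finset (ℕ × ℕ)} (hI : IsLower I)
    (hIn : I ⊆ range n ×ˢ range n) (φ : Fam n n)
    (p : ℕ) (F V : Type) [Field F] [Finite F] [AddCommGroup V] [Module F V] [Finite V]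
    (f f' : PartialFlag n F V) (ω : V) :
    wordOp (matrixWord A I) ((columnSteps n).pull φ) p F V f f' ω =
      ∑ J ∈ I.powerset, reachOp A J φ p F V f f' ω := by
  classical
  unfold wordOp reachOp
  rw [sum_comm]
  symm
  have hs : ∀ (h : PartialFlag n F V), (columnSteps n).map (refineFlag f h) = h := by
    intro h
    apply PartialFlag.ext_seq
    intro j
    rw [Reindex.seq_map]
    change (refineFlag f h).seq (j * n) = _
    have := seq_refineFlag f h (i := 0) (j := j) (Nat.zero_le n)
    rw [add_zero] at this
    rw [this, f.seq_zero, bot_inf_eq, sup_bot_eq]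
  refine Finset.sum_bij' (fun h _ => refineFlag f h) (fun g _ => (columnSteps n).map g)
    ?_ ?_ ?_ ?_ ?_
  · intro h hh
    exact mem_toFs.2 (isLabelled_refineFlag (mem_toFs.1 hh))
  · intro g hg
    exact mem_toFs.2 (hasBlocks_of_isLabelled (mem_toFs.1 hg)).1
  · intro h _
    exact hs h
  · intro g hg
    exact (hasBlocks_of_isLabelled (mem_toFs.1 hg)).2
  · intro h hh
    rw [← Finset.sum_fiberwise_of_maps_to (t := I.powerset) (g := fun μ => reach f h μ)]
    · refine sum_congr rfl fun J hJ => ?_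
      have hset : toFs {μ : V | reach f h μ = J} =
          (toFs {μ : V | μ ∈ markedSpan (matrixWord A I) f (refineFlag f h)}).filter
            fun μ => reach f h μ = J := by
        ext μ
        simp only [mem_filter, mem_toFs, Set.mem_ofPred_eq]
        rw [mem_markedSpan_refineFlag hI hIn]
        grind
      rw [hset]
      refine sum_congr rfl fun μ _ => ?_
      unfold Reindex.pull
      rw [hs]
    · intro μ hμ
      exact Finset.mem_powerset.2 ((mem_markedSpan_refineFlag hI hIn f h μ).1 (mem_toFs.1 hμ))

/-- Inclusion and exclusion: the words give the sums over all `J ⊆ I`, so `I` is reached by induction. -/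
theorem stable_reachOp (A : DecMat n) (I : Finset (ℕ × ℕ))
    (hIn : I ⊆ range n ×ˢ range n) {φ : Fam n n}
    (hφ : Stable (fun i j => ((min i j : ℕ) : ℤ)) φ) :
    Stable (fun i j => ((min i j : ℕ) : ℤ)) (reachOp A I φ) := by
  classical
  induction I using Finset.strongInduction with
  | H I ih =>
    by_cases hI : IsLower I
    · have h1 : Stable (n := n) (N := n) (fun i j => ((min i j : ℕ) : ℤ))
          (wordOp (matrixWord A I) ((columnSteps n).pull φ)) := by
        refine (validWord_matrixWord A hI).preservesStable _ ?_
        refine Reindex.stable_pull _ hφ fun l j hl hj => ?_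
        have hu : (columnSteps n).u l = l * n := rfl
        rw [hu, min_eq_left (Nat.mul_le_mul_right _ hl), wordShift_matrixWord A I hl]
      have h2 := h1.sub (Stable.sum I.ssubsets fun J hJ =>
        ih J (Finset.mem_ssubsets.1 hJ) ((Finset.mem_ssubsets.1 hJ).subset.trans hIn))
      refine h2.of_eq fun p F V _ _ _ _ _ f f' ω => ?_
      rw [wordOp_matrixWord A hI hIn, Finset.ssubsets,
        ← Finset.add_sum_erase _ _ (Finset.mem_powerset_self I)]
      ring
    · have h1 : Stable (n := n) (N := n) (fun i j => ((min i j : ℕ) : ℤ))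
          (fun p F V _ _ _ _ _ g f ω => ∑ i ∈ (∅ : Finset ℕ), φ p F V g f ω) :=
        Stable.sum ∅ fun i hi => absurd hi (by simp)
      refine h1.of_eq fun p F V _ _ _ _ _ f f' ω => ?_
      rw [Finset.sum_empty]
      refine sum_eq_zero fun h _ => sum_eq_zero fun μ hμ => ?_
      rw [mem_toFs] at hμ
      have hμ' : reach f h μ = I := hμ
      exact absurd (hμ' ▸ isLower_reach f h μ) hI

end MatrixWords

/-! ### The stable structure constants -/

section Exponents

variable {n : ℕ}

namespace DecMat

theorem below_shift (p : ℕ) (M : DecMat n) (a b : ℕ) : (M.shift p).Below a b ↔ M.Below a b :=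
  Iff.rfl

theorem corner_shift (p : ℕ) (M : DecMat n) {i j : ℕ} (hi : i ≤ n) (hj : j ≤ n) :
    (M.shift p).corner i j = M.corner i j + p * (min i j : ℕ) := by
  have h1 : ((p * (min i j : ℕ) : ℕ) : ℤ) = ∑ x : Fin n × Fin n,
      if (x.1 : ℕ) < i ∧ (x.2 : ℕ) < j then (if x.1 = x.2 then (p : ℤ) else 0) else 0 := by
    rw [Fintype.sum_prod_type]
    have h2 : ∀ a : Fin n, (∑ b : Fin n, if (a : ℕ) < i ∧ (b : ℕ) < j then
        (if a = b then (p : ℤ) else 0) else 0) = if (a : ℕ) < min i j then (p : ℤ) else 0 := by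
      intro a
      rw [sum_eq_single a]
      · simp [lt_min_iff]
      · grind
      · simp
    simp only [h2]
    have h3 := Fin.sum_univ_eq_sum_range (fun a => if a < min i j then (p : ℤ) else 0) n
    rw [h3, ← sum_filter]
    have h4 : (range n).filter (· < min i j) = range (min i j) := by
      ext x
      simp only [mem_filter, mem_range]
      omega
    rw [h4, sum_const, Finset.card_range]
    push_cast
    simp only [nsmul_eq_mul]
    push_cast
    ring
  push_cast at h1
  push_cast
  rw [h1]
  unfold corner
  rw [← sum_add_distrib]
  refine sum_congr rfl fun x _ => ?_
  rw [shift_mat]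
  split_ifs <;> simp

theorem normExp_eq (M : DecMat n) : M.normExp =
    -((∑ i, ∑ j, ∑ k, ∑ l, if ¬ i < k ∧ j < l then M.mat i j * M.mat k l else 0) +
      ∑ i, ∑ j, if ∃ x ∈ M.dec, i ≤ x.1 ∧ j ≤ x.2 then M.mat i j else 0) := by
  have h : (∑ i, ∑ j, ∑ k, ∑ l, if ¬ i < k ∧ j < l then M.mat i j * M.mat k l else 0) =
      (∑ i, ∑ j, ∑ k, ∑ l, if i < k ∨ j < l then M.mat i j * M.mat k l else 0) -
      M.flagDim := by
    unfold flagDim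
    simp only [← sum_sub_distrib]
    refine sum_congr rfl fun i _ => sum_congr rfl fun j _ =>
      sum_congr rfl fun k _ => sum_congr rfl fun l _ => ?_
    by_cases h1 : i < k <;> by_cases h2 : j < l <;> simp [h1, h2]
  rw [h]
  unfold normExp orbitDim
  ring

/-- The normalizing exponent is an affine function of the shift. -/
theorem exists_normExp_shift (M : DecMat n) :
    ∃ e : ℤ, ∀ p : ℕ, (M.shift p).normExp = M.normExp + p * e := by
  refine ⟨-((∑ i, ∑ j, ∑ k, ∑ l, if ¬ i < k ∧ j < l then
    (if i = j then M.mat k l else 0) + (if k = l then M.mat i j else 0) else 0) +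
      ∑ i, ∑ j, if ∃ x ∈ M.dec, i ≤ x.1 ∧ j ≤ x.2 then (if i = j then 1 else 0) else 0),
    fun p => ?_⟩
  rw [normExp_eq, normExp_eq, mul_neg, ← neg_add, neg_inj, mul_add]
  rw [add_add_add_comm]
  congr 1
  · simp only [mul_sum, ← sum_add_distrib]
    refine sum_congr rfl fun i _ => sum_congr rfl fun j _ =>
      sum_congr rfl fun k _ => sum_congr rfl fun l _ => ?_
    rw [shift_mat, shift_mat]
    grind
  · simp only [mul_sum, ← sum_add_distrib]
    refine sum_congr rfl fun i _ => sum_congr rfl fun j _ => ?_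
    have h0 : (M.shift p).dec = M.dec := rfl
    rw [shift_mat, h0]
    split_ifs <;> simp

end DecMat

open Classical in
theorem charFun_eq {F V : Type} [Field F] [AddCommGroup V] [Module F V] (M : DecMat n)
    (t : PartialFlag n F V × PartialFlag n F V × V) :
    charFun M t = if t ∈ orbit M then 1 else 0 := by
  unfold charFun
  rw [Set.indicator_apply]
  rfl

end Exponents

section Existence

variable {n : ℕ} [NeZero n]

open Classical in
/-- The positions weakly below the decoration. -/
def lowerSet (A : DecMat n) : Finset (ℕ × ℕ) := (range n ×ˢ range n).filter fun y => A.Below y.1 y.2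

open Classical in
theorem mem_lowerSet {A : DecMat n} {a b : ℕ} : (a, b) ∈ lowerSet A ↔ A.Below a b := by
  unfold lowerSet
  rw [mem_filter, Finset.mem_product, mem_range, mem_range]
  refine ⟨fun h => h.2, fun h => ⟨?_, h⟩⟩
  obtain ⟨x, -, h1, h2⟩ := h
  exact ⟨lt_of_le_of_lt h1 x.1.2, lt_of_le_of_lt h2 x.2.2⟩

theorem hasPosition_iff_hasBlocks {A : DecMat n} {p : ℕ} {F V : Type} [Field F] [AddCommGroup V]
    [Module F V] [FiniteDimensional F V] {f h : PartialFlag n F V} {μ : V} :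
    HasPosition (A.shift p) (f, h, μ) ↔ HasBlocks A p f h ∧ reach f h μ = lowerSet A := by
  constructor
  · intro hp
    refine ⟨fun i j => hp.blockSize i j, ?_⟩
    ext ⟨a, b⟩
    rw [mem_reach, mem_lowerSet]
    exact hp.2 a b
  · rintro ⟨h1, h2⟩
    refine hasPosition_of_blockSize h1 fun a b => ?_
    rw [DecMat.below_shift, ← mem_lowerSet, ← h2, mem_reach]

/-- The characteristic functions of the orbits attached to the shifts of a decorated matrix. -/
def charFam (B : DecMat n) : Fam n n :=
  fun p _ _ _ _ _ _ _ g f ω => ((charFun (B.shift p) (g, f, ω) : ℤ) : ℚ)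

theorem stable_charFam (B : DecMat n) :
    Stable (fun i j => ((min i j : ℕ) : ℤ)) (charFam B) := by
  classical
  intro r Z
  obtain ⟨p₀, hp₀⟩ := B.exists_effective_shift
  refine ⟨p₀, fun _ _ => if (∀ i j, i ≤ n → j ≤ n → r i j = B.corner i j) ∧
    ∀ a b, a ≤ n → b ≤ n → (¬ Z a b ↔ B.Below a b) then 1 else 0, stableFun_const _, ?_⟩
  intro p hp F V _ _ _ _ _ g f ω ht
  unfold charFam
  rw [charFun_eq]
  have hiff : (g, f, ω) ∈ orbit (B.shift p) ↔
      (∀ i j, i ≤ n → j ≤ n → r i j = B.corner i j) ∧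
        ∀ a b, a ≤ n → b ≤ n → (¬ Z a b ↔ B.Below a b) := by
    rw [mem_orbit_iff (hp₀ p hp)]
    refine and_congr ?_ ?_
    · refine forall₄_congr fun i j hi hj => ?_
      rw [ht.dim i j hi hj, DecMat.corner_shift p B hi hj]
      simp only
      constructor <;> intro h <;> linarith
    · constructor
      · intro h a b ha hb
        rw [← DecMat.below_shift p, ← h a b]
        exact not_congr (ht.mem a b ha hb).symm
      · intro h a b
        by_cases hab : a ≤ n ∧ b ≤ n
        · rw [DecMat.below_shift, ← h a b hab.1 hab.2]
          exact not_congr (ht.mem a b hab.1 hab.2)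
        · constructor
          · intro hω
            exfalso
            apply hω
            simp only
            rcases not_and_or.1 hab with h1 | h1
            · rw [g.seq_of_le (by omega), top_sup_eq]
              trivial
            · rw [f.seq_of_le (by omega), sup_top_eq]
              trivial
          · rintro ⟨x, -, h1, h2⟩
            have := x.1.2
            have := x.2.2
            omega
  simp only [hiff]
  split_ifs <;> simp

/-- Convolution with the function of an orbit is the operator of its reach. -/
theorem reachOp_eq_conv (A : DecMat n) {p : ℕ} (hA : (A.shift p).Effective) (B : DecMat n)
    (F V : Type) [Field F] [Finite F] [AddCommGroup V] [Module F V] [Finite V]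
    (f f' : PartialFlag n F V) (ω : V) :
    ((conv (charFun (A.shift p)) (charFun (B.shift p)) (f, f', ω) : ℤ) : ℚ) =
      reachOp A (lowerSet A) (charFam B) p F V f f' ω := by
  classical
  have : Fintype (PartialFlag n F V) := Fintype.ofFinite _
  have : Fintype V := Fintype.ofFinite _
  have hU : ∀ {α : Type} [Fintype α] (S : Set α), toFs S = Finset.univ.filter (· ∈ S) := by
    intro α _ S
    ext x
    simp [mem_toFs]
  unfold conv reachOp
  rw [finsum_eq_sum_of_fintype, Fintype.sum_prod_type, hU, sum_filter]
  push_cast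
  refine sum_congr rfl fun h _ => ?_
  rw [hU, sum_filter]
  split_ifs with hh
  · refine sum_congr rfl fun μ _ => ?_
    rw [charFun_eq, mem_orbit_iff hA, hasPosition_iff_hasBlocks]
    have hh' : HasBlocks A p f h := hh
    by_cases hr : reach f h μ = lowerSet A
    · rw [if_pos ⟨hh', hr⟩, Int.cast_one, one_mul]
      exact (if_pos hr).symm
    · rw [if_neg fun h => hr h.2, Int.cast_zero, zero_mul]
      exact (if_neg hr).symm
  · refine sum_eq_zero fun μ _ => ?_
    rw [charFun_eq, mem_orbit_iff hA, hasPosition_iff_hasBlocks, if_neg fun h => hh h.1,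
      Int.cast_zero, zero_mul]

open Classical in
theorem exists_stable_conv (A B C : DecMat n) :
    ∃ p₀ : ℕ, ∃ s ∈ stableFun, ∀ p, p₀ ≤ p →
      ∀ (F V : Type) [Field F] [Finite F] [AddCommGroup V] [Module F V] [Finite V]
        (t : PartialFlag n F V × PartialFlag n F V × V), t ∈ orbit (C.shift p) →
        ((conv (charFun (A.shift p)) (charFun (B.shift p)) t : ℤ) : ℚ) = s p (Nat.card F) := by
  obtain ⟨p₁, h₁⟩ := A.exists_effective_shift
  obtain ⟨p₂, h₂⟩ := C.exists_effective_shift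
  obtain ⟨p₃, s, hs, h₃⟩ := stable_reachOp A (lowerSet A) (Finset.filter_subset _ _)
    (stable_charFam B) C.corner fun a b => ¬ C.Below a b
  refine ⟨max p₁ (max p₂ p₃), s, hs, fun p hp F V _ _ _ _ _ t ht => ?_⟩
  obtain ⟨f, f', ω⟩ := t
  have ht' := hasPosition_of_mem_orbit (h₂ p (by omega)) ht
  rw [reachOp_eq_conv A (h₁ p (by omega)) B]
  refine h₃ p (by omega) F V f f' ω ⟨fun i j hi hj => ?_, fun a b _ _ => ?_⟩
  · rw [ht'.1 i j hi hj, C.corner_shift p hi hj]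
  · have := ht'.2 a b
    rw [DecMat.below_shift] at this
    rw [← this, not_not]

/-- The values of a product on the orbits are represented by a Laurent polynomial, which is the
stable structure constant up to the normalization. -/
theorem exists_represents_conv (A B C : DecMat n) :
    ∃ (p₀ : ℕ) (s : ℕ → ℕ → ℚ) (G : Qv[T;T⁻¹]) (e : ℤ), Represents (v ^ 2) s G ∧
      (∀ p, p₀ ≤ p →
        ∀ (F V : Type) [Field F] [Finite F] [AddCommGroup V] [Module F V] [Finite V]
          (t : PartialFlag n F V × PartialFlag n F V × V), t ∈ orbit (C.shift p) →
          ((conv (charFun (A.shift p)) (charFun (B.shift p)) t : ℤ) : ℚ) = s p (Nat.card F)) ∧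
      (∀ p : ℕ, (A.shift p).normExp + (B.shift p).normExp - (C.shift p).normExp =
        A.normExp + B.normExp - C.normExp + p * e) ∧
      IsStableConst A B C (LaurentPolynomial.C (v ^ (A.normExp + B.normExp - C.normExp)) *
        LaurentPolynomial.T (-e) * G) := by
  obtain ⟨p₀, s, ⟨G, hG⟩, h₀⟩ := exists_stable_conv A B C
  obtain ⟨a, ha⟩ := A.exists_normExp_shift
  obtain ⟨b, hb⟩ := B.exists_normExp_shift
  obtain ⟨c, hc⟩ := C.exists_normExp_shift
  have he : ∀ p : ℕ, (A.shift p).normExp + (B.shift p).normExp - (C.shift p).normExp =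
      A.normExp + B.normExp - C.normExp + p * (a + b - c) := by
    intro p
    rw [ha, hb, hc]
    ring
  refine ⟨p₀, s, G, a + b - c, hG, h₀, he, p₀, fun p hp => ?_⟩
  obtain ⟨f, g, h1, h2⟩ := hG p
  obtain ⟨P, rfl⟩ := exists_eq_mul_of_integer_values f g {q | q.Prime} Nat.infinite_setOfPred_prime
    fun q hq => by
      have hq' : q.Prime := hq
      have : Fact q.Prime := ⟨hq'⟩
      obtain ⟨d, t, ht⟩ := orbit_nonempty (ZMod q) (C.shift p)
      refine ⟨(h1 q hq'.two_le).1, conv (charFun (A.shift p)) (charFun (B.shift p)) t, ?_⟩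
      rw [h₀ p hp _ _ t ht, Nat.card_zmod]
      exact (h1 q hq'.two_le).2
  have hg : Polynomial.aeval (v ^ 2) g ≠ 0 := by
    intro h
    have : g = 0 := (injective_iff_map_eq_zero _).1 aeval_v_sq_injective g h
    exact (h1 2 le_rfl).1 (by simp [this])
  refine ⟨P, fun F _ _ d t ht => ?_, ?_⟩
  · rw [h₀ p hp F _ t ht]
    obtain ⟨h3, h4⟩ := h1 _ (two_le_natCard F)
    rw [Polynomial.eval_mul] at h4
    exact mul_right_cancel₀ h3 h4
  · have h5 : evalAt p G = Polynomial.aeval (v ^ 2) P := by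
      rw [map_mul, mul_comm] at h2
      exact mul_right_cancel₀ hg h2
    change evalAt p _ = _
    rw [map_mul, map_mul, evalAt_C, evalAt_T, h5, ← zpow_add₀ v_ne_zero, he]
    congr 2
    ring

theorem exists_isStableConst (A B C : DecMat n) : ∃ G, IsStableConst A B C G := by
  obtain ⟨_, _, _, _, -, -, -, h⟩ := exists_represents_conv A B C
  exact ⟨_, h⟩

theorem IsGenericConst.unique {A B C : DecMat n} {P P' : Polynomial ℚ}
    (h : IsGenericConst A B C P) (h' : IsGenericConst A B C P') : P = P' := by
  refine Polynomial.eq_of_infinite_eval_eq _ _ ?_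
  refine (Nat.infinite_setOfPred_prime.image (f := fun m : ℕ => (m : ℚ))
    Nat.cast_injective.injOn).mono ?_
  rintro _ ⟨q, hq, rfl⟩
  have : Fact q.Prime := ⟨hq⟩
  obtain ⟨d, t, ht⟩ := orbit_nonempty (ZMod q) C
  have h1 := h (ZMod q) d t ht
  have h2 := h' (ZMod q) d t ht
  rw [Nat.card_zmod] at h1 h2
  exact h1.symm.trans h2

theorem IsStableConst.unique {A B C : DecMat n} {G G' : Qv[T;T⁻¹]}
    (h : IsStableConst A B C G) (h' : IsStableConst A B C G') : G = G' := by
  obtain ⟨p₀, h⟩ := h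
  obtain ⟨p₁, h'⟩ := h'
  refine laurent_eq_of_evalAt G G' (max p₀ p₁) fun p hp => ?_
  obtain ⟨P, h1, h2⟩ := h p (by omega)
  obtain ⟨P', h1', h2'⟩ := h' p (by omega)
  change evalAt p G = _ at h2
  change evalAt p G' = _ at h2'
  rw [h2, h2', h1.unique h1']

/-- The evaluation `v' ↦ 1` of Laurent polynomials in `v'`. -/
abbrev evalOne : Qv[T;T⁻¹] →+* Qv := LaurentPolynomial.eval₂ (RingHom.id Qv) 1

theorem structConst_eq {A B C : DecMat n} {G : Qv[T;T⁻¹]} (h : IsStableConst A B C G) :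
    structConst A B C = evalOne G := by
  have hex : ∃ G, IsStableConst A B C G := ⟨G, h⟩
  unfold structConst
  rw [dif_pos hex, hex.choose_spec.unique h]

end Existence

/-! ### Bounds on the support of products -/

section Support

variable {n : ℕ}

namespace DecMat

theorem ro_eq_corner (M : DecMat n) (i : Fin n) :
    M.ro i = M.corner (i + 1) n - M.corner i n := by
  unfold ro corner
  rw [← sum_sub_distrib, Fintype.sum_prod_type]
  symm
  refine (sum_eq_single i ?_ ?_).trans ?_
  · intro a _ ha
    have ha' : (a : ℕ) ≠ i := fun h => ha (Fin.ext h)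
    refine sum_eq_zero fun j _ => ?_
    simp only
    split_ifs <;> omega
  · simp
  · refine sum_congr rfl fun j _ => ?_
    simp

theorem co_eq_corner (M : DecMat n) (j : Fin n) :
    M.co j = M.corner n (j + 1) - M.corner n j := by
  unfold co corner
  rw [← sum_sub_distrib, Fintype.sum_prod_type_right]
  symm
  refine (sum_eq_single j ?_ ?_).trans ?_
  · intro a _ ha
    have ha' : (a : ℕ) ≠ j := fun h => ha (Fin.ext h)
    refine sum_eq_zero fun j _ => ?_
    simp only
    split_ifs <;> omega
  · simp
  · refine sum_congr rfl fun i _ => ?_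
    simp

/-- The sum of the entries in the first `i` rows and outside of the first `i` columns. -/
def upper (M : DecMat n) (i : ℕ) : ℤ := M.corner i n - M.corner i i

/-- The sum of the entries in the first `i` columns and outside of the first `i` rows. -/
def lower (M : DecMat n) (i : ℕ) : ℤ := M.corner n i - M.corner i i

theorem upper_eq (M : DecMat n) (i : ℕ) : M.upper i =
    ∑ x : Fin n × Fin n, if (x.1 : ℕ) < i ∧ i ≤ (x.2 : ℕ) then M.mat x.1 x.2 else 0 := by
  unfold upper corner
  rw [← sum_sub_distrib]
  grind

theorem lower_eq (M : DecMat n) (i : ℕ) : M.lower i =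
    ∑ x : Fin n × Fin n, if (x.2 : ℕ) < i ∧ i ≤ (x.1 : ℕ) then M.mat x.1 x.2 else 0 := by
  unfold lower corner
  rw [← sum_sub_distrib]
  grind

/-- The off-diagonal part of the matrix is bounded by `b`, in a way which is subadditive under
composition of relative positions. -/
def Bounded (b : ℤ) (M : DecMat n) : Prop := ∀ i, i ≤ n → M.upper i ≤ b ∧ M.lower i ≤ b

theorem exists_bounded (M : DecMat n) : ∃ b, M.Bounded b := by
  refine ⟨∑ i ∈ range (n + 1), (|M.upper i| + |M.lower i|), fun i hi => ?_⟩
  have h := single_le_sum (f := fun i => |M.upper i| + |M.lower i|)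
    (fun i _ => add_nonneg (abs_nonneg _) (abs_nonneg _)) (Finset.mem_range.2 (Nat.lt_succ_of_le hi))
  grind

theorem Bounded.entry_le {b : ℤ} {M : DecMat n} (h : M.Bounded b) {i j : Fin n} (hij : i ≠ j) :
    M.mat i j ≤ b := by
  rcases lt_or_gt_of_ne hij with hlt | hlt
  · refine le_trans ?_ (h (i + 1) i.2).1
    rw [upper_eq]
    have h1 := single_le_sum (s := Finset.univ) (a := (i, j))
      (f := fun x : Fin n × Fin n =>
        if (x.1 : ℕ) < i + 1 ∧ i + 1 ≤ (x.2 : ℕ) then M.mat x.1 x.2 else 0) (fun x _ => by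
        split_ifs with hx
        · exact M.nonneg _ _ (by rintro h; rw [h] at hx; omega)
        · exact le_rfl) (mem_univ _)
    grind
  · refine le_trans ?_ (h (j + 1) j.2).2
    rw [lower_eq]
    have h1 := single_le_sum (s := Finset.univ) (a := (i, j))
      (f := fun x : Fin n × Fin n =>
        if (x.2 : ℕ) < j + 1 ∧ j + 1 ≤ (x.1 : ℕ) then M.mat x.1 x.2 else 0) (fun x _ => by
        split_ifs with hx
        · exact M.nonneg _ _ (by rintro h; rw [h] at hx; omega)
        · exact le_rfl) (mem_univ _)
    grind

/-- The off-diagonal part of the matrix, with the decoration. -/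
def offDiag (M : DecMat n) : (Fin n → Fin n → ℤ) × Finset (Fin n × Fin n) :=
  (fun i j => if i = j then 0 else M.mat i j, M.dec)

theorem finite_offDiag (b : ℤ) : (offDiag '' {M : DecMat n | M.Bounded b}).Finite := by
  refine ((Set.Finite.pi' fun _ : Fin n => Set.Finite.pi' fun _ : Fin n =>
    Set.finite_Icc (0 : ℤ) (max b 0)).prod Set.finite_univ).subset ?_
  rintro _ ⟨M, hM, rfl⟩
  have hM' : M.Bounded b := hM
  refine ⟨fun i j => ?_, trivial⟩
  unfold offDiag
  simp only
  split_ifs with h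
  · exact ⟨le_rfl, le_max_right _ _⟩
  · exact ⟨M.nonneg i j h, (hM'.entry_le h).trans (le_max_left _ _)⟩

theorem eq_of_offDiag {M M' : DecMat n} (h : M.offDiag = M'.offDiag)
    (hd : ∀ i, M.mat i i = M'.mat i i) : M = M' := by
  have h1 := congrArg Prod.fst h
  refine ext_mat ?_ (congrArg Prod.snd h)
  ext i j
  by_cases hij : i = j
  · rw [hij, hd]
  · have := congrFun (congrFun h1 i) j
    simpa only [offDiag, if_neg hij] using this

theorem finite_ro_bounded (r : Fin n → ℤ) (b : ℤ) :
    {M : DecMat n | M.ro = r ∧ M.Bounded b}.Finite := by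
  refine Set.Finite.of_finite_image ((finite_offDiag b).subset
    (Set.image_mono fun M hM => hM.2)) ?_
  rintro M ⟨hM, -⟩ M' ⟨hM', -⟩ h
  refine eq_of_offDiag h fun i => ?_
  have h1 : ∀ M : DecMat n, M.mat i i = M.ro i - ∑ j, M.offDiag.1 i j := by
    intro M
    unfold ro offDiag
    rw [← sum_sub_distrib, sum_eq_single i]
    · simp
    · intro j _ hj
      simp [Ne.symm hj]
    · simp
  rw [h1, h1, h, hM, hM']

theorem finite_co_bounded (r : Fin n → ℤ) (b : ℤ) :
    {M : DecMat n | M.co = r ∧ M.Bounded b}.Finite := by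
  refine Set.Finite.of_finite_image ((finite_offDiag b).subset
    (Set.image_mono fun M hM => hM.2)) ?_
  rintro M ⟨hM, -⟩ M' ⟨hM', -⟩ h
  refine eq_of_offDiag h fun i => ?_
  have h1 : ∀ M : DecMat n, M.mat i i = M.co i - ∑ j, M.offDiag.1 j i := by
    intro M
    unfold co offDiag
    rw [← sum_sub_distrib, sum_eq_single i]
    · simp
    · intro j _ hj
      simp [hj]
    · simp
  rw [h1, h1, h, hM, hM']

theorem shift_injective (p : ℕ) : Function.Injective (shift p : DecMat n → DecMat n) := by
  intro M M' h
  refine ext_mat ?_ (congrArg dec h : (shift p M).dec = (shift p M').dec)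
  ext i j
  have h1 := shift_mat p M i j
  rw [h, shift_mat] at h1
  exact (add_right_cancel h1).symm

end DecMat

variable {F V : Type} [Field F] [AddCommGroup V] [Module F V] [FiniteDimensional F V]

theorem exists_shift_hasPosition (p : ℕ) (t : PartialFlag n F V × PartialFlag n F V × V) :
    ∃ M : DecMat n, HasPosition (M.shift p) t := by
  obtain ⟨M, hM, ht⟩ := exists_hasPosition t
  let M' : DecMat n :=
    { mat := M.mat - diagonal (fun _ => (p : ℤ))
      dec := M.dec
      nonneg := fun i j h => by simpa [diagonal_apply_ne _ h] using M.nonneg i j h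
      chain := M.chain
      pos := fun x hx h => by simpa [diagonal_apply_ne _ h] using M.pos x hx h }
  have h : M'.shift p = M := DecMat.ext_mat (by simp [M', DecMat.shift]) rfl
  exact ⟨M', h ▸ ht⟩

section

variable {M : DecMat n} {p : ℕ} {f h : PartialFlag n F V} {μ : V}

theorem HasPosition.finrank_left (ht : HasPosition (M.shift p) (f, h, μ)) {i : ℕ} (hi : i ≤ n) :
    (finrank F (f.seq i) : ℤ) = M.corner i n + p * i := by
  have h1 := ht.1 i n hi le_rfl
  rwa [meetDim_top_right _ _ _ le_rfl, M.corner_shift p hi le_rfl, min_eq_left hi] at h1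

theorem HasPosition.finrank_right (ht : HasPosition (M.shift p) (f, h, μ)) {i : ℕ} (hi : i ≤ n) :
    (finrank F (h.seq i) : ℤ) = M.corner n i + p * i := by
  have h1 := ht.1 n i le_rfl hi
  rwa [meetDim_top_left _ _ _ le_rfl, M.corner_shift p le_rfl hi, min_eq_right hi] at h1

theorem HasPosition.ro_eq (ht : HasPosition (M.shift p) (f, h, μ)) (i : Fin n) :
    M.ro i = finrank F (f.seq (i + 1)) - finrank F (f.seq i) - p := by
  rw [M.ro_eq_corner, ht.finrank_left i.2, ht.finrank_left i.2.le]
  push_cast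
  ring

theorem HasPosition.co_eq (ht : HasPosition (M.shift p) (f, h, μ)) (i : Fin n) :
    M.co i = finrank F (h.seq (i + 1)) - finrank F (h.seq i) - p := by
  rw [M.co_eq_corner, ht.finrank_right i.2, ht.finrank_right i.2.le]
  push_cast
  ring

theorem HasPosition.upper_eq (ht : HasPosition (M.shift p) (f, h, μ)) {i : ℕ} (hi : i ≤ n) :
    M.upper i = finrank F (f.seq i) - finrank F ↥(f.seq i ⊓ h.seq i) := by
  have h1 := ht.1 i i hi hi
  rw [M.corner_shift p hi hi, min_self] at h1
  rw [ht.finrank_left hi, DecMat.upper]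
  simp only [meetDim] at h1
  rw [h1]
  ring

theorem HasPosition.lower_eq (ht : HasPosition (M.shift p) (f, h, μ)) {i : ℕ} (hi : i ≤ n) :
    M.lower i = finrank F (h.seq i) - finrank F ↥(f.seq i ⊓ h.seq i) := by
  have h1 := ht.1 i i hi hi
  rw [M.corner_shift p hi hi, min_self] at h1
  rw [ht.finrank_right hi, DecMat.lower]
  simp only [meetDim] at h1
  rw [h1]
  ring

theorem finrank_sub_inf_le (U X W : Submodule F V) :
    (finrank F U : ℤ) - finrank F ↥(U ⊓ W) ≤
      (finrank F U - finrank F ↥(U ⊓ X)) + (finrank F X - finrank F ↥(X ⊓ W)) := by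
  have h1 := finrank_sup_add_finrank_inf_eq (U ⊓ X) (X ⊓ W)
  have h2 : finrank F ↥(U ⊓ X ⊔ X ⊓ W) ≤ finrank F X :=
    finrank_mono (sup_le inf_le_right inf_le_left)
  have h3 : finrank F ↥(U ⊓ X ⊓ (X ⊓ W)) ≤ finrank F ↥(U ⊓ W) :=
    finrank_mono (le_inf (inf_le_left.trans inf_le_left) (inf_le_right.trans inf_le_right))
  omega

/-- The size of the part off the diagonal is subadditive. -/
theorem HasPosition.bounded {A B C : DecMat n} {f' : PartialFlag n F V} {ν ω : V} {b b' : ℤ}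
    (hA : HasPosition (A.shift p) (f, h, μ)) (hB : HasPosition (B.shift p) (h, f', ν))
    (hC : HasPosition (C.shift p) (f, f', ω)) (hb : A.Bounded b) (hb' : B.Bounded b') :
    C.Bounded (b + b') := by
  intro i hi
  have h1 := hb i hi
  have h2 := hb' i hi
  rw [hA.upper_eq hi, hA.lower_eq hi] at h1
  rw [hB.upper_eq hi, hB.lower_eq hi] at h2
  rw [hC.upper_eq hi, hC.lower_eq hi]
  have h3 := finrank_sub_inf_le (f.seq i) (h.seq i) (f'.seq i)
  grind

end

/-- If the product of the characteristic functions of two orbits does not vanish on a third orbit,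
then the row and column sums are compatible, and the off-diagonal part of the third matrix is
bounded. -/
theorem position_of_conv_ne_zero {A B C : DecMat n} {p : ℕ} (hA : (A.shift p).Effective)
    (hB : (B.shift p).Effective) {t : PartialFlag n F V × PartialFlag n F V × V}
    (hC : HasPosition (C.shift p) t)
    (h : conv (charFun (A.shift p)) (charFun (B.shift p)) t ≠ 0) :
    A.ro = C.ro ∧ B.co = C.co ∧ A.co = B.ro ∧
      ∀ b b', A.Bounded b → B.Bounded b' → C.Bounded (b + b') := by
  classical
  obtain ⟨f, f', ω⟩ := t
  obtain ⟨⟨k, μ⟩, hy⟩ : ∃ y : PartialFlag n F V × V,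
      charFun (A.shift p) (f, y.1, y.2) * charFun (B.shift p) (y.1, f', ω - y.2) ≠ 0 := by
    by_contra hcon
    push Not at hcon
    exact h ((finsum_congr hcon).trans finsum_zero)
  rw [charFun_eq, charFun_eq] at hy
  have h1 : (f, k, μ) ∈ orbit (A.shift p) := by
    by_contra hcon
    exact hy (by rw [if_neg hcon, zero_mul])
  have h2 : (k, f', ω - μ) ∈ orbit (B.shift p) := by
    by_contra hcon
    exact hy (by rw [if_neg hcon, mul_zero])
  have h1' := hasPosition_of_mem_orbit hA h1
  have h2' := hasPosition_of_mem_orbit hB h2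
  refine ⟨?_, ?_, ?_, fun b b' hb hb' => h1'.bounded h2' hC hb hb'⟩
  · funext i
    rw [h1'.ro_eq, hC.ro_eq]
  · funext i
    rw [h2'.co_eq, hC.co_eq]
  · funext i
    rw [h1'.co_eq, h2'.ro_eq]

theorem structConst_support [NeZero n] {A B C : DecMat n} (h : structConst A B C ≠ 0) :
    A.ro = C.ro ∧ B.co = C.co ∧ A.co = B.ro ∧
      ∀ b b', A.Bounded b → B.Bounded b' → C.Bounded (b + b') := by
  by_contra hcon
  apply h
  obtain ⟨p₁, h₁⟩ := A.exists_effective_shift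
  obtain ⟨p₂, h₂⟩ := B.exists_effective_shift
  obtain ⟨p₃, h₃⟩ := C.exists_effective_shift
  have h0 : IsStableConst A B C 0 := by
    refine ⟨max p₁ (max p₂ p₃), fun p hp => ⟨0, fun F _ _ d t ht => ?_, by simp⟩⟩
    rw [Polynomial.eval_zero, Int.cast_eq_zero]
    by_contra hne
    exact hcon (position_of_conv_ne_zero (h₁ p (by omega)) (h₂ p (by omega))
      (hasPosition_of_mem_orbit (h₃ p (by omega)) ht) hne)
  rw [structConst_eq h0, map_zero]

end Support

/-! ### Kernels on pairs of flags with values in the group algebra -/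

section Kernels

variable {n : ℕ} {F V : Type} [Field F] [AddCommGroup V] [Module F V] [Finite V]

instance : Fintype (PartialFlag n F V) := Fintype.ofFinite _

instance : DecidableEq (PartialFlag n F V) := Classical.decEq _

/-- Functions of two flags and a vector, as matrices indexed by flags with entries in the group
algebra of `V`: convolution becomes matrix multiplication. -/
abbrev Kern (n : ℕ) (F V : Type) [Field F] [AddCommGroup V] [Module F V] : Type :=
  Matrix (PartialFlag n F V) (PartialFlag n F V) (AddMonoidAlgebra ℚ V)

/-- The kernel given by the characteristic function of an orbit. -/
def orbitKern (M : DecMat n) : Kern n F V := fun f h =>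
  .ofCoeff (Finsupp.equivFunOnFinite.symm fun μ => ((charFun M (f, h, μ) : ℤ) : ℚ))

theorem coeff_orbitKern (M : DecMat n) (f h : PartialFlag n F V) (μ : V) :
    (orbitKern M f h).coeff μ = ((charFun M (f, h, μ) : ℤ) : ℚ) := rfl

theorem coeff_orbitKern_mul (A B : DecMat n) (f f' : PartialFlag n F V) (ω : V) :
    ((orbitKern A * orbitKern B : Kern n F V) f f').coeff ω =
      ((conv (charFun A) (charFun B) (f, f', ω) : ℤ) : ℚ) := by
  have : Fintype V := Fintype.ofFinite V
  unfold conv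
  rw [finsum_eq_sum_of_fintype, Fintype.sum_prod_type, Matrix.mul_apply,
    AddMonoidAlgebra.coeff_sum, Finsupp.finsetSum_apply]
  push_cast
  refine sum_congr rfl fun h _ => ?_
  rw [AddMonoidAlgebra.coeff_mul_apply_left, Finsupp.sum_fintype _ _ (by simp)]
  refine sum_congr rfl fun μ _ => ?_
  rw [coeff_orbitKern, coeff_orbitKern, neg_add_eq_sub]

theorem kern_entry_eq_sum [FiniteDimensional F V] {p : ℕ} {S : Finset (DecMat n)}
    (hS : ∀ M ∈ S, (M.shift p).Effective) (c : DecMat n → ℚ) {f h : PartialFlag n F V}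
    {x : AddMonoidAlgebra ℚ V}
    (h1 : ∀ M ∈ S, ∀ μ, HasPosition (M.shift p) (f, h, μ) → x.coeff μ = c M)
    (h2 : ∀ M, M ∉ S → ∀ μ, HasPosition (M.shift p) (f, h, μ) → x.coeff μ = 0) :
    x = ∑ M ∈ S, c M • orbitKern (M.shift p) f h := by
  classical
  ext μ
  rw [AddMonoidAlgebra.coeff_sum, Finsupp.finsetSum_apply]
  obtain ⟨M, hM⟩ := exists_shift_hasPosition p (f, h, μ)
  have key : ∀ M' ∈ S, (c M' • orbitKern (M'.shift p) f h).coeff μ =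
      if M' = M then c M' else 0 := by
    intro M' hM'
    rw [AddMonoidAlgebra.coeff_smul_apply, coeff_orbitKern, charFun_eq, mem_orbit_iff (hS M' hM')]
    by_cases h3 : M' = M
    · rw [if_pos h3, if_pos (h3 ▸ hM)]
      simp
    · rw [if_neg h3, if_neg fun h4 => h3 (DecMat.shift_injective p (h4.unique hM))]
      simp
  rw [sum_congr rfl key, Finset.sum_ite_eq']
  split_ifs with h3
  · exact h1 M h3 μ hM
  · exact h2 M h3 μ hM

/-- The product of two kernels in terms of products of orbits. Only one row of the first kernel and
one column of the second one matter. -/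
theorem coeff_kern_mul [FiniteDimensional F V] {p : ℕ} {S T : Finset (DecMat n)}
    (hS : ∀ M ∈ S, (M.shift p).Effective) (hT : ∀ M ∈ T, (M.shift p).Effective)
    (c d : DecMat n → ℚ) {K L : Kern n F V} {f f' : PartialFlag n F V}
    (h1 : ∀ M ∈ S, ∀ h μ, HasPosition (M.shift p) (f, h, μ) → (K f h).coeff μ = c M)
    (h2 : ∀ M, M ∉ S → ∀ h μ, HasPosition (M.shift p) (f, h, μ) → (K f h).coeff μ = 0)
    (h3 : ∀ M ∈ T, ∀ h μ, HasPosition (M.shift p) (h, f', μ) → (L h f').coeff μ = d M)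
    (h4 : ∀ M, M ∉ T → ∀ h μ, HasPosition (M.shift p) (h, f', μ) → (L h f').coeff μ = 0) (ω : V) :
    ((K * L) f f').coeff ω = ∑ A ∈ S, ∑ B ∈ T,
      c A * d B * ((conv (charFun (A.shift p)) (charFun (B.shift p)) (f, f', ω) : ℤ) : ℚ) := by
  have hK : ∀ h, K f h = ∑ M ∈ S, c M • orbitKern (M.shift p) f h := fun h =>
    kern_entry_eq_sum hS c (fun M hM μ => h1 M hM h μ) fun M hM μ => h2 M hM h μ
  have hL : ∀ h, L h f' = ∑ M ∈ T, d M • orbitKern (M.shift p) h f' := fun h =>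
    kern_entry_eq_sum hT d (fun M hM μ => h3 M hM h μ) fun M hM μ => h4 M hM h μ
  have key : (K * L) f f' = ∑ A ∈ S, ∑ B ∈ T, (c A * d B) •
      (orbitKern (A.shift p) * orbitKern (B.shift p) : Kern n F V) f f' := by
    simp only [Matrix.mul_apply, hK, hL, Finset.sum_mul_sum, Finset.smul_sum, smul_mul_smul_comm]
    rw [sum_comm]
    exact sum_congr rfl fun A _ => sum_comm
  rw [key]
  simp only [AddMonoidAlgebra.coeff_sum, Finsupp.finsetSum_apply,
    AddMonoidAlgebra.coeff_smul_apply, coeff_orbitKern_mul, smul_eq_mul]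

end Kernels

/-! ### The completed algebra -/

section Product

variable {n : ℕ} [NeZero n]

theorem eventually_effective (M : DecMat n) : ∀ᶠ p in Filter.atTop, (M.shift p).Effective := by
  obtain ⟨p₀, h⟩ := M.exists_effective_shift
  exact Filter.eventually_atTop.2 ⟨p₀, h⟩

theorem finite_structConst_support (A B : DecMat n) : {C | structConst A B C ≠ 0}.Finite := by
  obtain ⟨a, ha⟩ := A.exists_bounded
  obtain ⟨b, hb⟩ := B.exists_bounded
  refine (DecMat.finite_ro_bounded A.ro (a + b)).subset fun C hC => ?_
  obtain ⟨h1, -, -, h4⟩ := structConst_support hC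
  exact ⟨h1.symm, h4 a b ha hb⟩

theorem finite_support_mul (x y : KHat n) (C : DecMat n) :
    (Function.support fun AB : DecMat n × DecMat n =>
      x.1 AB.1 * y.1 AB.2 * structConst AB.1 AB.2 C).Finite := by
  refine ((x.2 C.ro).1.prod (y.2 C.co).2).subset ?_
  rintro ⟨A, B⟩ h
  obtain ⟨h1, h2, -, -⟩ := structConst_support (right_ne_zero_of_mul h)
  have h3 := left_ne_zero_of_mul h
  exact ⟨⟨left_ne_zero_of_mul h3, h1⟩, ⟨right_ne_zero_of_mul h3, h2⟩⟩

theorem formalMul_eq_sum {x y : DecMat n → Qv} {C : DecMat n} (S T : Finset (DecMat n))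
    (h : ∀ A B, x A ≠ 0 → y B ≠ 0 → structConst A B C ≠ 0 → A ∈ S ∧ B ∈ T) :
    formalMul x y C = ∑ A ∈ S, ∑ B ∈ T, x A * y B * structConst A B C := by
  classical
  unfold formalMul
  rw [finsum_eq_sum_of_support_subset (s := S ×ˢ T), Finset.sum_product]
  rintro ⟨A, B⟩ hAB
  have h1 := left_ne_zero_of_mul hAB
  have := h A B (left_ne_zero_of_mul h1) (right_ne_zero_of_mul h1) (right_ne_zero_of_mul hAB)
  simpa using this

theorem exists_ne_zero_of_formalMul {x y : DecMat n → Qv} {C : DecMat n}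
    (h : formalMul x y C ≠ 0) : ∃ A B, x A ≠ 0 ∧ y B ≠ 0 ∧ structConst A B C ≠ 0 := by
  by_contra hcon
  push Not at hcon
  apply h
  rw [formalMul_eq_sum ∅ ∅ fun A B hA hB hC => absurd (hcon A B hA hB) hC]
  simp

theorem formalMul_mem (x y : KHat n) : formalMul x.1 y.1 ∈ KHat n := by
  intro a
  constructor
  · refine (((x.2 a).1).biUnion fun A _ => ((y.2 A.co).1).biUnion fun B _ =>
      finite_structConst_support A B).subset ?_
    rintro C ⟨hC, ha⟩
    obtain ⟨A, B, hA, hB, h⟩ := exists_ne_zero_of_formalMul hC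
    obtain ⟨h1, -, h3, -⟩ := structConst_support h
    simp only [Set.mem_iUnion]
    exact ⟨A, ⟨hA, h1.trans ha⟩, B, ⟨hB, h3.symm⟩, h⟩
  · refine (((y.2 a).2).biUnion fun B _ => ((x.2 B.ro).2).biUnion fun A _ =>
      finite_structConst_support A B).subset ?_
    rintro C ⟨hC, ha⟩
    obtain ⟨A, B, hA, hB, h⟩ := exists_ne_zero_of_formalMul hC
    obtain ⟨-, h2, h3, -⟩ := structConst_support h
    simp only [Set.mem_iUnion]
    exact ⟨B, ⟨hB, h2.trans ha⟩, A, ⟨hA, h3⟩, h⟩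

/-- The members of the support with row sums `r`. -/
def rowSupport (x : KHat n) (r : Fin n → ℤ) : Finset (DecMat n) := (x.2 r).1.toFinset

/-- The members of the support with column sums `r`. -/
def colSupport (x : KHat n) (r : Fin n → ℤ) : Finset (DecMat n) := (x.2 r).2.toFinset

theorem mem_rowSupport {x : KHat n} {r : Fin n → ℤ} {M : DecMat n} :
    M ∈ rowSupport x r ↔ x.1 M ≠ 0 ∧ M.ro = r := Set.Finite.mem_toFinset _

theorem mem_colSupport {x : KHat n} {r : Fin n → ℤ} {M : DecMat n} :
    M ∈ colSupport x r ↔ x.1 M ≠ 0 ∧ M.co = r := Set.Finite.mem_toFinset _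

theorem formalMul_eq_sum_support (x y : KHat n) (C : DecMat n) {S T : Finset (DecMat n)}
    (hS : rowSupport x C.ro ⊆ S) (hT : colSupport y C.co ⊆ T) :
    formalMul x.1 y.1 C = ∑ A ∈ S, ∑ B ∈ T, x.1 A * y.1 B * structConst A B C :=
  formalMul_eq_sum S T fun A B hA hB h => by
    obtain ⟨h1, h2, -, -⟩ := structConst_support h
    exact ⟨hS (mem_rowSupport.2 ⟨hA, h1⟩), hT (mem_colSupport.2 ⟨hB, h2⟩)⟩

theorem formalMul_add_left (x x' y : KHat n) :
    formalMul (x + x').1 y.1 = formalMul x.1 y.1 + formalMul x'.1 y.1 := by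
  classical
  funext C
  rw [Pi.add_apply]
  set S := rowSupport x C.ro ∪ rowSupport x' C.ro ∪ rowSupport (x + x') C.ro
  rw [formalMul_eq_sum_support (x + x') y C (S := S) subset_union_right le_rfl,
    formalMul_eq_sum_support x y C (S := S)
      (Finset.subset_union_left.trans subset_union_left) le_rfl,
    formalMul_eq_sum_support x' y C (S := S)
      (Finset.subset_union_right.trans subset_union_left) le_rfl,
    ← sum_add_distrib]
  refine sum_congr rfl fun A _ => ?_
  rw [← sum_add_distrib]
  refine sum_congr rfl fun B _ => ?_
  change (x.1 A + x'.1 A) * _ * _ = _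
  ring

theorem formalMul_add_right (x y y' : KHat n) :
    formalMul x.1 (y + y').1 = formalMul x.1 y.1 + formalMul x.1 y'.1 := by
  classical
  funext C
  rw [Pi.add_apply]
  set S := colSupport y C.co ∪ colSupport y' C.co ∪ colSupport (y + y') C.co
  rw [formalMul_eq_sum_support x (y + y') C (T := S) le_rfl subset_union_right,
    formalMul_eq_sum_support x y C (T := S) le_rfl
      (Finset.subset_union_left.trans subset_union_left),
    formalMul_eq_sum_support x y' C (T := S) le_rfl
      (Finset.subset_union_right.trans subset_union_left),
    ← sum_add_distrib]
  refine sum_congr rfl fun A _ => ?_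
  rw [← sum_add_distrib]
  refine sum_congr rfl fun B _ => ?_
  change _ * (y.1 B + y'.1 B) * _ = _
  ring

theorem formalMul_smul_left (c : Qv) (x y : DecMat n → Qv) :
    formalMul (c • x) y = c • formalMul x y := by
  funext C
  rw [Pi.smul_apply]
  unfold formalMul
  rw [smul_finsum]
  refine finsum_congr fun AB => ?_
  simp only [Pi.smul_apply, smul_eq_mul]
  ring

theorem formalMul_smul_right (c : Qv) (x y : DecMat n → Qv) :
    formalMul x (c • y) = c • formalMul x y := by
  funext C
  rw [Pi.smul_apply]
  unfold formalMul
  rw [smul_finsum]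
  refine finsum_congr fun AB => ?_
  simp only [Pi.smul_apply, smul_eq_mul]
  ring

end Product

/-! ### Diagonal positions and the product of the completed algebra -/

section Unit

variable {n : ℕ}

section

variable {F V : Type} [Field F] [AddCommGroup V] [Module F V] [FiniteDimensional F V]
variable {C : DecMat n} {p : ℕ} {f h : PartialFlag n F V} {μ : V}

theorem HasPosition.vec_eq_zero_iff (ht : HasPosition (C.shift p) (f, h, μ)) :
    μ = 0 ↔ C.dec = ∅ := by
  constructor
  · rintro rfl
    refine Finset.eq_empty_of_forall_notMem fun x hx => ?_
    exact (ht.2 0 0).2 ⟨x, hx, Nat.zero_le _, Nat.zero_le _⟩ (Submodule.zero_mem _)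
  · intro hd
    by_contra hμ
    have h1 : μ ∉ f.seq 0 ⊔ h.seq 0 := by
      rwa [f.seq_zero, h.seq_zero, sup_bot_eq, Submodule.mem_bot]
    obtain ⟨x, hx, -⟩ := (ht.2 0 0).1 h1
    have hx' : x ∈ C.dec := hx
    rw [hd] at hx'
    simp at hx'

theorem HasPosition.lower_eq_zero_iff (ht : HasPosition (C.shift p) (f, h, μ)) {i : ℕ}
    (hi : i ≤ n) : C.lower i = 0 ↔ h.seq i ≤ f.seq i := by
  rw [ht.lower_eq hi, sub_eq_zero, Nat.cast_inj, ← inf_eq_right]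
  constructor
  · intro h1
    exact eq_of_le_of_finrank_eq inf_le_right h1.symm
  · intro h1
    rw [h1]

theorem HasPosition.upper_eq_zero_iff (ht : HasPosition (C.shift p) (f, h, μ)) {i : ℕ}
    (hi : i ≤ n) : C.upper i = 0 ↔ f.seq i ≤ h.seq i := by
  rw [ht.upper_eq hi, sub_eq_zero, Nat.cast_inj, ← inf_eq_left]
  constructor
  · intro h1
    exact eq_of_le_of_finrank_eq inf_le_left h1.symm
  · intro h1
    rw [h1]

theorem HasPosition.flags_eq_iff (ht : HasPosition (C.shift p) (f, h, μ)) :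
    f = h ↔ ∀ i j, i ≠ j → C.mat i j = 0 := by
  have h1 : f = h ↔ C.Bounded 0 := by
    constructor
    · rintro rfl i hi
      rw [(ht.upper_eq_zero_iff hi).2 le_rfl, (ht.lower_eq_zero_iff hi).2 le_rfl]
      exact ⟨le_rfl, le_rfl⟩
    · intro hb
      refine PartialFlag.ext_seq fun i => ?_
      rcases le_or_gt i n with hi | hi
      · have h2 := ht.upper_eq hi
        have h3 := ht.lower_eq hi
        have h4 : finrank F ↥(f.seq i ⊓ h.seq i) ≤ finrank F (f.seq i) := finrank_mono inf_le_left
        have h5 : finrank F ↥(f.seq i ⊓ h.seq i) ≤ finrank F (h.seq i) := finrank_mono inf_le_right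
        have h6 := hb i hi
        exact le_antisymm ((ht.upper_eq_zero_iff hi).1 (by omega))
          ((ht.lower_eq_zero_iff hi).1 (by omega))
      · rw [f.seq_of_le hi.le, h.seq_of_le hi.le]
  rw [h1]
  constructor
  · intro hb i j hij
    exact le_antisymm (hb.entry_le hij) (C.nonneg i j hij)
  · intro hz i _
    rw [C.upper_eq, C.lower_eq]
    constructor
    all_goals
      refine (sum_eq_zero fun x _ => ?_).le
      split_ifs with hx
      · exact hz _ _ fun h => by rw [h] at hx; omega
      · rfl

end

namespace DecMat

/-- The diagonal matrix without decoration. -/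
def diag (z : Fin n → ℤ) : DecMat n where
  mat := diagonal z
  dec := ∅
  nonneg := fun i j h => (diagonal_apply_ne z h).ge
  chain := by simp
  pos := by simp

theorem ro_diag (z : Fin n → ℤ) : (diag z).ro = z := by
  funext i
  simp [ro, diag, diagonal_apply]

theorem co_diag (z : Fin n → ℤ) : (diag z).co = z := by
  funext i
  simp [co, diag, diagonal_apply]

theorem shift_diag (z : Fin n → ℤ) (p : ℕ) : (diag z).shift p = diag fun i => z i + p :=
  ext_mat (by simp [shift, diag, Matrix.diagonal_add]) rfl

theorem normExp_diag (z : Fin n → ℤ) : (diag z).normExp = 0 := by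
  have h1 : ∀ i j k l : Fin n, (if ¬ i < k ∧ j < l then
      (diag z).mat i j * (diag z).mat k l else 0) = 0 := by
    intro i j k l
    simp only [diag, diagonal_apply]
    split_ifs with h h2 h3
    · rw [h2, h3] at h
      exact absurd h.2 h.1
    all_goals simp
  have h2 : (diag z).dec = ∅ := rfl
  rw [normExp_eq, h2]
  simp only [h1]
  simp

end DecMat

end Unit

/-- The algebra with underlying vector space `K̂`. -/
def KAlg (n : ℕ) : Type := KHat n

namespace KAlg

variable {n : ℕ}

instance : AddCommGroup (KAlg n) := inferInstanceAs (AddCommGroup (KHat n))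

instance : Module Qv (KAlg n) := inferInstanceAs (Module Qv (KHat n))

/-- The identification of the algebra with its underlying vector space. -/
def toKHat : KAlg n ≃ₗ[Qv] KHat n := LinearEquiv.refl Qv (KHat n)

variable [NeZero n]

instance : Mul (KAlg n) := ⟨fun x y => toKHat.symm ⟨_, formalMul_mem (toKHat x) (toKHat y)⟩⟩

theorem toKHat_mul (x y : KAlg n) :
    (toKHat (x * y)).1 = formalMul (toKHat x).1 (toKHat y).1 := rfl

theorem ext_val {x y : KAlg n} (h : (toKHat x).1 = (toKHat y).1) : x = y :=
  toKHat.injective (Subtype.ext h)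

end KAlg

/-! ### Elements of the completed algebra realized by kernels -/

section Realization

variable {n : ℕ}

/-- Families of kernels, one for each vector space over a finite field and each `l`, which is
meant to be a square root of the number of elements of the field. -/
abbrev KernFam (n : ℕ) : Type 1 :=
  ∀ (_ _ : ℕ) (F V : Type) [Field F] [Finite F] [AddCommGroup V] [Module F V] [Finite V], Kern n F V

/-- The element `x` of the completed algebra is the stable form of the family of kernels `Φ`: over
the fields with `l ^ 2` elements, and with `v` read as `l`, the coefficient of `Φ` at the shifted
normalized basis element `[A + pI]_Δ` is given for large `p` by a Laurent polynomial in `v' = v ^ (-p)`,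
whose value at `v' = 1` is the coefficient of `x` at `[A]_Δ`. -/
structure Realizes (Φ : KernFam n) (x : KAlg n) : Prop where
  bounded : ∃ b, ∀ M : DecMat n, ¬ M.Bounded b → (KAlg.toKHat x).1 M = 0 ∧
    ∀ (p l : ℕ) (F V : Type) [Field F] [Finite F] [AddCommGroup V] [Module F V] [Finite V],
      2 ≤ l → Nat.card F = l ^ 2 → ∀ (f h : PartialFlag n F V) (μ : V),
        HasPosition (M.shift p) (f, h, μ) → (Φ p l F V f h).coeff μ = 0
  coeff : ∀ M : DecMat n, ∃ (p₀ : ℕ) (s : ℕ → ℕ → ℚ) (G : Qv[T;T⁻¹]),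
    Represents v s G ∧ evalOne G = (KAlg.toKHat x).1 M ∧ ∀ p, p₀ ≤ p →
    ∀ (l : ℕ) (F V : Type) [Field F] [Finite F] [AddCommGroup V] [Module F V] [Finite V],
      2 ≤ l → Nat.card F = l ^ 2 → ∀ (f h : PartialFlag n F V) (μ : V),
        HasPosition (M.shift p) (f, h, μ) →
        (Φ p l F V f h).coeff μ = (l : ℚ) ^ (M.shift p).normExp * s p l

theorem represents_zpow (c d : ℤ) : Represents v (fun p l => (l : ℚ) ^ (c + p * d))
    (LaurentPolynomial.C (v ^ c) * LaurentPolynomial.T (-d)) := by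
  have := Represents.zpow 1 c d
  simpa using this

theorem Represents.sum {u : Qv} {ι : Type*} (I : Finset ι) {s : ι → ℕ → ℕ → ℚ}
    {G : ι → Qv[T;T⁻¹]} (h : ∀ i ∈ I, Represents u (s i) (G i)) :
    Represents u (fun p q => ∑ i ∈ I, s i p q) (∑ i ∈ I, G i) := by
  classical
  induction I using Finset.induction_on with
  | empty => simpa using Represents.const u 0
  | insert i I hi ih =>
    have h1 := (h i (Finset.mem_insert_self i I)).add
      (ih fun j hj => h j (Finset.mem_insert_of_mem hj))
    simp only [Finset.sum_insert hi]
    exact h1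

theorem DecMat.Bounded.mono {b b' : ℤ} {M : DecMat n} (h : M.Bounded b) (hb : b ≤ b') :
    M.Bounded b' := fun i hi => ⟨(h i hi).1.trans hb, (h i hi).2.trans hb⟩

theorem evalOne_T (m : ℤ) : evalOne (LaurentPolynomial.T m) = 1 := by
  rw [evalOne, LaurentPolynomial.eval₂_T, one_zpow, Units.val_one]

theorem evalOne_C (c : Qv) : evalOne (LaurentPolynomial.C c) = c := by
  rw [evalOne, LaurentPolynomial.eval₂_C, RingHom.id_apply]

namespace Realizes

theorem add {Φ Ψ : KernFam n} {x y : KAlg n} (hΦ : Realizes Φ x) (hΨ : Realizes Ψ y) :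
    Realizes (fun p l F V _ _ _ _ _ => Φ p l F V + Ψ p l F V) (x + y) := by
  constructor
  · obtain ⟨b, hb⟩ := hΦ.bounded
    obtain ⟨b', hb'⟩ := hΨ.bounded
    refine ⟨max b b', fun M hM => ?_⟩
    obtain ⟨h1, h2⟩ := hb M fun h => hM (h.mono (le_max_left _ _))
    obtain ⟨h1', h2'⟩ := hb' M fun h => hM (h.mono (le_max_right _ _))
    constructor
    · change (KAlg.toKHat x).1 M + (KAlg.toKHat y).1 M = 0
      rw [h1, h1', add_zero]
    · intro p l F V _ _ _ _ _ hl hF f h μ ht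
      change (Φ p l F V f h).coeff μ + (Ψ p l F V f h).coeff μ = 0
      rw [h2 p l F V hl hF f h μ ht, h2' p l F V hl hF f h μ ht, add_zero]
  · intro M
    obtain ⟨p₀, s, G, h1, h2, h3⟩ := hΦ.coeff M
    obtain ⟨p₀', s', G', h1', h2', h3'⟩ := hΨ.coeff M
    refine ⟨max p₀ p₀', s + s', G + G', h1.add h1', ?_, ?_⟩
    · rw [map_add, h2, h2']
      rfl
    · intro p hp l F V _ _ _ _ _ hl hF f h μ ht
      change (Φ p l F V f h).coeff μ + (Ψ p l F V f h).coeff μ = _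
      rw [h3 p (by omega) l F V hl hF f h μ ht, h3' p (by omega) l F V hl hF f h μ ht, ← mul_add]
      rfl

theorem neg {Φ : KernFam n} {x : KAlg n} (hΦ : Realizes Φ x) :
    Realizes (fun p l F V _ _ _ _ _ => -Φ p l F V) (-x) := by
  constructor
  · obtain ⟨b, hb⟩ := hΦ.bounded
    refine ⟨b, fun M hM => ?_⟩
    obtain ⟨h1, h2⟩ := hb M hM
    constructor
    · change -(KAlg.toKHat x).1 M = 0
      rw [h1, neg_zero]
    · intro p l F V _ _ _ _ _ hl hF f h μ ht
      change -(Φ p l F V f h).coeff μ = 0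
      rw [h2 p l F V hl hF f h μ ht, neg_zero]
  · intro M
    obtain ⟨p₀, s, G, h1, h2, h3⟩ := hΦ.coeff M
    refine ⟨p₀, _, _, (Represents.const v (-1)).mul h1, ?_, ?_⟩
    · rw [map_mul, h2, evalOne_C, map_neg, map_one, neg_one_mul]
      rfl
    · intro p hp l F V _ _ _ _ _ hl hF f h μ ht
      change -(Φ p l F V f h).coeff μ = (l : ℚ) ^ (M.shift p).normExp * (-1 * s p l)
      rw [h3 p hp l F V hl hF f h μ ht]
      ring

theorem zpow_smul {Φ : KernFam n} {x : KAlg n} (hΦ : Realizes Φ x) (k : ℤ) :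
    Realizes (fun p l F V _ _ _ _ _ => (l : ℚ) ^ k • Φ p l F V) (v ^ k • x) := by
  constructor
  · obtain ⟨b, hb⟩ := hΦ.bounded
    refine ⟨b, fun M hM => ?_⟩
    obtain ⟨h1, h2⟩ := hb M hM
    constructor
    · change v ^ k * (KAlg.toKHat x).1 M = 0
      rw [h1, mul_zero]
    · intro p l F V _ _ _ _ _ hl hF f h μ ht
      change (l : ℚ) ^ k * (Φ p l F V f h).coeff μ = 0
      rw [h2 p l F V hl hF f h μ ht, mul_zero]
  · intro M
    obtain ⟨p₀, s, G, h1, h2, h3⟩ := hΦ.coeff M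
    refine ⟨p₀, _, _, (represents_zpow k 0).mul h1, ?_, ?_⟩
    · rw [map_mul, map_mul, h2, evalOne_C, evalOne_T, mul_one]
      rfl
    · intro p hp l F V _ _ _ _ _ hl hF f h μ ht
      change (l : ℚ) ^ k * (Φ p l F V f h).coeff μ =
        (l : ℚ) ^ (M.shift p).normExp * ((l : ℚ) ^ (k + p * 0) * s p l)
      rw [h3 p hp l F V hl hF f h μ ht, mul_zero, add_zero]
      ring

variable [NeZero n]

/-- The product of kernels involves for each coefficient only finitely many structure constants. -/
theorem mul {Φ Ψ : KernFam n} {x y : KAlg n} (hΦ : Realizes Φ x) (hΨ : Realizes Ψ y) :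
    Realizes (fun p l F V _ _ _ _ _ => Φ p l F V * Ψ p l F V) (x * y) := by
  classical
  obtain ⟨b, hb⟩ := hΦ.bounded
  obtain ⟨b', hb'⟩ := hΨ.bounded
  have hx : ∀ {M : DecMat n}, (KAlg.toKHat x).1 M ≠ 0 → M.Bounded b := fun h => by
    by_contra hM
    exact h (hb _ hM).1
  have hy : ∀ {M : DecMat n}, (KAlg.toKHat y).1 M ≠ 0 → M.Bounded b' := fun h => by
    by_contra hM
    exact h (hb' _ hM).1
  constructor
  · refine ⟨b + b', fun C hC => ⟨?_, ?_⟩⟩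
    · by_contra hne
      rw [KAlg.toKHat_mul] at hne
      obtain ⟨A, B, hA, hB, h⟩ := exists_ne_zero_of_formalMul hne
      exact hC ((structConst_support h).2.2.2 b b' (hx hA) (hy hB))
    · intro p l F V _ _ _ _ _ hl hF f f' ω ht
      have : Fintype V := Fintype.ofFinite V
      change ((Φ p l F V * Ψ p l F V) f f').coeff ω = 0
      rw [Matrix.mul_apply, AddMonoidAlgebra.coeff_sum, Finsupp.finsetSum_apply]
      refine sum_eq_zero fun h _ => ?_
      rw [AddMonoidAlgebra.coeff_mul_apply_left, Finsupp.sum_fintype _ _ (by simp)]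
      refine sum_eq_zero fun μ _ => ?_
      obtain ⟨A, hA⟩ := exists_shift_hasPosition p (f, h, μ)
      obtain ⟨B, hB⟩ := exists_shift_hasPosition p (h, f', -μ + ω)
      by_cases hAb : A.Bounded b
      · have hBb : ¬ B.Bounded b' := fun hBb => hC (hA.bounded hB ht hAb hBb)
        rw [(hb' B hBb).2 p l F V hl hF h f' _ hB, mul_zero]
      · rw [(hb A hAb).2 p l F V hl hF f h _ hA, zero_mul]
  · intro C
    set S := (DecMat.finite_ro_bounded C.ro b).toFinset with hS
    set T := (DecMat.finite_co_bounded C.co b').toFinset with hT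
    have memS : ∀ M : DecMat n, M ∈ S ↔ M.ro = C.ro ∧ M.Bounded b := by
      intro M
      rw [hS, Set.Finite.mem_toFinset]
      rfl
    have memT : ∀ M : DecMat n, M ∈ T ↔ M.co = C.co ∧ M.Bounded b' := by
      intro M
      rw [hT, Set.Finite.mem_toFinset]
      rfl
    choose p₁ s₁ G₁ h₁ e₁ c₁ using hΦ.coeff
    choose p₂ s₂ G₂ h₂ e₂ c₂ using hΨ.coeff
    choose p₃ s₃ G₃ k h₃ c₃ k₃ i₃ using fun A B => exists_represents_conv A B C
    have hev : ∀ᶠ p in Filter.atTop, (C.shift p).Effective ∧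
        (∀ A ∈ S, (A.shift p).Effective ∧ p₁ A ≤ p ∧ ∀ B ∈ T, p₃ A B ≤ p) ∧
        ∀ B ∈ T, (B.shift p).Effective ∧ p₂ B ≤ p := by
      refine .and (eventually_effective C) (.and ?_ ?_)
      · exact (Filter.eventually_all_finset _).2 fun A _ => (eventually_effective A).and
          ((Filter.eventually_ge_atTop _).and ((Filter.eventually_all_finset _).2 fun B _ =>
            Filter.eventually_ge_atTop _))
      · exact (Filter.eventually_all_finset _).2 fun B _ => (eventually_effective B).and
          (Filter.eventually_ge_atTop _)
    obtain ⟨p₀, hp₀⟩ := Filter.eventually_atTop.1 hev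
    refine ⟨p₀, _, _, Represents.sum S fun A _ => Represents.sum T fun B _ =>
      ((h₁ A).mul (h₂ B)).mul ((represents_zpow (A.normExp + B.normExp - C.normExp) (k A B)).mul
        (h₃ A B).comp_sq), ?_, ?_⟩
    · rw [KAlg.toKHat_mul, formalMul_eq_sum S T, map_sum]
      · refine sum_congr rfl fun A _ => ?_
        rw [map_sum]
        refine sum_congr rfl fun B _ => ?_
        rw [map_mul, map_mul, e₁, e₂, structConst_eq (i₃ A B)]
      · intro A B hA hB h
        obtain ⟨h1, h2, -, -⟩ := structConst_support h
        exact ⟨(memS A).2 ⟨h1, hx hA⟩, (memT B).2 ⟨h2, hy hB⟩⟩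
    · intro p hp l F V _ _ _ _ _ hl hF f f' ω ht
      obtain ⟨eC, eS, eT⟩ := hp₀ p hp
      have hl0 : (l : ℚ) ≠ 0 := by
        have : l ≠ 0 := by omega
        exact_mod_cast this
      change ((Φ p l F V * Ψ p l F V) f f').coeff ω = _
      rw [coeff_kern_mul (S := S) (T := T) (fun A hA => (eS A hA).1) (fun B hB => (eT B hB).1)
        (fun A => (l : ℚ) ^ (A.shift p).normExp * s₁ A p l)
        (fun B => (l : ℚ) ^ (B.shift p).normExp * s₂ B p l)
        (fun A hA h μ hA' => c₁ A p (eS A hA).2.1 l F V hl hF f h μ hA')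
        (fun A hA h μ hA' => (hb A fun hAb => hA ((memS A).2 ⟨by
          funext i
          rw [hA'.ro_eq, ht.ro_eq], hAb⟩)).2 p l F V hl hF f h μ hA')
        (fun B hB h μ hB' => c₂ B p (eT B hB).2 l F V hl hF h f' μ hB')
        (fun B hB h μ hB' => (hb' B fun hBb => hB ((memT B).2 ⟨by
          funext i
          rw [hB'.co_eq, ht.co_eq], hBb⟩)).2 p l F V hl hF h f' μ hB') ω]
      rw [mul_sum]
      refine sum_congr rfl fun A hA => ?_
      rw [mul_sum]
      refine sum_congr rfl fun B hB => ?_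
      rw [c₃ A B p ((eS A hA).2.2 B hB) F V _ (mem_orbit_of_hasPosition eC ht), hF]
      change _ = (l : ℚ) ^ (C.shift p).normExp * (s₁ A p l * s₂ B p l *
        ((l : ℚ) ^ (A.normExp + B.normExp - C.normExp + p * k A B) * s₃ A B p (l ^ 2)))
      rw [← k₃, zpow_sub₀ hl0, zpow_add₀ hl0]
      field_simp

/-- An element of the completed algebra is determined by the family of kernels. -/
theorem eq_of_kernels {Φ Ψ : KernFam n} {x y : KAlg n} (hΦ : Realizes Φ x) (hΨ : Realizes Ψ y)
    (h : ∀ (p l : ℕ) (F V : Type) [Field F] [Finite F] [AddCommGroup V] [Module F V] [Finite V],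
      2 ≤ l → Nat.card F = l ^ 2 → Φ p l F V = Ψ p l F V) : x = y := by
  refine KAlg.ext_val (funext fun M => ?_)
  obtain ⟨p₁, s, G, h1, h2, h3⟩ := hΦ.coeff M
  obtain ⟨p₂, s', G', h1', h2', h3'⟩ := hΨ.coeff M
  obtain ⟨p₃, h4⟩ := M.exists_effective_shift
  rw [← h2, ← h2']
  congr 1
  refine h1.unique aeval_v_injective h1' {l | l.Prime} Nat.infinite_setOfPred_prime
    (fun l hl => Nat.Prime.two_le hl) (max p₁ (max p₂ p₃)) fun p hp l hl => ?_
  have hl' : l.Prime := hl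
  have : Fact l.Prime := ⟨hl'⟩
  have : Finite (GaloisField l 2) := Module.finite_of_finite (ZMod l)
  have hF : Nat.card (GaloisField l 2) = l ^ 2 := GaloisField.card l 2 two_ne_zero
  obtain ⟨d, ⟨f, g, μ⟩, ht⟩ := orbit_nonempty (GaloisField l 2) (M.shift p)
  have ht' := hasPosition_of_mem_orbit (h4 p (by omega)) ht
  have h5 := h3 p (by omega) l _ _ hl'.two_le hF f g μ ht'
  have h6 := h3' p (by omega) l _ _ hl'.two_le hF f g μ ht'
  rw [h p l _ _ hl'.two_le hF, h6] at h5
  have hl0 : (l : ℚ) ≠ 0 := by exact_mod_cast hl'.ne_zero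
  exact (mul_left_cancel₀ (zpow_ne_zero _ hl0) h5).symm

end Realizes

/-- A criterion for the realization of `A(𝐣)_Δ`. -/
theorem realizes_diagSum {D : DecMat n} {j : Fin n → ℤ} {Φ : KernFam n}
    (h1 : ∀ (M : DecMat n) (z : Fin n → ℤ), M.dec = D.dec → M.mat = D.mat + diagonal z →
      ∀ (p l : ℕ) (F V : Type) [Field F] [Finite F] [AddCommGroup V] [Module F V] [Finite V],
        2 ≤ l → Nat.card F = l ^ 2 → ∀ (f h : PartialFlag n F V) (μ : V),
        HasPosition (M.shift p) (f, h, μ) →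
        (Φ p l F V f h).coeff μ = (l : ℚ) ^ ((M.shift p).normExp + ∑ i, (z i + p) * j i))
    (h2 : ∀ M : DecMat n, ¬ (M.dec = D.dec ∧ ∃ z, M.mat = D.mat + diagonal z) →
      ∀ (p l : ℕ) (F V : Type) [Field F] [Finite F] [AddCommGroup V] [Module F V] [Finite V],
        2 ≤ l → Nat.card F = l ^ 2 → ∀ (f h : PartialFlag n F V) (μ : V),
        HasPosition (M.shift p) (f, h, μ) → (Φ p l F V f h).coeff μ = 0) :
    Realizes Φ (KAlg.toKHat.symm (diagSum D j)) := by
  classical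
  have hval : ∀ M, (KAlg.toKHat (KAlg.toKHat.symm (diagSum D j))).1 M = diagSumFun D j M :=
    fun _ => rfl
  constructor
  · obtain ⟨b, hb⟩ := D.exists_bounded
    refine ⟨b, fun M hM => ?_⟩
    have hne : ¬ (M.dec = D.dec ∧ ∃ z, M.mat = D.mat + diagonal z) := by
      rintro ⟨-, z, hz⟩
      apply hM
      have hoff : ∀ i j, i ≠ j → M.mat i j = D.mat i j := by
        intro i j hij
        rw [hz, Matrix.add_apply, diagonal_apply_ne _ hij, add_zero]
      intro i hi
      have := hb i hi
      rw [D.upper_eq, D.lower_eq] at this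
      rw [M.upper_eq, M.lower_eq]
      refine ⟨le_trans (Finset.sum_le_sum fun x _ => ?_) this.1,
        le_trans (Finset.sum_le_sum fun x _ => ?_) this.2⟩
      all_goals
        split_ifs with hx
        · exact (hoff _ _ fun h => by rw [h] at hx; omega).le
        · exact le_rfl
    refine ⟨?_, fun p l F V _ _ _ _ _ hl hF f h μ ht => h2 M hne p l F V hl hF f h μ ht⟩
    rw [hval]
    exact if_neg hne
  · intro M
    by_cases hM : M.dec = D.dec ∧ ∃ z, M.mat = D.mat + diagonal z
    · obtain ⟨hd, z, hz⟩ := hM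
      refine ⟨0, _, _, represents_zpow (∑ i, z i * j i) (∑ i, j i), ?_, ?_⟩
      · rw [map_mul, evalOne_C, evalOne_T, mul_one, hval]
        symm
        refine (if_pos ⟨hd, z, hz⟩).trans ?_
        congr 1
        refine sum_congr rfl fun i _ => ?_
        rw [hz, Matrix.add_apply, diagonal_apply_eq]
        ring
      · intro p _ l F V _ _ _ _ _ hl hF f h μ ht
        have hl0 : (l : ℚ) ≠ 0 := by
          have : l ≠ 0 := by omega
          exact_mod_cast this
        rw [h1 M z hd hz p l F V hl hF f h μ ht, zpow_add₀ hl0, mul_sum, ← sum_add_distrib]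
        congr 2
        exact sum_congr rfl fun i _ => by ring
    · refine ⟨0, _, _, Represents.const v 0, ?_, ?_⟩
      · rw [evalOne_C, map_zero, hval]
        exact (if_neg hM).symm
      · grind

end Realization

/-! ### Kernels of the generators -/

section Generators

variable {n : ℕ}

section Kernels

variable {F V : Type} [Field F] [AddCommGroup V] [Module F V] [Finite V]

/-- The dimension of the quotient `f_{a + 1} / f_a`. -/
def stepDim (a : Fin n) (f : PartialFlag n F V) : ℤ :=
  finrank F (f.seq (a + 1)) - finrank F (f.seq a)

/-- The diagonal kernel of the `k`-th power of `H_a`. -/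
def kernH (l : ℕ) (a : Fin n) (k : ℤ) : Kern n F V :=
  diagonal fun f => algebraMap ℚ _ ((l : ℚ) ^ (k * stepDim a f))

/-- The flag `h` arises from `f` by replacing the step between the `i`-th and `(i + 1)`-st graded
piece by one of its hyperplanes. -/
def Lowers (i : Fin (n - 1)) (f h : PartialFlag n F V) : Prop :=
  (∀ k, k ≠ (i : ℕ) + 1 → h.seq k = f.seq k) ∧ h.seq (i + 1) ≤ f.seq (i + 1) ∧
    finrank F (f.seq (i + 1)) = finrank F (h.seq (i + 1)) + 1

open Classical in
/-- The adjacency matrix of the relation `Lowers`. -/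
def kernLower (i : Fin (n - 1)) : Kern n F V := fun f h => if Lowers i f h then 1 else 0

open Classical in
theorem kernLower_apply (i : Fin (n - 1)) (f h : PartialFlag n F V) :
    (kernLower i : Kern n F V) f h = if Lowers i f h then 1 else 0 := rfl

/-- The kernel of `E_i`. -/
def kernE (l : ℕ) (i : Fin (n - 1)) : Kern n F V := (l : ℚ) • (kernH l (lft i) (-1) * kernLower i)

/-- The kernel of `F_i`. -/
def kernF (l : ℕ) (i : Fin (n - 1)) : Kern n F V :=
  (l : ℚ) • (kernH l (rgt i) (-1) * (kernLower i).transpose)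

/-- The uniform distribution on a subspace, as an idempotent of the group algebra. -/
def average (U : Submodule F V) : AddMonoidAlgebra ℚ V :=
  ((Nat.card U : ℚ))⁻¹ • ∑ u ∈ toFs (U : Set V), AddMonoidAlgebra.single u 1

/-- The kernel of `L`. -/
def kernL (F V : Type) [Field F] [AddCommGroup V] [Module F V] [Finite V] : Kern n F V :=
  diagonal fun f => average (f.seq 1)

open Classical in
theorem coeff_average (U : Submodule F V) (μ : V) :
    (average U).coeff μ = if μ ∈ U then (Nat.card U : ℚ)⁻¹ else 0 := by
  unfold average
  rw [AddMonoidAlgebra.coeff_smul_apply, AddMonoidAlgebra.coeff_sum, Finsupp.finsetSum_apply]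
  have h : ∀ u : V, ((AddMonoidAlgebra.single u 1 : AddMonoidAlgebra ℚ V).coeff) μ =
      if u = μ then 1 else 0 := by
    intro u
    rw [AddMonoidAlgebra.coeff_single, Finsupp.single_apply]
  simp only [h, Finset.sum_ite_eq', mem_toFs, SetLike.mem_coe]
  split_ifs <;> simp

open Classical in
theorem coeff_algebraMap (c : ℚ) (μ : V) :
    (algebraMap ℚ (AddMonoidAlgebra ℚ V) c).coeff μ = if μ = 0 then c else 0 := by
  rw [Algebra.algebraMap_eq_smul_one, AddMonoidAlgebra.coeff_smul_apply,
    AddMonoidAlgebra.one_def, AddMonoidAlgebra.coeff_single, Finsupp.single_apply]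
  simp [eq_comm]

open Classical in
theorem coeff_kernE (l : ℕ) (i : Fin (n - 1)) (f h : PartialFlag n F V) (μ : V) :
    (kernE l i f h).coeff μ =
      if Lowers i f h ∧ μ = 0 then (l : ℚ) * (l : ℚ) ^ (-stepDim (lft i) f) else 0 := by
  unfold kernE kernH
  rw [Matrix.smul_apply, diagonal_mul, AddMonoidAlgebra.coeff_smul_apply, kernLower_apply]
  by_cases hf : Lowers i f h
  · rw [if_pos hf, mul_one, coeff_algebraMap]
    simp [hf]
  · rw [if_neg hf, mul_zero, if_neg fun h => hf h.1]
    simp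

open Classical in
theorem coeff_kernF (l : ℕ) (i : Fin (n - 1)) (f h : PartialFlag n F V) (μ : V) :
    (kernF l i f h).coeff μ =
      if Lowers i h f ∧ μ = 0 then (l : ℚ) * (l : ℚ) ^ (-stepDim (rgt i) f) else 0 := by
  unfold kernF kernH
  rw [Matrix.smul_apply, diagonal_mul, AddMonoidAlgebra.coeff_smul_apply,
    Matrix.transpose_apply, kernLower_apply]
  by_cases hf : Lowers i h f
  · rw [if_pos hf, mul_one, coeff_algebraMap]
    simp [hf]
  · rw [if_neg hf, mul_zero, if_neg fun h => hf h.1]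
    simp

open Classical in
theorem coeff_diagonal (w : PartialFlag n F V → AddMonoidAlgebra ℚ V) (f h : PartialFlag n F V)
    (μ : V) : ((diagonal w : Kern n F V) f h).coeff μ =
      if f = h then (w f).coeff μ else 0 := by
  by_cases hfh : f = h
  · rw [hfh, diagonal_apply_eq, if_pos rfl]
  · rw [diagonal_apply_ne _ hfh, if_neg hfh]
    rfl

end Kernels

/-! ### Relative positions of the generators -/

section Positions

/-- The sum of the entries in the first `k` rows and outside of the first `k` columns. -/
def upperSum (A : Fin n → Fin n → ℤ) (k : ℕ) : ℤ :=
  ∑ x : Fin n × Fin n, if (x.1 : ℕ) < k ∧ k ≤ (x.2 : ℕ) then A x.1 x.2 else 0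

theorem DecMat.lower_eq_upperSum (M : DecMat n) (k : ℕ) :
    M.lower k = upperSum (fun a b => M.mat b a) k := by
  rw [M.lower_eq]
  exact (Equiv.prodComm (Fin n) (Fin n)).sum_comp (fun x : Fin n × Fin n =>
    if (x.1 : ℕ) < k ∧ k ≤ (x.2 : ℕ) then M.mat x.2 x.1 else 0)

variable {A : Fin n → Fin n → ℤ}

theorem le_upperSum (hA : ∀ a b, a ≠ b → 0 ≤ A a b) {a b : Fin n} {k : ℕ} (h1 : (a : ℕ) < k) (h2 : k ≤ (b : ℕ)) :
    A a b ≤ upperSum A k := by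
  have h := single_le_sum (s := Finset.univ) (a := (a, b))
    (f := fun x : Fin n × Fin n => if (x.1 : ℕ) < k ∧ k ≤ (x.2 : ℕ) then A x.1 x.2 else 0)
    (fun x _ => by grind) (mem_univ _)
  simp only at h
  rwa [if_pos ⟨h1, h2⟩] at h

theorem upperSum_eq_zero_iff (hA : ∀ a b, a ≠ b → 0 ≤ A a b) :
    (∀ k, k ≤ n → upperSum A k = 0) ↔ ∀ a b, a < b → A a b = 0 := by
  constructor
  · intro h a b hab
    have hab' : (a : ℕ) < b := hab
    exact le_antisymm ((le_upperSum hA hab' le_rfl).trans (h b b.2.le).le) (hA a b hab.ne)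
  · intro h k _
    refine sum_eq_zero fun x _ => ?_
    split_ifs with hx
    · exact h _ _ (Fin.lt_def.2 (by omega))
    · rfl

theorem upperSum_eq_single_iff (hA : ∀ a b, a ≠ b → 0 ≤ A a b) (i : Fin (n - 1)) :
    (∀ k, k ≤ n → upperSum A k = if k = (i : ℕ) + 1 then 1 else 0) ↔
      ∀ a b, a < b → A a b = if lft i = a ∧ rgt i = b then 1 else 0 := by
  have hsum : ∀ k, (∀ a b, a < b → ¬ (lft i = a ∧ rgt i = b) → A a b = 0) →
      upperSum A k = if k = (i : ℕ) + 1 then A (lft i) (rgt i) else 0 := by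
    intro k h
    unfold upperSum
    rw [sum_eq_single (lft i, rgt i)]
    · simp only [lft, rgt]
      split_ifs <;> first | rfl | omega
    · grind
    · simp
  constructor
  · intro h
    have hz : ∀ a b, a < b → ¬ (lft i = a ∧ rgt i = b) → A a b = 0 := by
      intro a b hab hne
      have hab' : (a : ℕ) < b := hab
      have hne' : ¬ ((i : ℕ) = a ∧ (i : ℕ) + 1 = b) := fun hcon =>
        hne ⟨Fin.ext hcon.1, Fin.ext hcon.2⟩
      have hb := b.2
      by_cases ha : (i : ℕ) = a
      · have h1 := le_upperSum hA hab' le_rfl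
        rw [h b hb.le, if_neg (by omega)] at h1
        exact le_antisymm h1 (hA a b hab.ne)
      · have h1 := le_upperSum hA (Nat.lt_succ_self a) (Nat.succ_le_of_lt hab')
        rw [h _ (by omega), if_neg (by omega)] at h1
        exact le_antisymm h1 (hA a b hab.ne)
    intro a b hab
    split_ifs with hc
    · have h1 := hsum (i + 1) hz
      have hi := i.2
      rw [h _ (by omega), if_pos rfl, if_pos rfl] at h1
      rw [← hc.1, ← hc.2, ← h1]
    · exact hz a b hab hc
  · intro h k _
    have hlt : lft i < rgt i := Fin.lt_def.2 (Nat.lt_succ_self _)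
    rw [hsum k fun a b hab hne => by rw [h a b hab, if_neg hne], h _ _ hlt]
    simp only [and_self, if_true]

theorem exists_add_diagonal_iff {M : DecMat n} {D : Matrix (Fin n) (Fin n) ℤ}  :
    (∃ z, M.mat = D + diagonal z) ↔ ∀ a b, a ≠ b → M.mat a b = D a b := by
  constructor
  · rintro ⟨z, hz⟩ a b hab
    rw [hz, Matrix.add_apply, diagonal_apply_ne _ hab, add_zero]
  · intro h
    refine ⟨fun a => M.mat a a - D a a, ?_⟩
    ext a b
    rw [Matrix.add_apply, diagonal_apply]
    split_ifs with hab
    · rw [hab]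
      ring
    · rw [add_zero, h a b hab]

variable {F V : Type} [Field F] [AddCommGroup V] [Module F V] [FiniteDimensional F V]
variable {M : DecMat n} {p : ℕ} {f h : PartialFlag n F V} {μ : V}

theorem HasPosition.lowers_iff_sums (ht : HasPosition (M.shift p) (f, h, μ)) (i : Fin (n - 1)) :
    Lowers i f h ↔ (∀ k, k ≤ n → M.upper k = if k = (i : ℕ) + 1 then 1 else 0) ∧
      ∀ k, k ≤ n → M.lower k = 0 := by
  constructor
  · rintro ⟨h1, h2, h3⟩
    constructor
    · intro k hk
      split_ifs with hki
      · rw [ht.upper_eq hk, hki, inf_eq_right.2 h2, h3]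
        push_cast
        ring
      · rw [ht.upper_eq_zero_iff hk, h1 k hki]
    · intro k hk
      rw [ht.lower_eq_zero_iff hk]
      by_cases hki : k = (i : ℕ) + 1
      · rw [hki]
        exact h2
      · rw [h1 k hki]
  · rintro ⟨h1, h2⟩
    have hi : (i : ℕ) + 1 ≤ n := by omega
    refine ⟨fun k hk => ?_, (ht.lower_eq_zero_iff hi).1 (h2 _ hi), ?_⟩
    · rcases le_or_gt k n with hkn | hkn
      · exact le_antisymm ((ht.lower_eq_zero_iff hkn).1 (h2 k hkn))
          ((ht.upper_eq_zero_iff hkn).1 ((h1 k hkn).trans (if_neg hk)))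
      · rw [f.seq_of_le hkn.le, h.seq_of_le hkn.le]
    · have h3 := h1 _ hi
      rw [if_pos rfl, ht.upper_eq hi, inf_eq_right.2 ((ht.lower_eq_zero_iff hi).1 (h2 _ hi))] at h3
      omega

theorem HasPosition.raises_iff_sums (ht : HasPosition (M.shift p) (f, h, μ)) (i : Fin (n - 1)) :
    Lowers i h f ↔ (∀ k, k ≤ n → M.lower k = if k = (i : ℕ) + 1 then 1 else 0) ∧
      ∀ k, k ≤ n → M.upper k = 0 := by
  constructor
  · rintro ⟨h1, h2, h3⟩
    constructor
    · intro k hk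
      split_ifs with hki
      · rw [ht.lower_eq hk, hki, inf_eq_left.2 h2, h3]
        push_cast
        ring
      · rw [ht.lower_eq_zero_iff hk, h1 k hki]
    · intro k hk
      rw [ht.upper_eq_zero_iff hk]
      by_cases hki : k = (i : ℕ) + 1
      · rw [hki]
        exact h2
      · rw [h1 k hki]
  · rintro ⟨h1, h2⟩
    have hi : (i : ℕ) + 1 ≤ n := by omega
    refine ⟨fun k hk => ?_, (ht.upper_eq_zero_iff hi).1 (h2 _ hi), ?_⟩
    · rcases le_or_gt k n with hkn | hkn
      · exact le_antisymm ((ht.upper_eq_zero_iff hkn).1 (h2 k hkn))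
          ((ht.lower_eq_zero_iff hkn).1 ((h1 k hkn).trans (if_neg hk)))
      · rw [f.seq_of_le hkn.le, h.seq_of_le hkn.le]
    · have h3 := h1 _ hi
      rw [if_pos rfl, ht.lower_eq hi, inf_eq_left.2 ((ht.upper_eq_zero_iff hi).1 (h2 _ hi))] at h3
      omega

theorem HasPosition.lowers_iff (ht : HasPosition (M.shift p) (f, h, μ)) (i : Fin (n - 1)) :
    Lowers i f h ↔ ∃ z, M.mat = (DecMat.unit (lft i) (rgt i)).mat + diagonal z := by
  have hlt : lft i < rgt i := Fin.lt_def.2 (Nat.lt_succ_self _)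
  rw [ht.lowers_iff_sums, exists_add_diagonal_iff]
  simp only [M.lower_eq_upperSum, M.upper_eq]
  rw [upperSum_eq_zero_iff fun a b hab => M.nonneg b a hab.symm]
  change (∀ k, k ≤ n → upperSum M.mat k = _) ∧ _ ↔ _
  rw [upperSum_eq_single_iff fun a b hab => M.nonneg a b hab]
  simp only [DecMat.unit, single_apply]
  constructor
  · grind
  · grind

theorem HasPosition.raises_iff (ht : HasPosition (M.shift p) (f, h, μ)) (i : Fin (n - 1)) :
    Lowers i h f ↔ ∃ z, M.mat = (DecMat.unit (rgt i) (lft i)).mat + diagonal z := by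
  have hlt : lft i < rgt i := Fin.lt_def.2 (Nat.lt_succ_self _)
  rw [ht.raises_iff_sums, exists_add_diagonal_iff]
  simp only [M.lower_eq_upperSum, M.upper_eq]
  rw [upperSum_eq_single_iff fun a b hab => M.nonneg b a hab.symm]
  change _ ∧ (∀ k, k ≤ n → upperSum M.mat k = 0) ↔ _
  rw [upperSum_eq_zero_iff fun a b hab => M.nonneg a b hab]
  simp only [DecMat.unit, single_apply]
  constructor
  · grind
  · grind

theorem HasPosition.flags_eq_iff_diagonal (ht : HasPosition (M.shift p) (f, h, μ)) :
    f = h ↔ ∃ z, M.mat = 0 + diagonal z := by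
  rw [ht.flags_eq_iff, exists_add_diagonal_iff]
  rfl

theorem HasPosition.stepDim_eq (ht : HasPosition (M.shift p) (f, h, μ)) (a : Fin n) :
    stepDim a f = M.ro a + p := by
  rw [ht.ro_eq, stepDim]
  ring

theorem HasPosition.dec_eq_zeroDec_iff [NeZero n] (ht : HasPosition (M.shift p) (f, f, μ)) :
    M.dec = {(0, 0)} ↔ μ ∈ f.seq 1 ∧ μ ≠ 0 := by
  have hval : ((0 : Fin n) : ℕ) = 0 := rfl
  have hB : ∀ a b : ℕ, M.Below a b ↔ μ ∉ f.seq (max a b) := by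
    intro a b
    rw [← DecMat.below_shift p, ← ht.2 a b]
    change μ ∉ f.seq a ⊔ f.seq b ↔ _
    rcases le_total a b with hab | hab
    · rw [max_eq_right hab, sup_eq_right.2 (f.seq_mono hab)]
    · rw [max_eq_left hab, sup_eq_left.2 (f.seq_mono hab)]
  constructor
  · intro hd
    constructor
    · by_contra hμ
      have h1 := (hB 1 1).2 hμ
      obtain ⟨x, hx, h2, h3⟩ := h1
      rw [hd, mem_singleton] at hx
      subst hx
      simp at h2
    · rintro rfl
      exact (hB 0 0).1 ⟨(0, 0), by rw [hd]; exact Finset.mem_singleton_self _, le_rfl, le_rfl⟩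
        (Submodule.zero_mem _)
  · rintro ⟨h1, h2⟩
    have key : ∀ x ∈ M.dec, x = (0, 0) := by
      intro x hx
      have h3 := (hB x.1 x.2).1 ⟨x, hx, le_rfl, le_rfl⟩
      have h4 : max (x.1 : ℕ) x.2 = 0 := by
        by_contra hcon
        exact h3 (f.seq_mono (Nat.one_le_iff_ne_zero.2 hcon) h1)
      exact Prod.ext (Fin.ext (by rw [hval]; omega)) (Fin.ext (by rw [hval]; omega))
    refine Finset.eq_singleton_iff_unique_mem.2 ⟨?_, key⟩
    have h5 : M.Below 0 0 := (hB 0 0).2 (by rwa [max_self, f.seq_zero, Submodule.mem_bot])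
    obtain ⟨x, hx, -, -⟩ := h5
    rwa [key x hx] at hx

end Positions

section NormExp

variable {M : DecMat n} {z : Fin n → ℤ}

theorem sum_single_mul (i j : Fin n) (g : Fin n → Fin n → ℤ) :
    ∑ a, ∑ b, (single i j (1 : ℤ)) a b * g a b = g i j := by
  rw [sum_eq_single i, sum_eq_single j]
  · simp
  · grind
  · simp
  · intro a _ ha
    refine sum_eq_zero fun b _ => ?_
    rw [single_apply, if_neg fun h => ha h.1.symm, zero_mul]
  · simp

theorem normExp_single_add_diagonal {i j : Fin n} (hd : M.dec = ∅)
    (hM : M.mat = single i j 1 + diagonal z) :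
    M.normExp = -((∑ a, if ¬ i < a ∧ j < a then z a else 0) +
      ∑ a, if ¬ a < i ∧ a < j then z a else 0) := by
  have hdec : (∑ i, ∑ j, if ∃ x ∈ M.dec, i ≤ x.1 ∧ j ≤ x.2 then M.mat i j else 0) = 0 := by
    rw [hd]
    simp
  rw [M.normExp_eq, hdec, add_zero]
  congr 1
  have key : ∀ a b c d : Fin n, (if ¬ a < c ∧ b < d then M.mat a b * M.mat c d else 0) =
      (single i j (1 : ℤ)) a b *
        (if ¬ a < c ∧ b < d then (diagonal z : Matrix (Fin n) (Fin n) ℤ) c d else 0) +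
      (single i j (1 : ℤ)) c d *
        (if ¬ a < c ∧ b < d then (diagonal z : Matrix (Fin n) (Fin n) ℤ) a b else 0) := by
    intro a b c d
    split_ifs with h
    · have h1 : (single i j (1 : ℤ)) a b * (single i j (1 : ℤ)) c d = 0 := by grind
      have h2 : (diagonal z : Matrix (Fin n) (Fin n) ℤ) a b *
          (diagonal z : Matrix (Fin n) (Fin n) ℤ) c d = 0 := by
        rw [diagonal_apply, diagonal_apply]
        split_ifs with h2 h3
        · grind
        all_goals simp
      rw [hM, Matrix.add_apply, Matrix.add_apply]
      linear_combination h1 + h2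
    · simp
  have hdiag : ∀ g : Fin n → Fin n → Prop, ∀ [∀ a b, Decidable (g a b)],
      (∑ c, ∑ d, if g c d then (diagonal z : Matrix (Fin n) (Fin n) ℤ) c d else 0) =
        ∑ a, if g a a then z a else 0 := by
    intro g _
    refine sum_congr rfl fun c _ => ?_
    rw [sum_eq_single c]
    · rw [diagonal_apply_eq]
    · intro d _ hdc
      rw [diagonal_apply_ne _ (Ne.symm hdc)]
      simp
    · simp
  simp only [key, sum_add_distrib]
  congr 1
  · simp only [← mul_sum, hdiag]
    exact sum_single_mul i j fun a b => ∑ c, if ¬ a < c ∧ b < c then z c else 0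
  · have hc : ∀ a b : Fin n, (∑ c, ∑ d, (single i j (1 : ℤ)) c d *
        (if ¬ a < c ∧ b < d then (diagonal z : Matrix (Fin n) (Fin n) ℤ) a b else 0)) =
        if ¬ a < i ∧ b < j then (diagonal z : Matrix (Fin n) (Fin n) ℤ) a b else 0 :=
      fun a b => sum_single_mul i j fun c d => if ¬ a < c ∧ b < d then
        (diagonal z : Matrix (Fin n) (Fin n) ℤ) a b else 0
    simp only [hc, hdiag]

theorem normExp_unit_lower (i : Fin (n - 1)) (hd : M.dec = ∅)
    (hM : M.mat = (DecMat.unit (lft i) (rgt i)).mat + diagonal z) :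
    M.normExp = -z (lft i) := by
  rw [normExp_single_add_diagonal hd hM, neg_inj]
  rw [sum_eq_zero, zero_add, sum_eq_single (lft i)]
  · rw [if_pos]
    exact ⟨lt_irrefl _, Fin.lt_def.2 (Nat.lt_succ_self _)⟩
  · intro a _ ha
    have ha' : (a : ℕ) ≠ i := fun h => ha (Fin.ext h)
    rw [if_neg]
    simp only [Fin.lt_def, lft, rgt]
    omega
  · simp
  · intro a _
    rw [if_neg]
    simp only [Fin.lt_def, lft, rgt]
    omega

theorem normExp_unit_raise (i : Fin (n - 1)) (hd : M.dec = ∅)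
    (hM : M.mat = (DecMat.unit (rgt i) (lft i)).mat + diagonal z) :
    M.normExp = -z (rgt i) := by
  rw [normExp_single_add_diagonal hd hM, neg_inj]
  rw [add_comm, sum_eq_zero, zero_add, sum_eq_single (rgt i)]
  · rw [if_pos]
    exact ⟨lt_irrefl _, Fin.lt_def.2 (Nat.lt_succ_self _)⟩
  · intro a _ ha
    have ha' : (a : ℕ) ≠ i + 1 := fun h => ha (Fin.ext h)
    rw [if_neg]
    simp only [Fin.lt_def, lft, rgt]
    omega
  · simp
  · intro a _
    rw [if_neg]
    simp only [Fin.lt_def, lft, rgt]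
    omega

theorem normExp_zeroDec [NeZero n] (hd : M.dec = {(0, 0)}) (hM : M.mat = diagonal z) :
    M.normExp = -z 0 := by
  have h1 : ∀ i j k l : Fin n, (if ¬ i < k ∧ j < l then M.mat i j * M.mat k l else 0) = 0 := by
    intro i j k l
    rw [hM, diagonal_apply, diagonal_apply]
    split_ifs with h h2 h3
    · rw [h2, h3] at h
      exact absurd h.2 h.1
    all_goals simp
  rw [M.normExp_eq]
  simp only [h1, Finset.sum_const_zero, zero_add]
  rw [hd, hM, neg_inj, sum_eq_single 0, sum_eq_single 0]
  · simp
  · grind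
  · simp
  · intro i _ hi
    refine sum_eq_zero fun j _ => if_neg ?_
    rintro ⟨x, hx, h2, -⟩
    rw [Finset.mem_singleton.1 hx] at h2
    exact hi (Fin.ext (Nat.le_zero.1 h2))
  · simp

theorem shift_mat_eq {D : Matrix (Fin n) (Fin n) ℤ} (hM : M.mat = D + diagonal z) (p : ℕ) :
    (M.shift p).mat = D + diagonal fun i => z i + p := by
  change M.mat + _ = _
  rw [hM, add_assoc, Matrix.diagonal_add]

end NormExp

end Generators

/-! ### Realization of the generators -/

section RealizedGenerators

variable {n : ℕ}

theorem natCast_ne_zero_of_two_le {l : ℕ} (hl : 2 ≤ l) : (l : ℚ) ≠ 0 := by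
  have : l ≠ 0 := by omega
  exact_mod_cast this

theorem DecMat.ro_of_mat_eq {M : DecMat n} {D : Matrix (Fin n) (Fin n) ℤ} {z : Fin n → ℤ}
    (hM : M.mat = D + diagonal z) (a : Fin n) : M.ro a = (∑ b, D a b) + z a := by
  unfold ro
  rw [hM, ← sub_eq_iff_eq_add', ← sum_sub_distrib, sum_eq_single a]
  · simp
  · intro b _ hb
    rw [Matrix.add_apply, diagonal_apply_ne _ (Ne.symm hb)]
    ring
  · simp

theorem sum_mul_piSingle (g : Fin n → ℤ) (a : Fin n) (k : ℤ) :
    ∑ i, g i * (Pi.single a k : Fin n → ℤ) i = g a * k := by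
  rw [sum_eq_single a (fun b _ hb => by rw [Pi.single_eq_of_ne hb, mul_zero]) (by simp),
    Pi.single_eq_same]

theorem realizes_kernE (i : Fin (n - 1)) :
    Realizes (fun _ l _ _ _ _ _ _ _ => kernE l i) (KAlg.toKHat.symm (eltE i)) := by
  refine realizes_diagSum ?_ ?_
  · intro M z hd hM p l F V _ _ _ _ _ hl _ f h μ ht
    have hl0 := natCast_ne_zero_of_two_le hl
    have hsum : ∑ b, (DecMat.unit (lft i) (rgt i)).mat (lft i) b = 1 := by
      simp [DecMat.unit, single_apply]
    rw [coeff_kernE, if_pos ⟨(ht.lowers_iff i).2 ⟨z, hM⟩, ht.vec_eq_zero_iff.2 hd⟩,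
      normExp_unit_lower i (M := M.shift p) hd (shift_mat_eq hM p), ht.stepDim_eq,
      DecMat.ro_of_mat_eq hM, hsum, ← zpow_one_add₀ hl0]
    congr 1
    simp only [Pi.zero_apply, mul_zero, Finset.sum_const_zero]
    ring
  · intro M hM p l F V _ _ _ _ _ hl _ f h μ ht
    rw [coeff_kernE, if_neg]
    rintro ⟨h1, h2⟩
    exact hM ⟨ht.vec_eq_zero_iff.1 h2, (ht.lowers_iff i).1 h1⟩

theorem realizes_kernF (i : Fin (n - 1)) :
    Realizes (fun _ l _ _ _ _ _ _ _ => kernF l i) (KAlg.toKHat.symm (eltF i)) := by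
  refine realizes_diagSum ?_ ?_
  · intro M z hd hM p l F V _ _ _ _ _ hl _ f h μ ht
    have hl0 := natCast_ne_zero_of_two_le hl
    have hsum : ∑ b, (DecMat.unit (rgt i) (lft i)).mat (rgt i) b = 1 := by
      simp [DecMat.unit, single_apply]
    rw [coeff_kernF, if_pos ⟨(ht.raises_iff i).2 ⟨z, hM⟩, ht.vec_eq_zero_iff.2 hd⟩,
      normExp_unit_raise i (M := M.shift p) hd (shift_mat_eq hM p), ht.stepDim_eq,
      DecMat.ro_of_mat_eq hM, hsum, ← zpow_one_add₀ hl0]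
    congr 1
    simp only [Pi.zero_apply, mul_zero, Finset.sum_const_zero]
    ring
  · intro M hM p l F V _ _ _ _ _ hl _ f h μ ht
    rw [coeff_kernF, if_neg]
    rintro ⟨h1, h2⟩
    exact hM ⟨ht.vec_eq_zero_iff.1 h2, (ht.raises_iff i).1 h1⟩

theorem eq_diag {M : DecMat n} {z : Fin n → ℤ} (hd : M.dec = ∅)
    (hM : M.mat = 0 + diagonal z) : M = DecMat.diag z :=
  DecMat.ext_mat (by rw [hM, zero_add]; rfl) hd

theorem realizes_kernH (a : Fin n) (k : ℤ) :
    Realizes (fun _ l _ _ _ _ _ _ _ => kernH l a k)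
      (KAlg.toKHat.symm (diagSum (DecMat.zero n) (Pi.single a k))) := by
  classical
  refine realizes_diagSum ?_ ?_
  · intro M z hd hM p l F V _ _ _ _ _ hl _ f h μ ht
    obtain rfl := eq_diag hd hM
    rw [kernH, coeff_diagonal, if_pos (ht.flags_eq_iff_diagonal.2 ⟨z, hM⟩), coeff_algebraMap,
      if_pos (ht.vec_eq_zero_iff.2 hd), ht.stepDim_eq, DecMat.ro_diag, DecMat.shift_diag,
      DecMat.normExp_diag, zero_add]
    congr 1
    rw [sum_mul_piSingle fun i => z i + p, mul_comm]
  · intro M hM p l F V _ _ _ _ _ hl _ f h μ ht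
    rw [kernH, coeff_diagonal]
    split_ifs with h1
    · rw [coeff_algebraMap, if_neg]
      intro h2
      exact hM ⟨ht.vec_eq_zero_iff.1 h2, ht.flags_eq_iff_diagonal.1 h1⟩
    · rfl

variable [NeZero n]

theorem card_seq_one {F V : Type} [Field F] [Finite F] [AddCommGroup V] [Module F V] [Finite V]
    {l : ℕ} (hF : Nat.card F = l ^ 2) (f : PartialFlag n F V) :
    (Nat.card (f.seq 1) : ℚ)⁻¹ = (l : ℚ) ^ (-2 * stepDim (0 : Fin n) f) := by
  have h0 : ((0 : Fin n) : ℕ) = 0 := rfl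
  rw [stepDim, h0, f.seq_zero, finrank_bot, Nat.cast_zero, sub_zero, zero_add,
    Module.natCard_eq_pow_finrank (K := F), hF, neg_mul, zpow_neg, ← pow_mul]
  congr 1
  exact_mod_cast rfl

/-- The two summands of `L` come from the zero vector and the nonzero vectors of the first step. -/
theorem realizes_kernL :
    Realizes (fun _ _ F V _ _ _ _ _ => kernL F V) (KAlg.toKHat.symm (eltL n)) := by
  classical
  have h1 := realizes_kernH (0 : Fin n) (-2)
  have h2 : Realizes (fun _ l F V _ _ _ _ _ => kernL F V - kernH l 0 (-2))
      (KAlg.toKHat.symm (diagSum (DecMat.zeroDec n) (Pi.single 0 (-1)))) := by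
    have hc : ∀ (l : ℕ) (F V : Type) [Field F] [Finite F] [AddCommGroup V] [Module F V] [Finite V],
        Nat.card F = l ^ 2 → ∀ (f h : PartialFlag n F V) (μ : V),
        ((kernL F V - kernH l 0 (-2) : Kern n F V) f h).coeff μ =
          if f = h ∧ μ ∈ f.seq 1 ∧ μ ≠ 0 then (l : ℚ) ^ (-2 * stepDim 0 f) else 0 := by
      intro l F V _ _ _ _ _ hF f h μ
      rw [kernL, kernH, Matrix.diagonal_sub, coeff_diagonal]
      change (if f = h then (average (f.seq 1)).coeff μ -
        (algebraMap ℚ (AddMonoidAlgebra ℚ V) ((l : ℚ) ^ (-2 * stepDim (0 : Fin n) f))).coeff μ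
        else 0) = _
      rw [coeff_average, coeff_algebraMap, card_seq_one hF]
      by_cases hfh : f = h
      · by_cases hμ : μ = 0
        · simp [hfh, hμ]
        · simp [hfh, hμ]
      · simp [hfh]
    refine realizes_diagSum ?_ ?_
    · intro M z hd hM p l F V _ _ _ _ _ hl hF f h μ ht
      have hM' : (M.shift p).mat = diagonal fun i => z i + p :=
        (shift_mat_eq hM p).trans (zero_add _)
      obtain rfl := ht.flags_eq_iff_diagonal.2 ⟨z, hM⟩
      rw [hc l F V hF, if_pos ⟨rfl, ht.dec_eq_zeroDec_iff.1 hd⟩, ht.stepDim_eq,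
        DecMat.ro_of_mat_eq hM, normExp_zeroDec (M := M.shift p) hd hM',
        sum_mul_piSingle fun i => z i + p]
      congr 1
      have h0 : ∑ b, (DecMat.zeroDec n).mat 0 b = 0 := sum_eq_zero fun _ _ => rfl
      rw [h0]
      ring
    · intro M hM p l F V _ _ _ _ _ hl hF f h μ ht
      rw [hc l F V hF, if_neg]
      rintro ⟨rfl, h2⟩
      exact hM ⟨ht.dec_eq_zeroDec_iff.2 h2, ht.flags_eq_iff_diagonal.1 rfl⟩
  have h3 := h1.add h2
  simp only [add_sub_cancel] at h3
  exact h3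

end RealizedGenerators

/-! ### Products of step kernels -/

section StepKernels

variable {n : ℕ} {F V : Type} [Field F] [AddCommGroup V] [Module F V]

/-- The flag with the step `i + 1` replaced by `U`, if `U` lies between the neighbouring steps. -/
def PartialFlag.setStep (f : PartialFlag n F V) (i : Fin (n - 1)) (U : Submodule F V) :
    PartialFlag n F V :=
  (stepInsertion (N := n) i i (i + 2) (by omega) le_rfl (by omega) (by omega) (by omega)
    le_rfl).build f U

theorem PartialFlag.seq_setStep_of_ne (f : PartialFlag n F V) {i : Fin (n - 1)} (U : Submodule F V)
    {k : ℕ} (hk : k ≠ i + 1) : (f.setStep i U).seq k = f.seq k :=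
  Insertion.seq_build_of_ne _ f U hk

theorem PartialFlag.seq_setStep_self (f : PartialFlag n F V) {i : Fin (n - 1)} {U : Submodule F V}
    (h1 : f.seq i ≤ U) (h2 : U ≤ f.seq (i + 2)) : (f.setStep i U).seq (i + 1) = U :=
  Insertion.seq_build_self (stepInsertion (N := n) i i (i + 2) (by omega) le_rfl (by omega)
    (by omega) (by omega) le_rfl) f h1 h2

/-- The two flags differ at most in the step `i + 1`, and these steps are related by `p`. -/
def StepRel (i : Fin (n - 1)) (p : Submodule F V → Submodule F V → Prop)
    (f h : PartialFlag n F V) : Prop :=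
  (∀ k, k ≠ (i : ℕ) + 1 → h.seq k = f.seq k) ∧ p (f.seq (i + 1)) (h.seq (i + 1))

/-- The two flags differ at most in the steps `i + 1` and `j + 1`, and these steps are related by
`p` and `r`. -/
def TwoStepRel (i : Fin (n - 1)) (p : Submodule F V → Submodule F V → Prop) (j : Fin (n - 1))
    (r : Submodule F V → Submodule F V → Prop) (f h : PartialFlag n F V) : Prop :=
  (∀ k, k ≠ (i : ℕ) + 1 → k ≠ (j : ℕ) + 1 → h.seq k = f.seq k) ∧
    p (f.seq (i + 1)) (h.seq (i + 1)) ∧ r (f.seq (j + 1)) (h.seq (j + 1))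

open Classical in
/-- The adjacency matrix of a relation between flags. -/
def relKern (A : PartialFlag n F V → PartialFlag n F V → Prop) : Kern n F V :=
  fun f h => if A f h then 1 else 0

open Classical in
theorem relKern_apply (A : PartialFlag n F V → PartialFlag n F V → Prop)
    (f h : PartialFlag n F V) : relKern A f h = if A f h then 1 else 0 := rfl

variable {p r : Submodule F V → Submodule F V → Prop} {i j : Fin (n - 1)}

theorem transpose_relKern_stepRel :
    (relKern (StepRel i p)).transpose = relKern (StepRel i fun A B => p B A) := by
  classical
  ext1 f h
  rw [Matrix.transpose_apply, relKern_apply, relKern_apply]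
  refine if_congr (and_congr ⟨fun h k hk => (h k hk).symm, fun h k hk => (h k hk).symm⟩
    Iff.rfl) rfl rfl

variable [Finite V]

theorem mul_stepKern_apply (M : Kern n F V) (f h : PartialFlag n F V) :
    (M * relKern (StepRel i p)) f h =
      ∑ U ∈ toFs {U : Submodule F V | (h.seq i ≤ U ∧ U ≤ h.seq (i + 2)) ∧ p U (h.seq (i + 1))},
        M f (h.setStep i U) := by
  classical
  rw [Matrix.mul_apply]
  simp only [relKern_apply, mul_ite, mul_one, mul_zero]
  rw [← sum_filter]
  refine Finset.sum_nbij' (fun k => k.seq (i + 1)) (fun U => h.setStep i U) ?_ ?_ ?_ ?_ ?_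
  · intro k hk
    obtain ⟨h1, h2⟩ := (Finset.mem_filter.1 hk).2
    refine mem_toFs.2 ⟨⟨?_, ?_⟩, h2⟩
    · rw [h1 _ (by omega)]
      exact k.seq_mono (by omega)
    · rw [h1 _ (by omega)]
      exact k.seq_mono (by omega)
  · intro U hU
    obtain ⟨⟨h1, h2⟩, h3⟩ := mem_toFs.1 hU
    refine Finset.mem_filter.2 ⟨mem_univ _, fun k hk => ?_, ?_⟩
    · rw [h.seq_setStep_of_ne U hk]
    · rwa [h.seq_setStep_self h1 h2]
  · intro k hk
    obtain ⟨h1, h2⟩ := (Finset.mem_filter.1 hk).2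
    refine PartialFlag.ext_seq fun m => ?_
    by_cases hm : m = (i : ℕ) + 1
    · rw [hm, h.seq_setStep_self]
      · rw [h1 _ (by omega)]
        exact k.seq_mono (by omega)
      · rw [h1 _ (by omega)]
        exact k.seq_mono (by omega)
    · rw [h.seq_setStep_of_ne _ hm, h1 m hm]
  · intro U hU
    obtain ⟨⟨h1, h2⟩, h3⟩ := mem_toFs.1 hU
    exact h.seq_setStep_self h1 h2
  · intro k hk
    obtain ⟨h1, h2⟩ := (Finset.mem_filter.1 hk).2
    congr 1
    refine PartialFlag.ext_seq fun m => ?_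
    by_cases hm : m = (i : ℕ) + 1
    · rw [hm, h.seq_setStep_self]
      · rw [h1 _ (by omega)]
        exact k.seq_mono (by omega)
      · rw [h1 _ (by omega)]
        exact k.seq_mono (by omega)
    · rw [h.seq_setStep_of_ne _ hm, h1 m hm]

/-- Products with step kernels count subspaces. -/
theorem relKern_mul_stepKern_apply (A : PartialFlag n F V → PartialFlag n F V → Prop)
    (f h : PartialFlag n F V) :
    (relKern A * relKern (StepRel i p)) f h =
      ((toFs {U : Submodule F V | ((h.seq i ≤ U ∧ U ≤ h.seq (i + 2)) ∧ p U (h.seq (i + 1))) ∧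
        A f (h.setStep i U)}).card : AddMonoidAlgebra ℚ V) := by
  classical
  rw [mul_stepKern_apply]
  simp only [relKern_apply]
  rw [Finset.sum_boole]
  congr 2
  ext U
  simp only [mem_filter, mem_toFs, Set.mem_ofPred_eq]

theorem stepKern_mul_relKern_apply (A : PartialFlag n F V → PartialFlag n F V → Prop)
    (f h : PartialFlag n F V) :
    (relKern (StepRel i p) * relKern A) f h =
      ((toFs {U : Submodule F V | ((f.seq i ≤ U ∧ U ≤ f.seq (i + 2)) ∧ p (f.seq (i + 1)) U) ∧
        A (f.setStep i U) h}).card : AddMonoidAlgebra ℚ V) := by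
  rw [← Matrix.transpose_apply (relKern (StepRel i p) * relKern A), transpose_mul,
    transpose_relKern_stepRel]
  exact relKern_mul_stepKern_apply (fun h f => A f h) h f

theorem stepKern_mul_self_apply (f h : PartialFlag n F V) :
    (relKern (StepRel i p) * relKern (StepRel i r)) f h =
      ((toFs {U : Submodule F V | ((h.seq i ≤ U ∧ U ≤ h.seq (i + 2)) ∧ r U (h.seq (i + 1))) ∧
        StepRel i (fun _ _ => p (f.seq (i + 1)) U) f h}).card : AddMonoidAlgebra ℚ V) := by
  rw [relKern_mul_stepKern_apply]
  congr 2
  ext U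
  simp only [mem_toFs, Set.mem_ofPred_eq]
  refine and_congr_right fun ⟨⟨h1, h2⟩, h3⟩ => ?_
  rw [StepRel, StepRel, h.seq_setStep_self h1 h2]
  refine and_congr_left fun _ => forall₂_congr fun k hk => ?_
  rw [h.seq_setStep_of_ne U hk]

theorem stepKern_mul_of_ne (hij : i ≠ j) :
    (relKern (StepRel i p) * relKern (StepRel j r) : Kern n F V) =
      relKern fun f h => TwoStepRel i p j r f h ∧ h.seq j ≤ f.seq (j + 1) ∧
        f.seq (j + 1) ≤ h.seq (j + 2) := by
  classical
  have hij' : (i : ℕ) ≠ j := fun h => hij (Fin.ext h)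
  ext1 f h
  rw [relKern_mul_stepKern_apply, relKern_apply]
  have key : ∀ U : Submodule F V,
      (((h.seq j ≤ U ∧ U ≤ h.seq (j + 2)) ∧ r U (h.seq (j + 1))) ∧
        StepRel i p f (h.setStep j U)) ↔ U = f.seq (j + 1) ∧ TwoStepRel i p j r f h ∧
          h.seq j ≤ f.seq (j + 1) ∧ f.seq (j + 1) ≤ h.seq (j + 2) := by
    intro U
    constructor
    · rintro ⟨⟨⟨h1, h2⟩, h3⟩, h4, h5⟩
      have hU : U = f.seq (j + 1) := by rw [← h4 (j + 1) (by omega), h.seq_setStep_self h1 h2]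
      rw [h.seq_setStep_of_ne U (by omega)] at h5
      subst hU
      refine ⟨rfl, ⟨fun k hk hk' => ?_, h5, h3⟩, h1, h2⟩
      rw [← h4 k hk, h.seq_setStep_of_ne _ hk']
    · rintro ⟨rfl, ⟨h1, h2, h3⟩, h4, h5⟩
      refine ⟨⟨⟨h4, h5⟩, h3⟩, fun k hk => ?_, ?_⟩
      · by_cases hk' : k = (j : ℕ) + 1
        · rw [hk', h.seq_setStep_self h4 h5]
        · rw [h.seq_setStep_of_ne _ hk', h1 k hk hk']
      · rwa [h.seq_setStep_of_ne _ (by omega)]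
  simp only [key]
  split_ifs with hc
  · rw [show toFs {U : Submodule F V | U = f.seq (j + 1) ∧ TwoStepRel i p j r f h ∧
        h.seq j ≤ f.seq (j + 1) ∧ f.seq (j + 1) ≤ h.seq (j + 2)} = {f.seq (j + 1)} by
      ext U
      simp only [mem_toFs, Set.mem_ofPred_eq, mem_singleton]
      exact and_iff_left hc]
    simp
  · rw [Finset.card_eq_zero.2, Nat.cast_zero]
    refine Finset.eq_empty_of_forall_notMem fun U hU => hc (mem_toFs.1 hU).2

theorem TwoStepRel.symm {f h : PartialFlag n F V} (hf : TwoStepRel i p j r f h) :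
    TwoStepRel j r i p f h :=
  ⟨fun k hk hk' => hf.1 k hk' hk, hf.2.2, hf.2.1⟩

/-- Step kernels commute if the steps are not adjacent, or if one of them lowers and the other one
raises a step. -/
theorem stepKern_comm (hij : i ≠ j)
    (H : ((i : ℕ) + 1 < j ∨ (j : ℕ) + 1 < i) ∨
      ((∀ A B, p A B → B ≤ A) ∧ ∀ A B, r A B → A ≤ B)) :
    (relKern (StepRel i p) * relKern (StepRel j r) : Kern n F V) =
      relKern (StepRel j r) * relKern (StepRel i p) := by
  have hij' : (i : ℕ) ≠ j := fun h => hij (Fin.ext h)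
  rw [stepKern_mul_of_ne hij, stepKern_mul_of_ne hij.symm]
  congr 1
  funext f h
  have key : TwoStepRel i p j r f h → (h.seq j ≤ f.seq (j + 1) ∧ f.seq (j + 1) ≤ h.seq (j + 2)) ∧
      h.seq i ≤ f.seq (i + 1) ∧ f.seq (i + 1) ≤ h.seq (i + 2) := by
    intro h0
    have hf : ∀ {a b}, a ≤ b → f.seq a ≤ f.seq b := fun hab => f.seq_mono hab
    have hh : ∀ {a b}, a ≤ b → h.seq a ≤ h.seq b := fun hab => h.seq_mono hab
    rcases H with H | ⟨H1, H2⟩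
    · rw [h0.1 j (by omega) (by omega), h0.1 (j + 2) (by omega) (by omega),
        h0.1 i (by omega) (by omega), h0.1 (i + 2) (by omega) (by omega)]
      grind
    · have h1 := H1 _ _ h0.2.1
      have h2 := H2 _ _ h0.2.2
      refine ⟨⟨?_, h2.trans (hh (by omega))⟩, (hh (by omega)).trans h1, ?_⟩
      · by_cases hk : (j : ℕ) = i + 1
        · rw [hk]
          exact h1.trans (hf (by omega))
        · rw [h0.1 _ (by omega) (by omega)]
          exact hf (by omega)
      · by_cases hk : (j : ℕ) = i + 1
        · rw [show (i : ℕ) + 2 = j + 1 by omega]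
          exact (hf (by omega)).trans h2
        · rw [h0.1 _ (by omega) (by omega)]
          exact hf (by omega)
  exact propext ⟨fun hc => ⟨hc.1.symm, (key hc.1).2⟩, fun hc => ⟨hc.1.symm, (key hc.1.symm).1⟩⟩

end StepKernels

/-! ### Intermediate subspaces -/

section Intermediate

variable {F V : Type} [Field F] [AddCommGroup V] [Module F V]

/-- `B` is a subspace of `A` of codimension `c`. -/
def Covers (c : ℕ) (A B : Submodule F V) : Prop := B ≤ A ∧ finrank F A = finrank F B + c

variable {A B D T : Submodule F V}

section

variable [FiniteDimensional F V]

theorem finrank_inf_of_covers (hB : B ≤ T) (hD : Covers 1 T D) (h : ¬ B ≤ D) :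
    finrank F B = finrank F ↥(B ⊓ D) + 1 := by
  have h1 := finrank_sup_add_finrank_inf_eq B D
  have h2 : finrank F D < finrank F ↥(B ⊔ D) :=
    finrank_lt_finrank_of_lt (lt_of_le_of_ne le_sup_right fun h3 => h (h3 ▸ le_sup_left))
  have h3 := finrank_mono (sup_le hB hD.1)
  have h4 := hD.2
  omega

theorem finrank_sup_of_covers (hT : T ≤ A) (hD : Covers 1 D T) (h : ¬ D ≤ A) :
    finrank F ↥(A ⊔ D) = finrank F A + 1 := by
  have h1 := finrank_sup_add_finrank_inf_eq A D
  have h2 : finrank F ↥(A ⊓ D) < finrank F D :=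
    finrank_lt_finrank_of_lt (lt_of_le_of_ne inf_le_right fun h3 => h (h3 ▸ inf_le_left))
  have h3 := finrank_mono (le_inf hT hD.1)
  have h4 := hD.2
  omega

end

variable [Finite F] [Finite V]

theorem card_toFs_false : (toFs {_W : Submodule F V | False}).card = 0 :=
  Finset.card_eq_zero.2 (Finset.eq_empty_of_forall_notMem fun _ hU => mem_toFs.1 hU)

theorem card_intermediate (h : Covers 2 B A) :
    (toFs {W : Submodule F V | A ≤ W ∧ W ≤ B ∧ finrank F W = finrank F A + 1}).card =
      Nat.card F + 1 := by
  have h1 := card_lines h.1 h.2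
  have h2 : (2 : ℚ) ≤ Nat.card F := by exact_mod_cast two_le_natCard F
  have h3 : ((Nat.card F : ℚ) - 1) ≠ 0 := by linarith
  have h4 := mul_left_cancel₀ h3 (h1.trans (by ring : _ = ((Nat.card F : ℚ) - 1) * (Nat.card F + 1)))
  exact_mod_cast h4

open Classical in
theorem card_intermediate_le (h : Covers 2 B A) (hA : A ≤ D)
    (hD : ¬ B ≤ D → finrank F B = finrank F ↥(B ⊓ D) + 1) :
    (toFs {W : Submodule F V | A ≤ W ∧ W ≤ B ⊓ D ∧ finrank F W = finrank F A + 1}).card =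
      if B ≤ D then Nat.card F + 1 else 1 := by
  split_ifs with hBD
  · rw [inf_eq_left.2 hBD, card_intermediate h]
  · have h2 := hD hBD
    have h3 := h.2
    rw [Finset.card_eq_one]
    refine ⟨B ⊓ D, Finset.eq_singleton_iff_unique_mem.2 ⟨mem_toFs.2 ⟨le_inf h.1 hA, le_rfl, ?_⟩,
      fun W hW => ?_⟩⟩
    · omega
    · obtain ⟨h4, h5, h6⟩ := mem_toFs.1 hW
      exact eq_of_le_of_finrank_eq h5 (by omega)

open Classical in
theorem card_intermediate_ge (h : Covers 2 B A) (hB : D ≤ B)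
    (hD : ¬ D ≤ A → finrank F ↥(A ⊔ D) = finrank F A + 1) :
    (toFs {W : Submodule F V | A ⊔ D ≤ W ∧ W ≤ B ∧ finrank F W = finrank F A + 1}).card =
      if D ≤ A then Nat.card F + 1 else 1 := by
  split_ifs with hDA
  · rw [sup_eq_left.2 hDA, card_intermediate h]
  · have h2 := hD hDA
    rw [Finset.card_eq_one]
    refine ⟨A ⊔ D, Finset.eq_singleton_iff_unique_mem.2 ⟨mem_toFs.2 ⟨le_rfl, sup_le h.1 hB, h2⟩,
      fun W hW => ?_⟩⟩
    obtain ⟨h4, h5, h6⟩ := mem_toFs.1 hW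
    exact (eq_of_le_of_finrank_eq h4 (by omega)).symm

end Intermediate

/-! ### Serre relations between step kernels -/

section Serre

variable {n : ℕ} {F V : Type} [Field F] [Finite F] [AddCommGroup V] [Module F V] [Finite V]

theorem kernLower_eq (i : Fin (n - 1)) : (kernLower i : Kern n F V) = relKern (StepRel i (Covers 1)) :=
  rfl

theorem stepRel_setStep_iff {i : Fin (n - 1)} {f h : PartialFlag n F V} {U : Submodule F V} :
    (((h.seq i ≤ U ∧ U ≤ h.seq (i + 2)) ∧ Covers 1 U (h.seq (i + 1))) ∧
      StepRel i (Covers 1) f (h.setStep i U)) ↔ StepRel i (Covers 2) f h ∧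
        (h.seq (i + 1) ≤ U ∧ U ≤ f.seq (i + 1) ∧
          finrank F U = finrank F (h.seq (i + 1)) + 1) := by
  constructor
  · rintro ⟨⟨h1, h2⟩, h3, h4⟩
    rw [h.seq_setStep_self h1.1 h1.2] at h4
    have h5 := h2.2
    have h6 := h4.2
    refine ⟨⟨fun k hk => ?_, h2.1.trans h4.1, by omega⟩, h2.1, h4.1, h2.2⟩
    rw [← h3 k hk, h.seq_setStep_of_ne U hk]
  · rintro ⟨hc, h1, h2, h3⟩
    have h4 := hc.2.2
    have h5 : h.seq i ≤ U ∧ U ≤ h.seq (i + 2) := by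
      refine ⟨(h.seq_mono (by omega)).trans h1, ?_⟩
      rw [hc.1 _ (by omega)]
      exact h2.trans (f.seq_mono (by omega))
    rw [StepRel, h.seq_setStep_self h5.1 h5.2]
    refine ⟨⟨h5, h1, h3⟩, fun k hk => ?_, h2, by omega⟩
    rw [h.seq_setStep_of_ne U hk, hc.1 k hk]

theorem kernLower_mul_self (i : Fin (n - 1)) :
    (kernLower i * kernLower i : Kern n F V) =
      (Nat.card F + 1) • relKern (StepRel i (Covers 2)) := by
  classical
  ext1 f h
  rw [kernLower_eq, relKern_mul_stepKern_apply, Matrix.smul_apply, relKern_apply]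
  simp only [stepRel_setStep_iff]
  split_ifs with hc
  · simp only [hc, true_and]
    rw [card_intermediate hc.2, nsmul_one]
  · simp only [hc, false_and]
    rw [card_toFs_false, Nat.cast_zero, smul_zero]

/-- The mixed product counts intermediate subspaces, `q + 1` of them if step `i` of `h` can be moved
twice before step `j`, and otherwise one. -/
theorem kernLower_serre_succ {i j : Fin (n - 1)} (hij : (i : ℕ) + 1 = j) :
    (kernLower i * kernLower i * kernLower j +
      Nat.card F • (kernLower j * (kernLower i * kernLower i)) : Kern n F V) =
      (Nat.card F + 1) • (kernLower i * kernLower j * kernLower i) := by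
  classical
  have hne : i ≠ j := fun h => by rw [h] at hij; omega
  rw [kernLower_mul_self]
  simp only [kernLower_eq, smul_mul_assoc, mul_smul_comm, stepKern_mul_of_ne hne,
    stepKern_mul_of_ne hne.symm, smul_smul, ← hij]
  ext1 f h
  rw [Matrix.add_apply, Matrix.smul_apply, Matrix.smul_apply, Matrix.smul_apply,
    relKern_mul_stepKern_apply, relKern_apply, relKern_apply]
  have hset : ∀ U : Submodule F V, (((h.seq i ≤ U ∧ U ≤ h.seq (i + 2)) ∧ Covers 1 U (h.seq (i + 1))) ∧
      TwoStepRel i (Covers 1) j (Covers 1) f (h.setStep i U) ∧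
        (h.setStep i U).seq (i + 1) ≤ f.seq (i + 1 + 1) ∧
        f.seq (i + 1 + 1) ≤ (h.setStep i U).seq (i + 1 + 2)) ↔
      TwoStepRel i (Covers 2) j (Covers 1) f h ∧ (h.seq (i + 1) ≤ U ∧
        U ≤ f.seq (i + 1) ⊓ h.seq (i + 2) ∧ finrank F U = finrank F (h.seq (i + 1)) + 1) := by
    intro U
    have h0 : ((h.seq i ≤ U ∧ U ≤ h.seq (i + 2)) → (h.setStep i U).seq (i + 1) = U) :=
      fun h1 => h.seq_setStep_self h1.1 h1.2
    have h0' : ∀ k, k ≠ (i : ℕ) + 1 → (h.setStep i U).seq k = h.seq k :=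
      fun k hk => h.seq_setStep_of_ne U hk
    constructor
    · rintro ⟨⟨h1, h2⟩, ⟨h3, h4, h5⟩, h6, h7⟩
      rw [h0 h1] at h4
      rw [h0' _ (by omega)] at h5
      have h8 := h4.2
      have h9 := h2.2
      exact ⟨⟨fun k hk hk' => by rw [← h3 k hk hk', h0' k hk], ⟨h2.1.trans h4.1, by omega⟩, h5⟩,
        h2.1, le_inf h4.1 h1.2, h2.2⟩
    · rintro ⟨⟨h1, h2, h3⟩, h4, h5, h6⟩
      have h7 : h.seq i ≤ U ∧ U ≤ h.seq (i + 2) :=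
        ⟨(h.seq_mono (by omega)).trans h4, h5.trans inf_le_right⟩
      have h8 := h2.2
      rw [TwoStepRel, h0 h7, h0' _ (by omega), h0' _ (by omega)]
      refine ⟨⟨h7, h4, h6⟩, ⟨fun k hk hk' => by rw [h0' k hk, h1 k hk hk'],
        ⟨h5.trans inf_le_left, by omega⟩, h3⟩,
        (h5.trans inf_le_left).trans (f.seq_mono (by omega)), ?_⟩
      rw [h1 _ (by omega) (by omega)]
      exact f.seq_mono (by omega)
  simp only [hset]
  by_cases hP : TwoStepRel i (Covers 2) j (Covers 1) f h
  · have h1 : h.seq (i + 1) ≤ f.seq (i + 1) := hP.2.1.1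
    have h2 := card_intermediate_le hP.2.1 (h.seq_mono (show (i : ℕ) + 1 ≤ i + 2 by omega)) fun hc =>
      finrank_inf_of_covers (f.seq_mono (show (i : ℕ) + 1 ≤ i + 2 by omega))
        (by have h3 := hP.2.2; rwa [← hij] at h3) hc
    have h3 : f.seq (i + 1 + 1) ≤ h.seq (i + 1 + 2) := by
      rw [hP.1 _ (by omega) (by omega)]
      exact f.seq_mono (by omega)
    have h4 : h.seq i ≤ f.seq (i + 1) := (h.seq_mono (by omega)).trans h1
    have h5 : h.seq (i + 1) ≤ f.seq (i + 1 + 1) := h1.trans (f.seq_mono (by omega))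
    simp only [hP, hP.symm, true_and, h2, h3, h4, h5, and_self, if_true]
    split_ifs
    all_goals simp only [nsmul_eq_mul]; push_cast; ring
  · have hP' : ¬ TwoStepRel j (Covers 1) i (Covers 2) f h := fun h => hP h.symm
    rw [if_neg fun h => hP h.1, if_neg fun h => hP' h.1]
    simp only [hP, false_and]
    rw [card_toFs_false]
    simp

theorem kernLower_serre_pred {i j : Fin (n - 1)} (hij : (j : ℕ) + 1 = i) :
    (kernLower j * (kernLower i * kernLower i) +
      Nat.card F • (kernLower i * kernLower i * kernLower j) : Kern n F V) =
      (Nat.card F + 1) • (kernLower i * (kernLower j * kernLower i)) := by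
  classical
  have hne : i ≠ j := fun h => by rw [h] at hij; omega
  rw [kernLower_mul_self]
  simp only [kernLower_eq, smul_mul_assoc, mul_smul_comm, stepKern_mul_of_ne hne,
    stepKern_mul_of_ne hne.symm, smul_smul]
  ext1 f h
  rw [Matrix.add_apply, Matrix.smul_apply, Matrix.smul_apply, Matrix.smul_apply,
    stepKern_mul_relKern_apply, relKern_apply, relKern_apply]
  have hset : ∀ U : Submodule F V, (((f.seq i ≤ U ∧ U ≤ f.seq (i + 2)) ∧ Covers 1 (f.seq (i + 1)) U) ∧
      TwoStepRel j (Covers 1) i (Covers 1) (f.setStep i U) h ∧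
        h.seq i ≤ (f.setStep i U).seq (i + 1) ∧
        (f.setStep i U).seq (i + 1) ≤ h.seq (i + 2)) ↔
      TwoStepRel i (Covers 2) j (Covers 1) f h ∧ (h.seq (i + 1) ⊔ f.seq i ≤ U ∧
        U ≤ f.seq (i + 1) ∧ finrank F U = finrank F (h.seq (i + 1)) + 1) := by
    intro U
    have h0 : ((f.seq i ≤ U ∧ U ≤ f.seq (i + 2)) → (f.setStep i U).seq (i + 1) = U) :=
      fun h1 => f.seq_setStep_self h1.1 h1.2
    have h0' : ∀ k, k ≠ (i : ℕ) + 1 → (f.setStep i U).seq k = f.seq k :=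
      fun k hk => f.seq_setStep_of_ne U hk
    constructor
    · rintro ⟨⟨h1, h2⟩, ⟨h3, h4, h5⟩, h6, h7⟩
      rw [h0 h1] at h5
      rw [h0' _ (by omega)] at h4
      have h8 := h5.2
      have h9 := h2.2
      exact ⟨⟨fun k hk hk' => by rw [h3 k hk' hk, h0' k hk], ⟨h5.1.trans h2.1, by omega⟩, h4⟩,
        sup_le h5.1 h1.1, h2.1, h5.2⟩
    · rintro ⟨⟨h1, h2, h3⟩, h4, h5, h6⟩
      have h4' := le_sup_left.trans h4
      have h7 : f.seq i ≤ U ∧ U ≤ f.seq (i + 2) :=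
        ⟨le_sup_right.trans h4, h5.trans (f.seq_mono (by omega))⟩
      have h8 := h2.2
      rw [TwoStepRel, h0 h7, h0' _ (by omega)]
      refine ⟨⟨h7, h5, by omega⟩, ⟨fun k hk hk' => by rw [h0' k hk', h1 k hk' hk],
        h3, h4', h6⟩, (h.seq_mono (by omega)).trans h4', ?_⟩
      rw [h1 _ (by omega) (by omega)]
      exact h7.2
  simp only [hset]
  by_cases hP : TwoStepRel i (Covers 2) j (Covers 1) f h
  · have h1 : h.seq (i + 1) ≤ f.seq (i + 1) := hP.2.1.1
    have h2 := card_intermediate_ge hP.2.1 (f.seq_mono (show (i : ℕ) ≤ i + 1 by omega)) fun hc =>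
      finrank_sup_of_covers (h.seq_mono (show (i : ℕ) ≤ i + 1 by omega))
        (by have h3 := hP.2.2; rwa [hij] at h3) hc
    have h3 : f.seq (i + 1) ≤ h.seq (i + 2) := by
      rw [hP.1 _ (by omega) (by omega)]
      exact f.seq_mono (by omega)
    have h4 : h.seq i ≤ f.seq (i + 1) := (h.seq_mono (by omega)).trans h1
    have h5 : h.seq j ≤ f.seq (j + 1) := by
      rw [hP.1 _ (by omega) (by omega)]
      exact f.seq_mono (by omega)
    have h6 : f.seq (j + 1) = f.seq i ∧ h.seq (j + 2) = h.seq (i + 1) := by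
      rw [← hij]
      exact ⟨rfl, rfl⟩
    rw [h6.1] at h5
    simp only [hP, hP.symm, true_and, h2, h3, h4, h5, h6, and_self, if_true]
    split_ifs
    all_goals simp only [nsmul_eq_mul]; push_cast; ring
  · have hP' : ¬ TwoStepRel j (Covers 1) i (Covers 2) f h := fun h => hP h.symm
    rw [if_neg fun h => hP' h.1, if_neg fun h => hP h.1]
    simp only [hP, false_and]
    rw [card_toFs_false]
    simp

end Serre

/-! ### Commutators of step kernels -/

section Commutator

variable {n : ℕ} {F V : Type} [Field F] [Finite F] [AddCommGroup V] [Module F V] [Finite V]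

theorem card_hyperplanes {A B : Submodule F V} (hAB : A ≤ B) {a : ℕ}
    (h : finrank F B = finrank F A + a) :
    ((Nat.card F : ℚ) - 1) *
      ((toFs {W : Submodule F V | A ≤ W ∧ W ≤ B ∧ finrank F W + 1 = finrank F B}).card : ℚ) =
      (Nat.card F : ℚ) ^ a - 1 := by
  have hdual : Finite (Dual F V) := Module.finite_of_finite F
  have h1 := Insertion.sum_hyperplanes hAB fun _ => 1
  simp only [sum_const, nsmul_eq_mul, mul_one] at h1
  have hle := dualAnnihilator_anti hAB
  have h2 : ((toFs {ξ : Dual F V | ξ ∈ A.dualAnnihilator ∧ ξ ∉ B.dualAnnihilator}).card : ℚ) =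
      (Nat.card F : ℚ) ^ ((finrank F V : ℤ) - finrank F A) -
        (Nat.card F : ℚ) ^ ((finrank F V : ℤ) - finrank F B) := by
    have h3 := Set.ncard_sdiff_add_ncard_of_subset
      (s := (B.dualAnnihilator : Set (Dual F V))) (t := (A.dualAnnihilator : Set (Dual F V))) hle
    rw [← ncard_dualAnnihilator, ← ncard_dualAnnihilator, card_toFs, eq_sub_iff_add_eq]
    exact_mod_cast h3
  have hq := natCard_cast_ne_zero F
  have h4 : (Nat.card F : ℚ) ^ ((finrank F V : ℤ) - finrank F A) =
      (Nat.card F : ℚ) ^ ((finrank F V : ℤ) - finrank F B) * (Nat.card F : ℚ) ^ a := by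
    rw [← zpow_natCast, ← zpow_add₀ hq, h]
    congr 1
    push_cast
    ring
  rw [h2, h4] at h1
  apply mul_left_cancel₀ (zpow_ne_zero ((finrank F V : ℤ) - finrank F B) hq)
  linear_combination h1

/-- Two different subspaces with a common hyperplane are hyperplanes of their sum. -/
theorem card_lower_eq_card_upper {A B S T : Submodule F V} (hAB : A ≠ B) (hA : S ≤ A ∧ A ≤ T)
    (hB : S ≤ B ∧ B ≤ T) :
    (toFs {U : Submodule F V | ((S ≤ U ∧ U ≤ T) ∧ Covers 1 B U) ∧ Covers 1 A U}).card =
      (toFs {U : Submodule F V | ((S ≤ U ∧ U ≤ T) ∧ Covers 1 U B) ∧ Covers 1 U A}).card := by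
  have hdim := finrank_sup_add_finrank_inf_eq A B
  have hlt : finrank F A = finrank F B →
      finrank F ↥(A ⊓ B) < finrank F A ∧ finrank F A < finrank F ↥(A ⊔ B) := by
    intro h
    have hle : ¬ A ≤ B := fun hle => hAB (eq_of_le_of_finrank_eq hle h)
    have h1 := finrank_lt_finrank_of_lt
      (lt_of_le_of_ne (inf_le_left : A ⊓ B ≤ A) fun h1 => hle (inf_eq_left.1 h1))
    omega
  have hlow : ∀ U, Covers 1 B U ∧ Covers 1 A U → A ⊓ B = U := by
    rintro U ⟨⟨h1, h2⟩, h3, h4⟩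
    have h5 := hlt (by omega)
    have h6 := finrank_mono (le_inf h3 h1)
    exact (eq_of_le_of_finrank_eq (le_inf h3 h1) (by omega)).symm
  have hup : ∀ U, Covers 1 U B ∧ Covers 1 U A → A ⊔ B = U := by
    rintro U ⟨⟨h1, h2⟩, h3, h4⟩
    have h5 := hlt (by omega)
    have h6 := finrank_mono (sup_le h3 h1)
    exact eq_of_le_of_finrank_eq (sup_le h3 h1) (by omega)
  refine Finset.card_nbij' (fun _ => A ⊔ B) (fun _ => A ⊓ B) ?_ ?_ ?_ ?_
  · intro U hU
    obtain ⟨⟨-, h2⟩, h3⟩ := mem_toFs.1 hU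
    obtain rfl := hlow U ⟨h2, h3⟩
    have h4 := h2.2
    have h5 := h3.2
    have h6 : Covers 1 (A ⊔ B) B ∧ Covers 1 (A ⊔ B) A :=
      ⟨⟨le_sup_right, by omega⟩, le_sup_left, by omega⟩
    exact mem_toFs.2 ⟨⟨⟨hA.1.trans le_sup_left, sup_le hA.2 hB.2⟩, h6.1⟩, h6.2⟩
  · intro U hU
    obtain ⟨⟨-, h2⟩, h3⟩ := mem_toFs.1 hU
    obtain rfl := hup U ⟨h2, h3⟩
    have h4 := h2.2
    have h5 := h3.2
    have h6 : Covers 1 B (A ⊓ B) ∧ Covers 1 A (A ⊓ B) :=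
      ⟨⟨inf_le_right, by omega⟩, inf_le_left, by omega⟩
    exact mem_toFs.2 ⟨⟨⟨le_inf hA.1 hB.1, inf_le_left.trans hA.2⟩, h6.1⟩, h6.2⟩
  · intro U hU
    exact hlow U ⟨(mem_toFs.1 hU).1.2, (mem_toFs.1 hU).2⟩
  · intro U hU
    exact hup U ⟨(mem_toFs.1 hU).1.2, (mem_toFs.1 hU).2⟩

/-- Off the diagonal the two products agree; on it they count hyperplanes and lines in the two
adjacent steps. -/
theorem kernLower_mul_transpose_sub {l : ℕ} (hF : Nat.card F = l ^ 2) (i : Fin (n - 1)) :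
    ((l : ℚ) ^ 2 - 1) • (kernLower i * (kernLower i).transpose -
      (kernLower i).transpose * kernLower i : Kern n F V) =
        kernH l (lft i) 2 - kernH l (rgt i) 2 := by
  classical
  have hq : (Nat.card F : ℚ) = (l : ℚ) ^ 2 := by exact_mod_cast hF
  ext1 f h
  rw [kernLower_eq, transpose_relKern_stepRel, Matrix.smul_apply, Matrix.sub_apply,
    Matrix.sub_apply, stepKern_mul_self_apply, stepKern_mul_self_apply, kernH, kernH]
  by_cases hoff : ∀ k, k ≠ (i : ℕ) + 1 → h.seq k = f.seq k
  · have hS : ∀ p, StepRel i p f h ↔ p (f.seq (i + 1)) (h.seq (i + 1)) :=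
      fun p => and_iff_right hoff
    simp only [hS]
    rw [hoff i (by omega), hoff (i + 2) (by omega)]
    by_cases hfh : f = h
    · subst hfh
      rw [diagonal_apply_eq, diagonal_apply_eq]
      have hle := fun a b hab => f.seq_mono (a := a) (b := b) hab
      have h1 : ∀ a : Fin n, ((finrank F (f.seq (a + 1)) : ℕ) : ℤ) =
          finrank F (f.seq a) + stepDim a f := fun a => by rw [stepDim]; ring
      have h2 : ∀ a : Fin n, ∃ m : ℕ, finrank F (f.seq (a + 1)) = finrank F (f.seq a) + m ∧
          (l : ℚ) ^ (2 * stepDim a f) = (Nat.card F : ℚ) ^ m := by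
        intro a
        obtain ⟨m, hm⟩ := Nat.exists_eq_add_of_le (finrank_mono (hle a (a + 1) (by omega)))
        refine ⟨m, hm, ?_⟩
        have h3 := h1 a
        rw [show stepDim a f = m by omega, zpow_mul, hq]
        norm_cast
      obtain ⟨m, hm, hm'⟩ := h2 (lft i)
      obtain ⟨m', hr, hr'⟩ := h2 (rgt i)
      have h3 := card_hyperplanes (hle i (i + 1) (by omega)) hm
      have h4 := card_lines (hle (i + 1) (i + 2) (by omega)) hr
      have h5 : {U : Submodule F V | ((f.seq i ≤ U ∧ U ≤ f.seq (i + 2)) ∧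
          Covers 1 (f.seq (i + 1)) U) ∧ Covers 1 (f.seq (i + 1)) U} =
          {W | f.seq i ≤ W ∧ W ≤ f.seq (i + 1) ∧ finrank F W + 1 = finrank F (f.seq (i + 1))} := by
        ext U
        exact ⟨fun h => ⟨h.1.1.1, h.2.1, h.2.2.symm⟩, fun h =>
          ⟨⟨⟨h.1, h.2.1.trans (hle _ _ (by omega))⟩, h.2.1, h.2.2.symm⟩, h.2.1, h.2.2.symm⟩⟩
      have h6 : {U : Submodule F V | ((f.seq i ≤ U ∧ U ≤ f.seq (i + 2)) ∧
          Covers 1 U (f.seq (i + 1))) ∧ Covers 1 U (f.seq (i + 1))} =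
          {W | f.seq (i + 1) ≤ W ∧ W ≤ f.seq (i + 2) ∧
            finrank F W = finrank F (f.seq (i + 1)) + 1} := by
        ext U
        exact ⟨fun h => ⟨h.2.1, h.1.1.2, h.2.2⟩, fun h =>
          ⟨⟨⟨(hle _ _ (by omega)).trans h.1, h.2.1⟩, h.1, h.2.2⟩, h.1, h.2.2⟩⟩
      rw [h5, h6, hm', hr', ← map_natCast (algebraMap ℚ (AddMonoidAlgebra ℚ V)),
        ← map_natCast (algebraMap ℚ (AddMonoidAlgebra ℚ V)), ← map_sub, ← map_sub,
        Algebra.smul_def, ← map_mul, ← hq]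
      congr 1
      linear_combination h3 - h4
    · have hne : f.seq (i + 1) ≠ h.seq (i + 1) := fun hc => hfh (PartialFlag.ext_seq fun k => by
        grind)
      rw [diagonal_apply_ne _ hfh, diagonal_apply_ne _ hfh,
        card_lower_eq_card_upper hne ⟨f.seq_mono (by omega), f.seq_mono (by omega)⟩]
      · simp
      · rw [← hoff i (by omega), ← hoff (i + 2) (by omega)]
        exact ⟨h.seq_mono (by omega), h.seq_mono (by omega)⟩
  · have hfh : f ≠ h := fun hc => hoff fun k _ => by rw [hc]
    rw [diagonal_apply_ne _ hfh, diagonal_apply_ne _ hfh]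
    simp only [StepRel, hoff, false_and, and_false, card_toFs_false, sub_self, smul_zero]

end Commutator

/-! ### Relations with the diagonal kernels -/

section Diagonal

variable {n : ℕ} {F V : Type} [Field F] [AddCommGroup V] [Module F V] [Finite V]

theorem kernH_mul_kernH {l : ℕ} (hl : 2 ≤ l) (a : Fin n) (k m : ℤ) :
    (kernH l a k * kernH l a m : Kern n F V) = kernH l a (k + m) := by
  rw [kernH, kernH, kernH, Matrix.diagonal_mul_diagonal]
  congr 1
  funext f
  rw [← map_mul, ← zpow_add₀ (natCast_ne_zero_of_two_le hl), add_mul]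

theorem kernH_zero (l : ℕ) (a : Fin n) : (kernH l a 0 : Kern n F V) = 1 := by
  rw [kernH, ← Matrix.diagonal_one]
  congr 1
  funext f
  rw [zero_mul, zpow_zero, map_one]

theorem diagonal_mul_comm (w w' : PartialFlag n F V → AddMonoidAlgebra ℚ V) :
    (diagonal w * diagonal w' : Kern n F V) =
      diagonal w' * diagonal w := by
  rw [Matrix.diagonal_mul_diagonal, Matrix.diagonal_mul_diagonal]
  congr 1
  funext f
  rw [mul_comm]

theorem Lowers.stepDim_eq {i : Fin (n - 1)} {f h : PartialFlag n F V} (hf : Lowers i f h)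
    (a : Fin n) : stepDim a h = stepDim a f + (kron a (rgt i) - kron a (lft i)) := by
  obtain ⟨h1, -, h3⟩ := hf
  have hl : a = lft i ↔ (a : ℕ) = i := Fin.ext_iff
  have hr : a = rgt i ↔ (a : ℕ) = i + 1 := Fin.ext_iff
  simp only [stepDim, kron, hl, hr]
  by_cases ha : (a : ℕ) = i
  · grind
  · grind

theorem kernLower_mul_kernH {l : ℕ} (hl : 2 ≤ l) (i : Fin (n - 1)) (a : Fin n) (k : ℤ) :
    (kernLower i * kernH l a k : Kern n F V) =
      (l : ℚ) ^ (k * (kron a (rgt i) - kron a (lft i))) • (kernH l a k * kernLower i) := by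
  classical
  ext1 f h
  rw [kernH, Matrix.smul_apply, Matrix.mul_diagonal, diagonal_mul, kernLower_apply]
  split_ifs with hf
  · rw [hf.stepDim_eq, one_mul, mul_one, Algebra.smul_def, ← map_mul,
      ← zpow_add₀ (natCast_ne_zero_of_two_le hl)]
    congr 2
    ring
  · rw [zero_mul, mul_zero, smul_zero]

theorem transpose_kernLower_mul_kernH {l : ℕ} (hl : 2 ≤ l) (i : Fin (n - 1)) (a : Fin n) (k : ℤ) :
    ((kernLower i).transpose * kernH l a k : Kern n F V) =
      (l : ℚ) ^ (k * (kron a (lft i) - kron a (rgt i))) •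
        (kernH l a k * (kernLower i).transpose) := by
  have h1 := congrArg transpose (kernLower_mul_kernH (F := F) (V := V) hl i a k)
  rw [Matrix.transpose_smul, transpose_mul, transpose_mul, kernH, Matrix.diagonal_transpose] at h1
  rw [kernH, h1, smul_smul, ← zpow_add₀ (natCast_ne_zero_of_two_le hl), ← mul_add,
    sub_add_sub_cancel, sub_self, mul_zero, zpow_zero, one_smul]

end Diagonal

/-! ### Relations with the averaging kernel -/

section Average

variable {n : ℕ} {F V : Type} [Field F] [AddCommGroup V] [Module F V] [Finite V]

theorem average_mul_average {U W : Submodule F V} (h : W ≤ U) :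
    average U * average W = average U := by
  classical
  have h1 : ∀ w ∈ W, average U * AddMonoidAlgebra.single w 1 = average U := by
    intro w hw
    refine AddMonoidAlgebra.ext (Finsupp.ext fun μ => ?_)
    have h2 : (average U * AddMonoidAlgebra.single w 1).coeff μ =
        (average U).coeff (μ - w) * 1 := by
      rw [sub_eq_add_neg]
      exact AddMonoidAlgebra.coeff_mul_single_apply _ _ _ _
    rw [h2, coeff_average, coeff_average, mul_one]
    exact if_congr (U.sub_mem_iff_left (h hw)) rfl rfl
  have h3 : (Nat.card W : ℚ) ≠ 0 := by exact_mod_cast Nat.card_pos.ne'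
  have h4 : (toFs (W : Set V)).card = Nat.card W := by
    rw [card_toFs]
    rfl
  rw [average.eq_1 W, mul_smul_comm, mul_sum, sum_congr rfl fun w hw =>
    h1 w (mem_toFs.1 hw), sum_const, h4, ← Nat.cast_smul_eq_nsmul ℚ, smul_smul,
    inv_mul_cancel₀ h3, one_smul]

theorem kernL_mul_self : kernL F V * kernL F V = (kernL F V : Kern n F V) := by
  rw [kernL, Matrix.diagonal_mul_diagonal]
  congr 1
  funext f
  exact average_mul_average le_rfl

theorem kernL_mul_kernLower (i : Fin (n - 1)) :
    kernL F V * kernLower i = (kernL F V * kernLower i * kernL F V : Kern n F V) := by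
  classical
  ext1 f h
  rw [kernL, Matrix.mul_diagonal, diagonal_mul, kernLower_apply]
  split_ifs with hf
  · rw [mul_one, average_mul_average]
    by_cases hi : 1 = (i : ℕ) + 1
    · have h2 := hf.2.1
      rwa [← hi] at h2
    · exact (hf.1 _ hi).le
  · rw [mul_zero, zero_mul]

theorem transpose_kernLower_mul_kernL (i : Fin (n - 1)) :
    (kernLower i).transpose * kernL F V =
      (kernL F V * (kernLower i).transpose * kernL F V : Kern n F V) := by
  have h := congrArg transpose (kernL_mul_kernLower (F := F) (V := V) i)
  simp only [transpose_mul, kernL, Matrix.diagonal_transpose] at h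
  rw [kernL, h, Matrix.mul_assoc]

theorem sum_average [Finite F] {A B : Submodule F V} (h : Covers 2 B A) :
    ∑ U ∈ toFs {U : Submodule F V | A ≤ U ∧ U ≤ B ∧ finrank F U = finrank F A + 1}, average U =
      average A + (Nat.card F : ℚ) • average B := by
  classical
  have hcard : ∀ U : Submodule F V, (Nat.card U : ℚ) = (Nat.card F : ℚ) ^ finrank F U := by
    intro U
    rw [Module.natCard_eq_pow_finrank (K := F), Nat.cast_pow]
  have hq := natCard_cast_ne_zero F
  refine AddMonoidAlgebra.ext (Finsupp.ext fun μ => ?_)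
  rw [AddMonoidAlgebra.coeff_sum, Finsupp.finsetSum_apply]
  change _ = (average A).coeff μ + ((Nat.card F : ℚ) • average B).coeff μ
  rw [AddMonoidAlgebra.coeff_smul_apply]
  simp only [coeff_average]
  rw [← sum_filter, sum_congr rfl (g := fun _ =>
    ((Nat.card F : ℚ) ^ (finrank F A + 1))⁻¹) fun U hU => by
      rw [hcard, (mem_toFs.1 (Finset.mem_filter.1 hU).1).2.2], sum_const, nsmul_eq_mul,
    hcard, hcard, h.2]
  by_cases hB : μ ∈ B
  · have h1 := card_intermediate_ge h ((span_singleton_le_iff_mem μ B).2 hB) fun hc =>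
      finrank_sup_span fun hA => hc ((span_singleton_le_iff_mem μ A).2 hA)
    have h2 : (toFs {U : Submodule F V | A ≤ U ∧ U ≤ B ∧ finrank F U = finrank F A + 1}).filter
        (μ ∈ ·) = toFs {U | A ⊔ F ∙ μ ≤ U ∧ U ≤ B ∧ finrank F U = finrank F A + 1} := by
      ext U
      simp only [mem_filter, mem_toFs, Set.mem_ofPred_eq, sup_le_iff, span_singleton_le_iff_mem]
      tauto
    rw [h2, h1, span_singleton_le_iff_mem, if_pos hB, pow_add, pow_add, smul_eq_mul]
    have hx : (Nat.card F : ℚ) ^ finrank F A ≠ 0 := pow_ne_zero _ hq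
    generalize (Nat.card F : ℚ) ^ finrank F A = x at hx
    split_ifs
    all_goals grind
  · rw [if_neg hB, if_neg fun hA => hB (h.1 hA), Finset.filter_false_of_mem fun U hU hc =>
      hB ((mem_toFs.1 hU).2.1 hc)]
    simp

/-- Only the case of moving the first step is not immediate: there the middle subspace runs through
the `q + 1` members of a pencil, and the averages over these are compared. -/
theorem kernLower_mul_kernL_mul_kernLower [Finite F] (i : Fin (n - 1)) :
    ((Nat.card F : ℚ) + 1) • (kernLower i * kernL F V * kernLower i : Kern n F V) =
      kernLower i * kernLower i * kernL F V +
        (Nat.card F : ℚ) • (kernL F V * (kernLower i * kernLower i)) := by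
  classical
  have hsum : ∀ f h : PartialFlag n F V,
      (kernLower i * kernL F V * kernLower i : Kern n F V) f h =
        if StepRel i (Covers 2) f h then ∑ U ∈ toFs {U : Submodule F V | h.seq (i + 1) ≤ U ∧
          U ≤ f.seq (i + 1) ∧ finrank F U = finrank F (h.seq (i + 1)) + 1},
            average ((h.setStep i U).seq 1) else 0 := by
    intro f h
    have h1 : ∀ g : PartialFlag n F V, (kernLower i * kernL F V : Kern n F V) f g =
        if StepRel i (Covers 1) f g then average (g.seq 1) else 0 := by
      intro g
      rw [kernL, Matrix.mul_diagonal, kernLower_eq, relKern_apply, ite_mul, one_mul, zero_mul]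
    rw [kernLower_eq, mul_stepKern_apply, ← kernLower_eq]
    simp only [h1]
    rw [← sum_filter]
    have h2 : ∀ U, U ∈ (toFs {U : Submodule F V | (h.seq i ≤ U ∧ U ≤ h.seq (i + 2)) ∧
        Covers 1 U (h.seq (i + 1))}).filter (fun U => StepRel i (Covers 1) f (h.setStep i U)) ↔
        StepRel i (Covers 2) f h ∧ (h.seq (i + 1) ≤ U ∧ U ≤ f.seq (i + 1) ∧
          finrank F U = finrank F (h.seq (i + 1)) + 1) := fun U => by
      rw [mem_filter, mem_toFs]
      exact stepRel_setStep_iff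
    split_ifs with hc
    · refine sum_congr (Finset.ext fun U => ?_) fun _ _ => rfl
      rw [h2, mem_toFs]
      exact and_iff_right hc
    · exact sum_eq_zero fun U hU => absurd ((h2 U).1 hU).1 hc
  have hNat : ((Nat.card F : ℚ) + 1) = ((Nat.card F + 1 : ℕ) : ℚ) := by push_cast; rfl
  rw [kernLower_mul_self, hNat, ← Nat.cast_smul_eq_nsmul ℚ, smul_mul_assoc, mul_smul_comm, smul_comm,
    ← smul_add]
  congr 1
  ext1 f h
  rw [hsum, Matrix.add_apply, Matrix.smul_apply, kernL, Matrix.mul_diagonal, diagonal_mul,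
    relKern_apply]
  split_ifs with hc
  · rw [one_mul, mul_one]
    by_cases hi : (i : ℕ) = 0
    · have h1 := sum_average hc.2
      simp only [hi] at h1 ⊢
      rw [← h1]
      refine sum_congr rfl fun U hU => ?_
      obtain ⟨h2, h3, h4⟩ := mem_toFs.1 hU
      have h5 := (stepRel_setStep_iff (i := i) (f := f) (h := h) (U := U)).2
        ⟨hc, by rw [hi]; exact h2, by rw [hi]; exact h3, h4⟩
      have h6 := h.seq_setStep_self h5.1.1.1 h5.1.1.2
      rw [hi] at h6
      rw [h6]
    · have h1 : ∀ U, (h.setStep i U).seq 1 = f.seq 1 := fun U => by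
        rw [h.seq_setStep_of_ne U (by omega), hc.1 1 (by omega)]
      simp only [h1, hc.1 1 (by omega)]
      rw [sum_const, card_intermediate hc.2, ← Nat.cast_smul_eq_nsmul ℚ, Nat.cast_add,
        Nat.cast_one, add_smul, one_smul, add_comm]
  · simp

end Average

/-! ### Relations between the kernels of the generators -/

section Twisted

variable {R : Type*} [Ring R] [Algebra ℚ R] {K K' X Y L : R} {l : ℚ}

theorem mul_mul_of_mul_eq_smul {c : ℚ} (h : X * K = c • (K * X)) (z : R) :
    X * (K * z) = c • (K * (X * z)) := by
  rw [← mul_assoc, h, smul_mul_assoc, mul_assoc]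

/-- The quantum Serre relation for `K X` and `K' Y` from a relation for `X` and `Y`. -/
theorem serre_of_twisted (hl : l ≠ 0) {β γ : ℤ} (hβγ : β + γ = -1)
    (h1 : X * K = l ^ (1 : ℤ) • (K * X)) (h2 : X * K' = l ^ β • (K' * X))
    (h3 : Y * K = l ^ γ • (K * Y)) (h4 : K' * K = K * K')
    (h : l ^ (1 + 2 * β) • (X * X * Y) + l ^ (1 + 2 * γ) • (Y * (X * X)) =
      (l + l⁻¹) • (X * Y * X)) :
    l • (K * X) * (l • (K * X)) * (l • (K' * Y)) + l • (K' * Y) * (l • (K * X) * (l • (K * X))) =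
      l ^ (1 : ℤ) • (l • (K * X) * (l • (K' * Y)) * (l • (K * X))) +
        l ^ (-1 : ℤ) • (l • (K * X) * (l • (K' * Y)) * (l • (K * X))) := by
  have h4' : ∀ z, K' * (K * z) = K * (K' * z) := fun z => by rw [← mul_assoc, h4, mul_assoc]
  have h5 := congrArg (fun z => l ^ 3 • (K * (K * (K' * z)))) h
  simp only [mul_add, mul_smul_comm, smul_add, smul_smul, mul_assoc] at h5
  obtain rfl : γ = -1 - β := by omega
  simp only [mul_assoc, smul_mul_assoc, mul_smul_comm, smul_smul, mul_mul_of_mul_eq_smul h1,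
    mul_mul_of_mul_eq_smul h2, mul_mul_of_mul_eq_smul h3, h4']
  rw [← add_smul]
  convert h5 using 2
  · congr 1
    rw [show 1 + 2 * β = 1 + β + β by ring, zpow_add₀ hl, zpow_add₀ hl]
    simp only [zpow_one]
    ring
  · congr 1
    rw [show 1 + 2 * (-1 - β) = 1 + (-1 - β) + (-1 - β) by ring, zpow_add₀ hl, zpow_add₀ hl]
    simp only [zpow_one]
    ring
  · rw [sub_eq_add_neg, zpow_add₀ hl, zpow_neg l β]
    have h6 : l ^ β ≠ 0 := zpow_ne_zero _ hl
    simp only [zpow_neg_one, zpow_one]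
    field_simp

/-- The relation survives the passage from `X` to `l • K * X` for `K` commuting with `X` up to `l`. -/
theorem sandwich_of_twisted {s t : ℚ} (h1 : X * K = l ^ (1 : ℤ) • (K * X)) (h2 : L * K = K * L)
    (h : (l + l⁻¹) • (X * L * X) = s • (X * X * L) + t • (L * (X * X))) :
    l ^ (1 : ℤ) • (l • (K * X) * L * (l • (K * X))) +
        l ^ (-1 : ℤ) • (l • (K * X) * L * (l • (K * X))) =
      s • (l • (K * X) * (l • (K * X)) * L) + t • (L * (l • (K * X) * (l • (K * X)))) := by
  have h2' : ∀ z, L * (K * z) = K * (L * z) := fun z => by rw [← mul_assoc, h2, mul_assoc]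
  have h5 := congrArg (fun z => l ^ 3 • (K * (K * z))) h
  simp only [mul_add, mul_smul_comm, smul_add, smul_smul, mul_assoc] at h5
  simp only [mul_assoc, smul_mul_assoc, mul_smul_comm, smul_smul, mul_mul_of_mul_eq_smul h1, h2',
    zpow_one, zpow_neg_one]
  rw [← add_smul]
  convert h5 using 2
  · ring
  · congr 1
    ring
  · congr 1
    ring

end Twisted

section Relations

variable {n : ℕ} {F V : Type} [Field F] [Finite F] [AddCommGroup V] [Module F V] [Finite V]
variable {l : ℕ}

local notation "𝓔" => (kernE l : Fin (n - 1) → Kern n F V)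
local notation "𝓕" => (kernF l : Fin (n - 1) → Kern n F V)
local notation "𝓗" => (kernH l : Fin n → ℤ → Kern n F V)
local notation "𝓛" => (kernL F V : Kern n F V)

theorem kernH_comm (a b : Fin n) (k m : ℤ) : 𝓗 a k * 𝓗 b m = 𝓗 b m * 𝓗 a k := diagonal_mul_comm _ _

theorem kernH_mul_kernL (a : Fin n) (k : ℤ) : 𝓗 a k * 𝓛 = 𝓛 * 𝓗 a k := diagonal_mul_comm _ _

theorem kron_eq (a b : Fin n) : kron a b = if (a : ℕ) = b then 1 else 0 :=
  if_congr Fin.ext_iff rfl rfl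

theorem kernLower_mul_kernH_of_eq (hl : 2 ≤ l) (i : Fin (n - 1)) (a : Fin n) {c : ℤ}
    (hc : kron a (lft i) - kron a (rgt i) = c := by
      simp only [kron_eq, lft, rgt]
      split_ifs <;> omega) :
    kernLower i * 𝓗 a (-1) = (l : ℚ) ^ c • (𝓗 a (-1) * kernLower i) := by
  rw [kernLower_mul_kernH hl, ← hc]
  congr 2
  ring

theorem transpose_kernLower_mul_kernH_of_eq (hl : 2 ≤ l) (i : Fin (n - 1)) (a : Fin n) {c : ℤ}
    (hc : kron a (rgt i) - kron a (lft i) = c := by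
      simp only [kron_eq, lft, rgt]
      split_ifs <;> omega) :
    (kernLower i).transpose * 𝓗 a (-1) = (l : ℚ) ^ c • (𝓗 a (-1) * (kernLower i).transpose) := by
  rw [transpose_kernLower_mul_kernH hl, ← hc]
  congr 2
  ring

/-- Multiples of the relations that are free of denominators. -/
theorem eq_of_nsmul {M N P : Kern n F V} {s t : ℤ} (hl : 2 ≤ l) (hF : Nat.card F = l ^ 2)
    (hs : s = -1 ∧ t = 1)
    (h : M + Nat.card F • N = (Nat.card F + 1) • P) :
    (l : ℚ) ^ s • M + (l : ℚ) ^ t • N = ((l : ℚ) + (l : ℚ)⁻¹) • P := by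
  have hl0 := natCast_ne_zero_of_two_le hl
  have h1 := congrArg (fun z => (l : ℚ)⁻¹ • z) h
  simp only [smul_add, ← Nat.cast_smul_eq_nsmul ℚ, smul_smul, hF] at h1
  rw [hs.1, hs.2, zpow_neg_one, zpow_one]
  convert h1 using 2
  · congr 1
    push_cast
    field_simp
  · push_cast
    field_simp

theorem kernE_serre {i j : Fin (n - 1)} (hl : 2 ≤ l) (hF : Nat.card F = l ^ 2)
    (hij : (i : ℕ) + 1 = j ∨ (j : ℕ) + 1 = i) :
    𝓔 i * 𝓔 i * 𝓔 j + 𝓔 j * (𝓔 i * 𝓔 i) =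
      (l : ℚ) ^ (1 : ℤ) • (𝓔 i * 𝓔 j * 𝓔 i) + (l : ℚ) ^ (-1 : ℤ) • (𝓔 i * 𝓔 j * 𝓔 i) := by
  have hl0 := natCast_ne_zero_of_two_le hl
  rcases hij with hij | hij
  · refine serre_of_twisted hl0 (β := -1) (γ := 0) rfl
      (kernLower_mul_kernH_of_eq hl _ _) (kernLower_mul_kernH_of_eq hl _ _)
      (kernLower_mul_kernH_of_eq hl _ _) (kernH_comm _ _ _ _)
      (eq_of_nsmul hl hF ⟨by norm_num, by norm_num⟩ (kernLower_serre_succ hij))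
  · rw [add_comm]
    refine (add_comm _ _).trans (serre_of_twisted hl0 (β := 0) (γ := -1) rfl
      (kernLower_mul_kernH_of_eq hl _ _) (kernLower_mul_kernH_of_eq hl _ _)
      (kernLower_mul_kernH_of_eq hl _ _) (kernH_comm _ _ _ _)
      ((add_comm _ _).trans ((eq_of_nsmul hl hF ⟨by norm_num, by norm_num⟩
        (kernLower_serre_pred hij)).trans (by rw [mul_assoc]))))

theorem kernF_serre {i j : Fin (n - 1)} (hl : 2 ≤ l) (hF : Nat.card F = l ^ 2)
    (hij : (i : ℕ) + 1 = j ∨ (j : ℕ) + 1 = i) :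
    𝓕 i * 𝓕 i * 𝓕 j + 𝓕 j * (𝓕 i * 𝓕 i) =
      (l : ℚ) ^ (1 : ℤ) • (𝓕 i * 𝓕 j * 𝓕 i) + (l : ℚ) ^ (-1 : ℤ) • (𝓕 i * 𝓕 j * 𝓕 i) := by
  have hl0 := natCast_ne_zero_of_two_le hl
  rcases hij with hij | hij
  · have h := congrArg transpose (kernLower_serre_succ (F := F) (V := V) hij)
    simp only [Matrix.transpose_add, Matrix.transpose_smul, transpose_mul] at h
    refine serre_of_twisted hl0 (β := 0) (γ := -1) rfl
      (transpose_kernLower_mul_kernH_of_eq hl _ _) (transpose_kernLower_mul_kernH_of_eq hl _ _)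
      (transpose_kernLower_mul_kernH_of_eq hl _ _) (kernH_comm _ _ _ _)
      ((add_comm _ _).trans ((eq_of_nsmul hl hF ⟨by norm_num, by norm_num⟩ h).trans
        (by rw [mul_assoc])))
  · have h := congrArg transpose (kernLower_serre_pred (F := F) (V := V) hij)
    simp only [Matrix.transpose_add, Matrix.transpose_smul, transpose_mul] at h
    refine serre_of_twisted hl0 (β := -1) (γ := 0) rfl
      (transpose_kernLower_mul_kernH_of_eq hl _ _) (transpose_kernLower_mul_kernH_of_eq hl _ _)
      (transpose_kernLower_mul_kernH_of_eq hl _ _) (kernH_comm _ _ _ _)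
      (eq_of_nsmul hl hF ⟨by norm_num, by norm_num⟩ h)

/-- Commuting `X` and `Y` yield commuting `K X` and `K' Y`, if the twists agree. -/
theorem mul_comm_of_twisted {R : Type*} [Ring R] [Algebra ℚ R] {K K' X Y : R} {c d : ℚ}
    (h1 : X * K' = c • (K' * X)) (h2 : Y * K = c • (K * Y)) (h3 : K * K' = K' * K)
    (h4 : X * Y = Y * X) : d • (K * X) * (d • (K' * Y)) = d • (K' * Y) * (d • (K * X)) := by
  have h3' : ∀ z, K * (K' * z) = K' * (K * z) := fun z => by rw [← mul_assoc, h3, mul_assoc]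
  simp only [mul_assoc, smul_mul_assoc, mul_smul_comm, smul_smul, mul_mul_of_mul_eq_smul h1,
    mul_mul_of_mul_eq_smul h2, h3', h4]

theorem kernE_comm {i j : Fin (n - 1)} (hl : 2 ≤ l)
    (hij : (i : ℕ) + 1 < j ∨ (j : ℕ) + 1 < i) : 𝓔 i * 𝓔 j = 𝓔 j * 𝓔 i := by
  refine mul_comm_of_twisted (c := (l : ℚ) ^ (0 : ℤ)) (kernLower_mul_kernH_of_eq hl _ _)
    (kernLower_mul_kernH_of_eq hl _ _) (kernH_comm _ _ _ _) ?_
  rw [kernLower_eq, kernLower_eq]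
  exact stepKern_comm (fun h => by rw [h] at hij; omega) (Or.inl hij)

theorem kernF_comm {i j : Fin (n - 1)} (hl : 2 ≤ l)
    (hij : (i : ℕ) + 1 < j ∨ (j : ℕ) + 1 < i) : 𝓕 i * 𝓕 j = 𝓕 j * 𝓕 i := by
  refine mul_comm_of_twisted (c := (l : ℚ) ^ (0 : ℤ))
    (transpose_kernLower_mul_kernH_of_eq hl _ _)
    (transpose_kernLower_mul_kernH_of_eq hl _ _) (kernH_comm _ _ _ _) ?_
  rw [kernLower_eq, kernLower_eq, transpose_relKern_stepRel, transpose_relKern_stepRel]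
  exact stepKern_comm (fun h => by rw [h] at hij; omega) (Or.inl hij)

theorem kernE_kernF_comm {i j : Fin (n - 1)} (hl : 2 ≤ l) (hij : i ≠ j) :
    𝓔 i * 𝓕 j = 𝓕 j * 𝓔 i := by
  have hij' : (i : ℕ) ≠ j := fun h => hij (Fin.ext h)
  refine mul_comm_of_twisted (c := (l : ℚ) ^ (if (i : ℕ) = j + 1 then (1 : ℤ) else 0))
    (kernLower_mul_kernH_of_eq hl _ _)
    (transpose_kernLower_mul_kernH_of_eq hl _ _) (kernH_comm _ _ _ _) ?_
  rw [kernLower_eq, kernLower_eq, transpose_relKern_stepRel]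
  exact stepKern_comm hij (Or.inr ⟨fun _ _ h => h.1, fun _ _ h => h.1⟩)

theorem kernE_kernF_sub (i : Fin (n - 1)) (hl : 2 ≤ l) (hF : Nat.card F = l ^ 2) :
    (l : ℚ) ^ (1 : ℤ) • (𝓔 i * 𝓕 i + -(𝓕 i * 𝓔 i)) +
        -((l : ℚ) ^ (-1 : ℤ) • (𝓔 i * 𝓕 i + -(𝓕 i * 𝓔 i))) =
      𝓗 (lft i) 1 * 𝓗 (rgt i) (-1) + -(𝓗 (lft i) (-1) * 𝓗 (rgt i) 1) := by
  have hl0 := natCast_ne_zero_of_two_le hl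
  have h1 : kernLower i * 𝓗 (rgt i) (-1) = (l : ℚ) ^ (-1 : ℤ) • (𝓗 (rgt i) (-1) * kernLower i) :=
    kernLower_mul_kernH_of_eq hl _ _
  have h2 : (kernLower i).transpose * 𝓗 (lft i) (-1) =
      (l : ℚ) ^ (-1 : ℤ) • (𝓗 (lft i) (-1) * (kernLower i).transpose) :=
    transpose_kernLower_mul_kernH_of_eq hl _ _
  have h3 : ∀ z, 𝓗 (rgt i) (-1) * (𝓗 (lft i) (-1) * z) = 𝓗 (lft i) (-1) * (𝓗 (rgt i) (-1) * z) :=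
    fun z => by rw [← mul_assoc, kernH_comm, mul_assoc]
  have h4 : 𝓔 i * 𝓕 i + -(𝓕 i * 𝓔 i) = (l : ℚ) • (𝓗 (lft i) (-1) * (𝓗 (rgt i) (-1) *
      (kernLower i * (kernLower i).transpose - (kernLower i).transpose * kernLower i))) := by
    simp only [kernE, kernF, mul_assoc, smul_mul_assoc, mul_smul_comm, smul_smul,
      mul_mul_of_mul_eq_smul h1, mul_mul_of_mul_eq_smul h2, h3, mul_sub, smul_sub, zpow_neg_one]
    rw [← sub_eq_add_neg, mul_inv_cancel₀ hl0, mul_one]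
  have h5 := congrArg (fun z => 𝓗 (lft i) (-1) * (𝓗 (rgt i) (-1) * z))
    (kernLower_mul_transpose_sub (V := V) hF i)
  simp only [mul_smul_comm, mul_sub] at h5
  have h7 : 𝓗 (lft i) (-1) * (𝓗 (rgt i) (-1) * 𝓗 (lft i) 2) = 𝓗 (rgt i) (-1) * 𝓗 (lft i) 1 := by
    rw [← h3, kernH_mul_kernH hl]
    norm_num
  rw [h7, kernH_mul_kernH hl] at h5
  rw [h4, ← sub_eq_add_neg, ← sub_eq_add_neg, ← sub_smul, smul_smul]
  simp only [mul_sub]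
  have h6 : ((l : ℚ) ^ (1 : ℤ) - (l : ℚ) ^ (-1 : ℤ)) * l = (l : ℚ) ^ 2 - 1 := by
    rw [zpow_one, zpow_neg_one]
    field_simp
  rw [h6, h5, kernH_comm (lft i) (rgt i) 1 (-1)]
  norm_num

theorem kernH_mul_kernE (hl : 2 ≤ l) (a : Fin n) (i : Fin (n - 1)) :
    𝓗 a 1 * 𝓔 i = (l : ℚ) ^ (kron a (lft i) - kron a (rgt i)) • (𝓔 i * 𝓗 a 1) := by
  rw [kernE, smul_mul_assoc, mul_assoc, kernLower_mul_kernH hl]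
  simp only [mul_smul_comm, smul_smul]
  rw [← mul_assoc (𝓗 a 1), kernH_comm a, mul_assoc, mul_left_comm, ← zpow_add₀
    (natCast_ne_zero_of_two_le hl)]
  norm_num

theorem kernH_mul_kernF (hl : 2 ≤ l) (a : Fin n) (i : Fin (n - 1)) :
    𝓗 a 1 * 𝓕 i = (l : ℚ) ^ (-kron a (lft i) + kron a (rgt i)) • (𝓕 i * 𝓗 a 1) := by
  rw [kernF, smul_mul_assoc, mul_assoc, transpose_kernLower_mul_kernH hl]
  simp only [mul_smul_comm, smul_smul]
  rw [← mul_assoc (𝓗 a 1), kernH_comm a, mul_assoc, mul_left_comm, ← zpow_add₀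
    (natCast_ne_zero_of_two_le hl)]
  norm_num

theorem kernL_mul_kernH_mul (a : Fin n) (k : ℤ) (M : Kern n F V) :
    𝓛 * (𝓗 a k * M) = 𝓗 a k * (𝓛 * M) := by
  rw [← mul_assoc, ← kernH_mul_kernL, mul_assoc]

theorem kernL_mul_kernE (i : Fin (n - 1)) : 𝓛 * 𝓔 i = 𝓛 * 𝓔 i * 𝓛 := by
  rw [kernE, mul_smul_comm, smul_mul_assoc, kernL_mul_kernH_mul, mul_assoc _ _ 𝓛,
    ← kernL_mul_kernLower]

theorem kernF_mul_kernL (i : Fin (n - 1)) : 𝓕 i * 𝓛 = 𝓛 * 𝓕 i * 𝓛 := by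
  rw [kernF, mul_smul_comm, smul_mul_assoc, smul_mul_assoc, kernL_mul_kernH_mul, mul_assoc _ _ 𝓛,
    mul_assoc _ _ 𝓛, ← transpose_kernLower_mul_kernL]

theorem kernLower_sandwich (hl : 2 ≤ l) (hF : Nat.card F = l ^ 2) (i : Fin (n - 1)) :
    ((l : ℚ) + (l : ℚ)⁻¹) • (kernLower i * 𝓛 * kernLower i) =
      (l : ℚ) ^ (-1 : ℤ) • (kernLower i * kernLower i * 𝓛) +
        (l : ℚ) ^ (1 : ℤ) • (𝓛 * (kernLower i * kernLower i)) := by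
  have hl0 := natCast_ne_zero_of_two_le hl
  have h1 := congrArg (fun z => (l : ℚ)⁻¹ • z)
    (kernLower_mul_kernL_mul_kernLower (F := F) (V := V) i)
  simp only [smul_add, smul_smul, hF] at h1
  rw [zpow_neg_one, zpow_one]
  convert h1 using 2
  · push_cast
    field_simp
  · congr 1
    push_cast
    field_simp

theorem kernE_sandwich (hl : 2 ≤ l) (hF : Nat.card F = l ^ 2) (i : Fin (n - 1)) :
    (l : ℚ) ^ (1 : ℤ) • (𝓔 i * 𝓛 * 𝓔 i) + (l : ℚ) ^ (-1 : ℤ) • (𝓔 i * 𝓛 * 𝓔 i) =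
      (l : ℚ) ^ (-1 : ℤ) • (𝓔 i * 𝓔 i * 𝓛) + (l : ℚ) ^ (1 : ℤ) • (𝓛 * (𝓔 i * 𝓔 i)) := by
  refine sandwich_of_twisted (kernLower_mul_kernH_of_eq hl _ _) (kernH_mul_kernL _ _).symm
    (kernLower_sandwich hl hF i)

theorem kernF_sandwich (hl : 2 ≤ l) (hF : Nat.card F = l ^ 2) (i : Fin (n - 1)) :
    (l : ℚ) ^ (1 : ℤ) • (𝓕 i * 𝓛 * 𝓕 i) + (l : ℚ) ^ (-1 : ℤ) • (𝓕 i * 𝓛 * 𝓕 i) =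
      (l : ℚ) ^ (1 : ℤ) • (𝓕 i * 𝓕 i * 𝓛) + (l : ℚ) ^ (-1 : ℤ) • (𝓛 * (𝓕 i * 𝓕 i)) := by
  have h := congrArg transpose (kernLower_sandwich (F := F) (V := V) hl hF i)
  have hL : transpose 𝓛 = 𝓛 := Matrix.diagonal_transpose _
  simp only [Matrix.transpose_add, Matrix.transpose_smul, transpose_mul, hL] at h
  refine sandwich_of_twisted (transpose_kernLower_mul_kernH_of_eq hl _ _)
    (kernH_mul_kernL _ _).symm ((congrArg _ (mul_assoc _ _ _)).trans (h.trans (add_comm _ _)))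

end Relations

/-! ### Associativity and unit of the completed algebra -/

section Ring

variable {n : ℕ}

namespace KAlg

open Classical in
/-- The basis element `[A]_Δ` of the completed algebra. -/
def basis (A : DecMat n) : KAlg n :=
  toKHat.symm ⟨Pi.single A 1, fun a => by
    constructor <;> refine (Set.finite_singleton A).subset fun M hM => ?_
    all_goals
      by_contra h
      exact hM.1 (Pi.single_eq_of_ne h _)⟩

open Classical in
theorem toKHat_basis (A : DecMat n) : (toKHat (basis A)).1 = Pi.single A 1 := rfl

open Classical in
/-- The element `[A]_Δ` is realized by multiples of the characteristic functions of the orbits of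
`A + pI`. -/
theorem realizes_basis (A : DecMat n) : Realizes (fun p l _ _ _ _ _ _ _ f h => .ofCoeff
    (Finsupp.equivFunOnFinite.symm fun μ =>
      if HasPosition (A.shift p) (f, h, μ) then (l : ℚ) ^ (A.shift p).normExp else 0))
    (basis A) := by
  constructor
  · obtain ⟨b, hb⟩ := A.exists_bounded
    refine ⟨b, fun M hM => ?_⟩
    have hne : M ≠ A := fun h => hM (h ▸ hb)
    exact ⟨Pi.single_eq_of_ne hne _, fun p l F V _ _ _ _ _ _ _ f h μ ht =>
      if_neg fun h' => hne (DecMat.shift_injective p (ht.unique h'))⟩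
  · intro M
    refine ⟨0, _, _, Represents.const v (if M = A then 1 else 0), ?_,
      fun p _ l F V _ _ _ _ _ _ _ f h μ ht => ?_⟩
    · rw [toKHat_basis, Pi.single_apply, evalOne_C]
      split_ifs <;> simp
    · change (if _ then _ else _) = _
      by_cases hM : M = A
      · rw [if_pos (hM ▸ ht), if_pos hM, hM, mul_one]
      · rw [if_neg fun h' => hM (DecMat.shift_injective p (ht.unique h')), if_neg hM, mul_zero]

variable [NeZero n]

theorem mul_basis_apply (x : KAlg n) (D E : DecMat n) :
    (toKHat (x * basis D)).1 E = ∑ᶠ M, (toKHat x).1 M * structConst M D E := by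
  classical
  rw [toKHat_mul, formalMul_eq_sum (rowSupport (toKHat x) E.ro) {D},
    finsum_eq_sum_of_support_subset (s := rowSupport (toKHat x) E.ro)]
  · exact sum_congr rfl fun M _ => by rw [sum_singleton, toKHat_basis, Pi.single_eq_same, mul_one]
  · exact fun M hM => mem_rowSupport.2
      ⟨left_ne_zero_of_mul hM, (structConst_support (right_ne_zero_of_mul hM)).1⟩
  · refine fun A B hA hB h => ⟨mem_rowSupport.2 ⟨hA, (structConst_support h).1⟩, ?_⟩
    by_contra hBD
    exact hB (Pi.single_eq_of_ne (fun h => hBD (mem_singleton.2 h)) _)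

theorem basis_mul_apply (x : KAlg n) (A E : DecMat n) :
    (toKHat (basis A * x)).1 E = ∑ᶠ M, (toKHat x).1 M * structConst A M E := by
  classical
  rw [toKHat_mul, formalMul_eq_sum {A} (colSupport (toKHat x) E.co), sum_singleton,
    finsum_eq_sum_of_support_subset (s := colSupport (toKHat x) E.co)]
  · exact sum_congr rfl fun M _ => by rw [toKHat_basis, Pi.single_eq_same, one_mul]
  · exact fun M hM => mem_colSupport.2
      ⟨left_ne_zero_of_mul hM, (structConst_support (right_ne_zero_of_mul hM)).2.1⟩
  · refine fun B M hB hM h => ⟨?_, mem_colSupport.2 ⟨hM, (structConst_support h).2.1⟩⟩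
    by_contra hBA
    exact hB (Pi.single_eq_of_ne (fun h => hBA (mem_singleton.2 h)) _)

theorem basis_mul_basis_apply (A B C : DecMat n) :
    (toKHat (basis A * basis B)).1 C = structConst A B C := by
  classical
  rw [mul_basis_apply, finsum_eq_single _ A fun M hM => by
    rw [toKHat_basis, Pi.single_eq_of_ne hM, zero_mul], toKHat_basis, Pi.single_eq_same, one_mul]

/-- Associativity of the structure constants, compared through kernels of basis elements. -/
theorem structConst_assoc (A B D E : DecMat n) :
    ∑ᶠ M, structConst A B M * structConst M D E =
      ∑ᶠ M, structConst B D M * structConst A M E := by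
  have hA := realizes_basis A
  have hD := realizes_basis D
  have hB := realizes_basis B
  have := ((hA.mul hB).mul hD).eq_of_kernels (hA.mul (hB.mul hD)) fun _ _ _ _ _ _ _ _ _ _ _ =>
    mul_assoc _ _ _
  have := congrArg (fun x => (toKHat x).1 E) this
  simpa only [mul_basis_apply _ D E, basis_mul_apply _ A E, basis_mul_basis_apply] using this

instance : One (KAlg n) := ⟨toKHat.symm (diagSum (DecMat.zero n) 0)⟩

theorem realizes_one : Realizes (fun _ _ _ _ _ _ _ _ _ => 1) (1 : KAlg n) := by
  have h := realizes_kernH (0 : Fin n) 0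
  simp only [kernH_zero, Pi.single_zero] at h
  exact h

open Classical in
theorem diagSumFun_zero_zero (M : DecMat n) :
    diagSumFun (DecMat.zero n) 0 M ≠ 0 ↔ ∃ z, M = DecMat.diag z := by
  have h0 : (DecMat.zero n).dec = ∅ := rfl
  have h1 : (DecMat.zero n).mat = 0 := rfl
  unfold diagSumFun
  rw [h0, h1]
  constructor
  · intro h
    rw [ne_eq, ite_eq_right_iff, not_forall] at h
    obtain ⟨⟨h2, z, h3⟩, -⟩ := h
    exact ⟨z, DecMat.ext_mat (by rw [h3, zero_add]; rfl) h2⟩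
  · rintro ⟨z, rfl⟩
    rw [if_pos ⟨rfl, z, (zero_add _).symm⟩]
    simp

theorem diagSumFun_diag (z : Fin n → ℤ) : diagSumFun (DecMat.zero n) 0 (DecMat.diag z) = 1 := by
  unfold diagSumFun
  rw [if_pos ⟨rfl, z, (zero_add _).symm⟩]
  simp

open Classical in
theorem structConst_diag_left (B C : DecMat n) :
    structConst (DecMat.diag C.ro) B C = if C = B then 1 else 0 := by
  have hB := realizes_basis B
  have := congrArg (fun x => (toKHat x).1 C)
    ((realizes_one.mul hB).eq_of_kernels hB fun _ _ _ _ _ _ _ _ _ _ _ => one_mul _)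
  rw [toKHat_basis, Pi.single_apply] at this
  rw [← this, mul_basis_apply, finsum_eq_single _ (DecMat.diag C.ro) fun M hM => ?_]
  · exact (mul_left_eq_self₀.2 (Or.inl (diagSumFun_diag _))).symm
  · by_contra hne
    obtain ⟨z, rfl⟩ := (diagSumFun_zero_zero M).1 (left_ne_zero_of_mul hne)
    have h1 := (structConst_support (right_ne_zero_of_mul hne)).1
    rw [DecMat.ro_diag] at h1
    exact hM (congrArg _ h1)

open Classical in
theorem structConst_diag_right (B C : DecMat n) :
    structConst B (DecMat.diag C.co) C = if C = B then 1 else 0 := by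
  have hB := realizes_basis B
  have := congrArg (fun x => (toKHat x).1 C)
    ((hB.mul realizes_one).eq_of_kernels hB fun _ _ _ _ _ _ _ _ _ _ _ => mul_one _)
  rw [toKHat_basis, Pi.single_apply] at this
  rw [← this, basis_mul_apply, finsum_eq_single _ (DecMat.diag C.co) fun M hM => ?_]
  · exact (mul_left_eq_self₀.2 (Or.inl (diagSumFun_diag _))).symm
  · by_contra hne
    obtain ⟨z, rfl⟩ := (diagSumFun_zero_zero M).1 (left_ne_zero_of_mul hne)
    have h1 := (structConst_support (right_ne_zero_of_mul hne)).2.1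
    rw [DecMat.co_diag] at h1
    exact hM (congrArg _ h1)

theorem formalMul_one_left (x : KHat n) :
    formalMul (diagSumFun (DecMat.zero n) 0) x.1 = x.1 := by
  classical
  funext C
  rw [formalMul_eq_sum {DecMat.diag C.ro} {C}]
  · rw [sum_singleton, sum_singleton, diagSumFun_diag,
      structConst_diag_left, if_pos rfl, one_mul, mul_one]
  · intro A B hA _ h
    obtain ⟨z, rfl⟩ := (diagSumFun_zero_zero A).1 hA
    have h1 := (structConst_support h).1
    rw [DecMat.ro_diag] at h1
    subst h1
    refine ⟨Finset.mem_singleton_self _, Finset.mem_singleton.2 ?_⟩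
    by_contra hBC
    rw [structConst_diag_left, if_neg (Ne.symm hBC)] at h
    exact h rfl

theorem formalMul_one_right (x : KHat n) :
    formalMul x.1 (diagSumFun (DecMat.zero n) 0) = x.1 := by
  classical
  funext C
  rw [formalMul_eq_sum {C} {DecMat.diag C.co}]
  · rw [sum_singleton, sum_singleton, diagSumFun_diag,
      structConst_diag_right, if_pos rfl, mul_one, mul_one]
  · intro B A _ hA h
    obtain ⟨z, rfl⟩ := (diagSumFun_zero_zero A).1 hA
    have h1 := (structConst_support h).2.1
    rw [DecMat.co_diag] at h1
    subst h1
    refine ⟨Finset.mem_singleton.2 ?_, Finset.mem_singleton_self _⟩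
    by_contra hBC
    rw [structConst_diag_right, if_neg (Ne.symm hBC)] at h
    exact h rfl

theorem formalMul_assoc (x y z : KHat n) :
    formalMul (formalMul x.1 y.1) z.1 = formalMul x.1 (formalMul y.1 z.1) := by
  classical
  funext C
  set SA := rowSupport x C.ro with hSA
  set SD := colSupport z C.co with hSD
  set SB := (SD.biUnion fun D => colSupport y D.ro) ∪ SA.biUnion fun A => rowSupport y A.co with hSB
  set X : KHat n := ⟨_, formalMul_mem x y⟩ with hX
  set Y : KHat n := ⟨_, formalMul_mem y z⟩ with hY
  set S := rowSupport X C.ro ∪ SA.biUnion fun A => SB.biUnion fun B =>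
    (finite_structConst_support A B).toFinset with hS
  set T := colSupport Y C.co ∪ SB.biUnion fun B => SD.biUnion fun D =>
    (finite_structConst_support B D).toFinset with hT
  have hl : formalMul X.1 z.1 C = ∑ M ∈ S, ∑ D ∈ SD, X.1 M * z.1 D * structConst M D C :=
    formalMul_eq_sum_support X z C subset_union_left le_rfl
  have hr : formalMul x.1 Y.1 C = ∑ A ∈ SA, ∑ M ∈ T, x.1 A * Y.1 M * structConst A M C :=
    formalMul_eq_sum_support x Y C le_rfl subset_union_left
  have hXM : ∀ M, ∀ D ∈ SD, X.1 M * z.1 D * structConst M D C =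
      ∑ A ∈ SA, ∑ B ∈ SB, x.1 A * y.1 B * z.1 D * (structConst A B M * structConst M D C) := by
    intro M D hD
    by_cases h : structConst M D C = 0
    · simp [h]
    · obtain ⟨h1, -, h3, -⟩ := structConst_support h
      have := formalMul_eq_sum_support x y M (S := SA) (T := SB) (by rw [h1])
        (Finset.Subset.trans (by grind)
          subset_union_left)
      change formalMul x.1 y.1 M * _ * _ = _
      rw [this, sum_mul, sum_mul]
      refine sum_congr rfl fun A _ => ?_
      rw [sum_mul, sum_mul]
      exact sum_congr rfl fun B _ => by ring
  have hYM : ∀ M, ∀ A ∈ SA, x.1 A * Y.1 M * structConst A M C =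
      ∑ B ∈ SB, ∑ D ∈ SD, x.1 A * y.1 B * z.1 D * (structConst B D M * structConst A M C) := by
    intro M A hA
    by_cases h : structConst A M C = 0
    · simp [h]
    · obtain ⟨-, h2, h3, -⟩ := structConst_support h
      have := formalMul_eq_sum_support y z M (S := SB) (T := SD)
        (Finset.Subset.trans (by grind)
          subset_union_right) (by rw [h2])
      change _ * formalMul y.1 z.1 M * _ = _
      rw [this, mul_sum, sum_mul]
      refine sum_congr rfl fun B _ => ?_
      rw [mul_sum, sum_mul]
      exact sum_congr rfl fun D _ => by ring
  change formalMul X.1 z.1 C = formalMul x.1 Y.1 C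
  have hl' : formalMul X.1 z.1 C = ∑ A ∈ SA, ∑ B ∈ SB, ∑ D ∈ SD,
      x.1 A * y.1 B * z.1 D * ∑ᶠ M, structConst A B M * structConst M D C := by
    rw [hl, sum_congr rfl fun M _ => sum_congr rfl (hXM M)]
    rw [sum_congr rfl fun M _ => sum_comm, sum_comm]
    refine sum_congr rfl fun A hA => ?_
    rw [sum_congr rfl fun M _ => sum_comm, sum_comm]
    refine sum_congr rfl fun B hB => ?_
    rw [sum_comm]
    refine sum_congr rfl fun D hD => ?_
    rw [← mul_sum, finsum_eq_sum_of_support_subset]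
    intro M hM
    refine Finset.mem_coe.2 (Finset.mem_union_right _ ?_)
    simp only [Finset.mem_biUnion, Set.Finite.mem_toFinset]
    exact ⟨A, hA, B, hB, left_ne_zero_of_mul hM⟩
  have hr' : formalMul x.1 Y.1 C = ∑ A ∈ SA, ∑ B ∈ SB, ∑ D ∈ SD,
      x.1 A * y.1 B * z.1 D * ∑ᶠ M, structConst B D M * structConst A M C := by
    rw [hr]
    refine sum_congr rfl fun A hA => ?_
    rw [sum_congr rfl fun M _ => hYM M A hA, sum_comm]
    refine sum_congr rfl fun B hB => ?_
    rw [sum_comm]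
    refine sum_congr rfl fun D hD => ?_
    rw [← mul_sum, finsum_eq_sum_of_support_subset]
    intro M hM
    refine Finset.mem_coe.2 (Finset.mem_union_right _ ?_)
    simp only [Finset.mem_biUnion, Set.Finite.mem_toFinset]
    exact ⟨B, hB, D, hD, left_ne_zero_of_mul hM⟩
  rw [hl', hr']
  simp only [structConst_assoc]

instance : Ring (KAlg n) :=
  { (inferInstance : AddCommGroup (KAlg n)), (inferInstance : Mul (KAlg n)),
    (inferInstance : One (KAlg n)) with
    left_distrib := fun x y z => ext_val (formalMul_add_right _ _ _)
    right_distrib := fun x y z => ext_val (formalMul_add_left _ _ _)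
    zero_mul := fun x => ext_val (by
      have := formalMul_smul_left 0 (0 : DecMat n → Qv) (toKHat x).1
      rwa [zero_smul, zero_smul] at this)
    mul_zero := fun x => ext_val (by
      have := formalMul_smul_right 0 (toKHat x).1 (0 : DecMat n → Qv)
      rwa [zero_smul, zero_smul] at this)
    mul_assoc := fun x y z => ext_val (formalMul_assoc _ _ _)
    one_mul := fun x => ext_val (formalMul_one_left _)
    mul_one := fun x => ext_val (formalMul_one_right _) }

instance : Algebra Qv (KAlg n) :=
  Algebra.ofModule (fun c x y => ext_val (formalMul_smul_left c _ _))
    fun c x y => ext_val (formalMul_smul_right c _ _)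

end KAlg

end Ring

/-! ### The homomorphism from `MU` -/

section Presentation

variable {n : ℕ} [NeZero n]

/-- The images of the generators of `MU` in the completed algebra. -/
def genImage : MUGen n → KAlg n
  | .L => KAlg.toKHat.symm (eltL n)
  | .E i => KAlg.toKHat.symm (eltE i)
  | .F i => KAlg.toKHat.symm (eltF i)
  | .H a => KAlg.toKHat.symm (eltH a)
  | .Hinv a => KAlg.toKHat.symm (eltHinv a)

/-- The kernels of the generators of `MU`. -/
def genKern : MUGen n → KernFam n
  | .L => fun _ _ F V _ _ _ _ _ => kernL F V
  | .E i => fun _ l _ _ _ _ _ _ _ => kernE l i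
  | .F i => fun _ l _ _ _ _ _ _ _ => kernF l i
  | .H a => fun _ l _ _ _ _ _ _ _ => kernH l a 1
  | .Hinv a => fun _ l _ _ _ _ _ _ _ => kernH l a (-1)

theorem realizes_genKern : ∀ g : MUGen n, Realizes (genKern g) (genImage g)
  | .L => realizes_kernL
  | .E i => realizes_kernE i
  | .F i => realizes_kernF i
  | .H a => realizes_kernH a 1
  | .Hinv a => realizes_kernH a (-1)

/-- The homomorphism from the free algebra given by the images of the generators. -/
def freeHom : FreeAlgebra Qv (MUGen n) →ₐ[Qv] KAlg n := FreeAlgebra.lift Qv genImage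

theorem v_add_inv_smul (x : KAlg n) : (v + v⁻¹) • x = v ^ (1 : ℤ) • x + v ^ (-1 : ℤ) • x := by
  rw [add_smul, zpow_one, zpow_neg_one]

theorem v_sub_inv_ne_zero : v - v⁻¹ ≠ 0 := by
  intro h
  have hv : v ≠ 0 := RatFunc.X_ne_zero
  have h1 : v ^ 2 = 1 := by
    field_simp at h
    linear_combination h
  have h2 : algebraMap (Polynomial ℚ) Qv (Polynomial.X ^ 2) = algebraMap (Polynomial ℚ) Qv 1 := by
    rw [map_pow, RatFunc.algebraMap_X, map_one]
    exact h1
  have h3 := congrArg Polynomial.natDegree (RatFunc.algebraMap_injective ℚ h2)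
  simp at h3

/-- The defining relations hold, since they hold for the kernels of the generators. -/
theorem freeHom_eq_of_rel {x y : FreeAlgebra Qv (MUGen n)} (h : MURel n x y) :
    freeHom x = freeHom y := by
  have hL := realizes_genKern (MUGen.L : MUGen n)
  have hE := fun i => realizes_genKern (MUGen.E i : MUGen n)
  have hF := fun i => realizes_genKern (MUGen.F i : MUGen n)
  have hH := fun a => realizes_genKern (MUGen.H a : MUGen n)
  have hH' := fun a => realizes_genKern (MUGen.Hinv a : MUGen n)
  have hι : ∀ g : MUGen n, freeHom (FreeAlgebra.ι Qv g) = genImage g := FreeAlgebra.lift_ι_apply _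
  have hv : ∀ x : KAlg n, v • x = v ^ (1 : ℤ) • x := fun x => by rw [zpow_one]
  cases h with
  | H_mul_Hinv a =>
    simp only [map_mul, map_one, Free.H, Free.Hinv, hι]
    refine ((hH a).mul (hH' a)).eq_of_kernels KAlg.realizes_one fun _ l F V _ _ _ _ _ hl _ => ?_
    exact (kernH_mul_kernH hl a 1 (-1)).trans (kernH_zero l a)
  | Hinv_mul_H a =>
    simp only [map_mul, map_one, Free.H, Free.Hinv, hι]
    refine ((hH' a).mul (hH a)).eq_of_kernels KAlg.realizes_one fun _ l F V _ _ _ _ _ hl _ => ?_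
    exact (kernH_mul_kernH hl a (-1) 1).trans (kernH_zero l a)
  | H_comm a b =>
    simp only [map_mul, Free.H, hι]
    exact ((hH a).mul (hH b)).eq_of_kernels ((hH b).mul (hH a)) fun _ l F V _ _ _ _ _ hl _ =>
      kernH_comm a b 1 1
  | E_serre i j hij =>
    simp only [pow_two, map_add, map_mul, map_smul, Free.E, hι, v_add_inv_smul]
    have h1 := ((hE i).mul (hE j)).mul (hE i)
    exact ((((hE i).mul (hE i)).mul (hE j)).add ((hE j).mul ((hE i).mul (hE i)))).eq_of_kernels
      ((h1.zpow_smul 1).add (h1.zpow_smul (-1))) fun _ l F V _ _ _ _ _ hl hF => kernE_serre hl hF hij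
  | F_serre i j hij =>
    simp only [pow_two, map_add, map_mul, map_smul, Free.F, hι, v_add_inv_smul]
    have h1 := ((hF i).mul (hF j)).mul (hF i)
    exact ((((hF i).mul (hF i)).mul (hF j)).add ((hF j).mul ((hF i).mul (hF i)))).eq_of_kernels
      ((h1.zpow_smul 1).add (h1.zpow_smul (-1))) fun _ l F V _ _ _ _ _ hl hF => kernF_serre hl hF hij
  | E_comm i j hij =>
    simp only [map_mul, Free.E, hι]
    exact ((hE i).mul (hE j)).eq_of_kernels ((hE j).mul (hE i)) fun _ l F V _ _ _ _ _ hl _ =>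
      kernE_comm hl hij
  | F_comm i j hij =>
    simp only [map_mul, Free.F, hι]
    exact ((hF i).mul (hF j)).eq_of_kernels ((hF j).mul (hF i)) fun _ l F V _ _ _ _ _ hl _ =>
      kernF_comm hl hij
  | H_E a i =>
    simp only [map_mul, map_smul, Free.H, Free.E, hι]
    exact ((hH a).mul (hE i)).eq_of_kernels (((hE i).mul (hH a)).zpow_smul _)
      fun _ l F V _ _ _ _ _ hl _ => kernH_mul_kernE hl a i
  | H_F a i =>
    simp only [map_mul, map_smul, Free.H, Free.F, hι]
    exact ((hH a).mul (hF i)).eq_of_kernels (((hF i).mul (hH a)).zpow_smul _)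
      fun _ l F V _ _ _ _ _ hl _ => kernH_mul_kernF hl a i
  | E_F i j =>
    split_ifs with hij
    · subst hij
      simp only [map_mul, map_sub, map_smul, Free.E, Free.F, Free.H, Free.Hinv, hι]
      rw [eq_inv_smul_iff₀ v_sub_inv_ne_zero, sub_smul, sub_eq_add_neg, sub_eq_add_neg,
        sub_eq_add_neg, ← zpow_neg_one v, hv]
      have h1 := ((hE i).mul (hF i)).add ((hF i).mul (hE i)).neg
      exact ((h1.zpow_smul 1).add (h1.zpow_smul (-1)).neg).eq_of_kernels
        (((hH (lft i)).mul (hH' (rgt i))).add ((hH' (lft i)).mul (hH (rgt i))).neg)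
        fun _ l F V _ _ _ _ _ hl hF => kernE_kernF_sub i hl hF
    · simp only [map_mul, map_sub, map_zero, Free.E, Free.F, hι]
      exact sub_eq_zero.2 (((hE i).mul (hF j)).eq_of_kernels ((hF j).mul (hE i))
        fun _ l F V _ _ _ _ _ hl _ => kernE_kernF_comm hl hij)
  | H_L a =>
    simp only [map_mul, Free.H, Free.L, hι]
    exact ((hH a).mul hL).eq_of_kernels (hL.mul (hH a)) fun _ l F V _ _ _ _ _ hl _ =>
      kernH_mul_kernL a 1
  | L_idem =>
    simp only [pow_two, map_mul, Free.L, hι]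
    exact (hL.mul hL).eq_of_kernels hL fun _ l F V _ _ _ _ _ hl _ => kernL_mul_self
  | L_E i =>
    simp only [map_mul, Free.E, Free.L, hι]
    exact (hL.mul (hE i)).eq_of_kernels ((hL.mul (hE i)).mul hL) fun _ l F V _ _ _ _ _ hl _ =>
      kernL_mul_kernE i
  | F_L i =>
    simp only [map_mul, Free.F, Free.L, hι]
    exact ((hF i).mul hL).eq_of_kernels ((hL.mul (hF i)).mul hL) fun _ l F V _ _ _ _ _ hl _ =>
      kernF_mul_kernL i
  | E_L_E i =>
    simp only [pow_two, map_add, map_mul, map_smul, Free.E, Free.L, hι, v_add_inv_smul]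
    rw [← zpow_neg_one v, hv]
    have h1 := ((hE i).mul hL).mul (hE i)
    exact ((h1.zpow_smul 1).add (h1.zpow_smul (-1))).eq_of_kernels
      (((((hE i).mul (hE i)).mul hL).zpow_smul (-1)).add
        ((hL.mul ((hE i).mul (hE i))).zpow_smul 1))
      fun _ l F V _ _ _ _ _ hl hF => kernE_sandwich hl hF i
  | F_L_F i =>
    simp only [pow_two, map_add, map_mul, map_smul, Free.F, Free.L, hι, v_add_inv_smul]
    rw [← zpow_neg_one v, hv]
    have h1 := ((hF i).mul hL).mul (hF i)
    exact ((h1.zpow_smul 1).add (h1.zpow_smul (-1))).eq_of_kernels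
      (((((hF i).mul (hF i)).mul hL).zpow_smul 1).add
        ((hL.mul ((hF i).mul (hF i))).zpow_smul (-1)))
      fun _ l F V _ _ _ _ _ hl hF => kernF_sandwich hl hF i

/-- The homomorphism from `MU` to the completed algebra. -/
def muHom : MU n →ₐ[Qv] KAlg n := RingQuot.liftAlgHom Qv ⟨freeHom, fun _ _ h => freeHom_eq_of_rel h⟩

theorem muHom_mk (x : FreeAlgebra Qv (MUGen n)) :
    muHom (RingQuot.mkAlgHom Qv (MURel n) x) = freeHom x :=
  RingQuot.liftAlgHom_mkAlgHom_apply Qv _ _ x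

theorem muHom_mk_ι (g : MUGen n) :
    muHom (RingQuot.mkAlgHom Qv (MURel n) (FreeAlgebra.ι Qv g)) = genImage g := by
  rw [muHom_mk]
  exact FreeAlgebra.lift_ι_apply _ _

theorem preimage_generators :
    (KAlg.toKHat : KAlg n ≃ₗ[Qv] KHat n) ⁻¹' generators n = Set.range genImage := by
  ext x
  constructor
  · rintro ((((h | ⟨i, h⟩) | ⟨i, h⟩) | ⟨a, h⟩) | ⟨a, h⟩)
    · exact ⟨.L, (KAlg.toKHat.symm_apply_eq).2 h.symm⟩
    · exact ⟨.E i, (KAlg.toKHat.symm_apply_eq).2 h⟩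
    · exact ⟨.F i, (KAlg.toKHat.symm_apply_eq).2 h⟩
    · exact ⟨.H a, (KAlg.toKHat.symm_apply_eq).2 h⟩
    · exact ⟨.Hinv a, (KAlg.toKHat.symm_apply_eq).2 h⟩
  · rintro ⟨g, rfl⟩
    cases g with
    | L => exact Or.inl (Or.inl (Or.inl (Or.inl rfl)))
    | E i => exact Or.inl (Or.inl (Or.inl (Or.inr ⟨i, rfl⟩)))
    | F i => exact Or.inl (Or.inl (Or.inr ⟨i, rfl⟩))
    | H a => exact Or.inl (Or.inr ⟨a, rfl⟩)
    | Hinv a => exact Or.inr ⟨a, rfl⟩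

theorem mem_mirabolicGl_iff {x : KAlg n} :
    x ∈ mirabolicGl (KAlg.toKHat : KAlg n ≃ₗ[Qv] KHat n) ↔ ∃ y, muHom y = x := by
  rw [mirabolicGl, preimage_generators, Algebra.adjoin_range_eq_range_freeAlgebra_lift]
  constructor
  · rintro ⟨y, rfl⟩
    exact ⟨_, muHom_mk y⟩
  · rintro ⟨y, rfl⟩
    obtain ⟨z, rfl⟩ := RingQuot.mkAlgHom_surjective Qv (MURel n) y
    exact ⟨z, (muHom_mk z).symm⟩

end Presentation

end

end Mirabolic

theorem proposition5p3p3 (n : ℕ) [NeZero n] :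
    -- stabilization: the stable structure constants exist and are unique
    (∀ A B C : Mirabolic.DecMat n, ∃! G : LaurentPolynomial Mirabolic.Qv,
      Mirabolic.IsStableConst A B C G) ∧
    -- the sums defining the product on the completion are finite
    (∀ (x y : Mirabolic.KHat n) (C : Mirabolic.DecMat n),
      (Function.support fun AB : Mirabolic.DecMat n × Mirabolic.DecMat n =>
        x.1 AB.1 * y.1 AB.2 * Mirabolic.structConst AB.1 AB.2 C).Finite) ∧
    -- this product makes the completion an associative unital algebra
    ∃ (K : Type) (_ : Ring K) (_ : Algebra Mirabolic.Qv K)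
      (e : K ≃ₗ[Mirabolic.Qv] Mirabolic.KHat n),
      (∀ x y : K, (e (x * y)).1 = Mirabolic.formalMul (e x).1 (e y).1) ∧
      -- and there is a surjective algebra homomorphism onto the mirabolic quantum gl_n
      ∃ φ : Mirabolic.MU n →ₐ[Mirabolic.Qv] Mirabolic.mirabolicGl e,
        Function.Surjective φ ∧
        (∀ i, e (φ (Mirabolic.MU.E i) : K) = Mirabolic.eltE i) ∧
        (∀ i, e (φ (Mirabolic.MU.F i) : K) = Mirabolic.eltF i) ∧
        (∀ a, e (φ (Mirabolic.MU.H a) : K) = Mirabolic.eltH a) ∧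
        e (φ (Mirabolic.MU.L) : K) = Mirabolic.eltL n := by
  have hgen : ∀ g : Mirabolic.MUGen n, Mirabolic.KAlg.toKHat (Mirabolic.muHom
      (RingQuot.mkAlgHom Mirabolic.Qv (Mirabolic.MURel n) (FreeAlgebra.ι Mirabolic.Qv g))) =
      Mirabolic.KAlg.toKHat (Mirabolic.genImage g) := fun g => by rw [Mirabolic.muHom_mk_ι]
  refine ⟨fun A B C => ?_, Mirabolic.finite_support_mul, Mirabolic.KAlg n, inferInstance,
    inferInstance, Mirabolic.KAlg.toKHat, Mirabolic.KAlg.toKHat_mul,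
    Mirabolic.muHom.codRestrict _ fun y => Mirabolic.mem_mirabolicGl_iff.2 ⟨y, rfl⟩, ?_,
    fun i => hgen (.E i), fun i => hgen (.F i), fun a => hgen (.H a), hgen .L⟩
  · obtain ⟨G, hG⟩ := Mirabolic.exists_isStableConst A B C
    exact ⟨G, hG, fun G' hG' => hG'.unique hG⟩
  · rintro ⟨x, hx⟩
    obtain ⟨y, rfl⟩ := Mirabolic.mem_mirabolicGl_iff.1 hx
    exact ⟨y, rfl⟩
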